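/- **Setting.** Let $\mathbb E$ be a finite-dimensional complex vector space with a Hermitian inner product and Kähler form $\omega$, $\Gamma\subset\mathbb E$ a discrete additive subgroup, $\mathbb T=\mathbb E/\Gamma$, $\pi:\mathbb E\to\mathbb T$ the projection, and $\Gamma_{\mathbb R}$ the real span of $\Gamma$. Put $\mathbb D=\{|x|<1\}\subset\mathbb C$ and $\mathbb D^*=\mathbb D\setminus\{0\}$. Let $f:\overline{\mathbb D}\setminus\{0\}\to\mathbb E$ be smooth, holomorphic in $\mathbb D^*$, with $f(x)=O(|x|^{-N})$ as $x\to0$ for some integer $N$. Assume: **(H0)** $f$ is not bounded. Then $f$ has an expansion, as $x\to0$, $$f(x)=\sum_{j=1}^{k}(1+O(x))\,x^{-d_j}v_j+v_{k+1}+O(x),$$ with $k\ge1$, integers $d_1>\dots>d_{k+1}=0$, and $v_1,\dots,v_k\in\mathbb E$ linearly independent over $\mathbb C$. Fix one; put $d=d_1$ and $\mathbb F_l=\mathrm{span}_{\mathbb C}(v_1,\dots,v_l)$. **(H1)** $\mathbb F_k\not\subset\Gamma_{\mathbb R}$. Let $\kappa\in\{1,\dots,k\}$ be the smallest index with $\mathbb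 Cv_\kappa\not\subset\Gamma_{\mathbb R}$. **(H2)** $e^{-id_\kappa\theta}v_\kappa\in\Gamma_{\mathbb R}$ for some $\theta\in\mathbb R$. Fix $\lambda\in\mathbb C$ with $|\lambda|=1$ and $\lambda^{d_\kappa}v_\kappa\in\Gamma_{\mathbb R}$, a $\mathbb C$-linear function $H$ on $\mathbb E$ such that $\{\operatorname{Im}H=0\}$ contains $\Gamma_{\mathbb R}$ but not $\mathbb Cv_\kappa$ and $H(\lambda^{d_\kappa}v_\kappa)=1$, and a holomorphic coordinate $x'=\lambda x+O(x^2)$ near $0$ with $H(f(x))=x'^{-d_\kappa}$; these exist. For $0\le p<2d_\kappa$ let $L'_p$ be the radius $\{x'=re^{ip\pi/d_\kappa},\ r>0 \text{ small}\}$ of the coordinate $x'$, and $L_p$ the radius $\{x=re^{i\theta_p},\ 0<r<1\}$ tangent to it at $0$, where $\theta_p=p\pi/d_\kappa-\arg\lambda$. Along $L'_p$ there is an expansion, as $x'\to0$, $$f=\sum_{j=1}^{\kappa-1}(1+O(x'))\lambda^{d_j}x'^{-d_j}v_j+\sum_{j=0}^{m}(1+O(x'))|x'|^{-\delta_j}\vartheta_j+\vartheta_{m+1}+O(x'),$$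 with integers $m\ge0$ and $d_\kappa=\delta_0>\dots>\delta_{m+1}=0$, real factors $1+O(x')$ in the second sum, and $\vartheta_0,\dots,\vartheta_m\in\mathbb E$ linearly independent over $\mathbb R$ modulo $\mathbb F_{\kappa-1}$. Put $\mathbb F'_m=\mathbb F_{\kappa-1}+\mathrm{span}_{\mathbb R}(\vartheta_0,\dots,\vartheta_m)$ and $V'=i\mathbb R\vartheta_0+\mathbb F'_m+\vartheta_{m+1}$ (all depending on $p$). Call $L'_p$ a *$\Gamma$-radius* if $\mathbb F'_m\subset\Gamma_{\mathbb R}$. **(H3)** There is at least one $\Gamma$-radius. For $\Theta\subset\mathbb R/2\pi\mathbb Z$ let $\mathbb D_\Theta=\{re^{i\theta}:0<r<1,\ \theta\in\Theta\}$, and let $\Lambda_f$ (resp. $\Lambda_{f,\Theta}$) be the set of cluster values in $\mathbb T$ of $\pi(f(x))$ as $x\to0$ (resp. as $x\to 0$, $x\in\mathbb D_\Theta$). **Theorem.** Under (H0)–(H3), let $L'_p$ be a $\Gamma$-radius and $V'$ the associated affine space. Let $\Theta\subset\mathbb R/2\pi\mathbb Z$ be compact, with $\theta_p$ in its interior and $\theta_q\notin\Theta$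 for every other $\Gamma$-radius $L'_q$. 1. Let $\mathbb U\subset\mathbb D_\Theta$ be open, relatively compact in $\mathbb D^*$, with piecewise smooth boundary (a finite union of regular smooth arcs) transverse to $L_p$, and $\mathbb U\cap L_p\ne\varnothing$. For $a\in(0,1]$ put $\mathbb U_a=a\mathbb U$ and $\mu_a=a^{2d-d_\kappa}\,\pi_*\big(f_*[\mathbb U_a]\wedge\omega\big)$, i.e. $a^{2d-d_\kappa}$ times the image under $\pi\circ f$ of the measure $f^*\omega$ restricted to $\mathbb U_a$. Then, as $a\to0^+$, $\mu_a$ converges, against continuous functions with compact support on $\mathbb T$, to a Haar measure of $\overline{\pi(V')}$, that is, to a translate of a Haar measure of the closed subgroup of $\mathbb T$ of which $\overline{\pi(V')}$ is a translate. 2. $\Lambda_{f,\Theta}=\overline{\pi(V')}$. Moreover, $\Lambda_f$ is a finite union of translates of connected closed real Lie subgroups of $\mathbb T$. -/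

import Mathlib

open Filter Topology MeasureTheory Asymptotics
open scoped ContDiff

namespace LieFlow

/-- The complex subspace `𝔽_l` spanned by `v_1, …, v_l` (so `𝔽_0 = 0`). -/
def flagSpace {E : Type*} [NormedAddCommGroup E] [InnerProductSpace ℂ E]
    (v : ℕ → E) (l : ℕ) : Submodule ℂ E :=
  Submodule.span ℂ (v '' Set.Icc 1 l)

/-- `Γ_ℝ`: the real vector subspace spanned by `Γ`. -/
noncomputable def realSpan {E : Type*} [NormedAddCommGroup E] [InnerProductSpace ℂ E]
    (Γ : AddSubgroup E) : Submodule ℝ E :=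
  Submodule.span ℝ (Γ : Set E)

/-- The expansion of `f` at the puncture along a flag, as `x → 0`:
`f(x) = (1+O(x)) x^{-d_1} v_1 + ⋯ + (1+O(x)) x^{-d_k} v_k + v_{k+1} + O(x)`,
with integers `d_1 > ⋯ > d_{k+1} = 0` and `v_1, …, v_k` linearly independent over `ℂ`.
The sequences `d`, `v` are indexed by `1, …, k+1`; their other values play no role. -/
structure IsFlagExpansion {E : Type*} [NormedAddCommGroup E] [InnerProductSpace ℂ E]
    (f : ℂ → E) (k : ℕ) (d : ℕ → ℕ) (v : ℕ → E) : Prop where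
  one_le : 1 ≤ k
  strictAnti : StrictAntiOn d (Set.Icc 1 (k + 1))
  last : d (k + 1) = 0
  indep : LinearIndepOn ℂ v (Set.Icc 1 k)
  expansion : ∃ (α : ℕ → ℂ → ℂ) (R : ℂ → E),
    (∀ j ∈ Set.Icc 1 k, (fun x => α j x - 1) =O[𝓝[≠] 0] (fun x : ℂ => x)) ∧
    R =O[𝓝[≠] 0] (fun x : ℂ => x) ∧
    ∀ᶠ x in 𝓝[≠] (0 : ℂ),
      f x = (∑ j ∈ Finset.Icc 1 k, (α j x * (x ^ d j)⁻¹) • v j) + v (k + 1) + R x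

theorem polar_aux {E : Type*} [NormedAddCommGroup E] [NormedSpace ℂ E] (N : ℕ) :
    ∀ g : ℂ → E, AnalyticAt ℂ g 0 → ∃ (b : ℕ → E) (R : ℂ → E),
      R =O[𝓝[≠] 0] (fun x : ℂ => x) ∧
      ∀ x : ℂ, x ≠ 0 →
        (x ^ N)⁻¹ • g x = (∑ e ∈ Finset.Ioc 0 N, (x ^ e)⁻¹ • b e) + b 0 + R x := by
  induction N with
  | zero =>
    intro g hg
    refine ⟨fun _ => g 0, fun x => g x - g 0, ?_, fun x _ => by simp⟩
    simpa using (hg.differentiableAt.isBigO_sub).mono nhdsWithin_le_nhds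
  | succ N ih =>
    intro g hg
    have hg1 : AnalyticAt ℂ (dslope g 0) 0 := by
      obtain ⟨p, hp⟩ := hg
      exact ⟨_, hp.has_fpower_series_dslope_fslope⟩
    obtain ⟨b, R, hR, hb⟩ := ih _ hg1
    refine ⟨fun e => if e = N + 1 then g 0 else b e, R, hR, fun x hx => ?_⟩
    have h1 : g x = g 0 + x • dslope g 0 x := by
      rw [dslope_of_ne _ hx, slope_def_module]
      simp [smul_smul, hx]
    have h2 := hb x hx
    rw [Finset.sum_Ioc_succ_top (by omega)]
    rw [Finset.sum_congr rfl (g := fun e => (x ^ e)⁻¹ • b e)]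
    · have h3 : (x ^ (N + 1))⁻¹ • x • dslope g 0 x = (x ^ N)⁻¹ • dslope g 0 x := by
        rw [smul_smul]; congr 1; field_simp; ring
      rw [h1, smul_add, h3, h2]
      simp only [if_true, if_neg (show (0:ℕ) ≠ N + 1 by omega)]
      abel
    · intro e he
      have : e ≠ N + 1 := by have := (Finset.mem_Ioc.1 he).2; omega
      simp [this]

theorem flag_aux {E : Type*} [NormedAddCommGroup E] [NormedSpace ℂ E] (b : ℕ → E) (N : ℕ)
    (t : ℕ) (ht : t ≤ N) :
    ∃ (k : ℕ) (d : ℕ → ℕ) (v : ℕ → E) (α : ℕ → ℂ → ℂ),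
      StrictAntiOn d (Set.Icc 1 k) ∧ (∀ j ∈ Set.Icc 1 k, N - t < d j) ∧
      LinearIndepOn ℂ v (Set.Icc 1 k) ∧
      (∀ j ∈ Set.Icc 1 k, (fun x => α j x - 1) =O[𝓝[≠] 0] (fun x : ℂ => x)) ∧
      ∀ x : ℂ, x ≠ 0 → ∑ e ∈ Finset.Ioc (N - t) N, (x ^ e)⁻¹ • b e =
        ∑ j ∈ Finset.Icc 1 k, (α j x * (x ^ d j)⁻¹) • v j := by
  induction t with
  | zero => exact ⟨0, fun _ => 0, fun _ => 0, fun _ _ => 0, by simp [StrictAntiOn]⟩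
  | succ t ih =>
    obtain ⟨k, d, v, α, h1, h2, h3, h4, h5⟩ := ih (by omega)
    set s := N - t with hs
    have hs' : N - (t + 1) = s - 1 := by omega
    have hs1 : 1 ≤ s := by omega
    have hsum : ∀ x : ℂ, ∑ e ∈ Finset.Ioc (s - 1) N, (x ^ e)⁻¹ • b e =
        (∑ e ∈ Finset.Ioc s N, (x ^ e)⁻¹ • b e) + (x ^ s)⁻¹ • b s := by
      intro x
      rw [← Finset.sum_Ioc_consecutive _ (show s - 1 ≤ s by omega) (show s ≤ N by omega), add_comm]
      congr 1
      have : Finset.Ioc (s - 1) s = {s} := by ext; simp; omega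
      rw [this, Finset.sum_singleton]
    rw [hs']
    by_cases hmem : b s ∈ Submodule.span ℂ (v '' Set.Icc 1 k)
    · have : ∃ c : ℕ → ℂ, b s = ∑ j ∈ Finset.Icc 1 k, c j • v j := by
        have h := hmem
        rw [← Finset.coe_Icc, Submodule.mem_span_image_finset_iff_exists_fun] at h
        obtain ⟨c, hc⟩ := h
        refine ⟨fun j => if hj : j ∈ Finset.Icc 1 k then c ⟨j, hj⟩ else 0, ?_⟩
        rw [← hc, ← Finset.sum_coe_sort (Finset.Icc 1 k)]
        exact Finset.sum_congr rfl fun j _ => by simp only [dif_pos j.2]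
      obtain ⟨c, hc⟩ := this
      refine ⟨k, d, v, fun j x => α j x + c j * x ^ (d j - s), h1,
        fun j hj => by have := h2 j hj; omega, h3, fun j hj => ?_, fun x hx => ?_⟩
      · have e1 : (fun x : ℂ => c j * x ^ (d j - s)) =O[𝓝[≠] 0] (fun x : ℂ => x) := by
          refine IsBigO.const_mul_left ?_ _
          have := h2 j hj
          obtain ⟨q, hq⟩ : ∃ q, d j - s = q + 1 := ⟨d j - s - 1, by omega⟩
          rw [hq]
          have h6 : (fun x : ℂ => x ^ q) =O[𝓝 0] (fun _ => (1 : ℂ)) :=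
            ((continuous_pow q).tendsto 0).isBigO_one ℂ
          have : (fun x : ℂ => x ^ (q + 1)) =O[𝓝 0] (fun x : ℂ => x) := by
            simpa [pow_succ] using h6.mul (isBigO_refl (fun x : ℂ => x) (𝓝 0))
          simpa using this.mono nhdsWithin_le_nhds
        refine ((h4 j hj).add e1).congr_left fun x => by ring
      · rw [hsum, h5 x hx, hc, Finset.smul_sum, ← Finset.sum_add_distrib]
        refine Finset.sum_congr rfl fun j hj => ?_
        have hlt := h2 j (by simpa using hj)
        rw [smul_smul, ← add_smul]
        congr 1
        have : x ^ d j = x ^ (d j - s) * x ^ s := by rw [← pow_add]; congr 1; omega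
        rw [this]; field_simp
    · have hup : ∀ j ∈ Set.Icc 1 k, j ≠ k + 1 := fun j hj => by have := hj.2; omega
      refine ⟨k + 1, Function.update d (k + 1) s, Function.update v (k + 1) (b s),
        Function.update α (k + 1) (fun _ => 1), ?_, ?_, ?_, ?_, ?_⟩
      · intro i hi j hj hij
        have hi' : i ≠ k + 1 := by have := hj.2; omega
        have hik : i ∈ Set.Icc 1 k := ⟨hi.1, by have := hi.2; omega⟩
        by_cases hj' : j = k + 1
        · subst hj'; simpa [hi'] using h2 i hik
        · simpa [hi', hj'] using h1 hik ⟨hj.1, by have := hj.2; omega⟩ hij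
      · intro j hj
        by_cases hj' : j = k + 1
        · subst hj'; simp; omega
        · have := h2 j ⟨hj.1, by have := hj.2; omega⟩
          simp [hj']; omega
      · have hins : Set.Icc 1 (k + 1) = insert (k + 1) (Set.Icc 1 k) := by
          ext i; simp; omega
        have himg : Set.EqOn (Function.update v (k + 1) (b s)) v (Set.Icc 1 k) :=
          fun j hj => by simp [hup j hj]
        rw [hins, linearIndepOn_insert (by simp)]
        refine ⟨h3.congr himg.symm, ?_⟩
        rw [Set.image_congr himg]
        simpa using hmem
      · intro j hj
        by_cases hj' : j = k + 1
        · subst hj'; simpa using isBigO_zero _ _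
        · simpa [hj'] using h4 j ⟨hj.1, by have := hj.2; omega⟩
      · intro x hx
        rw [hsum, h5 x hx, Finset.sum_Icc_succ_top (by omega)]
        congr 1
        · refine Finset.sum_congr rfl fun j hj => ?_
          simp [hup j (by simpa using hj)]
        · simp

/-- Every unbounded `f` of the kind considered has an expansion along a flag: a hypothesis
`IsFlagExpansion f k d v` only fixes the notation. -/
theorem exists_isFlagExpansion {E : Type*} [NormedAddCommGroup E] [InnerProductSpace ℂ E]
    [FiniteDimensional ℂ E] (f : ℂ → E)
    (hf_smooth : ContDiffOn ℝ ∞ f (Metric.closedBall 0 1 \ {0}))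
    (hf_hol : DifferentiableOn ℂ f (Metric.ball 0 1 \ {0}))
    (hf_growth : ∃ N : ℕ, f =O[𝓝[≠] 0] (fun x : ℂ => (x ^ N)⁻¹))
    (H0 : ¬ Bornology.IsBounded (f '' (Metric.closedBall 0 1 \ {0}))) :
    ∃ (k : ℕ) (d : ℕ → ℕ) (v : ℕ → E), IsFlagExpansion f k d v := by
  obtain ⟨N, hN⟩ := hf_growth
  have := FiniteDimensional.complete ℂ E
  have hball : Metric.ball (0 : ℂ) 1 ∈ 𝓝 0 := Metric.ball_mem_nhds _ one_pos
  -- removable singularity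
  obtain ⟨g, hg, hfg⟩ : ∃ g : ℂ → E, AnalyticAt ℂ g 0 ∧
      ∀ᶠ x in 𝓝[≠] (0 : ℂ), f x = (x ^ N)⁻¹ • g x := by
    set h : ℂ → E := fun x => x ^ N • f x with hh
    have hO : h =O[𝓝[≠] 0] (fun _ => (1 : ℂ)) := by
      have h1 : (fun x : ℂ => x ^ N) =O[𝓝[≠] 0] (fun x : ℂ => x ^ N) := isBigO_refl _ _
      refine (h1.smul hN).congr' (Eventually.of_forall fun _ => rfl) ?_
      filter_upwards [self_mem_nhdsWithin] with x hx
      have : x ≠ 0 := hx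
      simp [this]
    have hd : DifferentiableOn ℂ h (Metric.ball 0 1 \ {0}) :=
      ((differentiable_id.pow N).differentiableOn).smul hf_hol
    have ho : (fun z => h z - h 0) =o[𝓝[≠] 0] (fun z : ℂ => (z - 0)⁻¹) := by
      have h1 : (fun z => h z - h 0) =O[𝓝[≠] 0] (fun _ => (1 : ℂ)) :=
        hO.sub (isBigO_const_const _ one_ne_zero _)
      refine h1.trans_isLittleO ?_
      simp only [sub_zero]
      rw [isLittleO_const_left]
      right
      exact tendsto_norm_cobounded_atTop.comp (tendsto_inv₀_nhdsNE_zero)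
    have := Complex.differentiableOn_update_limUnder_of_isLittleO hball hd ho
    refine ⟨_, this.analyticAt hball, ?_⟩
    filter_upwards [self_mem_nhdsWithin] with x hx
    have hx : x ≠ 0 := hx
    simp [hx, hh]
  obtain ⟨b, R, hR, hb⟩ := polar_aux N g hg
  obtain ⟨k, d, v, α, h1, h2, h3, h4, h5⟩ := flag_aux b N N le_rfl
  have hexp : ∀ᶠ x in 𝓝[≠] (0 : ℂ),
      f x = (∑ j ∈ Finset.Icc 1 k, (α j x * (x ^ d j)⁻¹) • v j) + b 0 + R x := by
    filter_upwards [hfg, self_mem_nhdsWithin] with x hx hx0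
    rw [hx, hb x hx0, ← h5 x hx0, Nat.sub_self]
  have hk : 1 ≤ k := by
    by_contra hk
    have hk : k = 0 := by omega
    subst hk
    refine H0 ?_
    have hO : f =O[𝓝[≠] 0] (fun _ => (1 : ℝ)) := by
      have e1 : (fun x => b 0 + R x) =O[𝓝[≠] 0] (fun _ => (1 : ℝ)) := by
        refine (isBigO_const_const _ one_ne_zero _).add (hR.trans ?_)
        exact ((continuous_id.tendsto (0 : ℂ)).isBigO_one ℝ).mono nhdsWithin_le_nhds
      refine e1.congr' ?_ (EventuallyEq.refl _ _)
      filter_upwards [hexp] with x hx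
      rw [hx]; simp
    obtain ⟨C, hC⟩ := hO.bound
    rw [eventually_nhdsWithin_iff, Metric.eventually_nhds_iff] at hC
    obtain ⟨ε, hε, hC⟩ := hC
    have hcpt : IsCompact (Metric.closedBall (0 : ℂ) 1 \ Metric.ball 0 ε) :=
      (isCompact_closedBall _ _).diff Metric.isOpen_ball
    have hb1 := (hcpt.image_of_continuousOn (hf_smooth.continuousOn.mono (fun x hx => ⟨hx.1, by
      rintro rfl; exact hx.2 (Metric.mem_ball_self hε)⟩))).isBounded
    refine (hb1.union (Metric.isBounded_closedBall (x := (0 : E)) (r := C))).subset ?_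
    rintro _ ⟨x, hx, rfl⟩
    by_cases hxe : x ∈ Metric.ball 0 ε
    · right; simpa using hC hxe hx.2
    · left; exact ⟨x, ⟨hx.1, hxe⟩, rfl⟩
  have hup : ∀ j ∈ Set.Icc 1 k, j ≠ k + 1 := fun j hj => by have := hj.2; omega
  refine ⟨k, Function.update d (k + 1) 0, Function.update v (k + 1) (b 0), hk, ?_, by simp, ?_,
    α, R, h4, hR, ?_⟩
  · intro i hi j hj hij
    have hi' : i ≠ k + 1 := by have := hj.2; omega
    have hik : i ∈ Set.Icc 1 k := ⟨hi.1, by have := hi.2; omega⟩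
    by_cases hj' : j = k + 1
    · subst hj'; simpa [hi'] using (Nat.zero_le _).trans_lt (h2 i hik)
    · simpa [hi', hj'] using h1 hik ⟨hj.1, by have := hj.2; omega⟩ hij
  · exact h3.congr fun j hj => by simp [hup j hj]
  · filter_upwards [hexp] with x hx
    rw [hx]
    simp only [Function.update_self]
    congr 2
    refine Finset.sum_congr rfl fun j hj => ?_
    simp [hup j (by simpa using hj)]

/-- `κ` is the smallest index in `{1, …, k}` such that `ℂ v_κ` is not contained in `Γ_ℝ`. -/
def IsCriticalIndex {E : Type*} [NormedAddCommGroup E] [InnerProductSpace ℂ E]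
    (Γ : AddSubgroup E) (k : ℕ) (v : ℕ → E) (κ : ℕ) : Prop :=
  IsLeast {j : ℕ | 1 ≤ j ∧ j ≤ k ∧ ∃ c : ℂ, c • v j ∉ realSpan Γ} κ

/-- The radius of argument `θ` is an almost `Γ`-radius: `e^{-i d_κ θ} v_κ ∈ Γ_ℝ`. -/
def IsAlmostGammaRadius {E : Type*} [NormedAddCommGroup E] [InnerProductSpace ℂ E]
    (Γ : AddSubgroup E) (d : ℕ → ℕ) (v : ℕ → E) (κ : ℕ) (θ : ℝ) : Prop :=
  Complex.exp (-(Complex.I * (d κ : ℂ) * (θ : ℂ))) • v κ ∈ realSpan Γ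

/-- The choices made to introduce the second coordinate `x' = ξ(x) = lam x + O(x²)` near `0`:
`|lam| = 1` and `lam^{d_κ} v_κ ∈ Γ_ℝ`; `H` is a `ℂ`-linear function such that the real
hyperplane `Im H = 0` contains `Γ_ℝ` but not `ℂ v_κ`, normalized by `H(lam^{d_κ} v_κ) = 1`;
and `ξ` is holomorphic near `0` with `H(f(x)) = x'^{-d_κ}`. -/
structure IsAdaptedCoordinate {E : Type*} [NormedAddCommGroup E] [InnerProductSpace ℂ E]
    (Γ : AddSubgroup E) (f : ℂ → E) (d : ℕ → ℕ) (v : ℕ → E) (κ : ℕ)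
    (lam : ℂ) (H : E →ₗ[ℂ] ℂ) (ξ : ℂ → ℂ) : Prop where
  norm_lam : ‖lam‖ = 1
  lam_mem : lam ^ d κ • v κ ∈ realSpan Γ
  im_eq_zero : ∀ z ∈ realSpan Γ, (H z).im = 0
  im_ne_zero : ∃ c : ℂ, (H (c • v κ)).im ≠ 0
  normalized : H (lam ^ d κ • v κ) = 1
  analytic : AnalyticAt ℂ ξ 0
  map_zero : ξ 0 = 0
  deriv_eq : deriv ξ 0 = lam
  coord : ∀ᶠ x in 𝓝[≠] (0 : ℂ), H (f x) = (ξ x ^ d κ)⁻¹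

/-- The choices of `lam`, `H` and `x' = ξ(x)` can be made as soon as there is an almost `Γ`-radius:
a hypothesis `IsAdaptedCoordinate Γ f d v κ lam H ξ` only fixes the notation. -/
theorem exists_isAdaptedCoordinate {E : Type*} [NormedAddCommGroup E] [InnerProductSpace ℂ E]
    [FiniteDimensional ℂ E] (Γ : AddSubgroup E) (f : ℂ → E)
    (hf_hol : DifferentiableOn ℂ f (Metric.ball 0 1 \ {0}))
    (k : ℕ) (d : ℕ → ℕ) (v : ℕ → E) (hv : IsFlagExpansion f k d v)
    (κ : ℕ) (hκ : IsCriticalIndex Γ k v κ)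
    (H2 : ∃ θ : ℝ, IsAlmostGammaRadius Γ d v κ θ) :
    ∃ (lam : ℂ) (H : E →ₗ[ℂ] ℂ) (ξ : ℂ → ℂ), IsAdaptedCoordinate Γ f d v κ lam H ξ := by
  obtain ⟨⟨hκ1, hκk, c, hc⟩, hmin⟩ := hκ
  obtain ⟨θ, hθ⟩ := H2
  have hball : Metric.ball (0 : ℂ) 1 ∈ 𝓝 0 := Metric.ball_mem_nhds _ one_pos
  have hdκ : 0 < d κ := by
    have := hv.strictAnti (a := κ) (b := k + 1) ⟨hκ1, by omega⟩ ⟨by omega, le_rfl⟩ (by omega)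
    rwa [hv.last] at this
  -- the linear function
  obtain ⟨h, hh1, hh2⟩ := Submodule.exists_le_ker_of_notMem hc
  set H₀ : E →ₗ[ℂ] ℂ :=
    { toFun := fun z => ((h (Complex.I • z) : ℝ) : ℂ) + Complex.I * ((h z : ℝ) : ℂ)
      map_add' := by intro x y; simp only [smul_add, map_add]; push_cast; ring
      map_smul' := by
        intro a z
        have e1 : ∀ w : E, h (a • w) = a.re * h w + a.im * h (Complex.I • w) := by
          intro w
          have : a • w = a.re • w + a.im • (Complex.I • w) := by
            conv_lhs => rw [← Complex.re_add_im a]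
            rw [add_smul, mul_smul]; rfl
          rw [this, map_add, map_smul, map_smul]; rfl
        have e2 : h (Complex.I • a • z) = a.re * h (Complex.I • z) - a.im * h z := by
          rw [smul_comm, e1, smul_smul, Complex.I_mul_I, neg_one_smul, map_neg]; ring
        have e3 := Complex.re_add_im a
        simp only [RingHom.id_apply, smul_eq_mul]
        rw [e2, e1]
        conv_rhs => rw [← e3]
        push_cast
        linear_combination (-(a.im : ℂ) * (h z : ℂ)) * Complex.I_mul_I } with hH₀
  have him : ∀ z, (H₀ z).im = h z := by intro z; simp [hH₀]
  have him0 : ∀ z ∈ realSpan Γ, (H₀ z).im = 0 := fun z hz => by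
    rw [him]; exact hh2 hz
  set lam : ℂ := Complex.exp (-(Complex.I * θ)) with hlam
  have hlamd : lam ^ d κ = Complex.exp (-(Complex.I * (d κ : ℂ) * (θ : ℂ))) := by
    rw [hlam, ← Complex.exp_nat_mul]; congr 1; ring
  have hlam0 : lam ≠ 0 := Complex.exp_ne_zero _
  have hmem : lam ^ d κ • v κ ∈ realSpan Γ := by rw [hlamd]; exact hθ
  have hHv : H₀ (v κ) ≠ 0 := by
    intro h0
    have := him (c • v κ)
    rw [map_smul, h0] at this
    simp at this
    exact hh1 this.symm
  have hw : H₀ (lam ^ d κ • v κ) ≠ 0 := by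
    rw [map_smul]; exact smul_ne_zero (pow_ne_zero _ hlam0) hHv
  set w : ℝ := (H₀ (lam ^ d κ • v κ)).re with hwdef
  have hwc : H₀ (lam ^ d κ • v κ) = (w : ℂ) := by
    exact Complex.ext rfl (him0 _ hmem)
  have hw0 : (w : ℂ) ≠ 0 := hwc ▸ hw
  set H : E →ₗ[ℂ] ℂ := ((w : ℂ)⁻¹) • H₀ with hH
  have hHn : H (lam ^ d κ • v κ) = 1 := by
    rw [hH, LinearMap.smul_apply, hwc, smul_eq_mul, inv_mul_cancel₀ hw0]
  have hHim : ∀ z, (H z).im = w⁻¹ * h z := by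
    intro z
    rw [hH, LinearMap.smul_apply, smul_eq_mul, ← Complex.ofReal_inv, Complex.im_ofReal_mul, him]
  have hHim0 : ∀ z ∈ realSpan Γ, (H z).im = 0 := fun z hz => by
    rw [hHim, show h z = 0 from hh2 hz, mul_zero]
  have hHκ : H (v κ) = (lam ^ d κ)⁻¹ := by
    have := hHn
    rw [map_smul, smul_eq_mul] at this
    exact eq_inv_of_mul_eq_one_right this
  have hHj : ∀ j, 1 ≤ j → j < κ → H (v j) = 0 := by
    intro j hj1 hj2
    have hall : ∀ c : ℂ, c • v j ∈ realSpan Γ := by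
      by_contra hcon
      push Not at hcon
      exact absurd (hmin ⟨hj1, by omega, hcon⟩) (by omega)
    have a1 := hHim0 _ (hall 1)
    have a2 := hHim0 _ (hall Complex.I)
    rw [map_smul] at a1 a2
    apply Complex.ext <;> simp_all
  -- limit of `x ^ d_κ * H (f x)`
  set G : ℂ → ℂ := fun x => x ^ d κ * H (f x) with hG
  have hGO : (fun x => G x - (lam ^ d κ)⁻¹) =O[𝓝[≠] 0] (fun x : ℂ => x) := by
    obtain ⟨α, R, hα, hR, hexp⟩ := hv.expansion
    have hxO : (fun x : ℂ => x) =O[𝓝[≠] 0] (fun _ => (1 : ℂ)) :=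
      ((continuous_id.tendsto (0 : ℂ)).isBigO_one ℂ).mono nhdsWithin_le_nhds
    have hpow : ∀ q : ℕ, 0 < q → (fun x : ℂ => x ^ q) =O[𝓝[≠] 0] (fun x : ℂ => x) := by
      intro q hq
      obtain ⟨q, rfl⟩ : ∃ q', q = q' + 1 := ⟨q - 1, by omega⟩
      simpa [pow_succ] using (hxO.pow q).mul (isBigO_refl (fun x : ℂ => x) (𝓝[≠] 0))
    have hHR : (fun x => H (R x)) =O[𝓝[≠] 0] (fun x : ℂ => x) :=
      ((LinearMap.toContinuousLinearMap H).isBigO_comp R _).trans hR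
    have hα1 : ∀ j ∈ Set.Icc 1 k, (fun x => α j x) =O[𝓝[≠] 0] (fun _ => (1 : ℂ)) := by
      intro j hj
      have := ((hα j hj).trans hxO).add (isBigO_const_const (1 : ℂ) one_ne_zero _)
      exact this.congr_left fun x => by ring
    have hterm : ∀ j ∈ Finset.Icc 1 k,
        (fun x : ℂ => x ^ d κ * ((α j x * (x ^ d j)⁻¹) * H (v j)) -
          if j = κ then (lam ^ d κ)⁻¹ else 0) =O[𝓝[≠] 0] (fun x : ℂ => x) := by
      intro j hj
      have hj' : j ∈ Set.Icc 1 k := by simpa using hj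
      rcases lt_trichotomy j κ with hlt | heq | hgt
      · simp [hHj j hj'.1 hlt, hlt.ne, isBigO_zero]
      · subst heq
        refine ((hα j hj').const_mul_left ((lam ^ d j)⁻¹)).congr' ?_ (EventuallyEq.refl _ _)
        filter_upwards [self_mem_nhdsWithin] with x hx
        have hx : x ≠ 0 := hx
        rw [if_pos rfl, hHκ]; field_simp
      · have hd : d j < d κ := hv.strictAnti (a := κ) (b := j) ⟨hκ1, by omega⟩
          ⟨hj'.1, by have := hj'.2; omega⟩ hgt
        have := (((hα1 j hj').mul (hpow (d κ - d j) (by omega))).const_mul_left (H (v j)))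
        refine this.congr' ?_ (by simp [EventuallyEq.refl])
        filter_upwards [self_mem_nhdsWithin] with x hx
        have hx : x ≠ 0 := hx
        have e : x ^ d κ = x ^ (d κ - d j) * x ^ d j := by rw [← pow_add]; congr 1; omega
        rw [if_neg hgt.ne', e]; field_simp; ring
    have hsum := IsBigO.sum hterm
    have hlast : (fun x : ℂ => x ^ d κ * (H (v (k + 1)) + H (R x))) =O[𝓝[≠] 0]
        (fun x : ℂ => x) := by
      have b1 : (fun x => H (v (k + 1)) + H (R x)) =O[𝓝[≠] 0] (fun _ => (1 : ℂ)) :=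
        (isBigO_const_const _ one_ne_zero _).add (hHR.trans hxO)
      simpa using (hpow _ hdκ).mul b1
    refine (hsum.add hlast).congr' ?_ (EventuallyEq.refl _ _)
    filter_upwards [hexp] with x hx
    simp only [hG]
    rw [hx, Finset.sum_apply, Finset.sum_sub_distrib, Finset.sum_ite_eq']
    rw [if_pos (by simp; omega)]
    simp only [map_add, map_sum, map_smul, smul_eq_mul, Finset.mul_sum, mul_add]
    ring
  -- extend `G` and take a root
  set G' : ℂ → ℂ := Function.update G 0 (lam ^ d κ)⁻¹ with hG'
  have hGt : Tendsto G (𝓝[≠] 0) (𝓝 (lam ^ d κ)⁻¹) := by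
    have := hGO.trans_tendsto ((continuous_id.tendsto (0 : ℂ)).mono_left nhdsWithin_le_nhds)
    simpa using this.add_const ((lam ^ d κ)⁻¹)
  have hG'c : ContinuousAt G' 0 := by
    rw [hG', continuousAt_update_same]; exact hGt
  have hG'a : AnalyticAt ℂ G' 0 := by
    refine Complex.analyticAt_of_differentiable_on_punctured_nhds_of_continuousAt ?_ hG'c
    have hGd : DifferentiableOn ℂ G (Metric.ball 0 1 \ {0}) :=
      ((differentiable_id.pow (d κ)).differentiableOn).mul
        ((LinearMap.toContinuousLinearMap H).differentiable.comp_differentiableOn hf_hol)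
    rw [eventually_nhdsWithin_iff]
    filter_upwards [Metric.isOpen_ball.mem_nhds (Metric.mem_ball_self one_pos)] with x hx hx0
    have hx0 : x ≠ 0 := hx0
    have hn : Metric.ball (0 : ℂ) 1 \ {0} ∈ 𝓝 x :=
      (Metric.isOpen_ball.sdiff isClosed_singleton).mem_nhds ⟨hx, hx0⟩
    refine (hGd.differentiableAt hn).congr_of_eventuallyEq ?_
    filter_upwards [hn] with y hy
    have : y ≠ 0 := hy.2
    simp [hG', this]
  set P : ℂ → ℂ := fun x => lam ^ d κ * G' x with hP
  have hP0 : P 0 = 1 := by simp [hP, hG', hlam0]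
  have hPa : AnalyticAt ℂ P 0 := analyticAt_const.mul hG'a
  have hslit : P 0 ∈ Complex.slitPlane := by rw [hP0]; exact Complex.one_mem_slitPlane
  set Q : ℂ → ℂ := fun x => Complex.exp (-(Complex.log (P x)) / d κ) with hQ
  have hQa : AnalyticAt ℂ Q 0 := by
    have : AnalyticAt ℂ (fun x => -(Complex.log (P x)) / d κ) 0 :=
      ((hPa.clog hslit).neg).div_const
    exact this.cexp
  have hQ0 : Q 0 = 1 := by simp [hQ, hP0]
  refine ⟨lam, H, fun x => lam * x * Q x, ?_, hmem, hHim0, ⟨c, ?_⟩, hHn, ?_, by simp, ?_, ?_⟩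
  · rw [hlam, show -(Complex.I * (θ : ℂ)) = ((-θ : ℝ) : ℂ) * Complex.I by push_cast; ring]
    exact Complex.norm_exp_ofReal_mul_I _
  · rw [hHim]; exact mul_ne_zero (inv_ne_zero (by exact_mod_cast hw0)) hh1
  · exact (analyticAt_const.mul analyticAt_id).mul hQa
  · have h1 : HasDerivAt (fun x : ℂ => lam * x) lam 0 := by
      simpa using (hasDerivAt_id (0 : ℂ)).const_mul lam
    have := (h1.mul hQa.differentiableAt.hasDerivAt).deriv
    simp only [hQ0, mul_one, mul_zero, zero_mul, add_zero] at this
    exact this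
  · have hPne : ∀ᶠ x in 𝓝[≠] (0 : ℂ), P x ≠ 0 :=
      (hPa.continuousAt.eventually_ne (by rw [hP0]; exact one_ne_zero)).filter_mono
        nhdsWithin_le_nhds
    filter_upwards [hPne, self_mem_nhdsWithin] with x hx hx0
    have hx0 : x ≠ 0 := hx0
    have e1 : Q x ^ d κ = (P x)⁻¹ := by
      have hd' : (d κ : ℂ) ≠ 0 := by exact_mod_cast hdκ.ne'
      rw [hQ, ← Complex.exp_nat_mul, mul_div_cancel₀ _ hd', Complex.exp_neg, Complex.exp_log hx]
    have e2 : P x = lam ^ d κ * (x ^ d κ * H (f x)) := by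
      simp [hP, hG', hG, hx0]
    rw [mul_pow, mul_pow, e1, e2]
    rw [e2] at hx
    have hHf : H (f x) ≠ 0 := fun h => hx (by rw [h]; simp)
    field_simp

/-- The radius `L'_p` of the coordinate `x'`, as a set of points `x`: those for which
`x' = r e^{i p π / d_κ}` for some `r > 0` (only its germ at `0` is ever used). -/
def primedRadius (dκ : ℕ) (ξ : ℂ → ℂ) (p : ℕ) : Set ℂ :=
  {x | ∃ r : ℝ, 0 < r ∧
    ξ x = (r : ℂ) * Complex.exp (Complex.I * ((p * Real.pi / dκ : ℝ) : ℂ))}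

/-- The expansion of `f` along the radius `L'_p`: for `x' ∈ L'_p`, as `x' → 0`,
`f = ∑_{j=1}^{κ-1} (1+O(x')) lam^{d_j} x'^{-d_j} v_j
    + ∑_{j=0}^{m} (1+O(x')) |x'|^{-δ_j} ϑ_j + ϑ_{m+1} + O(x')`,
with integers `δ_0 = d_κ > δ_1 > ⋯ > δ_{m+1} = 0`, real factors `1+O(x')` in the second sum,
and `ϑ_0, …, ϑ_m` linearly independent over `ℝ` modulo `𝔽_{κ-1}`. -/
structure IsRadialExpansion {E : Type*} [NormedAddCommGroup E] [InnerProductSpace ℂ E]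
    (f : ℂ → E) (d : ℕ → ℕ) (v : ℕ → E) (κ : ℕ) (lam : ℂ) (ξ : ℂ → ℂ) (p : ℕ)
    (m : ℕ) (δ : ℕ → ℕ) (ϑ : ℕ → E) : Prop where
  first : δ 0 = d κ
  strictAnti : StrictAntiOn δ (Set.Iic (m + 1))
  last : δ (m + 1) = 0
  indep : LinearIndepOn ℝ
    (fun j => ((flagSpace v (κ - 1)).restrictScalars ℝ).mkQ (ϑ j)) (Set.Iic m)
  expansion : ∃ (α : ℕ → ℂ → ℂ) (β : ℕ → ℂ → ℝ) (R : ℂ → E),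
    (∀ j ∈ Set.Icc 1 (κ - 1),
      (fun x => α j x - 1) =O[𝓝[primedRadius (d κ) ξ p] 0] ξ) ∧
    (∀ j ∈ Set.Iic m, (fun x => β j x - 1) =O[𝓝[primedRadius (d κ) ξ p] 0] ξ) ∧
    R =O[𝓝[primedRadius (d κ) ξ p] 0] ξ ∧
    ∀ᶠ x in 𝓝[primedRadius (d κ) ξ p] (0 : ℂ),
      f x = (∑ j ∈ Finset.Icc 1 (κ - 1), (α j x * lam ^ d j * (ξ x ^ d j)⁻¹) • v j)
        + (∑ j ∈ Finset.range (m + 1), (β j x * (‖ξ x‖ ^ δ j)⁻¹) • ϑ j) + ϑ (m + 1) + R x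

/-- The real subspace `𝔽'_l` spanned by `𝔽_{κ-1}` and `ϑ_0, …, ϑ_l`. -/
noncomputable def radialSpace {E : Type*} [NormedAddCommGroup E] [InnerProductSpace ℂ E]
    (v : ℕ → E) (κ : ℕ) (ϑ : ℕ → E) (l : ℕ) : Submodule ℝ E :=
  (flagSpace v (κ - 1)).restrictScalars ℝ ⊔ Submodule.span ℝ (ϑ '' Set.Iic l)

/-- The real affine subspace `V' = iℝϑ_0 + 𝔽'_m + ϑ_{m+1}`. -/
noncomputable def limitAffine {E : Type*} [NormedAddCommGroup E] [InnerProductSpace ℂ E]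
    (v : ℕ → E) (κ : ℕ) (m : ℕ) (ϑ : ℕ → E) : AffineSubspace ℝ E :=
  AffineSubspace.mk' (ϑ (m + 1))
    (Submodule.span ℝ {Complex.I • ϑ 0} ⊔ radialSpace v κ ϑ m)

/-- `L'_p` is a `Γ`-radius: `𝔽'_m ⊆ Γ_ℝ`. -/
def IsGammaRadius {E : Type*} [NormedAddCommGroup E] [InnerProductSpace ℂ E]
    (Γ : AddSubgroup E) (f : ℂ → E) (d : ℕ → ℕ) (v : ℕ → E) (κ : ℕ) (lam : ℂ)
    (ξ : ℂ → ℂ) (p : ℕ) : Prop :=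
  ∃ (m : ℕ) (δ : ℕ → ℕ) (ϑ : ℕ → E),
    IsRadialExpansion f d v κ lam ξ p m δ ϑ ∧ radialSpace v κ ϑ m ≤ realSpan Γ

/-- The argument `pπ/d_κ - arg lam`, in the coordinate `x`, of the almost `Γ`-radius `L_p`
tangent at `0` to the radius `L'_p` of the coordinate `x' = lam x + O(x²)`. -/
noncomputable def radiusAngle (dκ : ℕ) (lam : ℂ) (p : ℕ) : Real.Angle :=
  ((p * Real.pi / dκ - Complex.arg lam : ℝ) : Real.Angle)

/-- The union `𝔻_Θ` of the radii of the punctured unit disc with argument in `Θ`. -/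
def sector (Θ : Set Real.Angle) : Set ℂ :=
  {x | 0 < ‖x‖ ∧ ‖x‖ < 1 ∧ (Complex.arg x : Real.Angle) ∈ Θ}

/-- The cluster values of `π(f(x))` in `𝕋 = E/Γ` as `x → 0`, `x ≠ 0`. -/
def clusterSet {E : Type*} [NormedAddCommGroup E] [InnerProductSpace ℂ E]
    (Γ : AddSubgroup E) (f : ℂ → E) : Set (E ⧸ Γ) :=
  {y | MapClusterPt y (𝓝[≠] (0 : ℂ)) (fun x => (f x : E ⧸ Γ))}

/-- The cluster values of `π(f(x))` in `𝕋 = E/Γ` as `x → 0`, `x ∈ 𝔻_Θ`. -/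
def sectorClusterSet {E : Type*} [NormedAddCommGroup E] [InnerProductSpace ℂ E]
    (Γ : AddSubgroup E) (f : ℂ → E) (Θ : Set Real.Angle) : Set (E ⧸ Γ) :=
  {y | MapClusterPt y (𝓝[sector Θ] (0 : ℂ)) (fun x => (f x : E ⧸ Γ))}

/-- `γ` restricted to `[0,1]` parametrizes a regular smooth arc. -/
def IsSmoothArc (γ : ℝ → ℂ) : Prop :=
  ContDiffOn ℝ ∞ γ (Set.Icc 0 1) ∧ ∀ t ∈ Set.Icc (0 : ℝ) 1, derivWithin γ (Set.Icc 0 1) t ≠ 0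

/-- The open sets `U` used to define the measures `μ_a`: relatively compact in the punctured
unit disc, contained in `𝔻_Θ`, meeting the radius of argument `φ`, and with a boundary which
is a finite union of regular smooth arcs, none of which is tangent to this radius at a common
point. -/
structure IsAdmissibleOpen (Θ : Set Real.Angle) (φ : Real.Angle) (U : Set ℂ) : Prop where
  isOpen : IsOpen U
  isCompact : IsCompact (closure U)
  closure_subset : closure U ⊆ Metric.ball 0 1 \ {0}
  subset_sector : U ⊆ sector Θ
  inter_nonempty : (U ∩ sector {φ}).Nonempty
  boundary : ∃ (N : ℕ) (γ : Fin N → ℝ → ℂ), (∀ i, IsSmoothArc (γ i)) ∧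
    frontier U = ⋃ i, γ i '' Set.Icc 0 1 ∧
    ∀ i, ∀ t ∈ Set.Icc (0 : ℝ) 1, γ i t ∈ sector {φ} →
      ∀ s : ℝ, derivWithin (γ i) (Set.Icc 0 1) t ≠ (s : ℂ) * γ i t

/-- The measure `μ_a = a^{2d - d_κ} π_*(f_*[U_a] ∧ ω)` on `𝕋 = E/Γ`, where `U_a = a U`, `d = d_1`,
and `ω` is the Kähler form of the Hermitian norm of `E`: since `f` is holomorphic,
`f^*ω = ‖f'(x)‖² i dx ∧ dx̄`, and `i dx ∧ dx̄` is twice the Lebesgue measure. -/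
noncomputable def flowMeasure {E : Type*} [NormedAddCommGroup E] [InnerProductSpace ℂ E]
    [MeasurableSpace E] (Γ : AddSubgroup E) (f : ℂ → E) (d : ℕ → ℕ) (κ : ℕ) (U : Set ℂ) (a : ℝ) :
    Measure (E ⧸ Γ) :=
  ENNReal.ofReal (a ^ (2 * d 1) / a ^ d κ) •
    ((volume.restrict ((fun x : ℂ => (a : ℂ) * x) '' U)).withDensity
      (fun x => ENNReal.ofReal (2 * ‖deriv f x‖ ^ 2))).map (fun x => (f x : E ⧸ Γ))

/-- `μ` is a Haar measure of the subset `S` of a topological additive group `T`: `S = t + G` is a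
translate of a closed subgroup `G`, and `μ` is the image of a Haar measure of `G` by the
translation by `t`. -/
def IsHaarMeasureOf {T : Type*} [AddCommGroup T] [TopologicalSpace T] [MeasurableSpace T]
    (S : Set T) (μ : Measure T) : Prop :=
  ∃ (G : AddSubgroup T) (t : T) (ν : Measure G), IsClosed (G : Set T) ∧
    S = (fun g => t + g) '' (G : Set T) ∧ ν.IsAddHaarMeasure ∧
    μ = ν.map (fun g : G => t + (g : T))

/-- `S` is a finite union of translates of connected closed subgroups of `T` (for a real Lie
group `T`, the closed subgroups are exactly its closed real Lie subgroups). -/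
def IsFiniteUnionOfTranslates {T : Type*} [AddCommGroup T] [TopologicalSpace T]
    (S : Set T) : Prop :=
  ∃ (N : ℕ) (t : Fin N → T) (G : Fin N → AddSubgroup T),
    (∀ i, IsClosed (G i : Set T) ∧ IsConnected (G i : Set T)) ∧
    S = ⋃ i, (fun g => t i + g) '' (G i : Set T)

end LieFlow

/-! Write q = d_κ. The form Im H vanishes on Γ_ℝ, so it descends to a continuous function on the
torus. Hence the points x near 0 that are sent to a fixed compact set satisfy |Im H(f(x))| ≤ M. As
H(f) = x'^{-q}, such points lie in 2q thin curved regions, one tangent to each radius L_p. On the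
p-th region z = (-1)^p H(f(x)) is a coordinate with values in a half strip {Re z large, |Im z| ≤ M},
whose inverse is x = η(z^{-1/q}) (`stripMap`, `eventually_exists_ray`). Everything is then read in
z.

In this coordinate a complex linear form of f is y^{-n}A(y), with y = z^{-1/q} and A analytic. Three
facts follow for a real form ℓ. If ℓ vanishes on 𝔽_{κ-1}, its leading exponent is at least -q, so
its z-derivative has a limit, and moving across the strip by iτ adds τ ℓ(iϑ_0) up to o(1)
(`tendsto_real_shift`). If ℓ vanishes on 𝔽'_m, it therefore tends to ℓ(ϑ_{m+1}) + τ ℓ(iϑ_0)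
(`tendsto_of_radialSpace`). If it vanishes on 𝔽_{κ-1} but not on 𝔽'_m, it is unbounded along the
strip (`tendsto_abs_atTop`).

Cluster values: when 𝔽'_m is not contained in Γ_ℝ, some form that descends to the torus is unbounded
on the strip, so nothing accumulates there. Otherwise f is asymptotic to V' modulo o(1). Thus every
cluster value lies in the closure of π(V') for some Γ-radius (`exists_radius_of_tendsto`).

Equidistribution: put z = N S + iτ with N = a^{-q}. The density of the rescaled measure converges in
L¹ to a function of S alone (`tendsto_integral_abs_sub`), since the strip has bounded width.
Transversality of the boundary makes the limiting indicator continuous outside a null set. By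
Stone–Weierstrass on a compact tube it is enough to test characters e^{2πiℓ}, with ℓ integral on Γ.
If ℓ is nonzero on 𝔽_{κ-1}, the phase has a pole of order greater than q and oscillates along or
across the strip, according to whether the real or the imaginary part of its leading coefficient is
nonzero. If ℓ vanishes there but not on 𝔽'_m, it oscillates along the strip. If ℓ vanishes on 𝔽'_m,
the phase converges. These limits are the integrals of the character against Haar measure on the
closure of π(𝔽'_m) times Lebesgue measure on the line iℝϑ_0, translated by ϑ_{m+1}
(`tendsto_integral_character`). The line is transverse to Γ_ℝ because H(ϑ_0) = ±1, so this product
is a Haar measure of the closure of π(V') (`exists_haar_translate`).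

Conversely, a Haar measure charges every neighbourhood of each point of its support set, so
equidistribution forces every point of the closure of π(V') to be a cluster value
(`sectorClusterSet_eq`). The full cluster set is the union over the finitely many Γ-radii, each
isolated in a small closed sector. -/

namespace LieFlow

/-! ### Laurent monomials in `z ^ (-1/q)` and their derivatives. -/

/-- The principal branch of `z ^ (-1/q)`. -/
noncomputable def stripRoot (q : ℕ) (z : ℂ) : ℂ := Complex.exp (-(Complex.log z) / q)

theorem stripRoot_ne_zero (q : ℕ) (z : ℂ) : stripRoot q z ≠ 0 := Complex.exp_ne_zero _

theorem stripRoot_pow {q : ℕ} (hq : q ≠ 0) {z : ℂ} (hz : z ≠ 0) : stripRoot q z ^ q = z⁻¹ := by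
  have hq' : (q : ℂ) ≠ 0 := by exact_mod_cast hq
  rw [stripRoot, ← Complex.exp_nat_mul, mul_div_cancel₀ _ hq', Complex.exp_neg, Complex.exp_log hz]

theorem norm_stripRoot_pow {q : ℕ} (hq : q ≠ 0) {z : ℂ} (hz : z ≠ 0) :
    ‖stripRoot q z‖ ^ q = ‖z‖⁻¹ := by
  rw [← norm_pow, stripRoot_pow hq hz, norm_inv]

theorem stripRoot_eq_ofReal {q : ℕ} {x : ℝ} (hx : 0 < x) :
    stripRoot q (x : ℂ) = ((Real.exp (-(Real.log x) / q) : ℝ) : ℂ) := by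
  rw [stripRoot, ← Complex.ofReal_log hx.le]; push_cast; rfl

theorem norm_stripRoot (q : ℕ) (z : ℂ) :
    ‖stripRoot q z‖ = Real.exp (-(Real.log ‖z‖) / q) := by
  rw [stripRoot, Complex.norm_exp]
  congr 1
  have : -Complex.log z / (q : ℂ) = ((q : ℝ)⁻¹ : ℝ) * (-Complex.log z) := by
    push_cast; ring
  rw [this, Complex.re_ofReal_mul, Complex.neg_re, Complex.log_re]; ring

/-- Since 1/z = y^q, the logarithmic derivative -1/(q z) is again a power of y. Differentiation in z
thus stays inside functions of y. -/
theorem hasDerivAt_stripRoot (q : ℕ) {z : ℂ} (hq : q ≠ 0) (hz : z ∈ Complex.slitPlane) :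
    HasDerivAt (stripRoot q) (-(1 / q : ℂ) * (stripRoot q z * stripRoot q z ^ q)) z := by
  have h1 := ((Complex.hasDerivAt_log hz).neg.div_const (q : ℂ)).cexp
  rw [stripRoot_pow hq (Complex.slitPlane_ne_zero hz)]
  refine h1.congr_deriv ?_
  simp only [stripRoot, Pi.neg_apply]; ring

/-- The coefficient function of the derivative of `z ↦ y ^ s • A y`, `y = z ^ (-1/q)`. -/
noncomputable def zpowDeriv {V : Type*} [NormedAddCommGroup V] [NormedSpace ℂ V]
    (q : ℕ) (s : ℤ) (A : ℂ → V) (y : ℂ) : V :=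
  -(1 / q : ℂ) • ((s : ℂ) • A y + y • deriv A y)

section vec
variable {V : Type*} [NormedAddCommGroup V] [NormedSpace ℂ V]

theorem analyticAt_zpowDeriv [CompleteSpace V] {q : ℕ} {s : ℤ} {A : ℂ → V} {y : ℂ}
    (hA : AnalyticAt ℂ A y) : AnalyticAt ℂ (zpowDeriv q s A) y := by
  unfold zpowDeriv
  have := hA.deriv
  fun_prop

theorem zpowDeriv_zero (q : ℕ) (s : ℤ) (A : ℂ → V) :
    zpowDeriv q s A 0 = (-(s : ℂ) / q) • A 0 := by
  simp only [zpowDeriv, zero_smul, add_zero, smul_smul]; congr 1; ring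

/-- Differentiation keeps the shape y^s A(y) and raises s by q, so it can be iterated and each
derivative has an explicit order of growth. -/
theorem hasDerivAt_zpow_smul {q : ℕ} (hq : q ≠ 0) (s : ℤ) {A : ℂ → V} {z : ℂ}
    (hz : z ∈ Complex.slitPlane) (hA : DifferentiableAt ℂ A (stripRoot q z)) :
    HasDerivAt (fun z => stripRoot q z ^ s • A (stripRoot q z))
      (stripRoot q z ^ (s + q) • zpowDeriv q s A (stripRoot q z)) z := by
  have h1 := hasDerivAt_stripRoot q hq hz
  have h0 := stripRoot_ne_zero q z
  have h2 := ((hasDerivAt_zpow s _ (Or.inl h0)).comp z h1)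
  have h3 := hA.hasDerivAt.scomp z h1
  refine (h2.smul h3).congr_deriv ?_
  simp only [Function.comp, zpowDeriv, smul_smul, smul_add]
  set y := stripRoot q z
  rw [add_comm]
  congr 2
  · rw [zpow_sub_one₀ h0, zpow_add₀ h0, zpow_natCast]; field_simp
  · rw [zpow_add₀ h0, zpow_natCast]; ring
end vec

/-! ### Half strips at infinity. -/

/-- Neighbourhoods of infinity in the half strip `|Im z| ≤ M`. -/
def stripFilter (M : ℝ) : Filter ℂ := comap Complex.re atTop ⊓ 𝓟 {z | |z.im| ≤ M}

theorem tendsto_re_stripFilter (M : ℝ) : Tendsto Complex.re (stripFilter M) atTop :=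
  tendsto_comap.mono_left inf_le_left

theorem eventually_im_stripFilter (M : ℝ) : ∀ᶠ z in stripFilter M, |z.im| ≤ M :=
  mem_inf_of_right (mem_principal_self _)

theorem tendsto_stripFilter_iff {ι : Type*} {l : Filter ι} {u : ι → ℂ} {M : ℝ} :
    Tendsto u l (stripFilter M) ↔
      Tendsto (fun i => (u i).re) l atTop ∧ ∀ᶠ i in l, |(u i).im| ≤ M := by
  rw [stripFilter, tendsto_inf, tendsto_comap_iff, tendsto_principal]; rfl

/-- The filter contains no pointwise information in the imaginary direction: statements along it are
uniform across the strip, as the oscillation estimates need. -/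
theorem eventually_stripFilter_iff {M : ℝ} {P : ℂ → Prop} :
    (∀ᶠ z in stripFilter M, P z) ↔ ∃ R : ℝ, ∀ z : ℂ, R ≤ z.re → |z.im| ≤ M → P z := by
  rw [stripFilter, eventually_inf_principal, eventually_comap]
  constructor
  · intro h
    obtain ⟨R, hR⟩ := eventually_atTop.1 h
    exact ⟨R, fun z hz hi => hR _ hz z rfl hi⟩
  · rintro ⟨R, hR⟩
    filter_upwards [eventually_ge_atTop R] with x hx z hz hi
    exact hR z (hz ▸ hx) hi

theorem eventually_re_pos_stripFilter (M : ℝ) : ∀ᶠ z in stripFilter M, 0 < z.re :=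
  (tendsto_re_stripFilter M).eventually_gt_atTop 0

theorem tendsto_norm_stripFilter (M : ℝ) : Tendsto (fun z : ℂ => ‖z‖) (stripFilter M) atTop :=
  tendsto_atTop_mono (fun z => Complex.re_le_norm z) (tendsto_re_stripFilter M)

theorem tendsto_im_div_norm_stripFilter (M : ℝ) :
    Tendsto (fun z : ℂ => z.im / ‖z‖) (stripFilter M) (𝓝 0) := by
  have h : Tendsto (fun z : ℂ => M / ‖z‖) (stripFilter M) (𝓝 0) :=
    (tendsto_norm_stripFilter M).const_div_atTop M
  refine squeeze_zero_norm' ?_ h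
  filter_upwards [eventually_im_stripFilter M] with z hz
  rw [norm_div, norm_norm, Real.norm_eq_abs]
  gcongr

theorem tendsto_arg_stripFilter (M : ℝ) : Tendsto Complex.arg (stripFilter M) (𝓝 0) := by
  have h := (Real.continuous_arcsin.tendsto 0).comp (tendsto_im_div_norm_stripFilter M)
  rw [Real.arcsin_zero] at h
  refine h.congr' ?_
  filter_upwards [eventually_re_pos_stripFilter M] with z hz
  rw [Complex.arg_of_re_nonneg hz.le]; rfl

theorem tendsto_re_div_norm_stripFilter (M : ℝ) :
    Tendsto (fun z : ℂ => z.re / ‖z‖) (stripFilter M) (𝓝 1) := by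
  have h := (Real.continuous_cos.tendsto 0).comp (tendsto_arg_stripFilter M)
  rw [Real.cos_zero] at h
  refine h.congr' ?_
  filter_upwards [eventually_re_pos_stripFilter M] with z hz
  exact Complex.cos_arg (by rintro rfl; simp at hz)

theorem tendsto_norm_stripRoot {q : ℕ} (hq : q ≠ 0) (M : ℝ) :
    Tendsto (fun z => ‖stripRoot q z‖) (stripFilter M) (𝓝 0) := by
  simp_rw [norm_stripRoot]
  refine Real.tendsto_exp_atBot.comp ?_
  refine Tendsto.atBot_div_const (by positivity) ?_
  exact tendsto_neg_atTop_atBot.comp (Real.tendsto_log_atTop.comp (tendsto_norm_stripFilter M))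

theorem tendsto_stripRoot {q : ℕ} (hq : q ≠ 0) (M : ℝ) :
    Tendsto (stripRoot q) (stripFilter M) (𝓝[≠] 0) :=
  tendsto_nhdsWithin_iff.2 ⟨tendsto_zero_iff_norm_tendsto_zero.2 (tendsto_norm_stripRoot hq M),
    Eventually.of_forall fun _ => stripRoot_ne_zero _ _⟩

/-- The phase of y is -arg z / q, and arg z tends to 0 because Im z stays bounded while Re z grows.
-/
theorem tendsto_stripRoot_div_norm (q : ℕ) (M : ℝ) :
    Tendsto (fun z => stripRoot q z / ‖stripRoot q z‖) (stripFilter M) (𝓝 1) := by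
  have h : Tendsto (fun z => Complex.exp (-(Complex.arg z : ℂ) * Complex.I / q)) (stripFilter M)
      (𝓝 (Complex.exp (-((0 : ℝ) : ℂ) * Complex.I / q))) := by
    refine Tendsto.cexp ?_
    exact ((((Complex.continuous_ofReal.tendsto 0).comp
      (tendsto_arg_stripFilter M)).neg).mul_const _).div_const _
  simp only [Complex.ofReal_zero, neg_zero, zero_mul, zero_div, Complex.exp_zero] at h
  refine h.congr fun z => ?_
  rw [norm_stripRoot, stripRoot, Complex.ofReal_exp, ← Complex.exp_sub]
  congr 1
  rw [Complex.log]
  push_cast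
  ring

/-- As y is asymptotically a positive real, y^s may be normalized by the real number ‖y‖^s. The real
and imaginary parts of A(0) then govern those of the function. -/
theorem tendsto_zpow_smul {V : Type*} [NormedAddCommGroup V] [NormedSpace ℂ V] {q : ℕ}
    (hq : q ≠ 0) (M : ℝ) (s : ℤ) {A : ℂ → V} (hA : ContinuousAt A 0) :
    Tendsto (fun z => (‖stripRoot q z‖ ^ s)⁻¹ • stripRoot q z ^ s • A (stripRoot q z))
      (stripFilter M) (𝓝 (A 0)) := by
  have h1 : Tendsto (fun z => (stripRoot q z / ‖stripRoot q z‖) ^ s) (stripFilter M) (𝓝 1) := by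
    simpa using (tendsto_stripRoot_div_norm q M).zpow₀ s (Or.inl one_ne_zero)
  have h2 := h1.smul (hA.tendsto.comp ((tendsto_stripRoot hq M).mono_right nhdsWithin_le_nhds))
  rw [one_smul] at h2
  refine h2.congr fun z => ?_
  rw [div_zpow, Function.comp, div_eq_mul_inv, mul_comm, mul_smul, ← Complex.coe_smul]
  push_cast
  rfl

/-! ### Oscillatory integrals on an interval. -/

/-- First derivative test for oscillatory integrals with a smooth weight. -/
theorem norm_integral_cexp_mul_le {a b : ℝ} (hab : a ≤ b) {Φ Φ' Φ'' w w' : ℝ → ℝ} {Λ ε B₀ B₁ : ℝ}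
    (hΛ : 0 < Λ)
    (h1 : ∀ t ∈ Set.Icc a b, HasDerivAt Φ (Φ' t) t)
    (h2 : ∀ t ∈ Set.Icc a b, HasDerivAt Φ' (Φ'' t) t)
    (h3 : ContinuousOn Φ'' (Set.Icc a b))
    (h4 : ∀ t ∈ Set.Icc a b, Λ ≤ |Φ' t|)
    (h5 : ∀ t ∈ Set.Icc a b, |Φ'' t| ≤ ε * |Φ' t| ^ 2)
    (hw : ∀ t ∈ Set.Icc a b, HasDerivAt w (w' t) t) (hw' : ContinuousOn w' (Set.Icc a b))
    (hB₀ : ∀ t ∈ Set.Icc a b, |w t| ≤ B₀) (hB₁ : ∀ t ∈ Set.Icc a b, |w' t| ≤ B₁) :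
    ‖∫ t in a..b, Complex.exp (Complex.I * Φ t) * w t‖ ≤
      2 * B₀ / Λ + (B₁ / Λ + B₀ * ε) * (b - a) := by
  have hB₀0 : 0 ≤ B₀ := (abs_nonneg _).trans (hB₀ a ⟨le_rfl, hab⟩)
  have hB₁0 : 0 ≤ B₁ := (abs_nonneg _).trans (hB₁ a ⟨le_rfl, hab⟩)
  have hne : ∀ t ∈ Set.Icc a b, Φ' t ≠ 0 := fun t ht h => by
    have := h4 t ht; rw [h, abs_zero] at this; linarith
  -- Integration by parts with u = w/(iΦ') against d(e^{iΦ}): the boundary terms give 2B₀/Λ, and u'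
  -- is bounded by B₁/Λ + B₀ε.
  set u : ℝ → ℂ := fun t => ((w t / Φ' t : ℝ) : ℂ) / Complex.I with hu
  set u' : ℝ → ℂ := fun t => (((w' t * Φ' t - w t * Φ'' t) / Φ' t ^ 2 : ℝ) : ℂ) / Complex.I with hu'
  set e : ℝ → ℂ := fun t => Complex.exp (Complex.I * Φ t) with he
  set e' : ℝ → ℂ := fun t => Complex.exp (Complex.I * Φ t) * (Complex.I * Φ' t) with he'
  have hIcc : Set.uIcc a b = Set.Icc a b := Set.uIcc_of_le hab
  have du : ∀ t ∈ Set.uIcc a b, HasDerivAt u (u' t) t := fun t ht => by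
    rw [hIcc] at ht
    exact (((hw t ht).div (h2 t ht) (hne t ht)).ofReal_comp).div_const _
  have de : ∀ t ∈ Set.uIcc a b, HasDerivAt e (e' t) t := fun t ht => by
    rw [hIcc] at ht
    exact ((h1 t ht).ofReal_comp.const_mul Complex.I).cexp
  have c1 : ContinuousOn Φ (Set.Icc a b) := fun t ht => (h1 t ht).continuousAt.continuousWithinAt
  have c2 : ContinuousOn Φ' (Set.Icc a b) := fun t ht => (h2 t ht).continuousAt.continuousWithinAt
  have c3 : ContinuousOn w (Set.Icc a b) := fun t ht => (hw t ht).continuousAt.continuousWithinAt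
  have cu' : ContinuousOn u' (Set.uIcc a b) := by
    rw [hIcc]
    refine (Complex.continuous_ofReal.comp_continuousOn ?_).div_const _
    exact ((hw'.mul c2).sub (c3.mul h3)).div (c2.pow 2) fun t ht => pow_ne_zero _ (hne t ht)
  have ce' : ContinuousOn e' (Set.uIcc a b) := by
    rw [hIcc]
    exact ((continuousOn_const.mul (Complex.continuous_ofReal.comp_continuousOn c1)).cexp).mul
      (continuousOn_const.mul (Complex.continuous_ofReal.comp_continuousOn c2))
  have key := intervalIntegral.integral_mul_deriv_eq_deriv_mul du de cu'.intervalIntegrable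
    ce'.intervalIntegrable
  have e1 : ∫ t in a..b, Complex.exp (Complex.I * Φ t) * w t = ∫ t in a..b, u t * e' t := by
    refine intervalIntegral.integral_congr fun t ht => ?_
    rw [hIcc] at ht
    have : (Φ' t : ℂ) ≠ 0 := by exact_mod_cast hne t ht
    simp only [hu, he']
    push_cast
    field_simp
  have ne : ∀ t, ‖e t‖ = 1 := fun t => by
    simp only [he]; rw [mul_comm]; exact Complex.norm_exp_ofReal_mul_I _
  have nu : ∀ t ∈ Set.Icc a b, ‖u t‖ ≤ B₀ / Λ := fun t ht => by
    simp only [hu]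
    rw [norm_div, Complex.norm_I, div_one, Complex.norm_real, Real.norm_eq_abs, abs_div]
    exact div_le_div₀ hB₀0 (hB₀ t ht) hΛ (h4 t ht)
  have nu' : ∀ t ∈ Set.Icc a b, ‖u' t‖ ≤ B₁ / Λ + B₀ * ε := fun t ht => by
    simp only [hu']
    rw [norm_div, Complex.norm_I, div_one, Complex.norm_real, Real.norm_eq_abs]
    have : (w' t * Φ' t - w t * Φ'' t) / Φ' t ^ 2 = w' t / Φ' t - w t * (Φ'' t / Φ' t ^ 2) := by
      have := hne t ht; field_simp
    rw [this]
    refine (abs_sub _ _).trans (add_le_add ?_ ?_)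
    · rw [abs_div]; exact div_le_div₀ hB₁0 (hB₁ t ht) hΛ (h4 t ht)
    · rw [abs_mul, abs_div, abs_pow]
      refine mul_le_mul (hB₀ t ht) ?_ (by positivity) hB₀0
      have : 0 < |Φ' t| := hΛ.trans_le (h4 t ht)
      rw [div_le_iff₀ (by positivity)]
      exact h5 t ht
  rw [e1, key]
  have hi : ‖∫ t in a..b, u' t * e t‖ ≤ (B₁ / Λ + B₀ * ε) * |b - a| := by
    refine intervalIntegral.norm_integral_le_of_norm_le_const fun t ht => ?_
    rw [Set.uIoc_of_le hab] at ht
    rw [norm_mul, ne, mul_one]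
    exact nu' t ⟨ht.1.le, ht.2⟩
  rw [abs_of_nonneg (by linarith)] at hi
  refine (norm_sub_le _ _).trans (add_le_add ((norm_sub_le _ _).trans ?_) hi)
  rw [norm_mul, norm_mul, ne, ne, mul_one, mul_one]
  have := nu a ⟨le_rfl, hab⟩
  have := nu b ⟨hab, le_rfl⟩
  have : 2 * B₀ / Λ = B₀ / Λ + B₀ / Λ := by ring
  linarith

/-- Integrals of rapidly oscillating functions against an integrable weight tend to zero. -/
theorem tendsto_integral_cexp_mul {ι : Type*} {l : Filter ι} {a b : ℝ} (hab : a ≤ b)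
    {Φ Φ' Φ'' : ι → ℝ → ℝ}
    (h : ∀ᶠ i in l, (∀ t ∈ Set.Icc a b, HasDerivAt (Φ i) (Φ' i t) t) ∧
      (∀ t ∈ Set.Icc a b, HasDerivAt (Φ' i) (Φ'' i t) t) ∧ ContinuousOn (Φ'' i) (Set.Icc a b))
    (hΛ : ∀ Λ : ℝ, ∀ᶠ i in l, ∀ t ∈ Set.Icc a b, Λ ≤ |Φ' i t|)
    (hε : ∀ ε > 0, ∀ᶠ i in l, ∀ t ∈ Set.Icc a b, |Φ'' i t| ≤ ε * |Φ' i t| ^ 2)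
    {W : ℝ → ℝ} (hW : IntervalIntegrable W volume a b) :
    Tendsto (fun i => ∫ t in a..b, Complex.exp (Complex.I * Φ i t) * W t) l (𝓝 0) := by
  rw [Metric.tendsto_nhds]
  intro η hη
  -- approximation of the weight by a polynomial
  obtain ⟨p, hp⟩ : ∃ p : Polynomial ℝ, ∫ t in a..b, |W t - p.eval t| ≤ η / 2 := by
    rw [intervalIntegrable_iff_integrableOn_Ioc_of_le hab] at hW
    obtain ⟨g, -, hg, hgc, hgi⟩ := hW.exists_hasCompactSupport_integral_sub_le
      (ε := η / 4) (by linarith)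
    -- The `+ 1` keeps the tolerance meaningful when a = b.
    obtain ⟨p, hp⟩ := exists_polynomial_near_of_continuousOn a b g hgc.continuousOn
      (η / 4 / (b - a + 1)) (by have : 0 < b - a + 1 := by linarith
                                positivity)
    refine ⟨p, ?_⟩
    rw [intervalIntegral.integral_of_le hab]
    have hpc : Continuous fun t => p.eval t := p.continuous
    have i1 : IntegrableOn (fun t => ‖W t - g t‖) (Set.Ioc a b) := (hW.sub hgi).norm
    have i2 : IntegrableOn (fun t => ‖g t - p.eval t‖) (Set.Ioc a b) :=
      ((hgc.sub hpc).norm.integrableOn_Icc (a := a) (b := b)).mono_set Set.Ioc_subset_Icc_self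
    calc ∫ t in Set.Ioc a b, |W t - p.eval t|
        ≤ ∫ t in Set.Ioc a b, (‖W t - g t‖ + ‖g t - p.eval t‖) := by
          refine setIntegral_mono_on ?_ (i1.add i2) measurableSet_Ioc fun t _ => ?_
          · have : IntegrableOn (fun t => ‖W t - p.eval t‖) (Set.Ioc a b) :=
              (hW.sub ((hpc.integrableOn_Icc (a := a) (b := b)).mono_set
                Set.Ioc_subset_Icc_self)).norm
            exact this
          · exact (abs_sub_le _ (g t) _)
      _ = (∫ t in Set.Ioc a b, ‖W t - g t‖) + ∫ t in Set.Ioc a b, ‖g t - p.eval t‖ :=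
          integral_add i1 i2
      _ ≤ η / 4 + η / 4 := by
          refine add_le_add hg ?_
          calc ∫ t in Set.Ioc a b, ‖g t - p.eval t‖
              ≤ ∫ t in Set.Ioc a b, η / 4 / (b - a + 1) := by
                refine setIntegral_mono_on i2 (by simp) measurableSet_Ioc fun t ht => ?_
                rw [norm_sub_rev]
                exact (hp t ⟨ht.1.le, ht.2⟩).le
            _ = (b - a) * (η / 4 / (b - a + 1)) := by
                simp [Measure.real, hab]
            _ ≤ η / 4 := by
                have : 0 < b - a + 1 := by linarith
                rw [← mul_div_assoc, div_le_iff₀ this]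
                nlinarith
      _ = η / 2 := by ring
  have hpc : Continuous fun t => p.eval t := p.continuous
  have hpc' : Continuous fun t => p.derivative.eval t := p.derivative.continuous
  obtain ⟨B₀, hB₀⟩ := isCompact_Icc.exists_bound_of_continuousOn (s := Set.Icc a b) hpc.continuousOn
  obtain ⟨B₁, hB₁⟩ := isCompact_Icc.exists_bound_of_continuousOn (s := Set.Icc a b)
    hpc'.continuousOn
  have hB₀0 : 0 ≤ B₀ := (norm_nonneg _).trans (hB₀ a ⟨le_rfl, hab⟩)
  have hB₁0 : 0 ≤ B₁ := (norm_nonneg _).trans (hB₁ a ⟨le_rfl, hab⟩)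
  -- choice of the parameters
  set C := 2 * B₀ + B₁ * (b - a) + 1 with hC
  set C' := B₀ * (b - a) + 1 with hC'
  have hC0 : 0 < C := by have := mul_nonneg hB₁0 (sub_nonneg.2 hab); positivity
  have hC'0 : 0 < C' := by have := mul_nonneg hB₀0 (sub_nonneg.2 hab); positivity
  filter_upwards [h, hΛ (8 * C / η), hε (η / (8 * C')) (by positivity)] with i ⟨k1, k2, k3⟩ k4 k5
  have key := norm_integral_cexp_mul_le hab (by positivity) k1 k2 k3 k4 k5
    (fun t _ => p.hasDerivAt t) hpc'.continuousOn hB₀ hB₁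
  have hbound : 2 * B₀ / (8 * C / η) + (B₁ / (8 * C / η) + B₀ * (η / (8 * C'))) * (b - a) <
      η / 2 := by
    have e1 : 2 * B₀ / (8 * C / η) + (B₁ / (8 * C / η) + B₀ * (η / (8 * C'))) * (b - a) =
        (η / 8) * ((C - 1) / C) + (η / 8) * ((C' - 1) / C') := by
      rw [hC, hC']; rw [hC] at hC0; rw [hC'] at hC'0; field_simp; ring
    have e2 : (C - 1) / C < 1 := by rw [div_lt_one hC0]; linarith
    have e3 : (C' - 1) / C' < 1 := by rw [div_lt_one hC'0]; linarith
    rw [e1]; nlinarith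
  have ce : ContinuousOn (fun t => Complex.exp (Complex.I * Φ i t)) (Set.uIcc a b) := by
    rw [Set.uIcc_of_le hab]
    have c1 : ContinuousOn (Φ i) (Set.Icc a b) :=
      fun t ht => (k1 t ht).continuousAt.continuousWithinAt
    exact (continuousOn_const.mul (Complex.continuous_ofReal.comp_continuousOn c1)).cexp
  have i1 : IntervalIntegrable (fun t => Complex.exp (Complex.I * Φ i t) *
      ((W t - p.eval t : ℝ) : ℂ)) volume a b :=
    IntervalIntegrable.continuousOn_mul
      ⟨(hW.sub (hpc.intervalIntegrable a b)).1.ofReal, (hW.sub (hpc.intervalIntegrable a b)).2.ofReal⟩ ce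
  have i2 : IntervalIntegrable (fun t => Complex.exp (Complex.I * Φ i t) *
      ((p.eval t : ℝ) : ℂ)) volume a b :=
    IntervalIntegrable.continuousOn_mul ⟨(hpc.intervalIntegrable a b).1.ofReal,
      (hpc.intervalIntegrable a b).2.ofReal⟩ ce
  have e1 : ∫ t in a..b, Complex.exp (Complex.I * Φ i t) * W t =
      (∫ t in a..b, Complex.exp (Complex.I * Φ i t) * ((W t - p.eval t : ℝ) : ℂ)) +
        ∫ t in a..b, Complex.exp (Complex.I * Φ i t) * ((p.eval t : ℝ) : ℂ) := by
    rw [← intervalIntegral.integral_add i1 i2]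
    refine intervalIntegral.integral_congr fun t _ => ?_
    push_cast; ring
  rw [dist_zero_right, e1]
  have e2 : ‖∫ t in a..b, Complex.exp (Complex.I * Φ i t) * ((W t - p.eval t : ℝ) : ℂ)‖ ≤ η / 2 := by
    refine (intervalIntegral.norm_integral_le_integral_norm hab).trans (le_trans (le_of_eq ?_) hp)
    refine intervalIntegral.integral_congr fun t _ => ?_
    simp only [norm_mul, Complex.norm_real, Real.norm_eq_abs]
    rw [mul_comm Complex.I, Complex.norm_exp_ofReal_mul_I, one_mul]
  exact (norm_add_le _ _).trans_lt (by linarith)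

/-! ### Oscillation of phases Re (y^s B(y)) on a strip. -/

theorem abs_two_pi_mul (a : ℝ) : |2 * Real.pi * a| = 2 * Real.pi * |a| := by
  rw [abs_mul, abs_of_pos Real.two_pi_pos]

section phase
variable {q : ℕ} {s : ℤ} {B : ℂ → ℂ} {c : ℂ} (M : ℝ)

/-- The constant c encodes the direction of differentiation: c = 1 along the strip and c = i across
it. -/
theorem tendsto_abs_re_zpow_smul (hq : q ≠ 0) {D : ℂ → ℂ} (hD : ContinuousAt D 0) (c : ℂ) :
    Tendsto (fun z => (‖stripRoot q z‖ ^ s)⁻¹ *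
      |(c * (stripRoot q z ^ s * D (stripRoot q z))).re|) (stripFilter M)
      (𝓝 |(c * D 0).re|) := by
  have h := (tendsto_zpow_smul hq M s hD).const_mul c
  have h2 := ((Complex.continuous_re.tendsto _).comp h).abs
  refine h2.congr fun z => ?_
  have h0 : 0 ≤ (‖stripRoot q z‖ ^ s)⁻¹ := inv_nonneg.2 (zpow_nonneg (norm_nonneg _) _)
  simp only [Function.comp, smul_eq_mul, Complex.real_smul]
  rw [mul_left_comm, Complex.re_ofReal_mul, abs_mul, abs_of_nonneg h0]

theorem tendsto_inv_norm_zpow_stripRoot (hq : q ≠ 0) (hs : s < 0) :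
    Tendsto (fun z => ‖stripRoot q z‖ ^ s) (stripFilter M) atTop := by
  obtain ⟨n, rfl⟩ : ∃ n : ℕ, s = -(n + 1 : ℕ) := ⟨(-s - 1).toNat, by omega⟩
  simp_rw [zpow_neg, zpow_natCast, ← inv_pow]
  refine (tendsto_pow_atTop (by omega)).comp ?_
  refine Tendsto.inv_tendsto_nhdsGT_zero (tendsto_nhdsWithin_iff.2
    ⟨tendsto_norm_stripRoot hq M, Eventually.of_forall fun z => ?_⟩)
  exact norm_pos_iff.2 (stripRoot_ne_zero q z)

/-- The second derivative is O(‖y‖^{s+2q}) and the square of the first has order 2s + 2q. The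
quotient is O(‖y‖^{-s}), which tends to 0 for s < 0. -/
theorem eventually_norm_deriv_two_le (hq : q ≠ 0) (hs : s < 0) (hB : AnalyticAt ℂ B 0)
    (hc : (c * zpowDeriv q s B 0).re ≠ 0) {ε : ℝ} (hε : 0 < ε) :
    ∀ᶠ z in stripFilter M,
      ‖stripRoot q z ^ (s + q + q) * zpowDeriv q (s + q) (zpowDeriv q s B) (stripRoot q z)‖ ≤
        ε * |(c * (stripRoot q z ^ (s + q) * zpowDeriv q s B (stripRoot q z))).re| ^ 2 := by
  have a1 := analyticAt_zpowDeriv (q := q) (s := s) hB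
  have a2 := analyticAt_zpowDeriv (q := q) (s := s + q) a1
  have t1 := tendsto_abs_re_zpow_smul (s := s + q) M hq a1.continuousAt c
  have t2 := (tendsto_zpow_smul hq M (s + q + q) a2.continuousAt).norm
  have t3 : Tendsto (fun z => ‖stripRoot q z‖ ^ (-s)) (stripFilter M) (𝓝 0) := by
    have := (tendsto_inv_norm_zpow_stripRoot M hq hs).inv_tendsto_atTop
    refine this.congr fun z => ?_
    rw [Pi.inv_apply, zpow_neg]
  have t4 := t2.mul t3
  have t5 := (t1.pow 2).const_mul ε
  rw [mul_zero] at t4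
  have hpos : (0 : ℝ) < ε * |(c * zpowDeriv q s B 0).re| ^ 2 := by positivity
  filter_upwards [t4.eventually_lt t5 hpos] with z hz
  have h0 : 0 < ‖stripRoot q z‖ := norm_pos_iff.2 (stripRoot_ne_zero q z)
  rw [norm_smul, norm_inv, Real.norm_of_nonneg (zpow_nonneg h0.le _), smul_eq_mul] at hz
  set r := ‖stripRoot q z‖
  set X := ‖stripRoot q z ^ (s + q + q) * zpowDeriv q (s + q) (zpowDeriv q s B) (stripRoot q z)‖
  set Y := |(c * (stripRoot q z ^ (s + q) * zpowDeriv q s B (stripRoot q z))).re|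
  have e1 : (r ^ (s + q + q))⁻¹ * X * r ^ (-s) = X * (r ^ (s + q : ℤ))⁻¹ ^ 2 := by
    have : (r ^ (s + q : ℤ))⁻¹ ^ 2 = (r ^ (s + q + q))⁻¹ * r ^ (-s) := by
      rw [← zpow_neg, ← zpow_neg, ← zpow_natCast, ← zpow_mul, ← zpow_add₀ h0.ne']
      congr 1; push_cast; ring
    rw [this]; ring
  rw [e1, mul_pow] at hz
  have h6 : 0 < (r ^ (s + q : ℤ))⁻¹ ^ 2 := by positivity
  have : X * (r ^ (s + q : ℤ))⁻¹ ^ 2 < ε * Y ^ 2 * (r ^ (s + q : ℤ))⁻¹ ^ 2 := by linarith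
  exact (lt_of_mul_lt_mul_right this h6.le).le

/-- The derivative has order s + q, so it blows up only for a pole of order greater than q. Hence
transverse oscillation is available for the leading directions 𝔽_{κ-1} only. -/
theorem eventually_le_abs_re_deriv (hq : q ≠ 0) (hs : s + q < 0) (hB : AnalyticAt ℂ B 0)
    (hc : (c * zpowDeriv q s B 0).re ≠ 0) (Λ : ℝ) :
    ∀ᶠ z in stripFilter M,
      Λ ≤ |(c * (stripRoot q z ^ (s + q) * zpowDeriv q s B (stripRoot q z))).re| := by
  have a1 := analyticAt_zpowDeriv (q := q) (s := s) hB
  have t1 := tendsto_abs_re_zpow_smul (s := s + q) M hq a1.continuousAt c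
  have t2 := (tendsto_inv_norm_zpow_stripRoot M hq hs).atTop_mul_pos (abs_pos.2 hc) t1
  filter_upwards [t2.eventually_ge_atTop Λ] with z hz
  have h0 : 0 < ‖stripRoot q z‖ := norm_pos_iff.2 (stripRoot_ne_zero q z)
  rwa [mul_inv_cancel_left₀ (zpow_pos h0 _).ne'] at hz

/-- Rescaling by N multiplies the derivative by a quantity comparable to Re z, of order ‖y‖^{-q}.
The product has order s, so any pole suffices along the strip. -/
theorem eventually_le_re_mul_abs_re_deriv (hq : q ≠ 0) (hs : s < 0) (hB : AnalyticAt ℂ B 0)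
    (hc : (c * zpowDeriv q s B 0).re ≠ 0) (Λ : ℝ) :
    ∀ᶠ z in stripFilter M,
      Λ ≤ z.re * |(c * (stripRoot q z ^ (s + q) * zpowDeriv q s B (stripRoot q z))).re| := by
  have a1 := analyticAt_zpowDeriv (q := q) (s := s) hB
  have t1 := tendsto_abs_re_zpow_smul (s := s + q) M hq a1.continuousAt c
  have t1' := (tendsto_re_div_norm_stripFilter M).mul t1
  rw [one_mul] at t1'
  have t2 := (tendsto_inv_norm_zpow_stripRoot M hq hs).atTop_mul_pos (abs_pos.2 hc) t1'
  filter_upwards [t2.eventually_ge_atTop Λ, eventually_re_pos_stripFilter M] with z hz hz0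
  have h0 : 0 < ‖stripRoot q z‖ := norm_pos_iff.2 (stripRoot_ne_zero q z)
  have hz1 : z ≠ 0 := by rintro rfl; simp at hz0
  refine hz.trans (le_of_eq ?_)
  set Y := |(c * (stripRoot q z ^ (s + q) * zpowDeriv q s B (stripRoot q z))).re|
  have e1 : ‖z‖ = (‖stripRoot q z‖ ^ q)⁻¹ := by rw [norm_stripRoot_pow hq hz1, inv_inv]
  rw [e1, zpow_add₀ h0.ne', zpow_natCast]
  have := (zpow_pos h0 s).ne'
  have := (pow_pos h0 q).ne'
  field_simp

theorem eventually_hasDerivAt_strip (hq : q ≠ 0) (hB : AnalyticAt ℂ B 0) :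
    ∀ᶠ z in stripFilter M,
      HasDerivAt (fun z => stripRoot q z ^ s * B (stripRoot q z))
        (stripRoot q z ^ (s + q) * zpowDeriv q s B (stripRoot q z)) z ∧
      HasDerivAt (fun z => stripRoot q z ^ (s + q) * zpowDeriv q s B (stripRoot q z))
        (stripRoot q z ^ (s + q + q) * zpowDeriv q (s + q) (zpowDeriv q s B) (stripRoot q z)) z ∧
      ContinuousAt (fun z => stripRoot q z ^ (s + q + q) *
        zpowDeriv q (s + q) (zpowDeriv q s B) (stripRoot q z)) z := by
  have a1 := analyticAt_zpowDeriv (q := q) (s := s) hB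
  have a2 := analyticAt_zpowDeriv (q := q) (s := s + q) a1
  have ht := (tendsto_stripRoot hq M).mono_right nhdsWithin_le_nhds
  filter_upwards [ht.eventually hB.eventually_analyticAt, ht.eventually a1.eventually_analyticAt,
    ht.eventually a2.eventually_analyticAt, eventually_re_pos_stripFilter M] with z h1 h2 h3 h4
  have h4 : z ∈ Complex.slitPlane := Or.inl h4
  exact ⟨hasDerivAt_zpow_smul hq s h4 h1.differentiableAt,
    hasDerivAt_zpow_smul hq (s + q) h4 h2.differentiableAt,
    (hasDerivAt_zpow_smul hq (s + q + q) h4 h3.differentiableAt).continuousAt⟩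

/-- Oscillation in the direction of the strip. -/
theorem tendsto_integral_phase_horizontal (hq : q ≠ 0) (hs : s < 0) (hB : AnalyticAt ℂ B 0)
    (hc : (B 0).re ≠ 0) {α β : ℝ} (hα : 0 < α) (hαβ : α ≤ β) {W : ℝ → ℝ}
    (hW : IntervalIntegrable W volume α β) (τ : ℝ) :
    Tendsto (fun N : ℝ => ∫ S in α..β, Complex.exp (Complex.I *
      ((2 * Real.pi * (stripRoot q (⟨N * S, τ⟩ : ℂ) ^ s * B (stripRoot q (⟨N * S, τ⟩ : ℂ))).re : ℝ)
        : ℂ)) * W S) atTop (𝓝 0) := by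
  have hc1 : ((1 : ℂ) * zpowDeriv q s B 0).re ≠ 0 := by
    rw [one_mul, zpowDeriv_zero, smul_eq_mul,
      show (-(s : ℂ) / q) = ((-(s : ℝ) / q : ℝ) : ℂ) by push_cast; rfl, Complex.re_ofReal_mul]
    have : (s : ℝ) ≠ 0 := by exact_mod_cast hs.ne
    have : (q : ℝ) ≠ 0 := by exact_mod_cast hq
    refine mul_ne_zero (div_ne_zero (neg_ne_zero.2 ‹_›) this) hc
  -- Because S is bounded below by α > 0, the whole segment N·[α, β] leaves every bounded set as N
  -- grows.
  have unif : ∀ {P : ℂ → Prop}, (∀ᶠ z in stripFilter |τ|, P z) →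
      ∀ᶠ N : ℝ in atTop, 0 < N ∧ ∀ S ∈ Set.Icc α β, P ⟨N * S, τ⟩ := by
    intro P hP
    obtain ⟨R, hR⟩ := eventually_stripFilter_iff.1 hP
    filter_upwards [eventually_ge_atTop (R / α), eventually_gt_atTop 0] with N hN hN0
    refine ⟨hN0, fun S hS => hR _ ?_ le_rfl⟩
    rw [div_le_iff₀ hα] at hN
    exact hN.trans (mul_le_mul_of_nonneg_left hS.1 hN0.le)
  have line : ∀ N S : ℝ, HasDerivAt (fun S : ℝ => (⟨N * S, τ⟩ : ℂ)) (N : ℂ) S := by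
    intro N S
    have h1 : (fun S : ℝ => (⟨N * S, τ⟩ : ℂ)) = fun S : ℝ => ((N * S : ℝ) : ℂ) + τ * Complex.I := by
      funext S; exact (Complex.mk_eq_add_mul_I _ _)
    rw [h1]
    simpa using (((hasDerivAt_id S).const_mul N).ofReal_comp).add_const ((τ : ℂ) * Complex.I)
  set h : ℂ → ℂ := fun z => stripRoot q z ^ s * B (stripRoot q z)
  set h' : ℂ → ℂ := fun z => stripRoot q z ^ (s + q) * zpowDeriv q s B (stripRoot q z)
  set h'' : ℂ → ℂ := fun z => stripRoot q z ^ (s + q + q) *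
    zpowDeriv q (s + q) (zpowDeriv q s B) (stripRoot q z)
  have chain : ∀ {k k' : ℂ → ℂ} {N S : ℝ}, HasDerivAt k (k' ⟨N * S, τ⟩) ⟨N * S, τ⟩ →
      HasDerivAt (fun S : ℝ => (k ⟨N * S, τ⟩).re) (N * (k' ⟨N * S, τ⟩).re) S := by
    intro k k' N S hk
    have h2 := hk.comp_of_eq S (line N S) rfl
    have h3 := Complex.reCLM.hasFDerivAt.comp_hasDerivAt S h2
    refine h3.congr_deriv ?_
    simp [mul_comm]
  refine tendsto_integral_cexp_mul hαβ (Φ := fun N S => 2 * Real.pi * (h ⟨N * S, τ⟩).re)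
    (Φ' := fun N S => 2 * Real.pi * (N * (h' ⟨N * S, τ⟩).re))
    (Φ'' := fun N S => 2 * Real.pi * (N * (N * (h'' ⟨N * S, τ⟩).re))) ?_ ?_ ?_ hW
  · filter_upwards [unif (eventually_hasDerivAt_strip |τ| hq hB (s := s))] with N hN
    refine ⟨fun S hS => (chain (hN.2 S hS).1).const_mul _,
      fun S hS => ((chain (hN.2 S hS).2.1).const_mul _).const_mul _, fun S hS => ?_⟩
    have h1 : ContinuousAt h'' ⟨N * S, τ⟩ := (hN.2 S hS).2.2
    have h2 : ContinuousAt (fun S : ℝ => h'' ⟨N * S, τ⟩) S :=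
      h1.comp_of_eq (line N S).continuousAt rfl
    exact (continuousAt_const.mul (continuousAt_const.mul (continuousAt_const.mul
      (Complex.continuous_re.continuousAt.comp h2)))).continuousWithinAt
  · intro Λ
    -- The factor β compensates S ≤ β in Re z = N S, leaving a bound on N times the derivative.
    filter_upwards [unif (eventually_le_re_mul_abs_re_deriv |τ| hq hs hB hc1 (|Λ| * β))] with N hN
    intro S hS
    have h1 := hN.2 S hS
    rw [one_mul] at h1
    have hS0 : 0 < S := hα.trans_le hS.1
    have hβ : 0 < β := hα.trans_le hαβ
    have h2 : |Λ| * β ≤ β * (N * |(h' ⟨N * S, τ⟩).re|) := by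
      refine h1.trans ?_
      have : 0 ≤ N * |(h' ⟨N * S, τ⟩).re| := mul_nonneg hN.1.le (abs_nonneg _)
      calc N * S * |(h' ⟨N * S, τ⟩).re| = S * (N * |(h' ⟨N * S, τ⟩).re|) := by ring
        _ ≤ _ := mul_le_mul_of_nonneg_right hS.2 this
    have h3 : |Λ| ≤ N * |(h' ⟨N * S, τ⟩).re| := by
      rw [mul_comm] at h2; exact le_of_mul_le_mul_left h2 hβ
    rw [abs_two_pi_mul, abs_mul, abs_of_pos hN.1]
    have h4 : 1 ≤ 2 * Real.pi := by have := Real.two_le_pi; linarith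
    calc Λ ≤ |Λ| := le_abs_self _
      _ ≤ 1 * (N * |(h' ⟨N * S, τ⟩).re|) := by rwa [one_mul]
      _ ≤ _ := mul_le_mul_of_nonneg_right h4 ((abs_nonneg _).trans h3)
  · intro ε hε
    filter_upwards [unif (eventually_norm_deriv_two_le |τ| hq hs hB hc1 hε)] with N hN
    intro S hS
    have h1 := hN.2 S hS
    rw [one_mul] at h1
    have h2 : |(h'' ⟨N * S, τ⟩).re| ≤ ε * |(h' ⟨N * S, τ⟩).re| ^ 2 :=
      (Complex.abs_re_le_norm _).trans h1
    rw [abs_two_pi_mul, abs_two_pi_mul, abs_mul, abs_mul, abs_mul, abs_of_pos hN.1]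
    have h4 : 1 ≤ 2 * Real.pi := by have := Real.two_le_pi; linarith
    calc 2 * Real.pi * (N * (N * |(h'' ⟨N * S, τ⟩).re|))
        ≤ 2 * Real.pi * (N * (N * (ε * |(h' ⟨N * S, τ⟩).re| ^ 2))) := by
          have := hN.1; gcongr
      _ ≤ (2 * Real.pi) ^ 2 * (N * (N * (ε * |(h' ⟨N * S, τ⟩).re| ^ 2))) := by
          have := hN.1
          refine mul_le_mul_of_nonneg_right ?_ (by positivity)
          nlinarith
      _ = _ := by ring

/-- Oscillation across the strip. -/
theorem tendsto_integral_phase_vertical (hq : q ≠ 0) (hs : s + q < 0) (hB : AnalyticAt ℂ B 0)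
    (hc : (B 0).im ≠ 0) {M : ℝ} (hM : 0 ≤ M) :
    Tendsto (fun X : ℝ => ∫ τ in (-M)..M, Complex.exp (Complex.I *
      ((2 * Real.pi * (stripRoot q (⟨X, τ⟩ : ℂ) ^ s * B (stripRoot q (⟨X, τ⟩ : ℂ))).re : ℝ)
        : ℂ))) atTop (𝓝 0) := by
  -- Differentiating in τ multiplies by i, so the relevant leading coefficient is a real multiple of
  -- Re (i B(0)) = -Im B(0).
  have hc1 : (Complex.I * zpowDeriv q s B 0).re ≠ 0 := by
    rw [zpowDeriv_zero, smul_eq_mul, mul_left_comm,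
      show (-(s : ℂ) / q) = ((-(s : ℝ) / q : ℝ) : ℂ) by push_cast; rfl, Complex.re_ofReal_mul]
    have : (s : ℝ) ≠ 0 := by have : s ≠ 0 := by omega
                             exact_mod_cast this
    have : (q : ℝ) ≠ 0 := by exact_mod_cast hq
    refine mul_ne_zero (div_ne_zero (neg_ne_zero.2 ‹_›) this) ?_
    simpa using hc
  have unif : ∀ {P : ℂ → Prop}, (∀ᶠ z in stripFilter M, P z) →
      ∀ᶠ X : ℝ in atTop, ∀ τ ∈ Set.Icc (-M) M, P ⟨X, τ⟩ := by
    intro P hP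
    obtain ⟨R, hR⟩ := eventually_stripFilter_iff.1 hP
    filter_upwards [eventually_ge_atTop R] with X hX
    exact fun τ hτ => hR _ hX (abs_le.2 hτ)
  have line : ∀ X τ : ℝ, HasDerivAt (fun τ : ℝ => (⟨X, τ⟩ : ℂ)) Complex.I τ := by
    intro X τ
    have h1 : (fun τ : ℝ => (⟨X, τ⟩ : ℂ)) = fun τ : ℝ => (X : ℂ) + τ * Complex.I := by
      funext τ; exact (Complex.mk_eq_add_mul_I _ _)
    rw [h1]
    simpa using ((((hasDerivAt_id τ).ofReal_comp).mul_const Complex.I).const_add (X : ℂ))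
  set h : ℂ → ℂ := fun z => stripRoot q z ^ s * B (stripRoot q z)
  set h' : ℂ → ℂ := fun z => stripRoot q z ^ (s + q) * zpowDeriv q s B (stripRoot q z)
  set h'' : ℂ → ℂ := fun z => stripRoot q z ^ (s + q + q) *
    zpowDeriv q (s + q) (zpowDeriv q s B) (stripRoot q z)
  have chain : ∀ (c : ℂ) {k k' : ℂ → ℂ} {X τ : ℝ}, HasDerivAt k (k' ⟨X, τ⟩) ⟨X, τ⟩ →
      HasDerivAt (fun τ : ℝ => (c * k ⟨X, τ⟩).re) ((Complex.I * c * k' ⟨X, τ⟩).re) τ := by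
    intro c k k' X τ hk
    have h2 := (hk.comp_of_eq τ (line X τ) rfl).const_mul c
    have h3 := Complex.reCLM.hasFDerivAt.comp_hasDerivAt τ h2
    refine h3.congr_deriv ?_
    simp only [Complex.reCLM_apply]; congr 1; ring
  have hW : IntervalIntegrable (fun _ : ℝ => (1 : ℝ)) volume (-M) M := by simp
  have key := tendsto_integral_cexp_mul (l := atTop) (by linarith)
    (Φ := fun X τ => 2 * Real.pi * (1 * h ⟨X, τ⟩).re)
    (Φ' := fun X τ => 2 * Real.pi * (Complex.I * 1 * h' ⟨X, τ⟩).re)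
    (Φ'' := fun X τ => 2 * Real.pi * (Complex.I * (Complex.I * 1) * h'' ⟨X, τ⟩).re) ?_ ?_ ?_ hW
  · refine key.congr fun X => intervalIntegral.integral_congr fun τ _ => ?_
    simp only [one_mul, Complex.ofReal_one, mul_one]; rfl
  · filter_upwards [unif (eventually_hasDerivAt_strip M hq hB (s := s))] with X hX
    refine ⟨fun S hS => (chain 1 (hX S hS).1).const_mul _,
      fun S hS => (chain (Complex.I * 1) (hX S hS).2.1).const_mul _, fun S hS => ?_⟩
    have h1 : ContinuousAt h'' ⟨X, S⟩ := (hX S hS).2.2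
    have h2 : ContinuousAt (fun S : ℝ => h'' ⟨X, S⟩) S :=
      h1.comp_of_eq (line X S).continuousAt rfl
    exact (continuousAt_const.mul (Complex.continuous_re.continuousAt.comp
      (continuousAt_const.mul h2))).continuousWithinAt
  · intro Λ
    filter_upwards [unif (eventually_le_abs_re_deriv M hq hs hB hc1 |Λ|)] with X hX
    intro S hS
    have h3 := hX S hS
    rw [abs_two_pi_mul, mul_one]
    have h4 : 1 ≤ 2 * Real.pi := by have := Real.two_le_pi; linarith
    calc Λ ≤ |Λ| := le_abs_self _
      _ ≤ 1 * |(Complex.I * h' ⟨X, S⟩).re| := by rwa [one_mul]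
      _ ≤ _ := mul_le_mul_of_nonneg_right h4 (abs_nonneg _)
  · intro ε hε
    filter_upwards [unif (eventually_norm_deriv_two_le M hq (by omega) hB hc1 hε)] with X hX
    intro S hS
    have h1 := hX S hS
    have h2 : |(Complex.I * (Complex.I * 1) * h'' ⟨X, S⟩).re| ≤
        ε * |(Complex.I * h' ⟨X, S⟩).re| ^ 2 := by
      refine (Complex.abs_re_le_norm _).trans (le_trans (le_of_eq ?_) h1)
      simp [h'']
    rw [abs_two_pi_mul, abs_two_pi_mul, mul_one]
    rw [mul_one] at h2
    have h4 : 1 ≤ 2 * Real.pi := by have := Real.two_le_pi; linarith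
    calc 2 * Real.pi * |(Complex.I * Complex.I * h'' ⟨X, S⟩).re|
        ≤ 2 * Real.pi * (ε * |(Complex.I * h' ⟨X, S⟩).re| ^ 2) := by gcongr
      _ ≤ (2 * Real.pi) ^ 2 * (ε * |(Complex.I * h' ⟨X, S⟩).re| ^ 2) := by
          refine mul_le_mul_of_nonneg_right ?_ (by positivity)
          nlinarith
      _ = _ := by ring

end phase

/-! ### Laurent expansions at the puncture and linear forms on the flag. -/

/-- Removable singularity theorem for y^n g(y); the prescribed limit becomes the value at 0. -/
theorem exists_analyticAt_of_tendsto {V : Type*} [NormedAddCommGroup V] [NormedSpace ℂ V]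
    [CompleteSpace V] {g : ℂ → V} {n : ℕ} {c : V}
    (hg : ∀ᶠ y in 𝓝[≠] (0 : ℂ), DifferentiableAt ℂ g y)
    (hc : Tendsto (fun y : ℂ => y ^ n • g y) (𝓝[≠] 0) (𝓝 c)) :
    ∃ A : ℂ → V, AnalyticAt ℂ A 0 ∧ A 0 = c ∧
      ∀ᶠ y in 𝓝[≠] (0 : ℂ), g y = (y ^ n)⁻¹ • A y := by
  refine ⟨Function.update (fun y => y ^ n • g y) 0 c, ?_, by simp, ?_⟩
  · apply Complex.analyticAt_of_differentiable_on_punctured_nhds_of_continuousAt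
    · filter_upwards [hg, self_mem_nhdsWithin] with y hy hy0
      have h1 : DifferentiableAt ℂ (fun y => y ^ n • g y) y :=
        (differentiableAt_id.pow n).smul hy
      refine h1.congr_of_eventuallyEq ?_
      filter_upwards [isOpen_ne.mem_nhds hy0] with u hu
      exact Function.update_of_ne hu _ _
    · exact continuousAt_update_same.2 hc
  · filter_upwards [self_mem_nhdsWithin] with y hy0
    have hy0 : y ≠ 0 := hy0
    rw [Function.update_of_ne hy0, smul_smul, inv_mul_cancel₀ (pow_ne_zero _ hy0), one_smul]

theorem isBigO_sub_of_tendsto {V : Type*} [NormedAddCommGroup V] [NormedSpace ℂ V]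
    [CompleteSpace V] {g : ℂ → V} {c : V}
    (hg : ∀ᶠ y in 𝓝[≠] (0 : ℂ), DifferentiableAt ℂ g y)
    (hc : Tendsto g (𝓝[≠] 0) (𝓝 c)) :
    (fun y => g y - c) =O[𝓝[≠] 0] (fun y : ℂ => y) := by
  obtain ⟨A, hA, hA0, hgA⟩ := exists_analyticAt_of_tendsto (n := 0) hg (by simpa using hc)
  have := hA.differentiableAt.isBigO_sub.mono (nhdsWithin_le_nhds (s := {0}ᶜ))
  simp only [sub_zero] at this
  refine this.congr' ?_ (EventuallyEq.refl _ _)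
  filter_upwards [hgA] with y hy
  rw [hy, hA0]; simp

section flag
variable {E : Type*} [NormedAddCommGroup E] [InnerProductSpace ℂ E]
  {V : Type*} [NormedAddCommGroup V] [NormedSpace ℂ V]
  {f : ℂ → E} {k : ℕ} {d : ℕ → ℕ} {v : ℕ → E}

theorem IsFlagExpansion.lt_of_lt (hv : IsFlagExpansion f k d v) {i j : ℕ} (hi : 1 ≤ i)
    (hij : i < j) (hj : j ≤ k + 1) : d j < d i :=
  hv.strictAnti ⟨hi, by omega⟩ ⟨by omega, hj⟩ hij

theorem IsFlagExpansion.pos (hv : IsFlagExpansion f k d v) {j : ℕ} (hj : 1 ≤ j) (hjk : j ≤ k) :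
    0 < d j := by
  have := hv.lt_of_lt hj (Nat.lt_succ_of_le hjk) le_rfl
  rwa [hv.last] at this

/-- A linear map which kills the first vectors of the flag sees the next one. -/
theorem IsFlagExpansion.tendsto [FiniteDimensional ℂ E] (hv : IsFlagExpansion f k d v) (L : E →ₗ[ℂ] V) {j : ℕ}
    (hj : 1 ≤ j) (hjk : j ≤ k) (hL : ∀ i, 1 ≤ i → i < j → L (v i) = 0) :
    Tendsto (fun x : ℂ => x ^ d j • L (f x)) (𝓝[≠] 0) (𝓝 (L (v j))) := by
  obtain ⟨α, R, hα, hR, hf⟩ := hv.expansion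
  have hLc : Continuous L := L.continuous_of_finiteDimensional
  have hdj := hv.pos hj hjk
  have hx : Tendsto (fun x : ℂ => x) (𝓝[≠] 0) (𝓝 0) := tendsto_id.mono_left nhdsWithin_le_nhds
  have hpow : ∀ n : ℕ, 0 < n → Tendsto (fun x : ℂ => x ^ n) (𝓝[≠] 0) (𝓝 0) := fun n hn => by
    simpa [hn.ne'] using hx.pow n
  have hα1 : ∀ i ∈ Set.Icc 1 k, Tendsto (α i) (𝓝[≠] 0) (𝓝 1) := fun i hi => by
    have := (hα i hi).trans_tendsto hx
    simpa using this.add_const 1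
  have hR0 : Tendsto R (𝓝[≠] 0) (𝓝 0) := hR.trans_tendsto hx
  have h1 : ∀ i ∈ Finset.Icc 1 k, Tendsto (fun x : ℂ => (x ^ d j * (α i x * (x ^ d i)⁻¹)) • L (v i))
      (𝓝[≠] 0) (𝓝 (if i = j then L (v j) else 0)) := by
    intro i hi
    rw [Finset.mem_Icc] at hi
    rcases lt_trichotomy i j with h | h | h
    · simp [h.ne, hL i hi.1 h]
    · subst h
      rw [if_pos rfl]
      have := (hα1 i hi).smul_const (L (v i))
      rw [one_smul] at this
      refine this.congr' ?_
      filter_upwards [self_mem_nhdsWithin] with x hx0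
      have hx0 : x ≠ 0 := hx0
      congr 1; field_simp
    · rw [if_neg h.ne']
      have hd := hv.lt_of_lt hj h (by omega)
      have := ((hpow (d j - d i) (by omega)).mul (hα1 i hi)).smul_const (L (v i))
      rw [zero_mul, zero_smul] at this
      refine this.congr' ?_
      filter_upwards [self_mem_nhdsWithin] with x hx0
      have hx0 : x ≠ 0 := hx0
      congr 1
      rw [show x ^ d j = x ^ (d j - d i) * x ^ d i by rw [← pow_add]; congr 1; omega]
      field_simp
  have h2 := tendsto_finsetSum (Finset.Icc 1 k) h1
  have h3 : Tendsto (fun x : ℂ => x ^ d j • L (v (k + 1) + R x)) (𝓝[≠] 0) (𝓝 0) := by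
    have := (hpow _ hdj).smul ((hLc.tendsto _).comp (hR0.const_add (v (k + 1))))
    rwa [zero_smul] at this
  have h4 := h2.add h3
  rw [Finset.sum_ite_eq' (Finset.Icc 1 k) j, if_pos (Finset.mem_Icc.2 ⟨hj, hjk⟩), add_zero] at h4
  refine h4.congr' ?_
  filter_upwards [hf] with x hx
  rw [hx, add_assoc, map_add L (∑ j ∈ Finset.Icc 1 k, _), smul_add, map_sum, Finset.smul_sum]
  congr 1
  exact Finset.sum_congr rfl fun i _ => by rw [map_smul, smul_smul]

/-- Supplies the index at which `IsFlagExpansion.tendsto` reads off the exact pole order of L ∘ f.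
-/
theorem exists_first_ne_zero (L : E →ₗ[ℂ] V) {l : ℕ} (hL : ∃ x ∈ flagSpace v l, L x ≠ 0) :
    ∃ j, 1 ≤ j ∧ j ≤ l ∧ L (v j) ≠ 0 ∧ ∀ i, 1 ≤ i → i < j → L (v i) = 0 := by
  classical
  have hex : ∃ j, 1 ≤ j ∧ j ≤ l ∧ L (v j) ≠ 0 := by
    by_contra! h
    obtain ⟨x, hx, hx0⟩ := hL
    have : flagSpace v l ≤ LinearMap.ker L := by
      rw [flagSpace, Submodule.span_le]
      rintro _ ⟨i, hi, rfl⟩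
      exact h i hi.1 hi.2
    exact hx0 (this hx)
  obtain ⟨h1, h2, h3⟩ := Nat.find_spec hex
  refine ⟨Nat.find hex, h1, h2, h3, fun i hi hij => ?_⟩
  by_contra h
  exact Nat.find_min hex hij ⟨hi, by omega, h⟩

theorem mem_flagSpace {l i : ℕ} (hi : 1 ≤ i) (hil : i ≤ l) : v i ∈ flagSpace v l :=
  Submodule.subset_span ⟨i, ⟨hi, hil⟩, rfl⟩

theorem IsFlagExpansion.notMem_flagSpace (hv : IsFlagExpansion f k d v) {j : ℕ} (hj : 1 ≤ j)
    (hjk : j ≤ k) : v j ∉ flagSpace v (j - 1) := by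
  have h1 : LinearIndepOn ℂ v (insert j (Set.Icc 1 (j - 1))) :=
    hv.indep.mono (by rintro i (rfl | hi)
                      · exact ⟨hj, hjk⟩
                      · exact ⟨hi.1, by have := hi.2; omega⟩)
  exact ((linearIndepOn_insert (by simp; omega)).1 h1).2

end flag

/-! ### Parametrization of the radii `L'_p`. -/

/-- `e^{i p π / q}`. -/
noncomputable def rayUnit (q p : ℕ) : ℂ := Complex.exp (Complex.I * ((p * Real.pi / q : ℝ) : ℂ))

theorem norm_rayUnit (q p : ℕ) : ‖rayUnit q p‖ = 1 := by
  rw [rayUnit, mul_comm, Complex.norm_exp_ofReal_mul_I]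

theorem rayUnit_ne_zero (q p : ℕ) : rayUnit q p ≠ 0 := Complex.exp_ne_zero _

theorem rayUnit_pow {q : ℕ} (hq : q ≠ 0) (p : ℕ) : rayUnit q p ^ q = (-1) ^ p := by
  have hq' : (q : ℂ) ≠ 0 := by exact_mod_cast hq
  rw [rayUnit, ← Complex.exp_nat_mul, ← Complex.exp_pi_mul_I, ← Complex.exp_nat_mul]
  congr 1
  push_cast
  field_simp

/-- `η` parametrizes a neighbourhood of `0` so that `ξ (η y) = e^{i p π / q} y`: the radius `L'_p`
corresponds to positive real numbers `y`. -/
structure IsRayParam (ξ : ℂ → ℂ) (lam : ℂ) (q p : ℕ) (η : ℂ → ℂ) : Prop where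
  analyticAt : AnalyticAt ℂ η 0
  map_zero : η 0 = 0
  hasDerivAt : HasDerivAt η (rayUnit q p / lam) 0
  right_inv : ∀ᶠ y in 𝓝 (0 : ℂ), ξ (η y) = rayUnit q p * y
  left_inv : ∀ᶠ x in 𝓝 (0 : ℂ), η ((rayUnit q p)⁻¹ * ξ x) = x

/-- The parametrization is the local inverse of ξ precomposed with the rotation by e^{ipπ/q}. -/
theorem exists_isRayParam {ξ : ℂ → ℂ} {lam : ℂ} (hξ : AnalyticAt ℂ ξ 0) (h0 : ξ 0 = 0)
    (hd : deriv ξ 0 = lam) (hlam : lam ≠ 0) (q p : ℕ) : ∃ η, IsRayParam ξ lam q p η := by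
  have hd' : deriv ξ 0 ≠ 0 := hd ▸ hlam
  set ζ := hξ.hasStrictDerivAt.localInverse _ _ _ hd' with hζ
  have a1 : AnalyticAt ℂ ζ 0 := by
    have := hξ.analyticAt_localInverse hd'
    rwa [h0] at this
  have z0 : ζ 0 = 0 := by
    have : ζ (ξ 0) = 0 := HasStrictFDerivAt.localInverse_apply_image ..
    rwa [h0] at this
  have d1 : HasDerivAt ζ lam⁻¹ 0 := by
    have := (hξ.hasStrictDerivAt.to_localInverse hd').hasDerivAt
    rw [← hd]
    simpa only [h0] using this
  have l1 : ∀ᶠ x in 𝓝 (0 : ℂ), ζ (ξ x) = x :=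
    (hξ.hasStrictDerivAt.hasStrictFDerivAt_equiv hd').eventually_left_inverse
  have r1 : ∀ᶠ x in 𝓝 (0 : ℂ), ξ (ζ x) = x := by
    have := (hξ.hasStrictDerivAt.hasStrictFDerivAt_equiv hd').eventually_right_inverse
    rwa [h0] at this
  set u := rayUnit q p with hu
  have u0 : u ≠ 0 := rayUnit_ne_zero q p
  have t0 : Tendsto (fun y : ℂ => u * y) (𝓝 0) (𝓝 0) := by
    simpa using (continuous_const_mul u).tendsto 0
  refine ⟨fun y => ζ (u * y), ?_, by simpa using z0, ?_, t0.eventually r1, ?_⟩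
  · exact AnalyticAt.comp_of_eq (f := fun y => u * y) a1 (by fun_prop) (by simp)
  · have h1 : HasDerivAt (fun y : ℂ => u * y) u 0 := by
      simpa using (hasDerivAt_id (0 : ℂ)).const_mul u
    have h2 := HasDerivAt.comp_of_eq (0 : ℂ) d1 h1 (by simp)
    exact h2.congr_deriv (by rw [div_eq_mul_inv, mul_comm])
  · filter_upwards [l1] with x hx
    rw [mul_inv_cancel_left₀ u0, hx]

section param
variable {ξ : ℂ → ℂ} {lam : ℂ} {q p : ℕ} {η : ℂ → ℂ}

theorem IsRayParam.tendsto_punctured (hη : IsRayParam ξ lam q p η) (h0 : ξ 0 = 0) :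
    Tendsto η (𝓝[≠] 0) (𝓝[≠] 0) := by
  refine tendsto_nhdsWithin_iff.2 ⟨?_, ?_⟩
  · have := hη.analyticAt.continuousAt.tendsto
    rw [hη.map_zero] at this
    exact this.mono_left nhdsWithin_le_nhds
  · filter_upwards [hη.right_inv.filter_mono nhdsWithin_le_nhds, self_mem_nhdsWithin] with y hy hy0
    intro h
    rw [Set.mem_singleton_iff] at h
    rw [h, h0] at hy
    exact mul_ne_zero (rayUnit_ne_zero q p) hy0 hy.symm

theorem IsRayParam.tendsto_div (hη : IsRayParam ξ lam q p η) :
    Tendsto (fun y => η y / y) (𝓝[≠] 0) (𝓝 (rayUnit q p / lam)) := by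
  have := hη.hasDerivAt.tendsto_slope
  refine this.congr fun y => ?_
  rw [slope_def_field, hη.map_zero, sub_zero, sub_zero]

theorem IsRayParam.differentiableAt_comp (hη : IsRayParam ξ lam q p η) (h0 : ξ 0 = 0)
    {V : Type*} [NormedAddCommGroup V] [NormedSpace ℂ V] {f : ℂ → V}
    (hf : ∀ᶠ x in 𝓝[≠] (0 : ℂ), DifferentiableAt ℂ f x) :
    ∀ᶠ y in 𝓝[≠] (0 : ℂ), DifferentiableAt ℂ (fun y => f (η y)) y := by
  filter_upwards [(hη.tendsto_punctured h0).eventually hf,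
    hη.analyticAt.eventually_analyticAt.filter_mono nhdsWithin_le_nhds] with y h1 h2
  exact h1.comp y h2.differentiableAt

/-- Passing from x to y changes a leading coefficient of order n by (y/x)^n, and η(y)/y tends to
e^{ipπ/q}/λ. -/
theorem IsRayParam.tendsto_pow_smul (hη : IsRayParam ξ lam q p η) (h0 : ξ 0 = 0) (hlam : lam ≠ 0)
    {V : Type*} [NormedAddCommGroup V] [NormedSpace ℂ V] {f : ℂ → V} {n : ℕ} {c : V}
    (hf : Tendsto (fun x : ℂ => x ^ n • f x) (𝓝[≠] 0) (𝓝 c)) :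
    Tendsto (fun y : ℂ => y ^ n • f (η y)) (𝓝[≠] 0) (𝓝 ((lam / rayUnit q p) ^ n • c)) := by
  have h1 := hf.comp (hη.tendsto_punctured h0)
  have h2 := (hη.tendsto_div.inv₀ (div_ne_zero (rayUnit_ne_zero q p) hlam)).pow n
  rw [inv_div] at h2
  refine (h2.smul h1).congr' ?_
  filter_upwards [(hη.tendsto_punctured h0).eventually self_mem_nhdsWithin] with y hy
  have hy : η y ≠ 0 := hy
  simp only [Function.comp, smul_smul]
  congr 1
  rw [inv_div, div_pow]; field_simp

end param

/-! ### Real linear forms along a radius. -/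

section radial
variable {E : Type*} [NormedAddCommGroup E] [InnerProductSpace ℂ E]
  {f : ℂ → E} {d : ℕ → ℕ} {v : ℕ → E} {κ : ℕ} {lam : ℂ} {ξ : ℂ → ℂ} {p m : ℕ} {δ : ℕ → ℕ}
  {ϑ : ℕ → E} {η : ℂ → ℂ}

theorem tendsto_ofReal_punctured :
    Tendsto (fun r : ℝ => (r : ℂ)) (𝓝[>] 0) (𝓝[≠] 0) := by
  refine tendsto_nhdsWithin_iff.2 ⟨?_, ?_⟩
  · simpa using (Complex.continuous_ofReal.tendsto 0).mono_left (nhdsWithin_le_nhds (s := Set.Ioi 0))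
  · filter_upwards [self_mem_nhdsWithin] with r hr
    have : r ≠ 0 := ne_of_gt hr
    simpa using this

theorem IsRayParam.tendsto_primedRadius {q : ℕ} (hη : IsRayParam ξ lam q p η) :
    Tendsto (fun r : ℝ => η r) (𝓝[>] 0) (𝓝[primedRadius q ξ p] 0) := by
  have h1 := tendsto_ofReal_punctured.mono_right (nhdsWithin_le_nhds (s := {(0 : ℂ)}ᶜ))
  refine tendsto_nhdsWithin_iff.2 ⟨?_, ?_⟩
  · have h2 := hη.analyticAt.continuousAt.tendsto
    rw [hη.map_zero] at h2
    exact h2.comp h1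
  · filter_upwards [h1.eventually hη.right_inv, self_mem_nhdsWithin] with r hr hr0
    exact ⟨r, hr0, by rw [hr, mul_comm, rayUnit]⟩

/-- On positive real parameters |x'| = r. All terms in 𝔽_{κ-1} are collected in a single vector,
since the forms used later kill that space. -/
theorem IsRadialExpansion.along_ray (hrad : IsRadialExpansion f d v κ lam ξ p m δ ϑ)
    (hη : IsRayParam ξ lam (d κ) p η) :
    ∃ (b : ℕ → ℝ → ℝ) (R : ℝ → E), (∀ j ≤ m, Tendsto (b j) (𝓝[>] 0) (𝓝 1)) ∧
      Tendsto R (𝓝[>] 0) (𝓝 0) ∧ ∀ᶠ r : ℝ in 𝓝[>] (0 : ℝ), ∃ a ∈ flagSpace v (κ - 1),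
        f (η r) = a + (∑ j ∈ Finset.range (m + 1), (b j r * (r ^ δ j)⁻¹) • ϑ j) + ϑ (m + 1) + R r := by
  obtain ⟨α, β, R, -, hβ, hR, hf⟩ := hrad.expansion
  have ht := hη.tendsto_primedRadius
  have hr : ∀ᶠ r : ℝ in 𝓝[>] 0, ξ (η r) = rayUnit (d κ) p * r :=
    (tendsto_ofReal_punctured.mono_right nhdsWithin_le_nhds).eventually hη.right_inv
  have hξ0 : Tendsto (fun r : ℝ => ξ (η r)) (𝓝[>] 0) (𝓝 0) := by
    have : Tendsto (fun r : ℝ => rayUnit (d κ) p * (r : ℂ)) (𝓝[>] 0) (𝓝 (rayUnit (d κ) p * 0)) :=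
      (tendsto_ofReal_punctured.mono_right nhdsWithin_le_nhds).const_mul _
    rw [mul_zero] at this
    exact this.congr' (hr.mono fun r h => h.symm)
  refine ⟨fun j r => β j (η r), fun r => R (η r), fun j hj => ?_, ?_, ?_⟩
  · have := ((hβ j hj).comp_tendsto ht).trans_tendsto hξ0
    simpa [Function.comp_def] using this.add_const 1
  · exact (hR.comp_tendsto ht).trans_tendsto hξ0
  · filter_upwards [ht.eventually hf, hr, self_mem_nhdsWithin] with r h1 h2 h3
    have hnorm : ‖ξ (η r)‖ = r := by
      rw [h2, norm_mul, norm_rayUnit, one_mul, Complex.norm_real, Real.norm_of_nonneg (le_of_lt h3)]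
    rw [hnorm] at h1
    refine ⟨_, ?_, h1⟩
    refine Submodule.sum_mem _ fun j hj => Submodule.smul_mem _ _ (mem_flagSpace ?_ ?_)
    · exact (Finset.mem_Icc.1 hj).1
    · exact (Finset.mem_Icc.1 hj).2

theorem flagSpace_le_radialSpace {l : ℕ} {a : E} (ha : a ∈ flagSpace v (κ - 1)) :
    a ∈ radialSpace v κ ϑ l :=
  (le_sup_left : _ ≤ radialSpace v κ ϑ l) ha

theorem mem_radialSpace {l i : ℕ} (hi : i ≤ l) : ϑ i ∈ radialSpace v κ ϑ l :=
  (le_sup_right : _ ≤ radialSpace v κ ϑ l) (Submodule.subset_span ⟨i, hi, rfl⟩)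

variable [FiniteDimensional ℂ E] {V : Type*} [NormedAddCommGroup V] [NormedSpace ℝ V]

/-- The real analogue of `IsFlagExpansion.tendsto`. The index j = m + 1 is allowed: there the
exponent is 0 and the constant term is read off. -/
theorem IsRadialExpansion.tendsto_pow_smul (hrad : IsRadialExpansion f d v κ lam ξ p m δ ϑ)
    (hη : IsRayParam ξ lam (d κ) p η) (L : E →ₗ[ℝ] V)
    (hL : ∀ a ∈ flagSpace v (κ - 1), L a = 0) {j : ℕ} (hj : j ≤ m + 1)
    (hLj : ∀ i < j, L (ϑ i) = 0) :
    Tendsto (fun r : ℝ => r ^ δ j • L (f (η r))) (𝓝[>] 0) (𝓝 (L (ϑ j))) := by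
  obtain ⟨b, R, hb, hR, hf⟩ := hrad.along_ray hη
  have hLc : Continuous L := L.continuous_of_finiteDimensional
  have hx : Tendsto (fun x : ℝ => x) (𝓝[>] 0) (𝓝 0) := tendsto_id.mono_left nhdsWithin_le_nhds
  have hpow : ∀ n : ℕ, 0 < n → Tendsto (fun x : ℝ => x ^ n) (𝓝[>] 0) (𝓝 0) := fun n hn => by
    simpa [hn.ne'] using hx.pow n
  have h1 : ∀ i ∈ Finset.range (m + 1),
      Tendsto (fun x : ℝ => (x ^ δ j * (b i x * (x ^ δ i)⁻¹)) • L (ϑ i))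
      (𝓝[>] 0) (𝓝 (if i = j then L (ϑ j) else 0)) := by
    intro i hi
    rw [Finset.mem_range] at hi
    rcases lt_trichotomy i j with h | h | h
    · simp [h.ne, hLj i h]
    · subst h
      rw [if_pos rfl]
      have := (hb i (by omega)).smul_const (L (ϑ i))
      rw [one_smul] at this
      refine this.congr' ?_
      filter_upwards [self_mem_nhdsWithin] with x hx0
      have hx0 : x ≠ 0 := ne_of_gt hx0
      congr 1; field_simp
    · rw [if_neg h.ne']
      have hd : δ i < δ j := hrad.strictAnti (Set.mem_Iic.2 hj) (Set.mem_Iic.2 hi.le) h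
      have := ((hpow (δ j - δ i) (by omega)).mul (hb i (by omega))).smul_const (L (ϑ i))
      rw [zero_mul, zero_smul] at this
      refine this.congr' ?_
      filter_upwards [self_mem_nhdsWithin] with x hx0
      have hx0 : x ≠ 0 := ne_of_gt hx0
      congr 1
      rw [show x ^ δ j = x ^ (δ j - δ i) * x ^ δ i by rw [← pow_add]; congr 1; omega]
      field_simp
  have h2 := tendsto_finsetSum (Finset.range (m + 1)) h1
  -- The bounded part contributes in the limit only for j = m + 1; for smaller j it is killed by the
  -- positive power of r.
  have h3 : Tendsto (fun x : ℝ => x ^ δ j • L (ϑ (m + 1) + R x)) (𝓝[>] 0)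
      (𝓝 (if j = m + 1 then L (ϑ j) else 0)) := by
    have hs := (hLc.tendsto _).comp (hR.const_add (ϑ (m + 1)))
    rw [add_zero] at hs
    split_ifs with h
    · subst h
      simp only [hrad.last, pow_zero, one_smul]
      exact hs
    · have hd : δ (m + 1) < δ j := hrad.strictAnti (Set.mem_Iic.2 hj) (Set.mem_Iic.2 le_rfl) (by omega)
      have := (hpow (δ j) (by omega)).smul hs
      rwa [zero_smul] at this
  have h4 := h2.add h3
  have h5 : (∑ c ∈ Finset.range (m + 1), if c = j then L (ϑ j) else 0) +
      (if j = m + 1 then L (ϑ j) else 0) = L (ϑ j) := by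
    rw [Finset.sum_ite_eq']
    by_cases h : j = m + 1
    · simp [h]
    · rw [if_pos (Finset.mem_range.2 (by omega)), if_neg h, add_zero]
  rw [h5] at h4
  refine h4.congr' ?_
  filter_upwards [hf] with x ⟨a, ha, hx⟩
  rw [hx, add_assoc, map_add L (a + _), map_add L a, hL a ha, zero_add, smul_add, map_sum,
    Finset.smul_sum]
  congr 1
  exact Finset.sum_congr rfl fun i _ => by rw [map_smul, smul_smul]

theorem IsRadialExpansion.tendsto_of_radialSpace_le
    (hrad : IsRadialExpansion f d v κ lam ξ p m δ ϑ) (hη : IsRayParam ξ lam (d κ) p η)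
    (L : E →ₗ[ℝ] V) (hL : ∀ a ∈ radialSpace v κ ϑ m, L a = 0) :
    Tendsto (fun r : ℝ => L (f (η r))) (𝓝[>] 0) (𝓝 (L (ϑ (m + 1)))) := by
  have := hrad.tendsto_pow_smul hη L (fun a ha => hL a (flagSpace_le_radialSpace ha)) le_rfl
    (fun i hi => hL _ (mem_radialSpace (by omega)))
  simpa only [hrad.last, pow_zero, one_smul] using this

/-- The first ϑ_j not killed by L has a positive exponent δ_j, and it dominates the later terms. -/
theorem IsRadialExpansion.tendsto_norm_atTop
    (hrad : IsRadialExpansion f d v κ lam ξ p m δ ϑ) (hη : IsRayParam ξ lam (d κ) p η)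
    (L : E →ₗ[ℝ] V) (hL : ∀ a ∈ flagSpace v (κ - 1), L a = 0)
    (hL' : ∃ a ∈ radialSpace v κ ϑ m, L a ≠ 0) :
    Tendsto (fun r : ℝ => ‖L (f (η r))‖) (𝓝[>] 0) atTop := by
  classical
  have hex : ∃ j, j ≤ m ∧ L (ϑ j) ≠ 0 := by
    by_contra! h
    obtain ⟨a, ha, ha0⟩ := hL'
    have : radialSpace v κ ϑ m ≤ LinearMap.ker L := by
      refine sup_le (fun a ha => hL a ha) ?_
      rw [Submodule.span_le]
      rintro _ ⟨i, hi, rfl⟩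
      exact h i hi
    exact ha0 (this ha)
  obtain ⟨h1, h2⟩ := Nat.find_spec hex
  set j := Nat.find hex
  have h3 : ∀ i < j, L (ϑ i) = 0 := fun i hi => by
    by_contra h
    exact Nat.find_min hex hi ⟨by omega, h⟩
  have hd : δ (m + 1) < δ j :=
    hrad.strictAnti (Set.mem_Iic.2 (by omega)) (Set.mem_Iic.2 le_rfl) (by omega)
  have h4 := (hrad.tendsto_pow_smul hη L hL (by omega) h3).norm
  have h5 : Tendsto (fun r : ℝ => (r⁻¹) ^ δ j) (𝓝[>] 0) atTop :=
    (tendsto_pow_atTop (by omega)).comp tendsto_inv_nhdsGT_zero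
  refine (h5.atTop_mul_pos (norm_pos_iff.2 h2) h4).congr' ?_
  filter_upwards [self_mem_nhdsWithin] with r hr
  have hr : 0 < r := hr
  rw [norm_smul, norm_pow, Real.norm_of_nonneg hr.le, ← mul_assoc, ← mul_pow,
    inv_mul_cancel₀ hr.ne', one_pow, one_mul]

end radial

/-! ### Existence of radial expansions. -/

/-- Greedy choice, going down through the pole orders. A coefficient independent over ℝ of the
vectors chosen so far is appended; a dependent one is absorbed in the earlier factors as c_j x^{δ_j
- s}, which is O(x) because δ_j > s. Starting from b_N ≠ 0 forces δ_0 = N. -/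
theorem exists_real_flag {V : Type*} [NormedAddCommGroup V] [NormedSpace ℝ V] (b : ℕ → V) (N : ℕ)
    (hN : 0 < N) (hb : b N ≠ 0) (t : ℕ) (ht : t + 1 ≤ N) :
    ∃ (m : ℕ) (δ : ℕ → ℕ) (ϑ : ℕ → V) (β : ℕ → ℝ → ℝ),
      δ 0 = N ∧ StrictAntiOn δ (Set.Iic m) ∧ (∀ j ≤ m, N - (t + 1) < δ j) ∧
      LinearIndepOn ℝ ϑ (Set.Iic m) ∧
      (∀ j ≤ m, (fun x => β j x - 1) =O[𝓝[>] 0] (fun x : ℝ => x)) ∧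
      ∀ x : ℝ, x ≠ 0 → ∑ e ∈ Finset.Ioc (N - (t + 1)) N, (x ^ e)⁻¹ • b e =
        ∑ j ∈ Finset.range (m + 1), (β j x * (x ^ δ j)⁻¹) • ϑ j := by
  induction t with
  | zero =>
    refine ⟨0, fun _ => N, fun _ => b N, fun _ _ => 1, rfl, ?_, fun _ _ => by beta_reduce; omega, ?_,
      fun _ _ => by simpa using isBigO_zero _ _, fun x _ => ?_⟩
    · intro i hi j hj hij
      have := Set.mem_Iic.1 hj; omega
    · have : Set.Iic 0 = {0} := by ext; simp
      rw [this]
      exact LinearIndepOn.singleton hb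
    · have : Finset.Ioc (N - (0 + 1)) N = {N} := by ext; simp; omega
      rw [this]; simp
  | succ t ih =>
    obtain ⟨m, δ, ϑ, α, h0, h1, h2, h3, h4, h5⟩ := ih (by omega)
    set s := N - (t + 1) with hs
    have hs' : N - (t + 1 + 1) = s - 1 := by omega
    have hs1 : 1 ≤ s := by omega
    have hsum : ∀ x : ℝ, ∑ e ∈ Finset.Ioc (s - 1) N, (x ^ e)⁻¹ • b e =
        (∑ e ∈ Finset.Ioc s N, (x ^ e)⁻¹ • b e) + (x ^ s)⁻¹ • b s := by
      intro x
      rw [← Finset.sum_Ioc_consecutive _ (show s - 1 ≤ s by omega) (show s ≤ N by omega), add_comm]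
      congr 1
      have : Finset.Ioc (s - 1) s = {s} := by ext; simp; omega
      rw [this, Finset.sum_singleton]
    rw [hs']
    by_cases hmem : b s ∈ Submodule.span ℝ (ϑ '' Set.Iic m)
    · have : ∃ c : ℕ → ℝ, b s = ∑ j ∈ Finset.range (m + 1), c j • ϑ j := by
        have h := hmem
        have hI : Set.Iic m = ((Finset.range (m + 1) : Finset ℕ) : Set ℕ) := by ext; simp
        rw [hI, Submodule.mem_span_image_finset_iff_exists_fun] at h
        obtain ⟨c, hc⟩ := h
        refine ⟨fun j => if hj : j ∈ Finset.range (m + 1) then c ⟨j, hj⟩ else 0, ?_⟩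
        rw [← hc, ← Finset.sum_coe_sort (Finset.range (m + 1))]
        exact Finset.sum_congr rfl fun j _ => by simp only [dif_pos j.2]
      obtain ⟨c, hc⟩ := this
      refine ⟨m, δ, ϑ, fun j x => α j x + c j * x ^ (δ j - s), h0, h1,
        fun j hj => by have := h2 j hj; omega, h3, fun j hj => ?_, fun x hx => ?_⟩
      · have e1 : (fun x : ℝ => c j * x ^ (δ j - s)) =O[𝓝[>] 0] (fun x : ℝ => x) := by
          refine IsBigO.const_mul_left ?_ _
          have := h2 j hj
          obtain ⟨q, hq⟩ : ∃ q, δ j - s = q + 1 := ⟨δ j - s - 1, by omega⟩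
          rw [hq]
          have h6 : (fun x : ℝ => x ^ q) =O[𝓝 0] (fun _ => (1 : ℝ)) :=
            ((continuous_pow q).tendsto 0).isBigO_one ℝ
          have : (fun x : ℝ => x ^ (q + 1)) =O[𝓝 0] (fun x : ℝ => x) := by
            simpa [pow_succ] using h6.mul (isBigO_refl (fun x : ℝ => x) (𝓝 0))
          simpa using this.mono nhdsWithin_le_nhds
        refine ((h4 j hj).add e1).congr_left fun x => by ring
      · rw [hsum, h5 x hx, hc, Finset.smul_sum, ← Finset.sum_add_distrib]
        refine Finset.sum_congr rfl fun j hj => ?_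
        have hlt := h2 j (by have := Finset.mem_range.1 hj; omega)
        rw [smul_smul, ← add_smul]
        congr 1
        have : x ^ δ j = x ^ (δ j - s) * x ^ s := by rw [← pow_add]; congr 1; omega
        rw [this]; field_simp
    · have hup : ∀ j ≤ m, j ≠ m + 1 := fun j hj => by omega
      refine ⟨m + 1, Function.update δ (m + 1) s, Function.update ϑ (m + 1) (b s),
        Function.update α (m + 1) (fun _ => 1), by simpa using h0, ?_, ?_, ?_, ?_, ?_⟩
      · intro i hi j hj hij
        have hj := Set.mem_Iic.1 hj
        have hi' : i ≠ m + 1 := by omega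
        have hik : i ≤ m := by omega
        by_cases hj' : j = m + 1
        · subst hj'; simpa [hi'] using h2 i hik
        · simpa [hi', hj'] using h1 (Set.mem_Iic.2 hik) (Set.mem_Iic.2 (show j ≤ m by omega)) hij
      · intro j hj
        by_cases hj' : j = m + 1
        · subst hj'; simp; omega
        · have := h2 j (by omega)
          simp [hj']; omega
      · have hins : Set.Iic (m + 1) = insert (m + 1) (Set.Iic m) := by
          ext i; simp; omega
        have himg : Set.EqOn (Function.update ϑ (m + 1) (b s)) ϑ (Set.Iic m) :=
          fun j hj => by simp [hup j hj]
        rw [hins, linearIndepOn_insert (by simp)]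
        refine ⟨h3.congr himg.symm, ?_⟩
        rw [Set.image_congr himg]
        simpa using hmem
      · intro j hj
        by_cases hj' : j = m + 1
        · subst hj'; simpa using isBigO_zero _ _
        · simpa [hj'] using h4 j (by omega)
      · intro x hx
        rw [hsum, h5 x hx, Finset.sum_range_succ _ (m + 1)]
        congr 1
        · refine Finset.sum_congr rfl fun j hj => ?_
          have : j ≠ m + 1 := by have := Finset.mem_range.1 hj; omega
          simp [this]
        · simp

/-- One Taylor step is split off before `polar_aux`, so that the top coefficient is known to be
a(0). -/
theorem exists_polar_part {V : Type*} [NormedAddCommGroup V] [NormedSpace ℂ V] {g a : ℂ → V} {q : ℕ}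
    (hq : 0 < q) (ha : AnalyticAt ℂ a 0) (hg : ∀ᶠ y in 𝓝[≠] (0 : ℂ), g y = (y ^ q)⁻¹ • a y) :
    ∃ (b : ℕ → V) (R : ℂ → V), b q = a 0 ∧ R =O[𝓝[≠] 0] (fun x : ℂ => x) ∧
      ∀ᶠ y in 𝓝[≠] (0 : ℂ), g y = (∑ e ∈ Finset.Ioc 0 q, (y ^ e)⁻¹ • b e) + b 0 + R y := by
  obtain ⟨N, rfl⟩ : ∃ N, q = N + 1 := ⟨q - 1, by omega⟩
  have ha1 : AnalyticAt ℂ (dslope a 0) 0 := by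
    obtain ⟨P, hP⟩ := ha
    exact ⟨_, hP.has_fpower_series_dslope_fslope⟩
  obtain ⟨b, R, hR, hb⟩ := polar_aux N _ ha1
  refine ⟨fun e => if e = N + 1 then a 0 else b e, R, if_pos rfl, hR, ?_⟩
  filter_upwards [hg, self_mem_nhdsWithin] with x hx hx0
  have hx0 : x ≠ 0 := hx0
  have h1 : a x = a 0 + x • dslope a 0 x := by
    rw [dslope_of_ne _ hx0, slope_def_module]
    simp [smul_smul, hx0]
  have h3 : (x ^ (N + 1))⁻¹ • x • dslope a 0 x = (x ^ N)⁻¹ • dslope a 0 x := by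
    rw [smul_smul]; congr 1; field_simp; ring
  have h4 : ∑ e ∈ Finset.Ioc 0 N, (x ^ e)⁻¹ • (if e = N + 1 then a 0 else b e) =
      ∑ e ∈ Finset.Ioc 0 N, (x ^ e)⁻¹ • b e := by
    refine Finset.sum_congr rfl fun e he => ?_
    have : e ≠ N + 1 := by have := (Finset.mem_Ioc.1 he).2; omega
    rw [if_neg this]
  rw [hx, h1, smul_add, h3, hb x hx0, Finset.sum_Ioc_succ_top (by omega), h4]
  simp only [if_true, if_neg (show (0 : ℕ) ≠ N + 1 by omega)]
  abel

/-- Split E = A ⊕ B with A = 𝔽_{κ-1}. The B-component of f has a pole of order exactly d_κ, and the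
real greedy algorithm applied to its polar part gives the ϑ_j. The A-component is expanded in the
basis v_1, …, v_{κ-1}, each coordinate having leading term of order d_j. -/
theorem exists_isRadialExpansion {E : Type*} [NormedAddCommGroup E] [InnerProductSpace ℂ E]
    [FiniteDimensional ℂ E] {f : ℂ → E} (hf : ∀ᶠ x in 𝓝[≠] (0 : ℂ), DifferentiableAt ℂ f x)
    {k : ℕ} {d : ℕ → ℕ} {v : ℕ → E} (hv : IsFlagExpansion f k d v)
    {κ : ℕ} (hκ1 : 1 ≤ κ) (hκk : κ ≤ k) {lam : ℂ} (hlam : lam ≠ 0) {ξ : ℂ → ℂ}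
    (hξ : ContinuousAt ξ 0) (hξ0 : ξ 0 = 0)
    {p : ℕ} {η : ℂ → ℂ} (hη : IsRayParam ξ lam (d κ) p η) :
    ∃ (m : ℕ) (δ : ℕ → ℕ) (ϑ : ℕ → E), IsRadialExpansion f d v κ lam ξ p m δ ϑ := by
  classical
  have hq : 0 < d κ := hv.pos hκ1 hκk
  set q := d κ with hqdef
  set u := rayUnit q p with hu
  have hu0 : u ≠ 0 := rayUnit_ne_zero q p
  have hdiff := hη.differentiableAt_comp hξ0 hf
  have hli : LinearIndependent ℂ (fun i : Finset.Icc 1 (κ - 1) => v i) := by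
    have : LinearIndepOn ℂ v (Finset.Icc 1 (κ - 1) : Finset ℕ) := by
      rw [Finset.coe_Icc]
      exact hv.indep.mono fun i hi => ⟨hi.1, by have := hi.2; omega⟩
    exact this
  have hA : flagSpace v (κ - 1) =
      Submodule.span ℂ (Set.range fun i : Finset.Icc 1 (κ - 1) => v i) := by
    rw [flagSpace, ← Finset.coe_Icc, Set.image_eq_range]; rfl
  set A := Submodule.span ℂ (Set.range fun i : Finset.Icc 1 (κ - 1) => v i) with hAdef
  obtain ⟨B, hAB⟩ := Submodule.exists_isCompl A
  set P : E →ₗ[ℂ] B := B.projectionOnto A hAB.symm with hP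
  set Q : E →ₗ[ℂ] A := A.projectionOnto B hAB with hQ
  have hPQ : ∀ e : E, (Q e : E) + P e = e := fun e =>
    Submodule.projection_add_projection_eq_self hAB e
  have hPA : ∀ e : E, P e = 0 ↔ e ∈ A := fun e =>
    Submodule.projectionOnto_apply_eq_zero_iff hAB.symm
  -- the part transverse to `A`
  have hPlim := hη.tendsto_pow_smul hξ0 hlam (hv.tendsto P hκ1 hκk fun i hi hij =>
    (hPA _).2 (hA ▸ mem_flagSpace hi (by omega)))
  have hPdiff : ∀ᶠ y in 𝓝[≠] (0 : ℂ), DifferentiableAt ℂ (fun y => P (f (η y))) y := by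
    filter_upwards [hdiff] with y hy
    exact (LinearMap.toContinuousLinearMap P).differentiableAt.comp y hy
  obtain ⟨a, ha, ha0, hga⟩ := exists_analyticAt_of_tendsto hPdiff hPlim
  obtain ⟨b, R, hbq, hR, hPexp⟩ := exists_polar_part hq ha hga
  have hbne : b q ≠ 0 := by
    rw [hbq, ha0]
    refine smul_ne_zero (pow_ne_zero _ (div_ne_zero hlam hu0)) fun h => ?_
    exact hv.notMem_flagSpace hκ1 hκk (hA ▸ (hPA _).1 h)
  obtain ⟨m, δ, ϑ, β, hδ0, hδ, hδpos, hϑ, hβ, hsum⟩ :=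
    exists_real_flag b q hq hbne (q - 1) (by omega)
  have hq0 : q - (q - 1 + 1) = 0 := by omega
  rw [hq0] at hδpos hsum
  -- the coordinates in `A`
  set bs := Module.Basis.span hli with hbs
  set φ : ℕ → E →ₗ[ℂ] ℂ := fun j =>
    if h : j ∈ Finset.Icc 1 (κ - 1) then (bs.coord ⟨j, h⟩).comp Q else 0 with hφ
  have hQv : ∀ (i : Finset.Icc 1 (κ - 1)), Q (v i) = bs i := fun i => by
    have : v i = ((bs i : A) : E) := by rw [hbs, Module.Basis.span_apply]
    rw [this]
    exact Submodule.projectionOnto_apply_left hAB _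
  have hφv : ∀ i j, i ∈ Finset.Icc 1 (κ - 1) → j ∈ Finset.Icc 1 (κ - 1) →
      φ j (v i) = if i = j then 1 else 0 := by
    intro i j hi hj
    simp only [hφ, dif_pos hj, LinearMap.comp_apply]
    rw [hQv ⟨i, hi⟩, Module.Basis.coord_apply, Module.Basis.repr_self, Finsupp.single_apply]
    simp
  have hQsum : ∀ e : E, (Q e : E) = ∑ j ∈ Finset.Icc 1 (κ - 1), φ j e • v j := by
    intro e
    conv_lhs => rw [← bs.sum_repr (Q e)]
    rw [← Finset.sum_coe_sort (Finset.Icc 1 (κ - 1)), Submodule.coe_sum]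
    refine Finset.sum_congr rfl fun j _ => ?_
    simp only [hφ, dif_pos j.2, LinearMap.comp_apply, Submodule.coe_smul]
    rw [hbs, Module.Basis.span_apply]; rfl
  -- the inverse parametrization
  set Y : ℂ → ℂ := fun x => u⁻¹ * ξ x with hY
  have hξt : Tendsto ξ (𝓝[primedRadius q ξ p] 0) (𝓝 0) := by
    have := hξ.tendsto; rw [hξ0] at this
    exact this.mono_left nhdsWithin_le_nhds
  have hYr : ∀ x ∈ primedRadius q ξ p, 0 < ‖ξ x‖ ∧ Y x = (‖ξ x‖ : ℂ) := by
    rintro x ⟨r, hr, hx⟩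
    have hn : ‖ξ x‖ = r := by
      rw [hx, norm_mul, ← rayUnit, norm_rayUnit, mul_one, Complex.norm_real,
        Real.norm_of_nonneg hr.le]
    refine ⟨hn ▸ hr, ?_⟩
    rw [hn, hY]
    simp only
    rw [hx, ← rayUnit, ← hu]; field_simp
  have hYt : Tendsto Y (𝓝[primedRadius q ξ p] 0) (𝓝[≠] 0) := by
    refine tendsto_nhdsWithin_iff.2 ⟨by simpa using hξt.const_mul u⁻¹, ?_⟩
    filter_upwards [self_mem_nhdsWithin] with x hx
    obtain ⟨h1, h2⟩ := hYr x hx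
    rw [Set.mem_compl_singleton_iff, h2]
    exact_mod_cast h1.ne'
  have hnt : Tendsto (fun x => ‖ξ x‖) (𝓝[primedRadius q ξ p] 0) (𝓝[>] 0) := by
    refine tendsto_nhdsWithin_iff.2 ⟨by simpa using hξt.norm, ?_⟩
    filter_upwards [self_mem_nhdsWithin] with x hx using (hYr x hx).1
  have hYO : Y =O[𝓝[primedRadius q ξ p] 0] ξ := (isBigO_refl ξ _).const_mul_left _
  have hηY : ∀ᶠ x in 𝓝[primedRadius q ξ p] 0, η (Y x) = x :=
    hη.left_inv.filter_mono nhdsWithin_le_nhds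
  -- Index m + 1 carries the constant term of the B-component. The factors α_j are defined as exact
  -- ratios of the coordinates of f to λ^{d_j} x'^{-d_j}, so the A-component leaves no remainder.
  refine ⟨m, Function.update δ (m + 1) 0, fun j => if j ≤ m then (ϑ j : E) else (b 0 : E),
    ?_, ?_, by simp, ?_, fun j x => φ j (f x) * ξ x ^ d j * (lam ^ d j)⁻¹,
    fun j x => β j ‖ξ x‖, fun x => (R (Y x) : E), ?_, ?_, ?_, ?_⟩
  · simpa using hδ0
  · intro i hi j hj hij
    have hj := Set.mem_Iic.1 hj
    have hi' : i ≠ m + 1 := by omega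
    by_cases hj' : j = m + 1
    · subst hj'; simpa [hi'] using (Nat.zero_le _).trans_lt (hδpos i (by omega))
    · simpa [hi', hj'] using hδ (Set.mem_Iic.2 (show i ≤ m by omega))
        (Set.mem_Iic.2 (show j ≤ m by omega)) hij
  -- The complement B embeds in E/𝔽_{κ-1}, so independence in B is independence modulo 𝔽_{κ-1}.
  · set T : B →ₗ[ℝ] (E ⧸ (flagSpace v (κ - 1)).restrictScalars ℝ) :=
      (((flagSpace v (κ - 1)).restrictScalars ℝ).mkQ).comp (B.subtype.restrictScalars ℝ) with hT
    have hTi : Function.Injective T := by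
      rw [← LinearMap.ker_eq_bot, LinearMap.ker_eq_bot']
      intro w hw
      have h1 : (w : E) ∈ flagSpace v (κ - 1) := by
        have : ((flagSpace v (κ - 1)).restrictScalars ℝ).mkQ (w : E) = 0 := hw
        rwa [Submodule.mkQ_apply, Submodule.Quotient.mk_eq_zero,
          Submodule.restrictScalars_mem] at this
      rw [hA] at h1
      have := Submodule.disjoint_def.1 hAB.disjoint _ h1 w.2
      exact_mod_cast this
    have := hϑ.map_injOn T hTi.injOn
    refine this.congr fun j hj => ?_
    simp [hT, Set.mem_Iic.1 hj]
  · intro j hj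
    have hjf : j ∈ Finset.Icc 1 (κ - 1) := Finset.mem_Icc.2 hj
    have l1 := hη.tendsto_pow_smul hξ0 hlam (hv.tendsto (φ j) hj.1
      (by have := hj.2; omega) fun i hi hij => by
        rw [hφv i j (Finset.mem_Icc.2 ⟨hi, by have := hj.2; omega⟩) hjf, if_neg hij.ne])
    rw [hφv j j hjf hjf, if_pos rfl] at l1
    have l2 : Tendsto (fun y => φ j (f (η y)) * (u * y) ^ d j * (lam ^ d j)⁻¹) (𝓝[≠] 0) (𝓝 1) := by
      have := (l1.const_mul (u ^ d j)).mul_const (lam ^ d j)⁻¹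
      rw [smul_eq_mul, mul_one, div_pow, mul_div_cancel₀ _ (pow_ne_zero _ hu0),
        mul_inv_cancel₀ (pow_ne_zero _ hlam)] at this
      refine this.congr fun y => ?_
      rw [smul_eq_mul, mul_pow]; ring
    have l3 : ∀ᶠ y in 𝓝[≠] (0 : ℂ), DifferentiableAt ℂ
        (fun y => φ j (f (η y)) * (u * y) ^ d j * (lam ^ d j)⁻¹) y := by
      filter_upwards [hdiff] with y hy
      have h1 : DifferentiableAt ℂ (fun y => φ j (f (η y))) y :=
        (LinearMap.toContinuousLinearMap (φ j)).differentiableAt.comp y hy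
      exact (h1.mul ((differentiableAt_id.const_mul u).pow _)).mul_const _
    have l4 := ((isBigO_sub_of_tendsto l3 l2).comp_tendsto hYt).trans hYO
    refine l4.congr' ?_ (EventuallyEq.refl _ _)
    filter_upwards [hηY] with x hx
    simp only [Function.comp]
    rw [hx, hY, mul_inv_cancel_left₀ hu0]
  · intro j hj
    have := (hβ j hj).comp_tendsto hnt
    exact (isBigO_norm_right (g' := ξ)).1 this
  · have := (hR.comp_tendsto hYt).trans hYO
    exact IsBigO.of_norm_left this.norm_left
  · filter_upwards [hηY, hYt.eventually hPexp, self_mem_nhdsWithin] with x h1 h2 h3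
    obtain ⟨hpos, hYx⟩ := hYr x h3
    have hξne : ξ x ≠ 0 := norm_pos_iff.1 hpos
    rw [h1] at h2
    have e1 : P (f x) = (∑ j ∈ Finset.range (m + 1), (β j ‖ξ x‖ * (‖ξ x‖ ^ δ j)⁻¹) • ϑ j) + b 0
        + R (Y x) := by
      rw [h2, ← hsum _ hpos.ne', hYx]
      congr 2
      refine Finset.sum_congr rfl fun e _ => ?_
      rw [← Complex.coe_smul]; push_cast; rfl
    have e2 : f x = (∑ j ∈ Finset.Icc 1 (κ - 1), φ j (f x) • v j) + P (f x) := by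
      rw [← hQsum, hPQ]
    refine e2.trans ?_
    rw [e1]
    rw [if_neg (by omega : ¬ m + 1 ≤ m)]
    simp only [Submodule.coe_add, Submodule.coe_sum]
    rw [← add_assoc, ← add_assoc]
    congr 3
    · refine Finset.sum_congr rfl fun j hj => ?_
      congr 1
      have := pow_ne_zero (d j) hξne
      have := pow_ne_zero (d j) hlam
      field_simp
    · refine Finset.sum_congr rfl fun j hj => ?_
      have hj := Finset.mem_range.1 hj
      rw [if_pos (by omega), Function.update_of_ne (by omega)]; rfl

/-! ### The map `f` on the strip around one radius. -/

/-- The standing assumptions on the expansion of `f` and on the adapted coordinate. -/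
structure IsFlowSetup {E : Type*} [NormedAddCommGroup E] [InnerProductSpace ℂ E]
    (Γ : AddSubgroup E) (f : ℂ → E) (k : ℕ) (d : ℕ → ℕ) (v : ℕ → E) (κ : ℕ)
    (lam : ℂ) (H : E →ₗ[ℂ] ℂ) (ξ : ℂ → ℂ) : Prop where
  diff : ∀ᶠ x in 𝓝[≠] (0 : ℂ), DifferentiableAt ℂ f x
  flag : IsFlagExpansion f k d v
  crit : IsCriticalIndex Γ k v κ
  coord : IsAdaptedCoordinate Γ f d v κ lam H ξ

/-- The coordinate `x = η (z ^ (-1/q))`. -/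
noncomputable def stripMap (η : ℂ → ℂ) (q : ℕ) (z : ℂ) : ℂ := η (stripRoot q z)

namespace IsFlowSetup
variable {E : Type*} [NormedAddCommGroup E] [InnerProductSpace ℂ E]
  {Γ : AddSubgroup E} {f : ℂ → E} {k : ℕ} {d : ℕ → ℕ} {v : ℕ → E} {κ : ℕ}
  {lam : ℂ} {H : E →ₗ[ℂ] ℂ} {ξ : ℂ → ℂ} {p m : ℕ} {δ : ℕ → ℕ} {ϑ : ℕ → E} {η : ℂ → ℂ}

theorem one_le (S : IsFlowSetup Γ f k d v κ lam H ξ) : 1 ≤ κ := S.crit.1.1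

theorem le_k (S : IsFlowSetup Γ f k d v κ lam H ξ) : κ ≤ k := S.crit.1.2.1

theorem pole_ne_zero (S : IsFlowSetup Γ f k d v κ lam H ξ) : d κ ≠ 0 :=
  (S.flag.pos S.one_le S.le_k).ne'

theorem lam_ne_zero (S : IsFlowSetup Γ f k d v κ lam H ξ) : lam ≠ 0 :=
  norm_pos_iff.1 (S.coord.norm_lam ▸ one_pos)

/-- By minimality of κ each complex line ℂv_i with i < κ lies in Γ_ℝ. -/
theorem flagSpace_le (S : IsFlowSetup Γ f k d v κ lam H ξ) {a : E}
    (ha : a ∈ flagSpace v (κ - 1)) : a ∈ realSpan Γ := by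
  have : ∀ c : ℂ, c • a ∈ realSpan Γ := by
    refine Submodule.span_induction (p := fun x _ => ∀ c : ℂ, c • x ∈ realSpan Γ) ?_ ?_ ?_ ?_ ha
    · rintro _ ⟨i, hi, rfl⟩ c
      by_contra h
      have := S.crit.2 ⟨hi.1, by have := hi.2; have := S.le_k; omega, c, h⟩
      have := hi.2; have := S.one_le; have := hi.1; omega
    · simp
    · intro x y _ _ hx hy c
      rw [smul_add]; exact Submodule.add_mem _ (hx c) (hy c)
    · intro b x _ hx c
      rw [smul_smul]; exact hx _
  simpa using this 1

/-- The space is stable under i and Im H vanishes on it, so both parts of H vanish. -/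
theorem map_flagSpace (S : IsFlowSetup Γ f k d v κ lam H ξ) {a : E}
    (ha : a ∈ flagSpace v (κ - 1)) : H a = 0 := by
  have h1 := S.coord.im_eq_zero _ (S.flagSpace_le ha)
  have h2 := S.coord.im_eq_zero _ (S.flagSpace_le (Submodule.smul_mem _ Complex.I ha))
  rw [map_smul, smul_eq_mul, Complex.I_mul_im] at h2
  exact Complex.ext h2 h1

theorem exists_param (S : IsFlowSetup Γ f k d v κ lam H ξ) (p : ℕ) :
    ∃ η, IsRayParam ξ lam (d κ) p η :=
  exists_isRayParam S.coord.analytic S.coord.map_zero S.coord.deriv_eq S.lam_ne_zero _ _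

theorem exists_radial [FiniteDimensional ℂ E] (S : IsFlowSetup Γ f k d v κ lam H ξ) (p : ℕ) :
    ∃ (m : ℕ) (δ : ℕ → ℕ) (ϑ : ℕ → E), IsRadialExpansion f d v κ lam ξ p m δ ϑ := by
  obtain ⟨η, hη⟩ := S.exists_param p
  exact exists_isRadialExpansion S.diff S.flag S.one_le S.le_k S.lam_ne_zero
    S.coord.analytic.continuousAt S.coord.map_zero hη

theorem tendsto_stripMap (S : IsFlowSetup Γ f k d v κ lam H ξ) (hη : IsRayParam ξ lam (d κ) p η)
    (M : ℝ) : Tendsto (stripMap η (d κ)) (stripFilter M) (𝓝[≠] 0) :=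
  (hη.tendsto_punctured S.coord.map_zero).comp (tendsto_stripRoot S.pole_ne_zero M)

/-- The reason for this coordinate: up to sign H ∘ f becomes z itself, which yields both injectivity
and control of Im H. -/
theorem coord_stripMap (S : IsFlowSetup Γ f k d v κ lam H ξ) (hη : IsRayParam ξ lam (d κ) p η)
    (M : ℝ) : ∀ᶠ z in stripFilter M, H (f (stripMap η (d κ) z)) = (-1) ^ p * z := by
  have h1 := (S.tendsto_stripMap hη M).eventually S.coord.coord
  have h2 := ((tendsto_stripRoot S.pole_ne_zero M).mono_right nhdsWithin_le_nhds).eventually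
    hη.right_inv
  filter_upwards [h1, h2, eventually_re_pos_stripFilter M] with z h1 h2 h3
  have hz : z ≠ 0 := by rintro rfl; simp at h3
  rw [h1, stripMap, h2, mul_pow, rayUnit_pow S.pole_ne_zero, stripRoot_pow S.pole_ne_zero hz,
    mul_inv, inv_inv, ← inv_pow]
  norm_num

theorem exists_laurent [FiniteDimensional ℂ E] (S : IsFlowSetup Γ f k d v κ lam H ξ)
    (hη : IsRayParam ξ lam (d κ) p η)
    {V : Type*} [NormedAddCommGroup V] [NormedSpace ℂ V] [CompleteSpace V] (L : E →ₗ[ℂ] V)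
    {n : ℕ} {c : V} (hL : Tendsto (fun x : ℂ => x ^ n • L (f x)) (𝓝[≠] 0) (𝓝 c)) :
    ∃ A : ℂ → V, AnalyticAt ℂ A 0 ∧ A 0 = (lam / rayUnit (d κ) p) ^ n • c ∧
      ∀ᶠ y in 𝓝[≠] (0 : ℂ), L (f (η y)) = y ^ (-(n : ℤ)) • A y := by
  have h1 := hη.tendsto_pow_smul S.coord.map_zero S.lam_ne_zero hL
  have h2 : ∀ᶠ y in 𝓝[≠] (0 : ℂ), DifferentiableAt ℂ (fun y => L (f (η y))) y := by
    filter_upwards [hη.differentiableAt_comp S.coord.map_zero S.diff] with y hy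
    exact (LinearMap.toContinuousLinearMap L).differentiableAt.comp y hy
  obtain ⟨A, hA, hA0, h⟩ := exists_analyticAt_of_tendsto h2 h1
  exact ⟨A, hA, hA0, h.mono fun y hy => by rw [hy, zpow_neg, zpow_natCast]⟩

/-- The flag bounds the pole order by d_κ, and comparison with the radial expansion on positive real
y identifies the leading coefficient as L(ϑ_0). -/
theorem exists_laurent_critical [FiniteDimensional ℂ E] (S : IsFlowSetup Γ f k d v κ lam H ξ)
    (hη : IsRayParam ξ lam (d κ) p η) (hrad : IsRadialExpansion f d v κ lam ξ p m δ ϑ)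
    {V : Type*} [NormedAddCommGroup V] [NormedSpace ℂ V] [CompleteSpace V] (L : E →ₗ[ℂ] V)
    (hL : ∀ a ∈ flagSpace v (κ - 1), L a = 0) :
    ∃ A : ℂ → V, AnalyticAt ℂ A 0 ∧ A 0 = L (ϑ 0) ∧
      ∀ᶠ y in 𝓝[≠] (0 : ℂ), L (f (η y)) = y ^ (-(d κ : ℤ)) • A y := by
  obtain ⟨A, hA, -, h⟩ := S.exists_laurent hη L (S.flag.tendsto L S.one_le S.le_k fun i hi hij =>
    hL _ (mem_flagSpace hi (by omega)))
  refine ⟨A, hA, ?_, h⟩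
  have h1 := hrad.tendsto_pow_smul hη (L.restrictScalars ℝ) hL (j := 0) (by omega) (by simp)
  rw [hrad.first] at h1
  have h2 : Tendsto (fun r : ℝ => A r) (𝓝[>] 0) (𝓝 (A 0)) :=
    hA.continuousAt.tendsto.comp (tendsto_ofReal_punctured.mono_right nhdsWithin_le_nhds)
  refine tendsto_nhds_unique h2 (h1.congr' ?_)
  filter_upwards [tendsto_ofReal_punctured.eventually h, self_mem_nhdsWithin] with r hr hr0
  have hr0 : (r : ℂ) ≠ 0 := by exact_mod_cast (ne_of_gt hr0)
  rw [LinearMap.restrictScalars_apply, hr, ← Complex.coe_smul, smul_smul, zpow_neg, zpow_natCast]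
  push_cast
  rw [mul_inv_cancel₀ (pow_ne_zero _ hr0), one_smul]

/-- Moving across the strip translates `f` by multiples of `i ϑ_0`, modulo `𝔽_{κ-1}`. -/
theorem tendsto_shift [FiniteDimensional ℂ E] (S : IsFlowSetup Γ f k d v κ lam H ξ)
    (hη : IsRayParam ξ lam (d κ) p η) (hrad : IsRadialExpansion f d v κ lam ξ p m δ ϑ)
    {V : Type*} [NormedAddCommGroup V] [NormedSpace ℂ V] [CompleteSpace V] (L : E →ₗ[ℂ] V)
    (hL : ∀ a ∈ flagSpace v (κ - 1), L a = 0) (M : ℝ) :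
    Tendsto (fun z : ℂ => L (f (stripMap η (d κ) z)) - L (f (stripMap η (d κ) (z.re : ℂ))) -
      (Complex.I * z.im) • L (ϑ 0)) (stripFilter M) (𝓝 0) := by
  obtain ⟨A, hA, hA0, h⟩ := S.exists_laurent_critical hη hrad L hL
  set q := d κ with hq
  have hq0 : q ≠ 0 := S.pole_ne_zero
  set A₁ := zpowDeriv q (-(q : ℤ)) A with hA₁
  have a1 : AnalyticAt ℂ A₁ 0 := analyticAt_zpowDeriv hA
  -- For exponent -q the factor -s/q is 1: y^{-q}A(y) behaves like z A(0), with derivative tending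
  -- to A(0).
  have a10 : A₁ 0 = A 0 := by
    have : (q : ℂ) ≠ 0 := by exact_mod_cast hq0
    rw [hA₁, zpowDeriv_zero]; push_cast; rw [neg_neg, div_self this, one_smul]
  have ht := tendsto_stripRoot hq0 M
  have hlim : Tendsto (fun z => A₁ (stripRoot q z)) (stripFilter M) (𝓝 (A 0)) := by
    have := a1.continuousAt.tendsto.comp (ht.mono_right nhdsWithin_le_nhds)
    rwa [a10] at this
  have hder : ∀ᶠ z in stripFilter M, HasDerivAt
      (fun z => stripRoot q z ^ (-(q : ℤ)) • A (stripRoot q z)) (A₁ (stripRoot q z)) z := by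
    filter_upwards [(ht.mono_right nhdsWithin_le_nhds).eventually hA.eventually_analyticAt,
      eventually_re_pos_stripFilter M] with z h1 h2
    have := hasDerivAt_zpow_smul hq0 (-(q : ℤ)) (Or.inl h2) h1.differentiableAt
    simpa using this
  rw [Metric.tendsto_nhds]
  intro ε hε
  have hε' : 0 < ε / (|M| + 1) := by positivity
  obtain ⟨R, hR⟩ := eventually_stripFilter_iff.1
    (((Metric.tendsto_nhds.1 hlim _ hε').and hder).and (ht.eventually h))
  filter_upwards [(tendsto_re_stripFilter M).eventually_ge_atTop R, eventually_im_stripFilter M]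
    with z hz1 hz2
  have hM : 0 ≤ M := (abs_nonneg _).trans hz2
  have hconv : Convex ℝ {w : ℂ | R ≤ w.re ∧ |w.im| ≤ M} := by
    have : {w : ℂ | R ≤ w.re ∧ |w.im| ≤ M} = {w : ℂ | R ≤ w.re} ∩ ({w : ℂ | w.im ≤ M} ∩
        {w : ℂ | -M ≤ w.im}) := by
      ext w; simp only [Set.mem_ofPred_eq, Set.mem_inter_iff, abs_le]; tauto
    rw [this]
    exact (convex_halfSpace_re_ge R).inter ((convex_halfSpace_im_le M).inter
      (convex_halfSpace_im_ge _))
  -- Mean value inequality for y^{-q}A(y) - z A(0), whose derivative is small, on the segment from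
  -- Re z to z, of length at most M.
  have key := hconv.norm_image_sub_le_of_norm_hasDerivWithin_le
    (f := fun w => stripRoot q w ^ (-(q : ℤ)) • A (stripRoot q w) - w • A 0)
    (f' := fun w => A₁ (stripRoot q w) - A 0) (C := ε / (|M| + 1))
    (fun w hw => ((hR w hw.1 hw.2).1.2.sub (by
      simpa using (hasDerivAt_id w).smul_const (A 0))).hasDerivWithinAt)
    (fun w hw => by rw [← dist_eq_norm]; exact (hR w hw.1 hw.2).1.1.le)
    (x := (z.re : ℂ)) (y := z) ⟨by simpa using hz1, by simpa using hM⟩ ⟨hz1, hz2⟩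
  have e1 : z - (z.re : ℂ) = Complex.I * z.im := by
    conv_lhs => rw [← Complex.re_add_im z]
    simp [mul_comm]
  have hz' := hR (z.re : ℂ) (by simpa using hz1) (by simpa using hM)
  simp only [stripMap]
  rw [dist_zero_right, (hR z hz1 hz2).2, hz'.2, ← hA0, ← e1, sub_smul]
  have e2 : stripRoot q z ^ (-(q : ℤ)) • A (stripRoot q z) -
      stripRoot q (z.re : ℂ) ^ (-(q : ℤ)) • A (stripRoot q (z.re : ℂ)) - (z • A 0 - (z.re : ℂ) • A 0)
      = stripRoot q z ^ (-(q : ℤ)) • A (stripRoot q z) - z • A 0 -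
        (stripRoot q (z.re : ℂ) ^ (-(q : ℤ)) • A (stripRoot q (z.re : ℂ)) - (z.re : ℂ) • A 0) := by
    abel
  rw [e2]
  refine key.trans_lt ?_
  have : ‖z - (z.re : ℂ)‖ ≤ |M| := by
    rw [e1, norm_mul, Complex.norm_I, one_mul, Complex.norm_real]
    exact hz2.trans (le_abs_self _)
  calc ε / (|M| + 1) * ‖z - (z.re : ℂ)‖ ≤ ε / (|M| + 1) * |M| := by gcongr
    _ < ε := by
      rw [div_mul_eq_mul_div, div_lt_iff₀ (by positivity)]
      nlinarith [abs_nonneg M]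

/-- A real form is the real part of a complex one. Since 𝔽_{κ-1} is a complex subspace, that
extension kills it too, and the complex statement applies. -/
theorem tendsto_real_shift [FiniteDimensional ℂ E] (S : IsFlowSetup Γ f k d v κ lam H ξ)
    (hη : IsRayParam ξ lam (d κ) p η) (hrad : IsRadialExpansion f d v κ lam ξ p m δ ϑ)
    (ℓ : E →ₗ[ℝ] ℝ) (hℓ : ∀ a ∈ flagSpace v (κ - 1), ℓ a = 0) (M : ℝ) :
    Tendsto (fun z : ℂ => ℓ (f (stripMap η (d κ) z)) - ℓ (f (stripMap η (d κ) (z.re : ℂ))) -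
      z.im * ℓ (Complex.I • ϑ 0)) (stripFilter M) (𝓝 0) := by
  set L : E →ₗ[ℂ] ℂ := Module.Dual.extendRCLike (𝕜 := ℂ) ℓ with hL
  have hre : ∀ x, (L x).re = ℓ x := fun x => Module.Dual.re_extendRCLike_apply (𝕜 := ℂ) ℓ x
  have hL0 : ∀ a ∈ flagSpace v (κ - 1), L a = 0 := by
    intro a ha
    refine Complex.ext (by rw [hre, hℓ a ha]; rfl) ?_
    have h2 := hre (Complex.I • a)
    rw [hℓ _ (Submodule.smul_mem _ _ ha), map_smul, smul_eq_mul, Complex.I_mul_re] at h2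
    simpa using h2
  have h := (Complex.continuous_re.tendsto _).comp (S.tendsto_shift hη hrad L hL0 M)
  rw [Complex.zero_re] at h
  refine h.congr fun z => ?_
  simp only [Function.comp, Complex.sub_re, hre]
  congr 1
  rw [mul_comm Complex.I, mul_smul, smul_eq_mul, Complex.re_ofReal_mul, ← map_smul, hre]

theorem tendsto_re_root (S : IsFlowSetup Γ f k d v κ lam H ξ) (M : ℝ) :
    Tendsto (fun z : ℂ => Real.exp (-(Real.log z.re) / d κ)) (stripFilter M) (𝓝[>] 0) := by
  have hq : (0 : ℝ) < d κ := by exact_mod_cast Nat.pos_of_ne_zero S.pole_ne_zero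
  refine tendsto_nhdsWithin_iff.2 ⟨?_, Eventually.of_forall fun _ => Real.exp_pos _⟩
  refine Real.tendsto_exp_atBot.comp (Tendsto.atBot_div_const hq ?_)
  exact tendsto_neg_atTop_atBot.comp (Real.tendsto_log_atTop.comp (tendsto_re_stripFilter M))

theorem eventually_stripMap_re (η : ℂ → ℂ) (q : ℕ) (M : ℝ) : ∀ᶠ z in stripFilter M,
    stripMap η q (z.re : ℂ) = η ((Real.exp (-(Real.log z.re) / q) : ℝ) : ℂ) := by
  filter_upwards [eventually_re_pos_stripFilter M] with z hz
  rw [stripMap, stripRoot_eq_ofReal hz]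

/-- Functionals vanishing on `𝔽'_m` have an affine limit on the strip. -/
theorem tendsto_of_radialSpace [FiniteDimensional ℂ E] (S : IsFlowSetup Γ f k d v κ lam H ξ)
    (hη : IsRayParam ξ lam (d κ) p η) (hrad : IsRadialExpansion f d v κ lam ξ p m δ ϑ)
    (ℓ : E →ₗ[ℝ] ℝ) (hℓ : ∀ a ∈ radialSpace v κ ϑ m, ℓ a = 0) (M : ℝ) :
    Tendsto (fun z : ℂ => ℓ (f (stripMap η (d κ) z)) - (ℓ (ϑ (m + 1)) +
      z.im * ℓ (Complex.I • ϑ 0))) (stripFilter M) (𝓝 0) := by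
  have h1 := S.tendsto_real_shift hη hrad ℓ (fun a ha => hℓ a (flagSpace_le_radialSpace ha)) M
  have h2 := ((hrad.tendsto_of_radialSpace_le hη ℓ hℓ).comp (S.tendsto_re_root M)).sub_const
    (ℓ (ϑ (m + 1)))
  rw [sub_self] at h2
  have h3 := h1.add h2
  rw [add_zero] at h3
  refine h3.congr' ?_
  filter_upwards [eventually_stripMap_re η (d κ) M] with z hz
  simp only [Function.comp]
  rw [hz]; ring

/-- Divergence holds along the central radius, and within the strip the form differs from its
central value by a bounded amount. -/
theorem tendsto_abs_atTop [FiniteDimensional ℂ E] (S : IsFlowSetup Γ f k d v κ lam H ξ)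
    (hη : IsRayParam ξ lam (d κ) p η) (hrad : IsRadialExpansion f d v κ lam ξ p m δ ϑ)
    (ℓ : E →ₗ[ℝ] ℝ) (hℓ : ∀ a ∈ flagSpace v (κ - 1), ℓ a = 0)
    (hℓ' : ∃ a ∈ radialSpace v κ ϑ m, ℓ a ≠ 0) (M : ℝ) :
    Tendsto (fun z : ℂ => |ℓ (f (stripMap η (d κ) z))|) (stripFilter M) atTop := by
  have h1 := S.tendsto_real_shift hη hrad ℓ hℓ M
  have h2 := (hrad.tendsto_norm_atTop hη ℓ hℓ hℓ').comp (S.tendsto_re_root M)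
  have h3 : ∀ᶠ z in stripFilter M, |ℓ (f (stripMap η (d κ) (z.re : ℂ)))| -
      (1 + M * |ℓ (Complex.I • ϑ 0)|) ≤ |ℓ (f (stripMap η (d κ) z))| := by
    filter_upwards [Metric.tendsto_nhds.1 h1 1 one_pos, eventually_im_stripFilter M] with z hz hz'
    rw [dist_zero_right, Real.norm_eq_abs] at hz
    set a := ℓ (f (stripMap η (d κ) z))
    set b := ℓ (f (stripMap η (d κ) (z.re : ℂ)))
    set c := ℓ (Complex.I • ϑ 0)
    have e1 : b = a - z.im * c - (a - b - z.im * c) := by ring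
    have e2 : |z.im * c| ≤ M * |c| := by rw [abs_mul]; gcongr
    have : |b| ≤ |a| + |z.im * c| + |a - b - z.im * c| := by
      conv_lhs => rw [e1]
      exact (abs_sub _ _).trans (add_le_add (abs_sub _ _) le_rfl)
    linarith
  refine tendsto_atTop_mono' _ h3 (tendsto_atTop_add_const_right _ _ (h2.congr' ?_))
  filter_upwards [eventually_stripMap_re η (d κ) M] with z hz
  simp only [Function.comp]
  rw [hz]; rfl

end IsFlowSetup

/-! ### Localization of cluster values near finitely many radii. -/

/-- `ℓ` descends to a continuous function on the quotient. -/
theorem exists_continuous_desc {E X : Type*} [NormedAddCommGroup E] [TopologicalSpace X]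
    (Γ : AddSubgroup E) {F : E → X} (hF : Continuous F) (hΓ : ∀ e, ∀ γ ∈ Γ, F (e + γ) = F e) :
    ∃ F' : E ⧸ Γ → X, Continuous F' ∧ ∀ e : E, F' (e : E ⧸ Γ) = F e := by
  refine ⟨fun y => Quotient.liftOn' y F ?_, ?_, fun e => rfl⟩
  · intro a b hab
    have h : -a + b ∈ Γ := QuotientAddGroup.leftRel_apply.1 hab
    have := hΓ a _ h
    rw [add_neg_cancel_left] at this
    exact this.symm
  · exact (QuotientAddGroup.isQuotientMap_mk Γ).continuous_iff.2 hF

theorem realSpan_mem {E : Type*} [NormedAddCommGroup E] [InnerProductSpace ℂ E]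
    {Γ : AddSubgroup E} {γ : E} (h : γ ∈ Γ) : γ ∈ realSpan Γ := Submodule.subset_span h

theorem exists_continuous_desc_linear {E : Type*} [NormedAddCommGroup E] [InnerProductSpace ℂ E]
    [FiniteDimensional ℂ E] {Γ : AddSubgroup E} (ℓ : E →ₗ[ℝ] ℝ) (hℓ : ∀ z ∈ realSpan Γ, ℓ z = 0) :
    ∃ F : E ⧸ Γ → ℝ, Continuous F ∧ ∀ e : E, F (e : E ⧸ Γ) = ℓ e :=
  exists_continuous_desc Γ ℓ.continuous_of_finiteDimensional fun e γ hγ => by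
    rw [map_add, hℓ γ (realSpan_mem hγ), add_zero]

theorem rayUnit_eq_pow {q : ℕ} (hq : q ≠ 0) (p : ℕ) :
    Complex.exp (2 * Real.pi * Complex.I / (2 * q : ℕ)) ^ p = rayUnit q p := by
  have hq' : (q : ℂ) ≠ 0 := by exact_mod_cast hq
  rw [rayUnit, ← Complex.exp_nat_mul]
  congr 1
  push_cast
  field_simp

theorem arg_rayUnit (q p : ℕ) :
    (Complex.arg (rayUnit q p) : Real.Angle) = ((p * Real.pi / q : ℝ) : Real.Angle) := by
  have := Complex.arg_cos_add_sin_mul_I_coe_angle ((p * Real.pi / q : ℝ) : Real.Angle)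
  rwa [Real.Angle.cos_coe, Real.Angle.sin_coe, Complex.ofReal_cos, Complex.ofReal_sin,
    ← Complex.exp_mul_I, mul_comm _ Complex.I, ← rayUnit] at this

theorem abs_im_neg_one_pow_mul (p : ℕ) (z : ℂ) : |((-1) ^ p * z).im| = |z.im| := by
  rcases neg_one_pow_eq_or ℂ p with h | h <;> simp [h]

theorem norm_neg_one_pow_mul (p : ℕ) (z : ℂ) : ‖(-1) ^ p * z‖ = ‖z‖ := by simp

namespace IsFlowSetup
variable {E : Type*} [NormedAddCommGroup E] [InnerProductSpace ℂ E]
  {Γ : AddSubgroup E} {f : ℂ → E} {k : ℕ} {d : ℕ → ℕ} {v : ℕ → E} {κ : ℕ}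
  {lam : ℂ} {H : E →ₗ[ℂ] ℂ} {ξ : ℂ → ℂ} {p m : ℕ} {δ : ℕ → ℕ} {ϑ : ℕ → E} {η : ℂ → ℂ}

theorem tendsto_coord (S : IsFlowSetup Γ f k d v κ lam H ξ) :
    Tendsto ξ (𝓝[≠] 0) (𝓝[≠] 0) := by
  have h := S.coord.analytic.differentiableAt.hasDerivAt
  rw [S.coord.deriv_eq] at h
  refine tendsto_nhdsWithin_iff.2 ⟨?_, ?_⟩
  · have := S.coord.analytic.continuousAt.tendsto
    rw [S.coord.map_zero] at this
    exact this.mono_left nhdsWithin_le_nhds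
  · have := h.eventually_ne (c := 0) S.lam_ne_zero
    exact this

theorem tendsto_norm_height (S : IsFlowSetup Γ f k d v κ lam H ξ) :
    Tendsto (fun x => ‖H (f x)‖) (𝓝[≠] 0) atTop := by
  have h1 : Tendsto (fun x => ‖ξ x‖⁻¹ ^ d κ) (𝓝[≠] 0) atTop :=
    (tendsto_pow_atTop S.pole_ne_zero).comp
      (tendsto_norm_cobounded_atTop.comp (tendsto_inv₀_nhdsNE_zero.comp S.tendsto_coord) |>.congr
        fun x => by simp)
  refine h1.congr' ?_
  filter_upwards [S.coord.coord] with x hx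
  rw [hx, norm_inv, norm_pow, inv_pow]

/-- Near `0`, the points where `Im H ∘ f` is bounded lie near one of the radii `L'_p`. -/
theorem eventually_exists_ray (S : IsFlowSetup Γ f k d v κ lam H ξ) (M : ℝ) :
    ∀ᶠ x in 𝓝[≠] (0 : ℂ), |(H (f x)).im| ≤ M → ∃ p < 2 * d κ,
      0 < ((-1) ^ p * H (f x)).re ∧
        ξ x = rayUnit (d κ) p * stripRoot (d κ) ((-1) ^ p * H (f x)) := by
  have hq := S.pole_ne_zero
  set q := d κ
  filter_upwards [S.tendsto_norm_height.eventually_gt_atTop M, S.coord.coord,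
    S.tendsto_coord.eventually self_mem_nhdsWithin] with x h1 h2 h3 h4
  have h3 : ξ x ≠ 0 := h3
  set h := H (f x) with hh
  -- The norm exceeds M while the imaginary part does not, so the real part cannot vanish.
  have hre : h.re ≠ 0 := by
    intro h0
    have : ‖h‖ = |h.im| := by
      rw [← Complex.re_add_im h, h0]; simp
    linarith
  obtain ⟨s, hs⟩ : ∃ s : ℕ, 0 < ((-1) ^ s * h).re := by
    rcases lt_or_gt_of_ne hre with h' | h'
    · exact ⟨1, by simpa using h'⟩
    · exact ⟨0, by simpa using h'⟩
  set Z := (-1) ^ s * h with hZ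
  have hZ0 : Z ≠ 0 := by intro h0; rw [h0] at hs; simp at hs
  set y := stripRoot q Z with hy
  have hy0 : y ≠ 0 := stripRoot_ne_zero _ _
  have hyq : y ^ q = Z⁻¹ := stripRoot_pow hq hZ0
  have hξq : ξ x ^ q = h⁻¹ := by rw [h2, inv_inv]
  have hh0 : h ≠ 0 := by intro h0; rw [h0] at hre; simp at hre
  -- The quotient ξ(x)/y is a 2q-th root of unity, hence some e^{ipπ/q}; its q-th power shows that p
  -- has the parity of s.
  have e1 : (ξ x / y) ^ q = (-1) ^ s := by
    rw [div_pow, hyq, hξq, hZ]; field_simp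
  have e2 : (ξ x / y) ^ (2 * q) = 1 := by
    rw [mul_comm, pow_mul, e1, ← pow_mul, mul_comm, pow_mul]; simp
  have : NeZero (2 * q) := ⟨by omega⟩
  obtain ⟨p, hp, hpe⟩ := (Complex.isPrimitiveRoot_exp (2 * q) (by omega)).eq_pow_of_pow_eq_one e2
  rw [rayUnit_eq_pow hq] at hpe
  have e3 : ((-1 : ℂ)) ^ p = (-1) ^ s := by rw [← rayUnit_pow hq, hpe, e1]
  refine ⟨p, hp, by rw [e3]; exact hs, ?_⟩
  rw [e3, hpe, ← hZ, ← hy]; field_simp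

theorem tendsto_arg_stripMap (S : IsFlowSetup Γ f k d v κ lam H ξ)
    (hη : IsRayParam ξ lam (d κ) p η) (M : ℝ) :
    Tendsto (fun z => (Complex.arg (stripMap η (d κ) z) : Real.Angle)) (stripFilter M)
      (𝓝 (radiusAngle (d κ) lam p)) := by
  have hq := S.pole_ne_zero
  have hne : rayUnit (d κ) p / lam ≠ 0 := div_ne_zero (rayUnit_ne_zero _ _) S.lam_ne_zero
  have h1 := (hη.tendsto_div.comp (tendsto_stripRoot hq M)).mul
    (tendsto_stripRoot_div_norm (d κ) M)
  rw [mul_one] at h1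
  have h2 := (Complex.continuousAt_arg_coe_angle hne).tendsto.comp h1
  have e : ((Real.Angle.coe ∘ Complex.arg) (rayUnit (d κ) p / lam)) =
      radiusAngle (d κ) lam p := by
    simp only [Function.comp]
    rw [Complex.arg_div_coe_angle (rayUnit_ne_zero _ _) S.lam_ne_zero, arg_rayUnit,
      radiusAngle, Real.Angle.coe_sub]
  rw [e] at h2
  refine h2.congr fun z => ?_
  simp only [Function.comp]
  have hn : 0 < ‖stripRoot (d κ) z‖⁻¹ := inv_pos.2 (norm_pos_iff.2 (stripRoot_ne_zero _ _))
  have e2 : η (stripRoot (d κ) z) / stripRoot (d κ) z * (stripRoot (d κ) z / ‖stripRoot (d κ) z‖) =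
      ((‖stripRoot (d κ) z‖⁻¹ : ℝ) : ℂ) * η (stripRoot (d κ) z) := by
    have := stripRoot_ne_zero (d κ) z
    push_cast; field_simp
  rw [e2, Complex.arg_real_mul _ hn, stripMap]

theorem exists_projection (W : Submodule ℝ E) :
    ∃ P : E →ₗ[ℝ] E, (∀ a ∈ W, P a = 0) ∧ ∀ e, e - P e ∈ W := by
  obtain ⟨B, hB⟩ := Submodule.exists_isCompl W
  refine ⟨B.projection W hB.symm, fun a ha => Submodule.projection_apply_of_mem_right _ ha,
    fun e => ?_⟩
  have h := Submodule.projection_add_projection_eq_self hB e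
  have : e - B.projection W hB.symm e = W.projection B hB e := by
    rw [sub_eq_iff_eq_add]; exact h.symm
  rw [this]
  exact Submodule.projection_apply_mem _ _

variable [FiniteDimensional ℂ E]

/-- Along an ultrafilter on which `π ∘ f` converges, the points lie near a single radius. -/
theorem exists_ray_of_tendsto (S : IsFlowSetup Γ f k d v κ lam H ξ) {ηs : ℕ → ℂ → ℂ}
    (hη : ∀ p, IsRayParam ξ lam (d κ) p (ηs p)) {𝒰 : Ultrafilter ℂ} (h𝒰 : ↑𝒰 ≤ 𝓝[≠] (0 : ℂ))
    {y : E ⧸ Γ} (hy : Tendsto (fun x => (f x : E ⧸ Γ)) 𝒰 (𝓝 y)) :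
    ∃ p < 2 * d κ, ∃ M : ℝ, Tendsto (fun x => (-1) ^ p * H (f x)) 𝒰 (stripFilter M) ∧
      ∀ᶠ x in 𝒰, stripMap (ηs p) (d κ) ((-1) ^ p * H (f x)) = x := by
  -- Im H vanishes on Γ_ℝ and so lives on the torus, where convergence of π ∘ f bounds it.
  obtain ⟨F, hFc, hF⟩ := exists_continuous_desc_linear (Γ := Γ)
    (Complex.imLm.comp (H.restrictScalars ℝ)) (fun z hz => S.coord.im_eq_zero z hz)
  have h1 : Tendsto (fun x => (H (f x)).im) 𝒰 (𝓝 (F y)) :=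
    ((hFc.tendsto y).comp hy).congr fun x => hF (f x)
  set M := |F y| + 1 with hM
  have h2 : ∀ᶠ x in (𝒰 : Filter ℂ), |(H (f x)).im| ≤ M := by
    filter_upwards [h1.abs.eventually_lt_const (show |F y| < M by rw [hM]; linarith)] with x hx
      using hx.le
  have h3 : ∀ᶠ x in (𝒰 : Filter ℂ), ∃ p ∈ Set.Iio (2 * d κ), 0 < ((-1) ^ p * H (f x)).re ∧
        ξ x = rayUnit (d κ) p * stripRoot (d κ) ((-1) ^ p * H (f x)) := by
    filter_upwards [h𝒰 (S.eventually_exists_ray M), h2] with x hx hx'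
    obtain ⟨p, hp, h⟩ := hx hx'
    exact ⟨p, hp, h⟩
  -- Only finitely many radii compete, so the ultrafilter selects one.
  rw [Ultrafilter.eventually_exists_mem_iff (Set.finite_Iio _)] at h3
  obtain ⟨p, hp, h3⟩ := h3
  refine ⟨p, hp, M, tendsto_stripFilter_iff.2 ⟨?_, ?_⟩, ?_⟩
  · have h4 := tendsto_atTop_add_const_right _ (-M) (S.tendsto_norm_height.mono_left h𝒰)
    refine tendsto_atTop_mono' _ ?_ h4
    filter_upwards [h3, h2] with x hx hx'
    have := Complex.norm_le_abs_re_add_abs_im ((-1) ^ p * H (f x))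
    rw [norm_neg_one_pow_mul, abs_im_neg_one_pow_mul, abs_of_pos hx.1] at this
    linarith
  · filter_upwards [h2] with x hx
    rwa [abs_im_neg_one_pow_mul]
  · filter_upwards [h3, h𝒰 ((hη p).left_inv.filter_mono nhdsWithin_le_nhds)] with x hx hx'
    rw [hx.2, inv_mul_cancel_left₀ (rayUnit_ne_zero _ _)] at hx'
    rw [stripMap]
    exact hx'

/-- A real form killing Γ_ℝ but not 𝔽'_m would descend to the torus and converge there, yet it tends
to infinity in absolute value on the strip. -/
theorem isGammaRadius_of_tendsto (S : IsFlowSetup Γ f k d v κ lam H ξ)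
    (hη : IsRayParam ξ lam (d κ) p η) (hrad : IsRadialExpansion f d v κ lam ξ p m δ ϑ)
    {ι : Type*} {l : Filter ι} [l.NeBot] {Z : ι → ℂ} {M : ℝ} (hZ : Tendsto Z l (stripFilter M))
    {y : E ⧸ Γ} (hy : Tendsto (fun i => (f (stripMap η (d κ) (Z i)) : E ⧸ Γ)) l (𝓝 y)) :
    radialSpace v κ ϑ m ≤ realSpan Γ := by
  intro a ha
  by_contra ha'
  obtain ⟨ℓ, hℓa, hℓ⟩ := Submodule.exists_le_ker_of_notMem ha'
  obtain ⟨F, hFc, hF⟩ := exists_continuous_desc_linear ℓ hℓ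
  have h1 := (S.tendsto_abs_atTop hη hrad ℓ (fun a ha => hℓ (S.flagSpace_le ha)) ⟨a, ha, hℓa⟩
    M).comp hZ
  have h2 := ((hFc.tendsto y).comp hy).abs
  refine not_tendsto_nhds_of_tendsto_atTop h1 _ (h2.congr fun i => ?_)
  simp only [Function.comp, hF]

theorem tendsto_of_forall_functional {ι : Type*} {l : Filter ι} {u : ι → E} {w : E}
    (P : E →ₗ[ℝ] E) (h : ∀ ℓ : E →ₗ[ℝ] ℝ, Tendsto (fun i => ℓ (P (u i))) l (𝓝 (ℓ w))) :
    Tendsto (fun i => P (u i)) l (𝓝 w) := by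
  set b := Module.finBasis ℝ E
  have h1 : Tendsto (fun i => ∑ j, b.coord j (P (u i)) • b j) l (𝓝 (∑ j, b.coord j w • b j)) :=
    tendsto_finsetSum _ fun j _ => (h (b.coord j)).smul_const _
  have e : ∀ w, ∑ j, b.coord j w • b j = w := fun w => b.sum_repr w
  simpa only [e] using h1

/-- With P a projection whose kernel is the direction of V', the vectors P(f) converge to
P(ϑ_{m+1}). Hence f stays asymptotically close to V'. -/
theorem mem_closure_of_tendsto (S : IsFlowSetup Γ f k d v κ lam H ξ)
    (hη : IsRayParam ξ lam (d κ) p η) (hrad : IsRadialExpansion f d v κ lam ξ p m δ ϑ)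
    {ι : Type*} {l : Filter ι} [l.NeBot] {Z : ι → ℂ} {M : ℝ} (hZ : Tendsto Z l (stripFilter M))
    {y : E ⧸ Γ} (hy : Tendsto (fun i => (f (stripMap η (d κ) (Z i)) : E ⧸ Γ)) l (𝓝 y)) :
    y ∈ closure ((fun z : E => (z : E ⧸ Γ)) '' (limitAffine v κ m ϑ : Set E)) := by
  set W := Submodule.span ℝ {Complex.I • ϑ 0} ⊔ radialSpace v κ ϑ m with hW
  obtain ⟨P, hP, hP'⟩ := exists_projection W
  set F : ι → E := fun i => f (stripMap η (d κ) (Z i)) with hF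
  have h1 : Tendsto (fun i => P (F i)) l (𝓝 (P (ϑ (m + 1)))) := by
    refine tendsto_of_forall_functional P fun ℓ => ?_
    have h2 := (S.tendsto_of_radialSpace hη hrad (ℓ.comp P) (fun a ha => by
      rw [LinearMap.comp_apply, hP a ((le_sup_right : _ ≤ W) ha), map_zero]) M).comp hZ
    have h3 : P (Complex.I • ϑ 0) = 0 :=
      hP _ ((le_sup_left : _ ≤ W) (Submodule.mem_span_singleton_self _))
    have h4 := h2.add_const (ℓ (P (ϑ (m + 1))))
    rw [zero_add] at h4
    refine h4.congr fun i => ?_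
    simp [h3, hF]
  -- Replacing P(f) by its limit gives a point of V' at distance o(1) from f.
  have h2 : Tendsto (fun i => F i - P (F i) + P (ϑ (m + 1)) - F i) l (𝓝 0) := by
    have := (h1.const_sub (P (ϑ (m + 1))))
    rw [sub_self] at this
    exact this.congr fun i => by abel
  have h3 : Tendsto (fun i => ((F i - P (F i) + P (ϑ (m + 1)) : E) : E ⧸ Γ) ) l (𝓝 y) := by
    have hc : Continuous (fun e : E => (e : E ⧸ Γ)) := continuous_quot_mk
    have := hy.add ((hc.tendsto (0 : E)).comp h2)
    rw [QuotientAddGroup.mk_zero, add_zero] at this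
    refine this.congr fun i => ?_
    change ((F i : E ⧸ Γ)) + ((F i - P (F i) + P (ϑ (m + 1)) - F i : E) : E ⧸ Γ) = _
    rw [← QuotientAddGroup.mk_add, add_sub_cancel]
  refine _root_.mem_closure_of_tendsto h3 (Eventually.of_forall fun i => ⟨_, ?_, rfl⟩)
  rw [SetLike.mem_coe, limitAffine, AffineSubspace.mem_mk', vsub_eq_sub]
  have e2 : F i - P (F i) + P (ϑ (m + 1)) - ϑ (m + 1) =
      (F i - P (F i)) - (ϑ (m + 1) - P (ϑ (m + 1))) := by abel
  rw [e2]
  exact Submodule.sub_mem _ (hP' _) (hP' _)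

end IsFlowSetup

/-! ### Characters and compactness in `E ⧸ Γ`. -/

section torus
variable {E : Type*} [NormedAddCommGroup E] [InnerProductSpace ℂ E] {Γ : AddSubgroup E}

/-- Real linear forms taking integral values on `Γ`. -/
def IsIntegral (Γ : AddSubgroup E) (ℓ : E →ₗ[ℝ] ℝ) : Prop := ∀ γ ∈ Γ, ∃ n : ℤ, ℓ γ = n

/-- The characters of `E ⧸ Γ` defined by integral linear forms. -/
def characters (Γ : AddSubgroup E) : Set C(E ⧸ Γ, ℂ) :=
  {χ | ∃ ℓ : E →ₗ[ℝ] ℝ, IsIntegral Γ ℓ ∧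
    ∀ e : E, χ (e : E ⧸ Γ) = Complex.exp (Complex.I * (2 * Real.pi * ℓ e : ℝ))}

variable [FiniteDimensional ℂ E]

theorem IsIntegral.exists_character {ℓ : E →ₗ[ℝ] ℝ} (hℓ : IsIntegral Γ ℓ) :
    ∃ χ : C(E ⧸ Γ, ℂ), ∀ e : E, χ (e : E ⧸ Γ) = Complex.exp (Complex.I * (2 * Real.pi * ℓ e : ℝ)) := by
  have hc : Continuous ℓ := ℓ.continuous_of_finiteDimensional
  obtain ⟨F, hF, hFe⟩ := exists_continuous_desc Γ
    (F := fun e => Complex.exp (Complex.I * (2 * Real.pi * ℓ e : ℝ)))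
    (by fun_prop) (fun e γ hγ => by
      obtain ⟨n, hn⟩ := hℓ γ hγ
      rw [map_add, hn]
      have : Complex.I * ((2 * Real.pi * (ℓ e + n) : ℝ) : ℂ) =
        Complex.I * ((2 * Real.pi * ℓ e : ℝ) : ℂ) + n * (2 * Real.pi * Complex.I) := by
        push_cast; ring
      rw [this, Complex.exp_add, Complex.exp_int_mul_two_pi_mul_I, mul_one])
  exact ⟨⟨F, hF⟩, hFe⟩

/-- Integral linear forms separate the points of the quotient. -/
theorem exists_isIntegral_of_notMem [DiscreteTopology Γ] {z : E} (hz : z ∉ Γ) :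
    ∃ ℓ : E →ₗ[ℝ] ℝ, IsIntegral Γ ℓ ∧ ¬ ∃ n : ℤ, ℓ z = n := by
  by_cases hzR : z ∈ realSpan Γ
  -- Γ is a full lattice in its real span. Coordinates in a ℤ-basis are integral on Γ, and a point
  -- outside Γ has a nonintegral one.
  · set L : Submodule ℤ E := AddSubgroup.toIntSubmodule Γ with hL
    have : DiscreteTopology L := ‹DiscreteTopology Γ›
    let g := (realSpan Γ).subtype
    let L₀ := L.comap (g.restrictScalars ℤ)
    have h_img : g '' L₀ = L := by
      ext x
      constructor
      · rintro ⟨y, hy, rfl⟩; exact hy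
      · intro hx; exact ⟨⟨x, Submodule.subset_span hx⟩, hx, rfl⟩
    have : DiscreteTopology L₀ := by
      refine DiscreteTopology.preimage_of_continuous_injective (L : Set E) ?_
        (Submodule.injective_subtype _)
      exact LinearMap.continuous_of_finiteDimensional g
    have : IsZLattice ℝ L₀ := ⟨by
      rw [← (Submodule.map_injective_of_injective (Submodule.injective_subtype _)).eq_iff,
        Submodule.map_span, Submodule.map_top, Submodule.range_subtype, h_img]
      rfl⟩
    have : Module.Finite ℤ L₀ := ZLattice.module_finite ℝ L₀
    have : Module.Free ℤ L₀ := ZLattice.module_free ℝ L₀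
    set b := Module.Free.chooseBasis ℤ L₀
    set B := b.ofZLatticeBasis ℝ L₀ with hB
    obtain ⟨i, hi⟩ : ∃ i, ¬ ∃ n : ℤ, B.coord i ⟨z, hzR⟩ = n := by
      by_contra! h
      choose n hn using h
      have h1 : (⟨z, hzR⟩ : realSpan Γ) ∈ Submodule.span ℤ (Set.range B) := by
        rw [← B.sum_repr ⟨z, hzR⟩]
        refine Submodule.sum_mem _ fun i _ => ?_
        have : B.repr ⟨z, hzR⟩ i = n i := hn i
        rw [this, Int.cast_smul_eq_zsmul]
        exact Submodule.smul_mem _ _ (Submodule.subset_span ⟨i, rfl⟩)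
      rw [hB, b.ofZLatticeBasis_span ℝ] at h1
      exact hz h1
    obtain ⟨ℓ, hℓ⟩ := LinearMap.exists_extend (B.coord i)
    have hℓ' : ∀ x : realSpan Γ, ℓ x = B.coord i x := fun x => LinearMap.congr_fun hℓ x
    refine ⟨ℓ, fun γ hγ => ?_, fun ⟨n, hn⟩ => hi ⟨n, ?_⟩⟩
    · refine ⟨b.repr ⟨⟨γ, realSpan_mem hγ⟩, hγ⟩ i, ?_⟩
      have h2 := b.ofZLatticeBasis_repr_apply ℝ L₀ ⟨⟨γ, realSpan_mem hγ⟩, hγ⟩ i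
      exact (hℓ' ⟨γ, realSpan_mem hγ⟩).trans h2
    · rw [← hn]; exact (hℓ' ⟨z, hzR⟩).symm
  · obtain ⟨ℓ, h1, h2⟩ := Submodule.exists_le_ker_of_notMem hzR
    -- Outside Γ_ℝ a form can kill Γ and take the value 1/2 at z.
    refine ⟨(1 / (2 * ℓ z)) • ℓ, fun γ hγ => ⟨0, ?_⟩, ?_⟩
    · have : ℓ γ = 0 := h2 (realSpan_mem hγ)
      simp [this]
    · rintro ⟨n, hn⟩
      rw [LinearMap.smul_apply, smul_eq_mul] at hn
      have h3 : (2 * n : ℝ) = 1 := by rw [← hn]; field_simp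
      have h4 : (2 * n : ℤ) = 1 := by exact_mod_cast h3
      omega

/-- Stone–Weierstrass on K. The conclusion concerns K only, because E/Γ need not be compact. -/
theorem exists_mem_span_characters [DiscreteTopology Γ] {K : Set (E ⧸ Γ)} (hK : IsCompact K)
    (φ : C(E ⧸ Γ, ℂ)) {ε : ℝ} (hε : 0 < ε) :
    ∃ ψ ∈ Submodule.span ℂ (characters Γ), ∀ y ∈ K, ‖φ y - ψ y‖ < ε := by
  have : CompactSpace K := isCompact_iff_compactSpace.1 hK
  set r : C(E ⧸ Γ, ℂ) →ₗ[ℂ] C(K, ℂ) :=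
    { toFun := fun g => g.restrict K, map_add' := fun _ _ => rfl, map_smul' := fun _ _ => rfl } with hr
  set S : Set C(K, ℂ) := r '' characters Γ with hS
  set A : StarSubalgebra ℂ C(K, ℂ) :=
    { toSubalgebra := Algebra.adjoin ℂ S
      star_mem' := by
        change Algebra.adjoin ℂ S ≤ star (Algebra.adjoin ℂ S)
        refine Algebra.adjoin_le ?_
        rintro - ⟨χ, ⟨ℓ, hℓ, hχ⟩, rfl⟩
        have hneg : IsIntegral Γ (-ℓ) := fun γ hγ => by
          obtain ⟨n, hn⟩ := hℓ γ hγ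
          exact ⟨-n, by simp [hn]⟩
        obtain ⟨χ', hχ'⟩ := hneg.exists_character
        refine Algebra.subset_adjoin ⟨χ', ⟨-ℓ, hneg, hχ'⟩, ?_⟩
        ext ⟨y, hy⟩
        induction y using QuotientAddGroup.induction_on with
        | H e =>
          change χ' e = star (χ e)
          rw [hχ', hχ, Complex.star_def, ← Complex.exp_conj]
          congr 1
          rw [map_mul, Complex.conj_I, Complex.conj_ofReal, LinearMap.neg_apply]
          push_cast; ring } with hA
  -- Products of characters are characters, so the algebra they generate is already their linear
  -- span.
  have hspan : Subalgebra.toSubmodule A.toSubalgebra = Submodule.span ℂ S := by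
    apply Algebra.adjoin_eq_span_of_subset
    refine Set.Subset.trans ?_ Submodule.subset_span
    intro x hx
    refine Submonoid.closure_induction (fun _ => id) ?_ ?_ hx
    · have h0 : IsIntegral Γ (0 : E →ₗ[ℝ] ℝ) := fun γ _ => ⟨0, by simp⟩
      obtain ⟨χ', hχ'⟩ := h0.exists_character
      refine ⟨χ', ⟨0, h0, hχ'⟩, ?_⟩
      ext ⟨y, hy⟩
      induction y using QuotientAddGroup.induction_on with
      | H e =>
        change χ' e = 1
        rw [hχ']; simp
    · rintro - - - - ⟨χ₁, ⟨ℓ₁, h₁, hχ₁⟩, rfl⟩ ⟨χ₂, ⟨ℓ₂, h₂, hχ₂⟩, rfl⟩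
      have h0 : IsIntegral Γ (ℓ₁ + ℓ₂) := fun γ hγ => by
        obtain ⟨n₁, hn₁⟩ := h₁ γ hγ
        obtain ⟨n₂, hn₂⟩ := h₂ γ hγ
        exact ⟨n₁ + n₂, by simp [hn₁, hn₂]⟩
      obtain ⟨χ', hχ'⟩ := h0.exists_character
      refine ⟨χ', ⟨_, h0, hχ'⟩, ?_⟩
      ext ⟨y, hy⟩
      induction y using QuotientAddGroup.induction_on with
      | H e =>
        change χ' e = χ₁ e * χ₂ e
        rw [hχ', hχ₁, hχ₂, ← Complex.exp_add, LinearMap.add_apply]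
        congr 1; push_cast; ring
  have hsep : A.SeparatesPoints := by
    rintro ⟨x, hx⟩ ⟨y, hy⟩ hxy
    induction x using QuotientAddGroup.induction_on with
    | H a =>
    induction y using QuotientAddGroup.induction_on with
    | H b =>
      have hab : -a + b ∉ Γ := fun h => hxy (Subtype.ext (QuotientAddGroup.eq.2 h))
      obtain ⟨ℓ, hℓ, hn⟩ := exists_isIntegral_of_notMem hab
      obtain ⟨χ, hχ⟩ := hℓ.exists_character
      refine ⟨_, ⟨r χ, Algebra.subset_adjoin ⟨χ, ⟨ℓ, hℓ, hχ⟩, rfl⟩, rfl⟩, ?_⟩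
      change χ a ≠ χ b
      rw [hχ, hχ]
      intro h
      obtain ⟨n, hn'⟩ := Complex.exp_eq_exp_iff_exists_int.1 h
      refine hn ⟨-n, ?_⟩
      have h2 : ((2 * Real.pi * ℓ a : ℝ) : ℂ) = ((2 * Real.pi * ℓ b + n * (2 * Real.pi) : ℝ) : ℂ) := by
        apply mul_left_cancel₀ Complex.I_ne_zero
        rw [hn']; push_cast; ring
      have h3 : 2 * Real.pi * ℓ a = 2 * Real.pi * ℓ b + n * (2 * Real.pi) := by exact_mod_cast h2
      have h4 : 2 * Real.pi * (ℓ a - ℓ b - n) = 0 := by linarith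
      have h5 := (mul_eq_zero.1 h4).resolve_left Real.two_pi_pos.ne'
      rw [map_add, map_neg]; push_cast; linarith
  have htop := ContinuousMap.starSubalgebra_topologicalClosure_eq_top_of_separatesPoints A hsep
  have hmem : r φ ∈ closure (A : Set C(K, ℂ)) := by
    have : r φ ∈ A.topologicalClosure := by rw [htop]; trivial
    exact this
  obtain ⟨g, hg, hdist⟩ := Metric.mem_closure_iff.1 hmem ε hε
  have hg' : g ∈ Submodule.span ℂ S := by rw [← hspan]; exact hg
  rw [hS, ← Submodule.map_span] at hg'
  obtain ⟨ψ, hψ, rfl⟩ := hg'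
  refine ⟨ψ, hψ, fun y hy => ?_⟩
  have := (ContinuousMap.dist_lt_iff hε).1 hdist ⟨y, hy⟩
  rwa [dist_eq_norm] at this

/-- Take integer parts of the coefficients with respect to finitely many elements of Γ spanning Γ_ℝ;
the sum of their norms is the bound. -/
theorem exists_bound_sub_mem (Γ : AddSubgroup E) :
    ∃ R : ℝ, ∀ g ∈ realSpan Γ, ∃ γ ∈ Γ, ‖g - γ‖ ≤ R := by
  obtain ⟨s, hs, hspan⟩ := (Submodule.fg_span_iff_fg_span_finset_subset (R := ℝ) (Γ : Set E)).1
    (IsNoetherian.noetherian _)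
  refine ⟨∑ a ∈ s, ‖a‖, fun g hg => ?_⟩
  rw [realSpan, hspan, Submodule.mem_span_finset'] at hg
  obtain ⟨c, rfl⟩ := hg
  refine ⟨∑ a : s, ⌊c a⌋ • (a : E), AddSubgroup.sum_mem _ fun a _ =>
    AddSubgroup.zsmul_mem _ (hs a.2) _, ?_⟩
  rw [← Finset.sum_sub_distrib, ← Finset.sum_coe_sort s]
  refine norm_sum_le_of_le _ fun a _ => ?_
  rw [← Int.cast_smul_eq_zsmul ℝ, ← sub_smul, norm_smul, Int.self_sub_floor,
    Real.norm_of_nonneg (Int.fract_nonneg _)]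
  exact mul_le_of_le_one_left (norm_nonneg _) (Int.fract_lt_one _).le

/-- Modulo Γ the component along Γ_ℝ can be kept bounded, and the transverse component is bounded by
assumption. -/
theorem isCompact_tube {P : E →ₗ[ℝ] E} (hP : ∀ a ∈ realSpan Γ, P a = 0)
    (hP' : ∀ e, e - P e ∈ realSpan Γ) (R : ℝ) :
    IsCompact ((fun e : E => (e : E ⧸ Γ)) '' {e | ‖P e‖ ≤ R}) := by
  have hPc : Continuous P := P.continuous_of_finiteDimensional
  have : ProperSpace E := FiniteDimensional.proper ℂ E
  have hc : Continuous (fun e : E => (e : E ⧸ Γ)) := continuous_quot_mk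
  obtain ⟨R₀, hR₀⟩ := exists_bound_sub_mem Γ
  obtain ⟨F, hF, hFe⟩ := exists_continuous_desc Γ (F := fun e => ‖P e‖) hPc.norm
    (fun e γ hγ => by rw [map_add, hP γ (realSpan_mem hγ), add_zero])
  -- The tube is unbounded in E, but its image is the closed part of the image of a single ball
  -- where the descended norm of P is at most R.
  have hset : (fun e : E => (e : E ⧸ Γ)) '' {e | ‖P e‖ ≤ R} =
      ((fun e : E => (e : E ⧸ Γ)) '' Metric.closedBall 0 (R₀ + R)) ∩ {y | F y ≤ R} := by
    ext y
    constructor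
    · rintro ⟨e, he, rfl⟩
      refine ⟨?_, by simpa [hFe] using he⟩
      obtain ⟨γ, hγ, hb⟩ := hR₀ _ (hP' e)
      refine ⟨e - γ, ?_, ?_⟩
      · rw [mem_closedBall_zero_iff]
        have : e - γ = (e - P e - γ) + P e := by abel
        rw [this]
        exact (norm_add_le _ _).trans (add_le_add hb he)
      · rw [QuotientAddGroup.eq]
        simpa using hγ
    · rintro ⟨⟨e, -, rfl⟩, he⟩
      exact ⟨e, by simpa [hFe] using he, rfl⟩
  rw [hset]
  exact ((isCompact_closedBall _ _).image hc).inter_right (isClosed_le hF continuous_const)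

theorem isCompact_image_realSpan (Γ : AddSubgroup E) :
    IsCompact ((fun e : E => (e : E ⧸ Γ)) '' (realSpan Γ : Set E)) := by
  obtain ⟨P, hP, hP'⟩ := IsFlowSetup.exists_projection (realSpan Γ)
  have := isCompact_tube hP hP' 0
  convert this using 2
  ext e
  simp only [SetLike.mem_coe, Set.mem_ofPred_eq, norm_le_zero_iff]
  exact ⟨hP e, fun h => by simpa [h] using hP' e⟩

end torus

/-! ### Closed subgroups of `E ⧸ Γ` and their Haar measures. -/

/-- A nonnegative test function which does not vanish on `S` has positive integral. -/
theorem IsHaarMeasureOf.integral_pos {T : Type*} [AddCommGroup T] [TopologicalSpace T]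
    [IsTopologicalAddGroup T] [T2Space T] [MeasurableSpace T] [BorelSpace T] {S : Set T}
    {μ : Measure T} (h : IsHaarMeasureOf S μ) {φ : T → ℝ} (hφ : Continuous φ)
    (hc : HasCompactSupport φ) (h0 : ∀ y, 0 ≤ φ y) {y : T} (hy : y ∈ S) (hφy : φ y ≠ 0) :
    0 < ∫ y, φ y ∂μ := by
  obtain ⟨G, t, ν, hG, rfl, hν, rfl⟩ := h
  obtain ⟨g, hg, rfl⟩ := hy
  have hcont : Continuous (fun g : G => t + (g : T)) := by fun_prop
  rw [integral_map hcont.measurable.aemeasurable hφ.aestronglyMeasurable]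
  have he : IsClosedEmbedding (fun g : G => t + (g : T)) :=
    (Homeomorph.addLeft t).isClosedEmbedding.comp hG.isClosedEmbedding_subtypeVal
  refine Continuous.integral_pos_of_hasCompactSupport_nonneg_nonzero (x := ⟨g, hg⟩)
    (hφ.comp hcont) (hc.comp_isClosedEmbedding he) (fun g => h0 _) hφy

section torus
variable {E : Type*} [NormedAddCommGroup E] [InnerProductSpace ℂ E]

/-- The closure of the image of a real subspace in the quotient. -/
noncomputable def torusClosure (Γ : AddSubgroup E) (W : Submodule ℝ E) : AddSubgroup (E ⧸ Γ) :=
  (W.toAddSubgroup.map (QuotientAddGroup.mk' Γ)).topologicalClosure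

theorem coe_torusClosure (Γ : AddSubgroup E) (W : Submodule ℝ E) :
    (torusClosure Γ W : Set (E ⧸ Γ)) = closure ((fun e : E => (e : E ⧸ Γ)) '' W) := rfl

theorem isClosed_torusClosure (Γ : AddSubgroup E) (W : Submodule ℝ E) :
    IsClosed (torusClosure Γ W : Set (E ⧸ Γ)) := isClosed_closure

theorem mk_mem_torusClosure (Γ : AddSubgroup E) {W : Submodule ℝ E} {a : E} (ha : a ∈ W) :
    (a : E ⧸ Γ) ∈ torusClosure Γ W := subset_closure ⟨a, ha, rfl⟩

theorem torusClosure_mono (Γ : AddSubgroup E) {W W' : Submodule ℝ E} (h : W ≤ W') :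
    torusClosure Γ W ≤ torusClosure Γ W' :=
  closure_mono (Set.image_mono h)

theorem closure_image_affine (Γ : AddSubgroup E) (W : Submodule ℝ E) (t : E) :
    closure ((fun e : E => (e : E ⧸ Γ)) '' (AffineSubspace.mk' t W : Set E)) =
      (fun g => (t : E ⧸ Γ) + g) '' (torusClosure Γ W : Set (E ⧸ Γ)) := by
  have h1 : (fun g => (t : E ⧸ Γ) + g) '' (torusClosure Γ W : Set (E ⧸ Γ)) =
      closure ((fun g => (t : E ⧸ Γ) + g) '' ((fun e : E => (e : E ⧸ Γ)) '' W)) := by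
    rw [coe_torusClosure]
    exact (Homeomorph.addLeft (t : E ⧸ Γ)).image_closure _
  rw [h1, Set.image_image]
  congr 1
  ext y
  constructor
  · rintro ⟨e, he, rfl⟩
    rw [SetLike.mem_coe, AffineSubspace.mem_mk', vsub_eq_sub] at he
    exact ⟨e - t, he, by beta_reduce; rw [← QuotientAddGroup.mk_add, add_sub_cancel]⟩
  · rintro ⟨e, he, rfl⟩
    refine ⟨t + e, ?_, rfl⟩
    rw [SetLike.mem_coe, AffineSubspace.mem_mk', vsub_eq_sub, add_sub_cancel_left]
    exact he

theorem isConnected_torusClosure (Γ : AddSubgroup E) (W : Submodule ℝ E) :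
    IsConnected (torusClosure Γ W : Set (E ⧸ Γ)) := by
  have hc : Continuous (fun e : E => (e : E ⧸ Γ)) := continuous_quot_mk
  rw [coe_torusClosure]
  exact ⟨⟨_, subset_closure ⟨0, W.zero_mem, rfl⟩⟩,
    (W.convex.isPreconnected.image _ hc.continuousOn).closure⟩

variable [FiniteDimensional ℂ E] {Γ : AddSubgroup E} [DiscreteTopology Γ]

theorem isCompact_torusClosure {W : Submodule ℝ E} (hW : W ≤ realSpan Γ) :
    IsCompact (torusClosure Γ W : Set (E ⧸ Γ)) :=
  (isCompact_image_realSpan Γ).of_isClosed_subset (isClosed_torusClosure Γ W)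
    (closure_minimal (Set.image_mono hW) (isCompact_image_realSpan Γ).isClosed)

open scoped Pointwise in
/-- Adding a direction transverse to `Γ_ℝ`. -/
theorem torusClosure_sup {W : Submodule ℝ E} (hW : W ≤ realSpan Γ) {w : E} {h : E →ₗ[ℝ] ℝ}
    (hh : ∀ z ∈ realSpan Γ, h z = 0) (hw : h w ≠ 0) :
    (torusClosure Γ (Submodule.span ℝ {w} ⊔ W) : Set (E ⧸ Γ)) =
      {y | ∃ g ∈ torusClosure Γ W, ∃ τ : ℝ, g + ((τ • w : E) : E ⧸ Γ) = y} := by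
  have hc : Continuous (fun e : E => (e : E ⧸ Γ)) := continuous_quot_mk
  obtain ⟨F, hF, hFe⟩ := exists_continuous_desc_linear h hh
  have hline : IsClosed (Set.range fun τ : ℝ => ((τ • w : E) : E ⧸ Γ)) := by
    -- The transverse line is the fixed set of the continuous map y ↦ (F(y)/h(w)) w, hence closed.
    -- Adding a compact subgroup keeps it closed.
    have : (Set.range fun τ : ℝ => ((τ • w : E) : E ⧸ Γ)) =
        {y | (((F y / h w) • w : E) : E ⧸ Γ) = y} := by
      ext y
      constructor
      · rintro ⟨τ, rfl⟩
        change (((F ((τ • w : E) : E ⧸ Γ) / h w) • w : E) : E ⧸ Γ) = _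
        rw [hFe, map_smul, smul_eq_mul, mul_div_cancel_right₀ _ hw]
      · intro hy; exact ⟨_, hy⟩
    rw [this]
    exact isClosed_eq (hc.comp ((hF.div_const _).smul continuous_const)) continuous_id
  have hsum := hline.add_left_of_isCompact (isCompact_torusClosure hW)
  have heq : {y | ∃ g ∈ torusClosure Γ W, ∃ τ : ℝ, g + ((τ • w : E) : E ⧸ Γ) = y} =
      (torusClosure Γ W : Set (E ⧸ Γ)) + Set.range fun τ : ℝ => ((τ • w : E) : E ⧸ Γ) := by
    ext y
    simp [Set.mem_add]
  apply Set.Subset.antisymm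
  · rw [heq, coe_torusClosure]
    refine closure_minimal ?_ hsum
    rintro _ ⟨e, he, rfl⟩
    obtain ⟨a, ha, b, hb, rfl⟩ := Submodule.mem_sup.1 he
    obtain ⟨τ, rfl⟩ := Submodule.mem_span_singleton.1 ha
    refine ⟨(b : E ⧸ Γ), mk_mem_torusClosure Γ hb, _, ⟨τ, rfl⟩, ?_⟩
    beta_reduce
    rw [← QuotientAddGroup.mk_add, add_comm]
  · rintro _ ⟨g, hg, τ, rfl⟩
    exact AddSubgroup.add_mem _ (torusClosure_mono Γ le_sup_right hg)
      (mk_mem_torusClosure Γ ((le_sup_left : _ ≤ Submodule.span ℝ {w} ⊔ W)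
        (Submodule.smul_mem _ _ (Submodule.mem_span_singleton_self w))))

variable [MeasurableSpace E] [BorelSpace E]

/-- The closed subgroup attached to ℝw + W is the image of the compact group of W times ℝ under a
continuous surjective proper homomorphism. Such a homomorphism carries the product Haar measure to a
Haar measure. -/
theorem exists_haar_translate {W : Submodule ℝ E} (hW : W ≤ realSpan Γ) {w : E} {h : E →ₗ[ℝ] ℝ}
    (hh : ∀ z ∈ realSpan Γ, h z = 0) (hw : h w ≠ 0)
    (ν₀ : Measure (torusClosure Γ W)) [ν₀.IsAddHaarMeasure] [IsFiniteMeasure ν₀]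
    {c : ℝ} (hc : 0 < c) (t : E) :
    ∃ μ : Measure (E ⧸ Γ),
      IsHaarMeasureOf (closure ((fun e : E => (e : E ⧸ Γ)) ''
        (AffineSubspace.mk' t (Submodule.span ℝ {w} ⊔ W) : Set E))) μ ∧
      ∀ φ : E ⧸ Γ → ℝ, Continuous φ → HasCompactSupport φ →
        ∫ y, φ y ∂μ = c * ∫ τ : ℝ, ∫ g, φ (t + g + ((τ • w : E) : E ⧸ Γ)) ∂ν₀ := by
  have hmk : Continuous (fun e : E => (e : E ⧸ Γ)) := continuous_quot_mk
  have : PolishSpace E := by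
    have := FiniteDimensional.complete ℂ E
    have : ProperSpace E := FiniteDimensional.proper ℂ E
    infer_instance
  have hcpt : CompactSpace (torusClosure Γ W) :=
    isCompact_iff_compactSpace.1 (isCompact_torusClosure hW)
  obtain ⟨F, hF, hFe⟩ := exists_continuous_desc_linear h hh
  have hFadd : ∀ y y' : E ⧸ Γ, F (y + y') = F y + F y' := by
    intro y y'
    induction y using QuotientAddGroup.induction_on with
    | H a =>
    induction y' using QuotientAddGroup.induction_on with
    | H b => rw [← QuotientAddGroup.mk_add, hFe, hFe, hFe, map_add]
  have hFW : ∀ g ∈ torusClosure Γ W, F g = 0 := by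
    have : (torusClosure Γ W : Set (E ⧸ Γ)) ⊆ {y | F y = 0} := by
      rw [coe_torusClosure]
      refine closure_minimal ?_ (isClosed_eq hF continuous_const)
      rintro _ ⟨e, he, rfl⟩
      exact (hFe e).trans (hh e (hW he))
    exact fun g hg => this hg
  set G := torusClosure Γ (Submodule.span ℝ {w} ⊔ W) with hG
  have hmem : ∀ x : torusClosure Γ W × ℝ, (x.1 : E ⧸ Γ) + ((x.2 • w : E) : E ⧸ Γ) ∈ G := by
    intro x
    have : (x.1 : E ⧸ Γ) + ((x.2 • w : E) : E ⧸ Γ) ∈ (G : Set (E ⧸ Γ)) := by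
      rw [hG, torusClosure_sup hW hh hw]
      exact ⟨x.1, x.1.2, x.2, rfl⟩
    exact this
  set Ψ : torusClosure Γ W × ℝ →+ G :=
    { toFun := fun x => ⟨(x.1 : E ⧸ Γ) + ((x.2 • w : E) : E ⧸ Γ), hmem x⟩
      map_zero' := by
        apply Subtype.ext
        simp
      map_add' := fun x y => by
        apply Subtype.ext
        simp only [Prod.fst_add, Prod.snd_add, add_smul, QuotientAddGroup.mk_add, AddSubgroup.coe_add]
        abel } with hΨ
  have hΨv : ∀ x, (Ψ x : E ⧸ Γ) = (x.1 : E ⧸ Γ) + ((x.2 • w : E) : E ⧸ Γ) := fun x => rfl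
  have hΨc : Continuous Ψ := by
    refine Continuous.subtype_mk ?_ _
    exact (continuous_subtype_val.comp continuous_fst).add
      (hmk.comp (continuous_snd.smul continuous_const))
  have hΨs : Function.Surjective Ψ := by
    rintro ⟨y, hy⟩
    have hy' : y ∈ (G : Set (E ⧸ Γ)) := hy
    rw [hG, torusClosure_sup hW hh hw] at hy'
    obtain ⟨g, hg, τ, rfl⟩ := hy'
    exact ⟨(⟨g, hg⟩, τ), rfl⟩
  have hΨF : ∀ x, F (Ψ x : E ⧸ Γ) = x.2 * h w := fun x => by
    rw [hΨv, hFadd, hFW _ x.1.2, hFe, map_smul, zero_add, smul_eq_mul]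
  -- The descended form F recovers the real parameter from the image, and the other factor is
  -- compact; this gives properness.
  have hΨp : Tendsto Ψ (cocompact _) (cocompact _) := by
    rw [hasBasis_cocompact.tendsto_right_iff]
    intro K hK
    have hK1 : IsCompact ((fun y : G => F (y : E ⧸ Γ) / h w) '' K) :=
      hK.image ((hF.comp continuous_subtype_val).div_const _)
    rw [Filter.Eventually, Filter.mem_cocompact]
    refine ⟨Set.univ ×ˢ ((fun y : G => F (y : E ⧸ Γ) / h w) '' K), isCompact_univ.prod hK1, ?_⟩
    intro x hx hxK
    refine hx ⟨Set.mem_univ _, Ψ x, hxK, ?_⟩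
    beta_reduce
    rw [hΨF, mul_div_cancel_right₀ _ hw]
  set ν := (ν₀.prod (volume : Measure ℝ)).map Ψ with hν
  have hνH : ν.IsAddHaarMeasure := Measure.isAddHaarMeasure_map _ Ψ hΨc hΨs hΨp
  have hν' : (ENNReal.ofReal c • ν).IsAddHaarMeasure :=
    Measure.IsAddHaarMeasure.smul ν (by simpa using hc) ENNReal.ofReal_ne_top
  have htc : Continuous (fun g : G => (t : E ⧸ Γ) + (g : E ⧸ Γ)) := by fun_prop
  refine ⟨(ENNReal.ofReal c • ν).map (fun g : G => (t : E ⧸ Γ) + g),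
    ⟨G, t, ENNReal.ofReal c • ν, isClosed_torusClosure _ _, closure_image_affine Γ _ t, hν', rfl⟩, ?_⟩
  intro φ hφ hφc
  rw [integral_map htc.measurable.aemeasurable hφ.aestronglyMeasurable, integral_smul_measure,
    ENNReal.toReal_ofReal hc.le, smul_eq_mul, hν,
    integral_map (f := fun x : G => φ ((t : E ⧸ Γ) + x)) hΨc.measurable.aemeasurable
      (hφ.comp htc).aestronglyMeasurable]
  congr 1
  have hcont : Continuous fun x : torusClosure Γ W × ℝ => φ ((t : E ⧸ Γ) + (Ψ x : E ⧸ Γ)) :=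
    hφ.comp (htc.comp hΨc)
  have hsupp : HasCompactSupport fun x : torusClosure Γ W × ℝ => φ ((t : E ⧸ Γ) + (Ψ x : E ⧸ Γ)) := by
    have he : IsClosedEmbedding (fun g : G => (t : E ⧸ Γ) + (g : E ⧸ Γ)) :=
      (Homeomorph.addLeft (t : E ⧸ Γ)).isClosedEmbedding.comp
        (isClosed_torusClosure _ _).isClosedEmbedding_subtypeVal
    have h1 := hφc.comp_isClosedEmbedding he
    rw [hasCompactSupport_iff_eventuallyEq] at h1 ⊢
    rw [coclosedCompact_eq_cocompact] at h1 ⊢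
    exact hΨp.eventually h1
  rw [integral_prod_symm _ (hcont.integrable_of_hasCompactSupport hsupp)]
  refine integral_congr_ae (Eventually.of_forall fun τ => ?_)
  refine integral_congr_ae (Eventually.of_forall fun g => ?_)
  simp only [hΨv, add_assoc]

end torus

/-! ### Double integrals computed along one family of fibres. -/

section products
variable {μ₁ μ₂ : Measure ℝ} [IsFiniteMeasure μ₂] {g : ℝ → ℝ × ℝ → ℂ}
  {w : ℝ → ℝ}

theorem integrable_mul_weight (hw : Integrable w μ₁) {u : ℝ × ℝ → ℂ} {b : ℝ}
    (hm : AEStronglyMeasurable u (μ₁.prod μ₂)) (hb : ∀ x, ‖u x‖ ≤ b) :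
    Integrable (fun x => u x * (w x.1 : ℂ)) (μ₁.prod μ₂) := by
  have h1 : Integrable (fun x : ℝ × ℝ => ((w x.1 : ℝ) : ℂ)) (μ₁.prod μ₂) := (hw.comp_fst μ₂).ofReal
  exact h1.bdd_mul hm (Eventually.of_forall hb)

/-- For oscillation along the strip: Fubini with S inside, then dominated convergence in τ. -/
theorem tendsto_integral_prod_of_fibers_snd [IsFiniteMeasure μ₁] (hw : Integrable w μ₁)
    (hm : ∀ᶠ N in atTop, AEStronglyMeasurable (g N) (μ₁.prod μ₂)) (hb : ∀ N x, ‖g N x‖ ≤ 1)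
    {c : ℝ → ℂ}
    (h : ∀ᵐ τ ∂μ₂, Tendsto (fun N => ∫ S, g N (S, τ) * w S ∂μ₁) atTop (𝓝 (c τ))) :
    Tendsto (fun N => ∫ x, g N x * w x.1 ∂(μ₁.prod μ₂)) atTop (𝓝 (∫ τ, c τ ∂μ₂)) := by
  have h1 : Tendsto (fun N => ∫ τ, ∫ S, g N (S, τ) * w S ∂μ₁ ∂μ₂) atTop (𝓝 (∫ τ, c τ ∂μ₂)) := by
    refine tendsto_integral_filter_of_dominated_convergence (fun _ => ∫ S, ‖w S‖ ∂μ₁) ?_ ?_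
      (integrable_const _) h
    · filter_upwards [hm] with N hN
      exact (integrable_mul_weight hw hN (hb N)).aestronglyMeasurable.prod_swap.integral_prod_right'
    · refine Eventually.of_forall fun N => Eventually.of_forall fun τ => ?_
      refine norm_integral_le_of_norm_le hw.norm (Eventually.of_forall fun S => ?_)
      rw [norm_mul, Complex.norm_real]
      exact mul_le_of_le_one_left (norm_nonneg _) (hb N _)
  refine h1.congr' ?_
  filter_upwards [hm] with N hN
  rw [integral_prod_symm _ (integrable_mul_weight hw hN (hb N))]

/-- For oscillation or convergence across the strip. The weight depends on S alone, so it leaves the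
inner integral, which carries no weight. -/
theorem tendsto_integral_prod_of_fibers_fst [IsFiniteMeasure μ₁] (hw : Integrable w μ₁)
    (hm : ∀ᶠ N in atTop, AEStronglyMeasurable (g N) (μ₁.prod μ₂)) (hb : ∀ N x, ‖g N x‖ ≤ 1)
    {c : ℂ}
    (h : ∀ᵐ S ∂μ₁, Tendsto (fun N => ∫ τ, g N (S, τ) ∂μ₂) atTop (𝓝 c)) :
    Tendsto (fun N => ∫ x, g N x * w x.1 ∂(μ₁.prod μ₂)) atTop
      (𝓝 (c * ((∫ S, w S ∂μ₁ : ℝ) : ℂ))) := by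
  have h1 : Tendsto (fun N => ∫ S, (∫ τ, g N (S, τ) ∂μ₂) * w S ∂μ₁) atTop
      (𝓝 (∫ S, c * w S ∂μ₁)) := by
    refine tendsto_integral_filter_of_dominated_convergence (fun S => μ₂.real Set.univ * ‖w S‖) ?_ ?_
      (hw.norm.const_mul _) ?_
    · filter_upwards [hm] with N hN
      exact hN.integral_prod_right'.mul hw.ofReal.aestronglyMeasurable
    · refine Eventually.of_forall fun N => Eventually.of_forall fun S => ?_
      rw [norm_mul, Complex.norm_real]
      gcongr
      have := norm_integral_le_of_norm_le_const (μ := μ₂) (f := fun τ => g N (S, τ)) (C := 1)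
        (Eventually.of_forall fun τ => hb N _)
      simpa using this
    · filter_upwards [h] with S hS
      exact hS.mul_const _
  rw [integral_const_mul, integral_complex_ofReal] at h1
  refine h1.congr' ?_
  filter_upwards [hm] with N hN
  rw [integral_prod _ (integrable_mul_weight hw hN (hb N))]
  simp only [integral_mul_const]

end products

/-! ### Integrals of characters over long strips. -/

theorem eventually_forall_strip {M : ℝ} {P : ℂ → Prop} (hP : ∀ᶠ z in stripFilter M, P z) {α : ℝ}
    (hα : 0 < α) : ∀ᶠ N : ℝ in atTop, ∀ S, α ≤ S → ∀ τ, |τ| ≤ M → P ⟨N * S, τ⟩ := by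
  obtain ⟨R, hR⟩ := eventually_stripFilter_iff.1 hP
  filter_upwards [eventually_ge_atTop (R / α), eventually_ge_atTop 0] with N hN hN0 S hS τ hτ
  refine hR _ ?_ hτ
  change R ≤ N * S
  rw [div_le_iff₀ hα] at hN
  exact hN.trans (mul_le_mul_of_nonneg_left hS hN0)

theorem tendsto_strip {M S τ : ℝ} (hS : 0 < S) (hτ : |τ| ≤ M) :
    Tendsto (fun N : ℝ => (⟨N * S, τ⟩ : ℂ)) atTop (stripFilter M) := by
  rw [tendsto_stripFilter_iff]
  exact ⟨tendsto_id.atTop_mul_const hS, Eventually.of_forall fun _ => hτ⟩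

theorem norm_cexp_I_mul (x : ℝ) : ‖Complex.exp (Complex.I * (x : ℂ))‖ = 1 := by
  rw [mul_comm]; exact Complex.norm_exp_ofReal_mul_I x

namespace IsFlowSetup
variable {E : Type*} [NormedAddCommGroup E] [InnerProductSpace ℂ E] [FiniteDimensional ℂ E]
  {Γ : AddSubgroup E} {f : ℂ → E} {k : ℕ} {d : ℕ → ℕ} {v : ℕ → E} {κ : ℕ}
  {lam : ℂ} {H : E →ₗ[ℂ] ℂ} {ξ : ℂ → ℂ} {p m : ℕ} {δ : ℕ → ℕ} {ϑ : ℕ → E} {η : ℂ → ℂ}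

theorem eventually_continuousAt_stripMap (S : IsFlowSetup Γ f k d v κ lam H ξ)
    (hη : IsRayParam ξ lam (d κ) p η) (M : ℝ) :
    ∀ᶠ z in stripFilter M, ContinuousAt (fun z => f (stripMap η (d κ) z)) z := by
  filter_upwards [(tendsto_stripRoot S.pole_ne_zero M).eventually
    (hη.differentiableAt_comp S.coord.map_zero S.diff), eventually_re_pos_stripFilter M] with z h1 h2
  exact ContinuousAt.comp (f := stripRoot (d κ)) (g := fun y => f (η y)) h1.continuousAt
    (hasDerivAt_stripRoot _ S.pole_ne_zero (Or.inl h2)).continuousAt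

theorem eventually_aestronglyMeasurable (S : IsFlowSetup Γ f k d v κ lam H ξ)
    (hη : IsRayParam ξ lam (d κ) p η) {α : ℝ} (hα : 0 < α) (β M : ℝ) {X : Type*}
    [TopologicalSpace X] [TopologicalSpace.PseudoMetrizableSpace X] {Φ : E → X}
    (hΦ : Continuous Φ) [SecondCountableTopology X]:
    ∀ᶠ N : ℝ in atTop, AEStronglyMeasurable
      (fun x : ℝ × ℝ => Φ (f (stripMap η (d κ) ⟨N * x.1, x.2⟩)))
      ((volume.restrict (Set.Ioc α β)).prod (volume.restrict (Set.Ioc (-M) M))) := by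
  filter_upwards [eventually_forall_strip (S.eventually_continuousAt_stripMap hη M) hα] with N hN
  rw [Measure.prod_restrict]
  refine ContinuousOn.aestronglyMeasurable ?_ (measurableSet_Ioc.prod measurableSet_Ioc)
  rintro ⟨S, τ⟩ ⟨hS, hτ⟩
  refine ContinuousAt.continuousWithinAt ?_
  have h := hN S hS.1.le τ (abs_le.2 ⟨hτ.1.le, hτ.2⟩)
  have h1 : Continuous fun x : ℝ × ℝ => (⟨N * x.1, x.2⟩ : ℂ) := by
      simp only [Complex.mk_eq_add_mul_I]; fun_prop
  have h2 : ContinuousAt (fun x : ℝ × ℝ => f (stripMap η (d κ) ⟨N * x.1, x.2⟩)) (S, τ) :=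
    ContinuousAt.comp (g := fun z => f (stripMap η (d κ) z))
      (f := fun x : ℝ × ℝ => (⟨N * x.1, x.2⟩ : ℂ)) h h1.continuousAt
  exact hΦ.continuousAt.comp h2

variable {α β M : ℝ} {w : ℝ → ℝ} (ℓ : E →ₗ[ℝ] ℝ)

/-- A linear form which is not constant on the leading complex directions oscillates. -/
theorem tendsto_integral_phase_of_flag (S : IsFlowSetup Γ f k d v κ lam H ξ)
    (hη : IsRayParam ξ lam (d κ) p η) (hℓ : ∃ a ∈ flagSpace v (κ - 1), ℓ a ≠ 0)
    (hα : 0 < α) (hαβ : α ≤ β) (hM : 0 ≤ M) (hw : IntegrableOn w (Set.Ioc α β)) :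
    Tendsto (fun N : ℝ => ∫ x : ℝ × ℝ, Complex.exp (Complex.I *
      ((2 * Real.pi * ℓ (f (stripMap η (d κ) ⟨N * x.1, x.2⟩)) : ℝ) : ℂ)) * w x.1
      ∂((volume.restrict (Set.Ioc α β)).prod (volume.restrict (Set.Ioc (-M) M)))) atTop (𝓝 0) := by
  set L : E →ₗ[ℂ] ℂ := Module.Dual.extendRCLike (𝕜 := ℂ) ℓ with hL
  have hre : ∀ x, (L x).re = ℓ x := fun x => Module.Dual.re_extendRCLike_apply (𝕜 := ℂ) ℓ x
  obtain ⟨a, ha, ha0⟩ := hℓ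
  obtain ⟨j, hj1, hj2, hj, hji⟩ := exists_first_ne_zero L
    ⟨a, ha, fun h => ha0 (by rw [← hre, h]; rfl)⟩
  have hκ := S.one_le
  have hκk := S.le_k
  obtain ⟨A, hA, hA0, hLA⟩ := S.exists_laurent hη L (S.flag.tendsto L hj1 (by omega) hji)
  have hdj : d κ < d j := S.flag.lt_of_lt hj1 (by omega) (by omega)
  have hq := S.pole_ne_zero
  have hs : (-(d j : ℤ)) + d κ < 0 := by omega
  have hA0' : A 0 ≠ 0 := by
    rw [hA0]
    exact smul_ne_zero (pow_ne_zero _ (div_ne_zero S.lam_ne_zero (rayUnit_ne_zero _ _))) hj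
  have hm := S.eventually_aestronglyMeasurable hη hα β M
    (Φ := fun e => Complex.exp (Complex.I * ((2 * Real.pi * ℓ e : ℝ) : ℂ)))
    (by have : Continuous ℓ := ℓ.continuous_of_finiteDimensional
        fun_prop)
  have hrepr := eventually_forall_strip ((tendsto_stripRoot hq M).eventually hLA) hα
  have hval : ∀ᶠ N : ℝ in atTop, ∀ S, α ≤ S → ∀ τ, |τ| ≤ M →
      ℓ (f (stripMap η (d κ) ⟨N * S, τ⟩)) = (stripRoot (d κ) (⟨N * S, τ⟩ : ℂ) ^ (-(d j : ℤ)) *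
        A (stripRoot (d κ) (⟨N * S, τ⟩ : ℂ))).re := by
    filter_upwards [hrepr] with N hN S hS τ hτ
    rw [← hre, stripMap, hN S hS τ hτ, smul_eq_mul]
  -- The leading coefficient is nonzero. If its real part is nonzero the phase oscillates along the
  -- strip; otherwise its imaginary part makes it oscillate across, the pole order d_j being larger
  -- than d_κ.
  by_cases hR : (A 0).re = 0
  · have hI : (A 0).im ≠ 0 := fun h => hA0' (Complex.ext hR h)
    have h := tendsto_integral_prod_of_fibers_fst (g := fun N x => Complex.exp (Complex.I *
      ((2 * Real.pi * ℓ (f (stripMap η (d κ) ⟨N * x.1, x.2⟩)) : ℝ) : ℂ))) (c := 0) hw hm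
      (fun N x => (norm_cexp_I_mul _).le) ?_
    · simpa using h
    · refine (ae_restrict_iff' measurableSet_Ioc).2 (Eventually.of_forall fun s hs' => ?_)
      have hs0 : 0 < s := hα.trans hs'.1
      have := (tendsto_integral_phase_vertical hq hs hA hI hM).comp
        (tendsto_id.atTop_mul_const hs0)
      refine this.congr' ?_
      filter_upwards [hval] with N hN
      simp only [Function.comp, id]
      rw [intervalIntegral.integral_of_le (by linarith)]
      refine setIntegral_congr_fun measurableSet_Ioc fun τ hτ => ?_
      rw [hN s hs'.1.le τ (abs_le.2 ⟨hτ.1.le, hτ.2⟩)]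
  · have h := tendsto_integral_prod_of_fibers_snd (g := fun N x => Complex.exp (Complex.I *
      ((2 * Real.pi * ℓ (f (stripMap η (d κ) ⟨N * x.1, x.2⟩)) : ℝ) : ℂ))) (c := fun _ => 0) hw hm
      (fun N x => (norm_cexp_I_mul _).le) ?_
    · simpa using h
    · refine (ae_restrict_iff' measurableSet_Ioc).2 (Eventually.of_forall fun τ hτ => ?_)
      have := tendsto_integral_phase_horizontal hq (s := -(d j : ℤ)) (by omega) hA hR hα hαβ
        ((intervalIntegrable_iff_integrableOn_Ioc_of_le hαβ).2 hw) τ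
      refine this.congr' ?_
      filter_upwards [hval] with N hN
      rw [intervalIntegral.integral_of_le hαβ]
      refine setIntegral_congr_fun measurableSet_Ioc fun s hs' => ?_
      rw [hN s hs'.1.le τ (abs_le.2 ⟨hτ.1.le, hτ.2⟩)]

/-- Along the central radius, an unbounded linear form has a pole of order less than `d_κ`
in the variable `1 / re z`, up to a real factor. -/
theorem exists_real_laurent (S : IsFlowSetup Γ f k d v κ lam H ξ)
    (hη : IsRayParam ξ lam (d κ) p η) (hrad : IsRadialExpansion f d v κ lam ξ p m δ ϑ)
    (hℓ : ∀ a ∈ flagSpace v (κ - 1), ℓ a = 0) (hℓ' : ∃ a ∈ radialSpace v κ ϑ m, ℓ a ≠ 0) :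
    ∃ (s : ℤ) (B : ℂ → ℂ), s < 0 ∧ AnalyticAt ℂ B 0 ∧ (B 0).re ≠ 0 ∧
      ∀ᶠ z in stripFilter 0, ℓ (f (stripMap η (d κ) z)) =
        (stripRoot (d κ) z ^ s * B (stripRoot (d κ) z)).re := by
  set L : E →ₗ[ℂ] ℂ := Module.Dual.extendRCLike (𝕜 := ℂ) ℓ with hL
  have hre : ∀ x, (L x).re = ℓ x := fun x => Module.Dual.re_extendRCLike_apply (𝕜 := ℂ) ℓ x
  have hL0 : ∀ a ∈ flagSpace v (κ - 1), L a = 0 := by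
    intro a ha
    refine Complex.ext (by rw [hre, hℓ a ha]; rfl) ?_
    have h2 := hre (Complex.I • a)
    rw [hℓ _ (Submodule.smul_mem _ _ ha), map_smul, smul_eq_mul, Complex.I_mul_re] at h2
    simpa using h2
  obtain ⟨A, hA, -, hLA⟩ := S.exists_laurent_critical hη hrad L hL0
  have hq := S.pole_ne_zero
  have hAc : AnalyticAt ℂ (fun y => starRingEnd ℂ (A (starRingEnd ℂ y))) 0 := by
    rw [Complex.analyticAt_iff_eventually_differentiableAt]
    have h1 := hA.eventually_analyticAt
    have h2 : Tendsto (starRingEnd ℂ) (𝓝 0) (𝓝 0) := by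
      have := Complex.continuous_conj.tendsto 0
      rwa [map_zero] at this
    filter_upwards [h2.eventually h1] with y hy
    have := hy.differentiableAt.hasDerivAt.conj_conj
    rw [Complex.conj_conj] at this
    exact this.differentiableAt
  -- Averaging A with its Schwarz reflection gives an analytic function equal to Re A on the real
  -- axis.
  set A' : ℂ → ℂ := fun y => (A y + starRingEnd ℂ (A (starRingEnd ℂ y))) / 2 with hA'
  have hA'a : AnalyticAt ℂ A' 0 := (hA.add hAc).div_const
  have hreal : ∀ r : ℝ, A' r = ((A r).re : ℂ) := by
    intro r
    simp only [hA', Complex.conj_ofReal]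
    rw [Complex.add_conj]; push_cast; ring
  have hroot : ∀ᶠ z in stripFilter 0, ∃ r : ℝ, 0 < r ∧ stripRoot (d κ) z = r := by
    filter_upwards [eventually_re_pos_stripFilter 0, eventually_im_stripFilter 0] with z h1 h2
    have : z = ((z.re : ℝ) : ℂ) := Complex.ext rfl (by simpa using h2)
    rw [this]
    exact ⟨_, Real.exp_pos _, stripRoot_eq_ofReal h1⟩
  have hval : ∀ᶠ z in stripFilter 0, ((ℓ (f (stripMap η (d κ) z)) : ℝ) : ℂ) =
      stripRoot (d κ) z ^ (-(d κ : ℤ)) * A' (stripRoot (d κ) z) := by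
    filter_upwards [hroot, (tendsto_stripRoot hq 0).eventually hLA] with z h1 h2
    obtain ⟨r, hr, h1⟩ := h1
    rw [← hre, stripMap, h2, h1, hreal, smul_eq_mul, ← Complex.ofReal_zpow, Complex.re_ofReal_mul]
    push_cast; rfl
  have hatTop := S.tendsto_abs_atTop hη hrad ℓ hℓ hℓ' 0
  have : (stripFilter 0).NeBot := (tendsto_strip (S := 1) (τ := 0) (M := 0) one_pos (by simp)).neBot
  have hroot0 := (tendsto_stripRoot hq 0).mono_right nhdsWithin_le_nhds
  -- The real part of A may vanish at 0 although A does not, so its order of vanishing must be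
  -- divided out to see the true pole.
  obtain hz | ⟨j, B, hB, hB0, hAB⟩ : (∀ᶠ y in 𝓝 (0 : ℂ), A' y = 0) ∨
      ∃ (j : ℕ) (B : ℂ → ℂ), AnalyticAt ℂ B 0 ∧ B 0 ≠ 0 ∧ ∀ᶠ y in 𝓝 (0 : ℂ), A' y = y ^ j * B y := by
    by_cases hz : ∀ᶠ y in 𝓝 (0 : ℂ), A' y = 0
    · exact Or.inl hz
    · right
      have hfin : analyticOrderAt A' 0 ≠ ⊤ := by rwa [Ne, analyticOrderAt_eq_top]
      obtain ⟨B, hB, hB0, h⟩ := hA'a.analyticOrderAt_ne_top.1 hfin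
      exact ⟨_, B, hB, hB0, h.mono fun y hy => by rw [hy]; beta_reduce; rw [sub_zero, smul_eq_mul]⟩
  · exfalso
    obtain ⟨z, h1, h2, h3⟩ := ((hatTop.eventually_gt_atTop 0).and
      (hval.and (hroot0.eventually hz))).exists
    rw [h3, mul_zero] at h2
    rw [Complex.ofReal_eq_zero.1 h2] at h1
    simp at h1
  · have hval' : ∀ᶠ z in stripFilter 0, ((ℓ (f (stripMap η (d κ) z)) : ℝ) : ℂ) =
        stripRoot (d κ) z ^ ((j : ℤ) - d κ) * B (stripRoot (d κ) z) := by
      filter_upwards [hval, hroot0.eventually hAB] with z h1 h2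
      rw [h1, h2, ← mul_assoc, ← zpow_natCast, ← zpow_add₀ (stripRoot_ne_zero _ _)]
      congr 2; ring
    refine ⟨(j : ℤ) - d κ, B, ?_, hB, ?_, hval'.mono fun z hz => by
      rw [← hz, Complex.ofReal_re]⟩
    -- A nonnegative total exponent would keep ℓ ∘ f bounded along the radius, against its
    -- divergence.
    · by_contra hs
      obtain ⟨n, hn⟩ : ∃ n : ℕ, (j : ℤ) - d κ = n := ⟨((j : ℤ) - d κ).toNat, by omega⟩
      have hlim : Tendsto (fun z => ‖stripRoot (d κ) z ^ ((j : ℤ) - d κ) *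
          B (stripRoot (d κ) z)‖) (stripFilter 0) (𝓝 ‖(0 : ℂ) ^ n * B 0‖) := by
        simp only [hn, zpow_natCast]
        exact ((hroot0.pow n).mul (hB.continuousAt.tendsto.comp hroot0)).norm
      refine not_tendsto_nhds_of_tendsto_atTop hatTop _ (hlim.congr' ?_)
      filter_upwards [hval'] with z hz
      rw [← hz, Complex.norm_real, Real.norm_eq_abs]
    -- B is real on the positive axis, so its nonzero value at 0 is real.
    · have him : (B 0).im = 0 := by
        have h1 : Tendsto (fun z => (B (stripRoot (d κ) z)).im) (stripFilter 0) (𝓝 (B 0).im) :=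
          (Complex.continuous_im.tendsto _).comp (hB.continuousAt.tendsto.comp hroot0)
        refine tendsto_nhds_unique (h1.congr' ?_) tendsto_const_nhds
        filter_upwards [hroot, hval'] with z h1 h2
        obtain ⟨r, hr, h1⟩ := h1
        rw [h1] at h2 ⊢
        have h3 := congrArg Complex.im h2
        rw [Complex.ofReal_im, ← Complex.ofReal_zpow, Complex.im_ofReal_mul] at h3
        exact (mul_eq_zero.1 h3.symm).resolve_left (zpow_ne_zero _ hr.ne')
      exact fun h => hB0 (Complex.ext h him)

/-- On each horizontal line the phase differs from the one on the central line by a constant plus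
o(1), so oscillation on the central line suffices. -/
theorem tendsto_integral_phase_of_radial (S : IsFlowSetup Γ f k d v κ lam H ξ)
    (hη : IsRayParam ξ lam (d κ) p η) (hrad : IsRadialExpansion f d v κ lam ξ p m δ ϑ)
    (hℓ : ∀ a ∈ flagSpace v (κ - 1), ℓ a = 0) (hℓ' : ∃ a ∈ radialSpace v κ ϑ m, ℓ a ≠ 0)
    (hα : 0 < α) (hαβ : α ≤ β) (hw : IntegrableOn w (Set.Ioc α β)) :
    Tendsto (fun N : ℝ => ∫ x : ℝ × ℝ, Complex.exp (Complex.I *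
      ((2 * Real.pi * ℓ (f (stripMap η (d κ) ⟨N * x.1, x.2⟩)) : ℝ) : ℂ)) * w x.1
      ∂((volume.restrict (Set.Ioc α β)).prod (volume.restrict (Set.Ioc (-M) M)))) atTop (𝓝 0) := by
  have hq := S.pole_ne_zero
  have hℓc : Continuous ℓ := ℓ.continuous_of_finiteDimensional
  obtain ⟨s, B, hs, hB, hB0, hval⟩ := S.exists_real_laurent ℓ hη hrad hℓ hℓ'
  have hm := fun M => S.eventually_aestronglyMeasurable hη hα β M
    (Φ := fun e => Complex.exp (Complex.I * ((2 * Real.pi * ℓ e : ℝ) : ℂ))) (by fun_prop)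
  set Φ : ℂ → ℂ := fun z =>
    Complex.exp (Complex.I * ((2 * Real.pi * ℓ (f (stripMap η (d κ) z)) : ℝ) : ℂ)) with hΦ
  have hΦ1 : ∀ z, ‖Φ z‖ = 1 := fun z => norm_cexp_I_mul _
  have hcenter : Tendsto (fun N : ℝ => ∫ s in Set.Ioc α β, Φ ⟨N * s, 0⟩ * w s) atTop (𝓝 0) := by
    have := tendsto_integral_phase_horizontal hq hs hB hB0 hα hαβ
      ((intervalIntegrable_iff_integrableOn_Ioc_of_le hαβ).2 hw) 0
    refine this.congr' ?_
    filter_upwards [eventually_forall_strip hval hα] with N hN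
    rw [intervalIntegral.integral_of_le hαβ]
    refine setIntegral_congr_fun measurableSet_Ioc fun s hs' => ?_
    simp only [hΦ]
    rw [hN s hs'.1.le 0 (by simp)]
  have hmeas1 : ∀ τ : ℝ, ∀ᶠ N : ℝ in atTop, AEStronglyMeasurable (fun s => Φ ⟨N * s, τ⟩)
      (volume.restrict (Set.Ioc α β)) := by
    intro τ
    filter_upwards [eventually_forall_strip (S.eventually_continuousAt_stripMap hη |τ|) hα] with N hN
    refine ContinuousOn.aestronglyMeasurable (fun s hs' => ?_) measurableSet_Ioc
    refine ContinuousAt.continuousWithinAt ?_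
    have h1 : Continuous fun s : ℝ => (⟨N * s, τ⟩ : ℂ) := by
      simp only [Complex.mk_eq_add_mul_I]; fun_prop
    have h2 : ContinuousAt (fun s : ℝ => f (stripMap η (d κ) ⟨N * s, τ⟩)) s :=
      ContinuousAt.comp (g := fun z => f (stripMap η (d κ) z))
        (f := fun s : ℝ => (⟨N * s, τ⟩ : ℂ)) (hN s hs'.1.le τ le_rfl) h1.continuousAt
    have h3 : Continuous fun e => Complex.exp (Complex.I * ((2 * Real.pi * ℓ e : ℝ) : ℂ)) := by
      fun_prop
    exact h3.continuousAt.comp h2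
  have h := tendsto_integral_prod_of_fibers_snd (g := fun N x => Φ ⟨N * x.1, x.2⟩)
    (c := fun _ => 0) hw (hm M) (fun N x => (hΦ1 _).le) ?_
  · rwa [integral_zero] at h
  refine (ae_restrict_iff' measurableSet_Ioc).2 (Eventually.of_forall fun τ hτ => ?_)
  set e : ℂ := Complex.exp (Complex.I * ((2 * Real.pi * (τ * ℓ (Complex.I • ϑ 0)) : ℝ) : ℂ)) with he
  -- Moving to height τ multiplies the exponential by the fixed factor e up to o(1), by
  -- `tendsto_real_shift`; dominated convergence makes the error negligible.
  have hdiff : Tendsto (fun N : ℝ => ∫ s in Set.Ioc α β,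
      (Φ ⟨N * s, τ⟩ - e * Φ ⟨N * s, 0⟩) * w s) atTop (𝓝 (∫ s in Set.Ioc α β, (0 : ℂ))) := by
    refine tendsto_integral_filter_of_dominated_convergence (fun s => 2 * ‖w s‖) ?_ ?_
      (hw.norm.const_mul _) ?_
    · filter_upwards [hmeas1 τ, hmeas1 0] with N h1 h2
      exact (h1.sub (h2.const_mul e)).mul hw.ofReal.aestronglyMeasurable
    · refine Eventually.of_forall fun N => Eventually.of_forall fun s => ?_
      rw [norm_mul, Complex.norm_real]
      gcongr
      refine (norm_sub_le _ _).trans ?_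
      rw [norm_mul, hΦ1, hΦ1, he, norm_cexp_I_mul]; norm_num
    · refine (ae_restrict_iff' measurableSet_Ioc).2 (Eventually.of_forall fun s hs' => ?_)
      have h1 := (S.tendsto_real_shift hη hrad ℓ hℓ |τ|).comp
        (tendsto_strip (hα.trans hs'.1) (le_refl |τ|))
      have h2 : Tendsto (fun x : ℝ => Complex.exp (Complex.I * ((2 * Real.pi * x : ℝ) : ℂ)) - 1)
          (𝓝 0) (𝓝 0) := by
        have : Continuous fun x : ℝ => Complex.exp (Complex.I * ((2 * Real.pi * x : ℝ) : ℂ)) - 1 := by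
          fun_prop
        simpa using this.tendsto 0
      have h3 := (h2.comp h1).norm
      rw [norm_zero] at h3
      have h4 : Tendsto (fun N : ℝ => ‖Φ ⟨N * s, τ⟩ - e * Φ ⟨N * s, 0⟩‖) atTop (𝓝 0) := by
        refine h3.congr fun N => ?_
        have : Φ ⟨N * s, τ⟩ - e * Φ ⟨N * s, 0⟩ = e * Φ ⟨N * s, 0⟩ * (Complex.exp (Complex.I *
            ((2 * Real.pi * (ℓ (f (stripMap η (d κ) ⟨N * s, τ⟩)) -
              ℓ (f (stripMap η (d κ) ⟨N * s, 0⟩)) - τ * ℓ (Complex.I • ϑ 0)) : ℝ) : ℂ)) - 1) := by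
          simp only [hΦ, he]
          rw [mul_sub, mul_one, ← Complex.exp_add, ← Complex.exp_add]
          congr 2
          push_cast; ring
        rw [this, norm_mul, norm_mul, hΦ1, he, norm_cexp_I_mul, one_mul, one_mul]
        rfl
      have h5 := (tendsto_zero_iff_norm_tendsto_zero.2 h4).mul_const (w s : ℂ)
      rwa [zero_mul] at h5
  have h6 := hdiff.add (hcenter.const_mul e)
  rw [integral_zero, mul_zero, zero_add] at h6
  refine h6.congr' ?_
  filter_upwards [hmeas1 τ, hmeas1 0] with N h1 h2
  have i1 : Integrable (fun s => Φ ⟨N * s, 0⟩ * (w s : ℂ)) (volume.restrict (Set.Ioc α β)) :=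
    Integrable.bdd_mul (c := 1) hw.ofReal h2 (Eventually.of_forall fun s => (hΦ1 _).le)
  have i2 : Integrable (fun s => Φ ⟨N * s, τ⟩ * (w s : ℂ)) (volume.restrict (Set.Ioc α β)) :=
    Integrable.bdd_mul (c := 1) hw.ofReal h1 (Eventually.of_forall fun s => (hΦ1 _).le)
  rw [← integral_const_mul, ← integral_add]
  · refine integral_congr_ae (Eventually.of_forall fun s => ?_)
    beta_reduce; ring
  · refine (i2.sub (i1.const_mul e)).congr (Eventually.of_forall fun s => ?_)
    simp only [Pi.sub_apply]; ring
  · exact i1.const_mul e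

theorem tendsto_integral_phase_of_eq_zero (S : IsFlowSetup Γ f k d v κ lam H ξ)
    (hη : IsRayParam ξ lam (d κ) p η) (hrad : IsRadialExpansion f d v κ lam ξ p m δ ϑ)
    (hℓ : ∀ a ∈ radialSpace v κ ϑ m, ℓ a = 0)
    (hα : 0 < α) (hw : IntegrableOn w (Set.Ioc α β)) :
    Tendsto (fun N : ℝ => ∫ x : ℝ × ℝ, Complex.exp (Complex.I *
      ((2 * Real.pi * ℓ (f (stripMap η (d κ) ⟨N * x.1, x.2⟩)) : ℝ) : ℂ)) * w x.1
      ∂((volume.restrict (Set.Ioc α β)).prod (volume.restrict (Set.Ioc (-M) M)))) atTop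
      (𝓝 ((∫ τ in Set.Ioc (-M) M, Complex.exp (Complex.I *
        ((2 * Real.pi * (ℓ (ϑ (m + 1)) + τ * ℓ (Complex.I • ϑ 0)) : ℝ) : ℂ))) *
        ((∫ s in Set.Ioc α β, w s : ℝ) : ℂ))) := by
  have hℓc : Continuous ℓ := ℓ.continuous_of_finiteDimensional
  have hm := S.eventually_aestronglyMeasurable hη hα β M
    (Φ := fun e => Complex.exp (Complex.I * ((2 * Real.pi * ℓ e : ℝ) : ℂ))) (by fun_prop)
  refine tendsto_integral_prod_of_fibers_fst (g := fun N x => Complex.exp (Complex.I *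
      ((2 * Real.pi * ℓ (f (stripMap η (d κ) ⟨N * x.1, x.2⟩)) : ℝ) : ℂ))) hw hm
      (fun N x => (norm_cexp_I_mul _).le) ?_
  refine (ae_restrict_iff' measurableSet_Ioc).2 (Eventually.of_forall fun s hs' => ?_)
  have hs0 := hα.trans hs'.1
  refine tendsto_integral_filter_of_dominated_convergence (fun _ => 1) ?_ ?_
      (integrable_const _) ?_
  · filter_upwards [eventually_forall_strip (S.eventually_continuousAt_stripMap hη M) hα] with N hN
    refine ContinuousOn.aestronglyMeasurable (fun τ hτ => ?_) measurableSet_Ioc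
    refine ContinuousAt.continuousWithinAt ?_
    have h1 : Continuous fun τ : ℝ => (⟨N * s, τ⟩ : ℂ) := by
      simp only [Complex.mk_eq_add_mul_I]; fun_prop
    have h2 : ContinuousAt (fun τ : ℝ => f (stripMap η (d κ) ⟨N * s, τ⟩)) τ :=
      ContinuousAt.comp (g := fun z => f (stripMap η (d κ) z))
        (f := fun τ : ℝ => (⟨N * s, τ⟩ : ℂ)) (hN s hs'.1.le τ (abs_le.2 ⟨hτ.1.le, hτ.2⟩))
        h1.continuousAt
    have h3 : Continuous fun e => Complex.exp (Complex.I * ((2 * Real.pi * ℓ e : ℝ) : ℂ)) := by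
      fun_prop
    exact h3.continuousAt.comp h2
  · exact Eventually.of_forall fun N => Eventually.of_forall fun τ => (norm_cexp_I_mul _).le
  · refine (ae_restrict_iff' measurableSet_Ioc).2 (Eventually.of_forall fun τ hτ => ?_)
    have h1 := (S.tendsto_of_radialSpace hη hrad ℓ hℓ |τ|).comp
      (tendsto_strip hs0 (le_refl |τ|))
    have h2 : Tendsto (fun N : ℝ => ℓ (f (stripMap η (d κ) ⟨N * s, τ⟩))) atTop
        (𝓝 (ℓ (ϑ (m + 1)) + τ * ℓ (Complex.I • ϑ 0))) := by
      have := h1.add_const (ℓ (ϑ (m + 1)) + τ * ℓ (Complex.I • ϑ 0))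
      rw [zero_add] at this
      refine this.congr fun N => ?_
      simp only [Function.comp]; ring
    have h3 : Continuous fun x : ℝ => Complex.exp (Complex.I * ((2 * Real.pi * x : ℝ) : ℂ)) := by
      fun_prop
    exact (h3.tendsto _).comp h2

end IsFlowSetup

/-! ### Equidistribution of long strips. -/

theorem character_add {E : Type*} [NormedAddCommGroup E] [InnerProductSpace ℂ E]
    {Γ : AddSubgroup E} {ℓ : E →ₗ[ℝ] ℝ} {χ : C(E ⧸ Γ, ℂ)}
    (hχ : ∀ e : E, χ (e : E ⧸ Γ) = Complex.exp (Complex.I * (2 * Real.pi * ℓ e : ℝ)))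
    (y y' : E ⧸ Γ) : χ (y + y') = χ y * χ y' := by
  induction y using QuotientAddGroup.induction_on with
  | H a =>
  induction y' using QuotientAddGroup.induction_on with
  | H b =>
    rw [← QuotientAddGroup.mk_add, hχ, hχ, hχ, ← Complex.exp_add, map_add]
    congr 1; push_cast; ring

theorem norm_character {E : Type*} [NormedAddCommGroup E] [InnerProductSpace ℂ E]
    {Γ : AddSubgroup E} {ℓ : E →ₗ[ℝ] ℝ} {χ : C(E ⧸ Γ, ℂ)}
    (hχ : ∀ e : E, χ (e : E ⧸ Γ) = Complex.exp (Complex.I * (2 * Real.pi * ℓ e : ℝ)))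
    (y : E ⧸ Γ) : ‖χ y‖ = 1 := by
  induction y using QuotientAddGroup.induction_on with
  | H a => rw [hχ]; exact norm_cexp_I_mul _

section haar
variable {E : Type*} [NormedAddCommGroup E] [InnerProductSpace ℂ E] [FiniteDimensional ℂ E]
  [MeasurableSpace E] [BorelSpace E] {Γ : AddSubgroup E} [DiscreteTopology Γ]
  {W : Submodule ℝ E} {ℓ : E →ₗ[ℝ] ℝ} {χ : C(E ⧸ Γ, ℂ)}

/-- Some multiple b of a has ℓ(b) = 1/2. Translation by b preserves the Haar measure and changes the
sign of the character. -/
theorem integral_character_eq_zero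
    (hχ : ∀ e : E, χ (e : E ⧸ Γ) = Complex.exp (Complex.I * (2 * Real.pi * ℓ e : ℝ)))
    (hℓ : ∃ a ∈ W, ℓ a ≠ 0) (ν₀ : Measure (torusClosure Γ W)) [ν₀.IsAddHaarMeasure] :
    ∫ g, χ (g : E ⧸ Γ) ∂ν₀ = 0 := by
  obtain ⟨a, ha, ha0⟩ := hℓ
  set b : E := (1 / (2 * ℓ a)) • a with hb
  have hbW : b ∈ W := W.smul_mem _ ha
  have hℓb : ℓ b = 1 / 2 := by
    rw [hb, map_smul, smul_eq_mul]; field_simp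
  have hχb : χ (b : E ⧸ Γ) = -1 := by
    rw [hχ, hℓb, ← Complex.exp_pi_mul_I]
    congr 1; push_cast; ring
  have h := integral_add_right_eq_self (μ := ν₀) (fun g => χ (g : E ⧸ Γ))
    ⟨(b : E ⧸ Γ), mk_mem_torusClosure Γ hbW⟩
  simp only [AddSubgroup.coe_add, character_add hχ, hχb, mul_neg, mul_one, integral_neg] at h
  linear_combination -(1 / 2 : ℂ) * h

theorem integral_character_eq_one
    (hχ : ∀ e : E, χ (e : E ⧸ Γ) = Complex.exp (Complex.I * (2 * Real.pi * ℓ e : ℝ)))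
    (hℓ : ∀ a ∈ W, ℓ a = 0) (ν₀ : Measure (torusClosure Γ W)) [IsProbabilityMeasure ν₀] :
    ∫ g, χ (g : E ⧸ Γ) ∂ν₀ = 1 := by
  have : (torusClosure Γ W : Set (E ⧸ Γ)) ⊆ {y | χ y = 1} := by
    rw [coe_torusClosure]
    refine closure_minimal ?_ (isClosed_eq χ.continuous continuous_const)
    rintro _ ⟨e, he, rfl⟩
    rw [Set.mem_ofPred_eq, hχ, hℓ e he]; simp
  have h1 : ∀ g : torusClosure Γ W, χ (g : E ⧸ Γ) = 1 := fun g => this g.2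
  simp [h1]

end haar

namespace IsFlowSetup
variable {E : Type*} [NormedAddCommGroup E] [InnerProductSpace ℂ E] [FiniteDimensional ℂ E]
  {Γ : AddSubgroup E} {f : ℂ → E} {k : ℕ} {d : ℕ → ℕ} {v : ℕ → E} {κ : ℕ}
  {lam : ℂ} {H : E →ₗ[ℂ] ℂ} {ξ : ℂ → ℂ} {p m : ℕ} {δ : ℕ → ℕ} {ϑ : ℕ → E} {η : ℂ → ℂ}
  {α β M : ℝ} {w : ℝ → ℝ}

/-- Keeps the image of the strip in a fixed tube. For a projection along Γ_ℝ the tube is compact in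
the torus, so Stone–Weierstrass can be used. -/
theorem eventually_norm_projection_le (S : IsFlowSetup Γ f k d v κ lam H ξ)
    (hη : IsRayParam ξ lam (d κ) p η) (hrad : IsRadialExpansion f d v κ lam ξ p m δ ϑ)
    {P : E →ₗ[ℝ] E} (hP : ∀ a ∈ radialSpace v κ ϑ m, P a = 0) (M : ℝ) :
    ∀ᶠ z in stripFilter M, ‖P (f (stripMap η (d κ) z))‖ ≤
      1 + ‖P (ϑ (m + 1))‖ + M * ‖P (Complex.I • ϑ 0)‖ := by
  have h1 : Tendsto (fun z : ℂ => P (f (stripMap η (d κ) z) - ϑ (m + 1) -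
      z.im • (Complex.I • ϑ 0))) (stripFilter M) (𝓝 0) := by
    refine tendsto_of_forall_functional P fun ℓ => ?_
    have := S.tendsto_of_radialSpace hη hrad (ℓ.comp P) (fun a ha => by
      rw [LinearMap.comp_apply, hP a ha, map_zero]) M
    rw [map_zero]
    refine this.congr fun z => ?_
    simp only [LinearMap.comp_apply, map_sub, map_smul, smul_eq_mul]; ring
  filter_upwards [Metric.tendsto_nhds.1 h1 1 one_pos, eventually_im_stripFilter M] with z hz hz'
  rw [dist_zero_right] at hz
  have e : P (f (stripMap η (d κ) z)) = P (f (stripMap η (d κ) z) - ϑ (m + 1) -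
      z.im • (Complex.I • ϑ 0)) + P (ϑ (m + 1)) + z.im • P (Complex.I • ϑ 0) := by
    simp only [map_sub, map_smul]; abel
  rw [e]
  refine (norm_add_le _ _).trans (add_le_add ((norm_add_le _ _).trans (add_le_add hz.le le_rfl)) ?_)
  rw [norm_smul]
  exact mul_le_mul_of_nonneg_right hz' (norm_nonneg _)

variable [MeasurableSpace E] [BorelSpace E] [DiscreteTopology Γ]

/-- Weyl's criterion. The prospective limit factors as an integral along the line iℝϑ_0 times the
mean of the character over the closure of π(𝔽'_m). That mean is 0 or 1 according to whether ℓ is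
nonzero on 𝔽'_m, matching the three asymptotic regimes. -/
theorem tendsto_integral_character (S : IsFlowSetup Γ f k d v κ lam H ξ)
    (hη : IsRayParam ξ lam (d κ) p η) (hrad : IsRadialExpansion f d v κ lam ξ p m δ ϑ)
    (ν₀ : Measure (torusClosure Γ (radialSpace v κ ϑ m))) [ν₀.IsAddHaarMeasure]
    [IsProbabilityMeasure ν₀]
    (hα : 0 < α) (hαβ : α ≤ β) (hM : 0 ≤ M) (hw : IntegrableOn w (Set.Ioc α β))
    {ψ : C(E ⧸ Γ, ℂ)} (hψ : ψ ∈ characters Γ) :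
    Tendsto (fun N : ℝ => ∫ x : ℝ × ℝ, ψ (f (stripMap η (d κ) ⟨N * x.1, x.2⟩) : E ⧸ Γ) * w x.1
      ∂((volume.restrict (Set.Ioc α β)).prod (volume.restrict (Set.Ioc (-M) M)))) atTop
      (𝓝 ((∫ x : ℝ × torusClosure Γ (radialSpace v κ ϑ m),
        ψ ((ϑ (m + 1) : E ⧸ Γ) + x.2 + ((x.1 • (Complex.I • ϑ 0) : E) : E ⧸ Γ))
        ∂((volume.restrict (Set.Ioc (-M) M)).prod ν₀)) * ((∫ s in Set.Ioc α β, w s : ℝ) : ℂ))) := by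
  obtain ⟨ℓ, hℓ, hψℓ⟩ := hψ
  have hT : ∫ x : ℝ × torusClosure Γ (radialSpace v κ ϑ m),
        ψ ((ϑ (m + 1) : E ⧸ Γ) + x.2 + ((x.1 • (Complex.I • ϑ 0) : E) : E ⧸ Γ))
        ∂((volume.restrict (Set.Ioc (-M) M)).prod ν₀) =
      (∫ τ in Set.Ioc (-M) M, Complex.exp (Complex.I *
        ((2 * Real.pi * (ℓ (ϑ (m + 1)) + τ * ℓ (Complex.I • ϑ 0)) : ℝ) : ℂ))) *
        ∫ g, ψ (g : E ⧸ Γ) ∂ν₀ := by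
    rw [← integral_prod_mul]
    refine integral_congr_ae (Eventually.of_forall fun x => ?_)
    beta_reduce
    rw [add_right_comm, character_add hψℓ, ← QuotientAddGroup.mk_add, hψℓ, map_add, map_smul,
      smul_eq_mul]
  simp only [hψℓ]
  rw [hT]
  by_cases h1 : ∃ a ∈ radialSpace v κ ϑ m, ℓ a ≠ 0
  · rw [integral_character_eq_zero hψℓ h1, mul_zero, zero_mul]
    by_cases h2 : ∃ a ∈ flagSpace v (κ - 1), ℓ a ≠ 0
    · exact S.tendsto_integral_phase_of_flag ℓ hη h2 hα hαβ hM hw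
    · push Not at h2
      exact S.tendsto_integral_phase_of_radial ℓ hη hrad h2 h1 hα hαβ hw
  · push Not at h1
    rw [integral_character_eq_one hψℓ h1, mul_one]
    exact S.tendsto_integral_phase_of_eq_zero ℓ hη hrad h1 hα hw

theorem integrable_pushforward (ν₀ : Measure (torusClosure Γ (radialSpace v κ ϑ m)))
    [IsProbabilityMeasure ν₀] {ψ : E ⧸ Γ → ℂ} (hψ : Continuous ψ) {b : ℝ} (hb : ∀ y, ‖ψ y‖ ≤ b)
    (t w' : E) :
    Integrable (fun x : ℝ × torusClosure Γ (radialSpace v κ ϑ m) =>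
      ψ ((t : E ⧸ Γ) + x.2 + ((x.1 • w' : E) : E ⧸ Γ)))
      ((volume.restrict (Set.Ioc (-M) M)).prod ν₀) := by
  have : PolishSpace E := by
    have := FiniteDimensional.complete ℂ E
    have : ProperSpace E := FiniteDimensional.proper ℂ E
    infer_instance
  have hmk : Continuous (fun e : E => (e : E ⧸ Γ)) := continuous_quot_mk
  have hc : Continuous (fun x : ℝ × torusClosure Γ (radialSpace v κ ϑ m) =>
      ψ ((t : E ⧸ Γ) + x.2 + ((x.1 • w' : E) : E ⧸ Γ))) :=
    hψ.comp (((continuous_const).add (continuous_subtype_val.comp continuous_snd)).add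
      (hmk.comp (continuous_fst.smul continuous_const)))
  exact Integrable.of_bound hc.aestronglyMeasurable b (Eventually.of_forall fun x => hb _)

theorem eventually_integrable_strip (S : IsFlowSetup Γ f k d v κ lam H ξ)
    (hη : IsRayParam ξ lam (d κ) p η) (hα : 0 < α) (hw : IntegrableOn w (Set.Ioc α β))
    {ψ : E ⧸ Γ → ℂ} (hψ : Continuous ψ) {b : ℝ} (hb : ∀ y, ‖ψ y‖ ≤ b) (M : ℝ) :
    ∀ᶠ N : ℝ in atTop, Integrable
      (fun x : ℝ × ℝ => ψ (f (stripMap η (d κ) ⟨N * x.1, x.2⟩) : E ⧸ Γ) * (w x.1 : ℂ))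
      ((volume.restrict (Set.Ioc α β)).prod (volume.restrict (Set.Ioc (-M) M))) := by
  have hmk : Continuous (fun e : E => (e : E ⧸ Γ)) := continuous_quot_mk
  filter_upwards [S.eventually_aestronglyMeasurable hη hα β M (hψ.comp hmk)] with N hN
  exact integrable_mul_weight hw hN fun x => hb _

theorem tendsto_integral_of_mem_span (S : IsFlowSetup Γ f k d v κ lam H ξ)
    (hη : IsRayParam ξ lam (d κ) p η) (hrad : IsRadialExpansion f d v κ lam ξ p m δ ϑ)
    (ν₀ : Measure (torusClosure Γ (radialSpace v κ ϑ m))) [ν₀.IsAddHaarMeasure]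
    [IsProbabilityMeasure ν₀]
    (hα : 0 < α) (hαβ : α ≤ β) (hM : 0 ≤ M) (hw : IntegrableOn w (Set.Ioc α β))
    {ψ : C(E ⧸ Γ, ℂ)} (hψ : ψ ∈ Submodule.span ℂ (characters Γ)) :
    (∃ b, ∀ y, ‖ψ y‖ ≤ b) ∧
    Tendsto (fun N : ℝ => ∫ x : ℝ × ℝ, ψ (f (stripMap η (d κ) ⟨N * x.1, x.2⟩) : E ⧸ Γ) * w x.1
      ∂((volume.restrict (Set.Ioc α β)).prod (volume.restrict (Set.Ioc (-M) M)))) atTop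
      (𝓝 ((∫ x : ℝ × torusClosure Γ (radialSpace v κ ϑ m),
        ψ ((ϑ (m + 1) : E ⧸ Γ) + x.2 + ((x.1 • (Complex.I • ϑ 0) : E) : E ⧸ Γ))
        ∂((volume.restrict (Set.Ioc (-M) M)).prod ν₀)) * ((∫ s in Set.Ioc α β, w s : ℝ) : ℂ))) := by
  induction hψ using Submodule.span_induction with
  | mem ψ hψ =>
    refine ⟨⟨1, fun y => ?_⟩, S.tendsto_integral_character hη hrad ν₀ hα hαβ hM hw hψ⟩
    obtain ⟨ℓ, -, hψℓ⟩ := hψ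
    exact (norm_character hψℓ y).le
  | zero => exact ⟨⟨0, fun y => by simp⟩, by simp⟩
  | add ψ ψ' _ _ ih ih' =>
    obtain ⟨⟨b, hb⟩, h1⟩ := ih
    obtain ⟨⟨b', hb'⟩, h2⟩ := ih'
    refine ⟨⟨b + b', fun y => (norm_add_le _ _).trans (add_le_add (hb y) (hb' y))⟩, ?_⟩
    have := h1.add h2
    rw [← add_mul, ← integral_add (integrable_pushforward ν₀ ψ.continuous hb _ _)
      (integrable_pushforward ν₀ ψ'.continuous hb' _ _)] at this
    refine this.congr' ?_
    filter_upwards [S.eventually_integrable_strip hη hα hw ψ.continuous hb M,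
      S.eventually_integrable_strip hη hα hw ψ'.continuous hb' M] with N h3 h4
    rw [← integral_add h3 h4]
    refine integral_congr_ae (Eventually.of_forall fun x => ?_)
    beta_reduce
    rw [ContinuousMap.add_apply, add_mul]
  | smul c ψ _ ih =>
    obtain ⟨⟨b, hb⟩, h1⟩ := ih
    refine ⟨⟨‖c‖ * b, fun y => ?_⟩, ?_⟩
    · rw [ContinuousMap.smul_apply, norm_smul]
      exact mul_le_mul_of_nonneg_left (hb y) (norm_nonneg _)
    · have := h1.const_mul c
      rw [← mul_assoc, ← integral_const_mul] at this
      refine this.congr fun N => ?_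
      rw [← integral_const_mul]
      refine integral_congr_ae (Eventually.of_forall fun x => ?_)
      beta_reduce
      rw [ContinuousMap.smul_apply, smul_eq_mul, mul_assoc]

/-- Equidistribution of the images of long strips. -/
theorem tendsto_integral_strip_complex (S : IsFlowSetup Γ f k d v κ lam H ξ)
    (hη : IsRayParam ξ lam (d κ) p η) (hrad : IsRadialExpansion f d v κ lam ξ p m δ ϑ)
    (hΓ : radialSpace v κ ϑ m ≤ realSpan Γ)
    (ν₀ : Measure (torusClosure Γ (radialSpace v κ ϑ m))) [ν₀.IsAddHaarMeasure]
    [IsProbabilityMeasure ν₀]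
    (hα : 0 < α) (hαβ : α ≤ β) (hM : 0 ≤ M) (hw : IntegrableOn w (Set.Ioc α β))
    (φ : C(E ⧸ Γ, ℂ)) {b : ℝ} (hb : ∀ y, ‖φ y‖ ≤ b) :
    Tendsto (fun N : ℝ => ∫ x : ℝ × ℝ, φ (f (stripMap η (d κ) ⟨N * x.1, x.2⟩) : E ⧸ Γ) * w x.1
      ∂((volume.restrict (Set.Ioc α β)).prod (volume.restrict (Set.Ioc (-M) M)))) atTop
      (𝓝 ((∫ x : ℝ × torusClosure Γ (radialSpace v κ ϑ m),
        φ ((ϑ (m + 1) : E ⧸ Γ) + x.2 + ((x.1 • (Complex.I • ϑ 0) : E) : E ⧸ Γ))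
        ∂((volume.restrict (Set.Ioc (-M) M)).prod ν₀)) * ((∫ s in Set.Ioc α β, w s : ℝ) : ℂ))) := by
  obtain ⟨P, hP, hP'⟩ := exists_projection (realSpan Γ)
  set R := 1 + ‖P (ϑ (m + 1))‖ + M * ‖P (Complex.I • ϑ 0)‖ with hR
  set K := (fun e : E => (e : E ⧸ Γ)) '' {e | ‖P e‖ ≤ R} with hK
  have hKc : IsCompact K := isCompact_tube hP hP' R
  have hK1 := eventually_forall_strip
    (S.eventually_norm_projection_le hη hrad (fun a ha => hP a (hΓ ha)) M) hα
  have hK2 : ∀ g ∈ torusClosure Γ (radialSpace v κ ϑ m), ∀ τ : ℝ, |τ| ≤ M →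
      (ϑ (m + 1) : E ⧸ Γ) + g + ((τ • (Complex.I • ϑ 0) : E) : E ⧸ Γ) ∈ K := by
    intro g hg τ hτ
    have : g ∈ (fun e : E => (e : E ⧸ Γ)) '' (realSpan Γ : Set E) := by
      have : (torusClosure Γ (radialSpace v κ ϑ m) : Set (E ⧸ Γ)) ⊆
          (fun e : E => (e : E ⧸ Γ)) '' (realSpan Γ : Set E) := by
        rw [coe_torusClosure]
        exact closure_minimal (Set.image_mono hΓ) (isCompact_image_realSpan Γ).isClosed
      exact this hg
    obtain ⟨a, ha, rfl⟩ := this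
    refine ⟨ϑ (m + 1) + a + τ • (Complex.I • ϑ 0), ?_, rfl⟩
    rw [Set.mem_ofPred_eq, map_add, map_add, hP a ha, add_zero, map_smul, hR]
    refine (norm_add_le _ _).trans ?_
    rw [norm_smul]
    have := mul_le_mul_of_nonneg_right hτ (norm_nonneg (P (Complex.I • ϑ 0)))
    rw [Real.norm_eq_abs]; linarith
  set μ := (volume.restrict (Set.Ioc α β)).prod (volume.restrict (Set.Ioc (-M) M)) with hμ
  set A := ∫ s in Set.Ioc α β, ‖w s‖ with hA
  have hA0 : 0 ≤ A := integral_nonneg fun _ => norm_nonneg _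
  rw [Metric.tendsto_nhds]
  intro ε hε
  -- Approximating φ by ψ costs at most ε' · 2MA on the strip and again in the limit; together that
  -- is below ε/2. The `+ 1` covers MA = 0.
  set ε' := ε / (2 * (2 * (2 * M * A) + 1)) with hε'
  have hε'0 : 0 < ε' := by positivity
  obtain ⟨ψ, hψ, hφψ⟩ := exists_mem_span_characters hKc φ hε'0
  obtain ⟨⟨b', hb'⟩, hψt⟩ := S.tendsto_integral_of_mem_span hη hrad ν₀ hα hαβ hM hw hψ
  have hc : ‖((∫ s in Set.Ioc α β, w s : ℝ) : ℂ)‖ ≤ A := by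
    rw [Complex.norm_real]; exact norm_integral_le_integral_norm _
  have hvol : (volume.restrict (Set.Ioc (-M) M)).real Set.univ = 2 * M := by
    rw [Measure.real, Measure.restrict_apply_univ, Real.volume_Ioc,
      ENNReal.toReal_ofReal (by linarith)]; ring
  have hin : ∀ᵐ x : ℝ × ℝ ∂μ, α ≤ x.1 ∧ |x.2| ≤ M := by
    rw [hμ, Measure.prod_restrict]
    refine (ae_restrict_iff' (measurableSet_Ioc.prod measurableSet_Ioc)).2
      (Eventually.of_forall fun x hx => ⟨hx.1.1.le, abs_le.2 ⟨hx.2.1.le, hx.2.2⟩⟩)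
  filter_upwards [Metric.tendsto_nhds.1 hψt (ε / 2) (half_pos hε), hK1,
    S.eventually_integrable_strip hη hα hw ψ.continuous hb' M,
    S.eventually_integrable_strip hη hα hw φ.continuous hb M] with N h1 h2 h3 h4
  have e1 : ‖(∫ x, φ (f (stripMap η (d κ) ⟨N * x.1, x.2⟩) : E ⧸ Γ) * w x.1 ∂μ) -
      ∫ x, ψ (f (stripMap η (d κ) ⟨N * x.1, x.2⟩) : E ⧸ Γ) * w x.1 ∂μ‖ ≤ ε' * (2 * M * A) := by
    rw [← integral_sub h4 h3]
    have hint : Integrable (fun x : ℝ × ℝ => ε' * ‖w x.1‖) μ := (hw.norm.comp_fst _).const_mul _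
    refine (norm_integral_le_of_norm_le hint ?_).trans (le_of_eq ?_)
    · filter_upwards [hin] with x hx
      rw [← sub_mul, norm_mul, Complex.norm_real]
      gcongr
      exact (hφψ _ ⟨_, h2 _ hx.1 _ hx.2, rfl⟩).le
    · rw [integral_const_mul, hμ]
      congr 1
      have := integral_prod_mul (μ := volume.restrict (Set.Ioc α β))
        (ν := volume.restrict (Set.Ioc (-M) M)) (fun s => ‖w s‖) (fun _ => (1 : ℝ))
      simp only [mul_one] at this
      rw [this, integral_const, hvol, smul_eq_mul]; ring
  have e2 : ‖(∫ x : ℝ × torusClosure Γ (radialSpace v κ ϑ m),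
        φ ((ϑ (m + 1) : E ⧸ Γ) + x.2 + ((x.1 • (Complex.I • ϑ 0) : E) : E ⧸ Γ))
        ∂((volume.restrict (Set.Ioc (-M) M)).prod ν₀)) -
      ∫ x : ℝ × torusClosure Γ (radialSpace v κ ϑ m),
        ψ ((ϑ (m + 1) : E ⧸ Γ) + x.2 + ((x.1 • (Complex.I • ϑ 0) : E) : E ⧸ Γ))
        ∂((volume.restrict (Set.Ioc (-M) M)).prod ν₀)‖ ≤ ε' * (2 * M) := by
    rw [← integral_sub (integrable_pushforward ν₀ φ.continuous hb _ _)
      (integrable_pushforward ν₀ ψ.continuous hb' _ _)]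
    refine (norm_integral_le_of_norm_le_const (C := ε') ?_).trans (le_of_eq ?_)
    · have : ∀ᵐ x : ℝ × torusClosure Γ (radialSpace v κ ϑ m)
          ∂((volume.restrict (Set.Ioc (-M) M)).prod ν₀), x.1 ∈ Set.Ioc (-M) M :=
        Measure.quasiMeasurePreserving_fst.ae (ae_restrict_mem measurableSet_Ioc)
      filter_upwards [this] with x hx
      exact (hφψ _ (hK2 _ x.2.2 _ (abs_le.2 ⟨hx.1.le, hx.2⟩))).le
    · rw [← Set.univ_prod_univ, measureReal_prod_prod, hvol, probReal_univ, mul_one]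
  set I₁ := ∫ x, φ (f (stripMap η (d κ) ⟨N * x.1, x.2⟩) : E ⧸ Γ) * w x.1 ∂μ
  set I₂ := ∫ x, ψ (f (stripMap η (d κ) ⟨N * x.1, x.2⟩) : E ⧸ Γ) * w x.1 ∂μ
  set T₁ := ∫ x : ℝ × torusClosure Γ (radialSpace v κ ϑ m),
        φ ((ϑ (m + 1) : E ⧸ Γ) + x.2 + ((x.1 • (Complex.I • ϑ 0) : E) : E ⧸ Γ))
        ∂((volume.restrict (Set.Ioc (-M) M)).prod ν₀)
  set T₂ := ∫ x : ℝ × torusClosure Γ (radialSpace v κ ϑ m),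
        ψ ((ϑ (m + 1) : E ⧸ Γ) + x.2 + ((x.1 • (Complex.I • ϑ 0) : E) : E ⧸ Γ))
        ∂((volume.restrict (Set.Ioc (-M) M)).prod ν₀)
  set c := ((∫ s in Set.Ioc α β, w s : ℝ) : ℂ)
  rw [dist_eq_norm] at h1 ⊢
  have e3 : I₁ - T₁ * c = (I₁ - I₂) + (I₂ - T₂ * c) - (T₁ - T₂) * c := by ring
  have e4 : ‖(T₁ - T₂) * c‖ ≤ ε' * (2 * M * A) := by
    rw [norm_mul]
    calc _ ≤ ε' * (2 * M) * A := mul_le_mul e2 hc (norm_nonneg _) (by positivity)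
      _ = _ := by ring
  have e5 : 2 * (ε' * (2 * M * A)) < ε / 2 := by
    rw [hε', div_mul_eq_mul_div, mul_div_assoc', div_lt_iff₀ (by positivity)]
    nlinarith
  rw [e3]
  calc _ ≤ ‖I₁ - I₂‖ + ‖I₂ - T₂ * c‖ + ‖(T₁ - T₂) * c‖ :=
        (norm_sub_le _ _).trans (add_le_add (norm_add_le _ _) le_rfl)
    _ < ε := by linarith

/-- The real form of the previous limit, with the product integral written as iterated so that it
matches `exists_haar_translate`. -/
theorem tendsto_integral_strip (S : IsFlowSetup Γ f k d v κ lam H ξ)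
    (hη : IsRayParam ξ lam (d κ) p η) (hrad : IsRadialExpansion f d v κ lam ξ p m δ ϑ)
    (hΓ : radialSpace v κ ϑ m ≤ realSpan Γ)
    (ν₀ : Measure (torusClosure Γ (radialSpace v κ ϑ m))) [ν₀.IsAddHaarMeasure]
    [IsProbabilityMeasure ν₀]
    (hα : 0 < α) (hαβ : α ≤ β) (hM : 0 ≤ M) (hw : IntegrableOn w (Set.Ioc α β))
    {φ : E ⧸ Γ → ℝ} (hφ : Continuous φ) {b : ℝ} (hb : ∀ y, |φ y| ≤ b) :
    Tendsto (fun N : ℝ => ∫ x : ℝ × ℝ, φ (f (stripMap η (d κ) ⟨N * x.1, x.2⟩) : E ⧸ Γ) * w x.1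
      ∂((volume.restrict (Set.Ioc α β)).prod (volume.restrict (Set.Ioc (-M) M)))) atTop
      (𝓝 ((∫ τ in Set.Ioc (-M) M, ∫ g, φ ((ϑ (m + 1) : E ⧸ Γ) + g +
        ((τ • (Complex.I • ϑ 0) : E) : E ⧸ Γ)) ∂ν₀) * ∫ s in Set.Ioc α β, w s)) := by
  set φ' : C(E ⧸ Γ, ℂ) := ⟨fun y => (φ y : ℂ), Complex.continuous_ofReal.comp hφ⟩ with hφ'
  have hb' : ∀ y, ‖φ' y‖ ≤ b := fun y => by
    change ‖((φ y : ℝ) : ℂ)‖ ≤ b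
    rw [Complex.norm_real]; exact hb y
  have h := S.tendsto_integral_strip_complex hη hrad hΓ ν₀ hα hαβ hM hw φ' hb'
  have h2 := (Complex.continuous_re.tendsto _).comp h
  have hi := integrable_pushforward ν₀ (M := M) φ'.continuous hb' (ϑ (m + 1)) (Complex.I • ϑ 0)
  have hi' : Integrable (fun x : ℝ × torusClosure Γ (radialSpace v κ ϑ m) =>
      φ ((ϑ (m + 1) : E ⧸ Γ) + x.2 + ((x.1 • (Complex.I • ϑ 0) : E) : E ⧸ Γ)))
      ((volume.restrict (Set.Ioc (-M) M)).prod ν₀) := hi.re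
  have e : ∫ x : ℝ × torusClosure Γ (radialSpace v κ ϑ m),
        φ' ((ϑ (m + 1) : E ⧸ Γ) + x.2 + ((x.1 • (Complex.I • ϑ 0) : E) : E ⧸ Γ))
        ∂((volume.restrict (Set.Ioc (-M) M)).prod ν₀) =
      ((∫ τ in Set.Ioc (-M) M, ∫ g, φ ((ϑ (m + 1) : E ⧸ Γ) + g +
        ((τ • (Complex.I • ϑ 0) : E) : E ⧸ Γ)) ∂ν₀ : ℝ) : ℂ) := by
    rw [← integral_prod _ hi', ← integral_complex_ofReal]; rfl
  rw [e, ← Complex.ofReal_mul, Complex.ofReal_re] at h2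
  refine h2.congr fun N => ?_
  simp only [Function.comp]
  rw [← Complex.ofReal_re (∫ x : ℝ × ℝ, φ (f (stripMap η (d κ) ⟨N * x.1, x.2⟩) : E ⧸ Γ) * w x.1
      ∂((volume.restrict (Set.Ioc α β)).prod (volume.restrict (Set.Ioc (-M) M)))),
    ← integral_complex_ofReal]
  congr 1
  refine integral_congr_ae (Eventually.of_forall fun x => ?_)
  simp [hφ']

end IsFlowSetup

/-! ### Scaling, transversality and the change of variables. -/

/-- The positive real number whose `-q`-th power is `s`. -/
noncomputable def realRoot (q : ℕ) (s : ℝ) : ℝ := Real.exp (-(Real.log s) / q)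

theorem realRoot_pos (q : ℕ) (s : ℝ) : 0 < realRoot q s := Real.exp_pos _

theorem realRoot_pow {q : ℕ} (hq : q ≠ 0) {s : ℝ} (hs : 0 < s) : realRoot q s ^ q = s⁻¹ := by
  have hq' : (q : ℝ) ≠ 0 := by exact_mod_cast hq
  rw [realRoot, ← Real.exp_nat_mul, mul_div_cancel₀ _ hq', Real.exp_neg, Real.exp_log hs]

theorem realRoot_mul (q : ℕ) {s t : ℝ} (hs : 0 < s) (ht : 0 < t) :
    realRoot q (s * t) = realRoot q s * realRoot q t := by
  rw [realRoot, realRoot, realRoot, ← Real.exp_add, Real.log_mul hs.ne' ht.ne']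
  congr 1; ring

theorem realRoot_inv_pow {q : ℕ} (hq : q ≠ 0) {a : ℝ} (ha : 0 < a) :
    realRoot q ((a ^ q)⁻¹) = a := by
  have hq' : (q : ℝ) ≠ 0 := by exact_mod_cast hq
  rw [realRoot, Real.log_inv, neg_neg, Real.log_pow, mul_div_cancel_left₀ _ hq', Real.exp_log ha]

theorem realRoot_injOn {q : ℕ} (hq : q ≠ 0) : Set.InjOn (realRoot q) (Set.Ioi 0) := by
  intro s hs t ht h
  have := congrArg (· ^ q) h
  simp only [realRoot_pow hq hs, realRoot_pow hq ht] at this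
  exact inv_injective this

theorem continuousOn_realRoot (q : ℕ) : ContinuousOn (realRoot q) (Set.Ioi 0) := by
  unfold realRoot
  refine Real.continuous_exp.comp_continuousOn ((ContinuousOn.neg ?_).div_const _)
  exact Real.continuousOn_log.mono fun s hs => ne_of_gt hs

theorem realRoot_le_iff {q : ℕ} (hq : q ≠ 0) {s t : ℝ} (hs : 0 < s) (ht : 0 < t) :
    realRoot q s ≤ realRoot q t ↔ t ≤ s := by
  have hq' : (0 : ℝ) < q := by exact_mod_cast Nat.pos_of_ne_zero hq
  rw [realRoot, realRoot, Real.exp_le_exp, div_le_div_iff_of_pos_right hq', neg_le_neg_iff,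
    Real.log_le_log_iff ht hs]

/-- A set of reals all of whose points are isolated is countable. -/
theorem countable_of_isolated {T : Set ℝ} (hT : ∀ t ∈ T, ∀ᶠ s in 𝓝[≠] t, s ∉ T) : T.Countable := by
  have : DiscreteTopology T := by
    rw [discreteTopology_subtype_iff]
    intro t ht
    rw [← Filter.empty_mem_iff_bot, mem_inf_principal]
    filter_upwards [hT t ht] with s hs h using hs h
  exact IsLindelof.countable (HereditarilyLindelofSpace.isLindelof T) this

/-- At a transverse intersection Im(γ/u) has nonzero derivative, so the intersection parameters are
isolated, hence countable. -/
theorem countable_ray_inter_arc {γ : ℝ → ℂ} (hγ : IsSmoothArc γ) {u : ℂ} (hu : u ≠ 0)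
    (h : ∀ t ∈ Set.Icc (0 : ℝ) 1, (∃ r : ℝ, 0 < r ∧ γ t = r * u) →
      ∀ s : ℝ, derivWithin γ (Set.Icc 0 1) t ≠ (s : ℂ) * γ t) :
    {r : ℝ | 0 < r ∧ (r : ℂ) * u ∈ γ '' Set.Icc 0 1}.Countable := by
  set T := {t | t ∈ Set.Icc (0 : ℝ) 1 ∧ ∃ r : ℝ, 0 < r ∧ γ t = r * u} with hT
  have hTc : T.Countable := by
    refine countable_of_isolated fun t ht => ?_
    have hd : HasDerivWithinAt γ (derivWithin γ (Set.Icc 0 1) t) (Set.Icc 0 1) t :=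
      (hγ.1.differentiableOn (by simp) t ht.1).hasDerivWithinAt
    -- L is the imaginary part of z/u; its kernel is the real line through u, so L(γ') ≠ 0 expresses
    -- transversality.
    set L : ℂ →L[ℝ] ℝ := Complex.imCLM.comp
      ((ContinuousLinearMap.mul ℝ ℂ) u⁻¹) with hL
    have hLapp : ∀ z, L z = (u⁻¹ * z).im := fun z => rfl
    have hd2 := L.hasFDerivAt.comp_hasDerivWithinAt t hd
    obtain ⟨r, hr, hrt⟩ := ht.2
    have hne : L (derivWithin γ (Set.Icc 0 1) t) ≠ 0 := by
      intro h0
      rw [hLapp] at h0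
      set c := derivWithin γ (Set.Icc 0 1) t
      refine h t ht.1 ht.2 ((u⁻¹ * c).re / r) ?_
      have e : u⁻¹ * c = ((u⁻¹ * c).re : ℂ) := Complex.ext rfl (by simpa using h0)
      have hr' : (r : ℂ) ≠ 0 := by exact_mod_cast hr.ne'
      change c = _
      rw [hrt]
      push_cast
      rw [← e]; field_simp
    have := hd2.eventually_ne (c := 0) hne
    rw [eventually_nhdsWithin_iff] at this ⊢
    filter_upwards [this] with s hs hst hsT
    refine hs ⟨hsT.1, hst⟩ ?_
    obtain ⟨r', -, hr'⟩ := hsT.2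
    simp only [Function.comp]
    rw [hLapp, hr', mul_left_comm, inv_mul_cancel₀ hu, mul_one, Complex.ofReal_im]
  refine (hTc.image fun t => (γ t / u).re).mono ?_
  rintro r ⟨hr, t, ht, htr⟩
  refine ⟨t, ⟨ht, r, hr, htr⟩, ?_⟩
  beta_reduce
  rw [htr, mul_div_cancel_right₀ _ hu, Complex.ofReal_re]

/-- Change of variables `x = g (N s + i τ)`. -/
theorem integral_image_stretch {g g' : ℂ → ℂ} {N : ℝ} (hN : 0 < N) {T : Set (ℝ × ℝ)}
    (hT : MeasurableSet T)
    (hg : ∀ x ∈ T, HasDerivAt g (g' ⟨N * x.1, x.2⟩) ⟨N * x.1, x.2⟩)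
    (hinj : Set.InjOn (fun x : ℝ × ℝ => g ⟨N * x.1, x.2⟩) T) (ψ : ℂ → ℝ) :
    ∫ y in (fun x : ℝ × ℝ => g ⟨N * x.1, x.2⟩) '' T, ψ y =
      ∫ x in T, N * ‖g' ⟨N * x.1, x.2⟩‖ ^ 2 * ψ (g ⟨N * x.1, x.2⟩) := by
  -- The stretch is real linear of determinant N, while the complex derivative g' contributes ‖g'‖²
  -- to the Jacobian.
  set A : ℂ →ₗ[ℝ] ℂ := Matrix.toLin Complex.basisOneI Complex.basisOneI !![N, 0; 0, 1] with hA
  have hAapp : ∀ z : ℂ, A z = ⟨N * z.re, z.im⟩ := by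
    intro z
    rw [hA, Matrix.toLin_apply]
    simp [Matrix.mulVec, dotProduct, Fin.sum_univ_two, Complex.coe_basisOneI,
      Complex.coe_basisOneI_repr, Complex.ext_iff]
  have hAdet : LinearMap.det A = N := by
    rw [hA, LinearMap.det_toLin, Matrix.det_fin_two]; simp
  set A' : ℂ →L[ℝ] ℂ := LinearMap.toContinuousLinearMap A with hA'
  set e := Complex.measurableEquivRealProd with he
  have hee : ∀ z : ℂ, e z = (z.re, z.im) := fun z => rfl
  have hmp := Complex.volume_preserving_equiv_real_prod
  set s : Set ℂ := e ⁻¹' T with hs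
  have hsm : MeasurableSet s := e.measurable hT
  have himg : (fun x : ℝ × ℝ => g ⟨N * x.1, x.2⟩) '' T = (fun z : ℂ => g (A' z)) '' s := by
    ext y
    constructor
    · rintro ⟨x, hx, rfl⟩
      exact ⟨⟨x.1, x.2⟩, hx, congrArg g (hAapp _)⟩
    · rintro ⟨z, hz, rfl⟩
      exact ⟨e z, hz, congrArg g (hAapp _).symm⟩
  have hder : ∀ z ∈ s, HasFDerivWithinAt (fun z : ℂ => g (A' z))
      (((ContinuousLinearMap.mul ℝ ℂ) (g' ⟨N * z.re, z.im⟩)).comp A') s z := by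
    intro z hz
    have h1 := hg _ hz
    have h2 : HasFDerivAt g ((ContinuousLinearMap.mul ℝ ℂ) (g' ⟨N * z.re, z.im⟩)) (A' z) := by
      have e1 : A' z = ⟨N * z.re, z.im⟩ := hAapp z
      rw [e1]
      refine (h1.hasFDerivAt.restrictScalars ℝ).congr_fderiv ?_
      ext; simp [mul_comm, hee]
    exact (h2.comp z A'.hasFDerivAt).hasFDerivWithinAt
  have hdet : ∀ c : ℂ, (((ContinuousLinearMap.mul ℝ ℂ) c).comp A').det = ‖c‖ ^ 2 * N := by
    intro c
    have : (((ContinuousLinearMap.mul ℝ ℂ) c).comp A').det =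
        LinearMap.det ((LinearMap.mul ℝ ℂ c) ∘ₗ A) := rfl
    rw [this, LinearMap.det_comp, hAdet, ← Complex.normSq_eq_norm_sq, ← Algebra.norm_complex_apply,
      Algebra.norm_apply]
    rfl
  rw [himg, integral_image_eq_integral_abs_det_fderiv_smul volume hsm hder]
  · rw [← hmp.setIntegral_preimage_emb e.measurableEmbedding]
    refine setIntegral_congr_fun hsm fun z hz => ?_
    have e1 : A' z = ⟨N * z.re, z.im⟩ := hAapp z
    rw [hdet, abs_of_nonneg (by positivity), e1, smul_eq_mul, mul_comm (‖_‖ ^ 2)]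
    rfl
  · intro z hz z' hz' h
    have e1 : A' z = ⟨N * z.re, z.im⟩ := hAapp z
    have e2 : A' z' = ⟨N * z'.re, z'.im⟩ := hAapp z'
    beta_reduce at h
    rw [e1, e2] at h
    exact e.injective (@hinj (e z) hz (e z') hz' h)

/-! ### Localization in a sector and the size of the derivative. -/

namespace IsFlowSetup
variable {E : Type*} [NormedAddCommGroup E] [InnerProductSpace ℂ E] [FiniteDimensional ℂ E]
  {Γ : AddSubgroup E} {f : ℂ → E} {k : ℕ} {d : ℕ → ℕ} {v : ℕ → E} {κ : ℕ}
  {lam : ℂ} {H : E →ₗ[ℂ] ℂ} {ξ : ℂ → ℂ} {p m : ℕ} {δ : ℕ → ℕ} {ϑ : ℕ → E} {η : ℂ → ℂ}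

theorem exists_bound_im_height (S : IsFlowSetup Γ f k d v κ lam H ξ) {K : Set (E ⧸ Γ)}
    (hK : IsCompact K) : ∃ M : ℝ, 0 ≤ M ∧ ∀ e : E, (e : E ⧸ Γ) ∈ K → |(H e).im| ≤ M := by
  obtain ⟨F, hFc, hF⟩ := exists_continuous_desc_linear (Γ := Γ)
    (Complex.imLm.comp (H.restrictScalars ℝ)) (fun z hz => S.coord.im_eq_zero z hz)
  obtain ⟨M, hM⟩ := hK.exists_bound_of_continuousOn hFc.continuousOn
  refine ⟨|M|, abs_nonneg _, fun e he => ?_⟩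
  have := hM _ he
  rw [hF] at this
  exact this.trans (le_abs_self _)

/-- Near the puncture, the points of the sector which are sent to a given compact set lie in the
strip around the only `Γ`-radius of the sector. -/
theorem eventually_stripMap_eq (S : IsFlowSetup Γ f k d v κ lam H ξ) {ηs : ℕ → ℂ → ℂ}
    (hη : ∀ p, IsRayParam ξ lam (d κ) p (ηs p)) {Θ : Set Real.Angle} (hΘ : IsClosed Θ)
    (huniq : ∀ q < 2 * d κ, IsGammaRadius Γ f d v κ lam ξ q → radiusAngle (d κ) lam q ∈ Θ → q = p)
    {K : Set (E ⧸ Γ)} (hK : IsCompact K) (X : ℝ) :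
    ∀ᶠ x in 𝓝[≠] (0 : ℂ), (Complex.arg x : Real.Angle) ∈ Θ → (f x : E ⧸ Γ) ∈ K →
      X ≤ ((-1) ^ p * H (f x)).re ∧ stripMap (ηs p) (d κ) ((-1) ^ p * H (f x)) = x := by
  -- Ultrafilter form of the claim: by compactness π ∘ f converges along it, which selects a
  -- Γ-radius with angle in the closed set Θ, and that radius is p.
  have key : ∀ᶠ x in 𝓝[≠] (0 : ℂ) ⊓ 𝓟 {x | (Complex.arg x : Real.Angle) ∈ Θ ∧ (f x : E ⧸ Γ) ∈ K},
      X ≤ ((-1) ^ p * H (f x)).re ∧ stripMap (ηs p) (d κ) ((-1) ^ p * H (f x)) = x := by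
    rw [Filter.Eventually, Filter.mem_iff_ultrafilter]
    intro 𝒰 h𝒰
    have h1 : ↑𝒰 ≤ 𝓝[≠] (0 : ℂ) := h𝒰.trans inf_le_left
    have h2 : ∀ᶠ x in (𝒰 : Filter ℂ), (Complex.arg x : Real.Angle) ∈ Θ ∧ (f x : E ⧸ Γ) ∈ K :=
      (h𝒰.trans inf_le_right) (mem_principal_self _)
    obtain ⟨y, -, hy⟩ := hK.ultrafilter_le_nhds (𝒰.map fun x => (f x : E ⧸ Γ))
      (le_principal_iff.2 (h2.mono fun x hx => hx.2))
    have hy : Tendsto (fun x => (f x : E ⧸ Γ)) 𝒰 (𝓝 y) := hy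
    obtain ⟨p', hp', M, hZ, hx⟩ := S.exists_ray_of_tendsto hη h1 hy
    obtain ⟨m, δ, ϑ, hrad⟩ := S.exists_radial p'
    have hy' : Tendsto (fun x => (f (stripMap (ηs p') (d κ) ((-1) ^ p' * H (f x))) : E ⧸ Γ)) 𝒰
        (𝓝 y) := hy.congr' (hx.mono fun x hx => by beta_reduce; rw [hx])
    have hγ : IsGammaRadius Γ f d v κ lam ξ p' :=
      ⟨m, δ, ϑ, hrad, S.isGammaRadius_of_tendsto (hη p') hrad hZ hy'⟩
    have harg := ((S.tendsto_arg_stripMap (hη p') M).comp hZ)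
    have hmem : radiusAngle (d κ) lam p' ∈ Θ := by
      refine hΘ.mem_of_tendsto harg ?_
      filter_upwards [hx, h2] with x hx hx'
      simp only [Function.comp]
      rw [hx]; exact hx'.1
    obtain rfl := huniq p' hp' hγ hmem
    have h3 := (tendsto_stripFilter_iff.1 hZ).1.eventually_ge_atTop X
    exact h3.and hx
  rw [eventually_inf_principal] at key
  filter_upwards [key] with x hx h1 h2 using hx ⟨h1, h2⟩

/-- Ensures that iϑ_0 is transverse to Γ_ℝ, with |Im H(iϑ_0)| = 1. -/
theorem map_leading (S : IsFlowSetup Γ f k d v κ lam H ξ)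
    (hη : IsRayParam ξ lam (d κ) p η) (hrad : IsRadialExpansion f d v κ lam ξ p m δ ϑ) :
    H (ϑ 0) = (-1) ^ p := by
  have h1 := S.tendsto_shift hη hrad H (fun a ha => S.map_flagSpace ha) 1
  have h2 : Tendsto (fun N : ℝ => (⟨N * 1, 1⟩ : ℂ)) atTop (stripFilter 1) :=
    tendsto_strip one_pos (by simp)
  have h3 : Tendsto (fun N : ℝ => (⟨N * 1, 0⟩ : ℂ)) atTop (stripFilter 1) :=
    tendsto_strip one_pos (by simp)
  have h4 := h1.comp h2
  -- The shift from N to N + i changes H ∘ f by exactly (-1)^p i, and asymptotically by i H(ϑ_0).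
  have h5 : Tendsto (fun _ : ℝ => Complex.I * ((-1) ^ p - H (ϑ 0))) atTop (𝓝 0) := by
    refine h4.congr' ?_
    filter_upwards [h2.eventually (S.coord_stripMap hη 1), h3.eventually (S.coord_stripMap hη 1)]
      with N h6 h7
    simp only [Function.comp]
    have e : (((⟨N * 1, 1⟩ : ℂ).re : ℝ) : ℂ) = ⟨N * 1, 0⟩ := rfl
    rw [e, h6, h7, Complex.mk_eq_add_mul_I, Complex.mk_eq_add_mul_I, smul_eq_mul]
    push_cast; ring
  have h6 := tendsto_nhds_unique h5 tendsto_const_nhds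
  have h7 := (mul_eq_zero.1 h6.symm).resolve_left Complex.I_ne_zero
  exact (sub_eq_zero.1 h7).symm

end IsFlowSetup

theorem tendsto_norm_stripRoot_div {q : ℕ} (M : ℝ) :
    Tendsto (fun z : ℂ => ‖stripRoot q z‖ / realRoot q z.re) (stripFilter M) (𝓝 1) := by
  have h1 := (Real.continuousAt_log one_ne_zero).tendsto.comp (tendsto_re_div_norm_stripFilter M)
  have h2 := (Real.continuous_exp.tendsto _).comp (h1.div_const (q : ℝ))
  rw [Real.log_one, zero_div, Real.exp_zero] at h2
  refine h2.congr' ?_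
  filter_upwards [eventually_re_pos_stripFilter M] with z hz
  have hz' : ‖z‖ ≠ 0 := norm_ne_zero_iff.2 fun h => by simp [h] at hz
  simp only [Function.comp]
  rw [norm_stripRoot, realRoot, ← Real.exp_sub, Real.log_div hz.ne' hz']
  congr 1; ring

theorem IsRayParam.tendsto_stripMap_div {ξ : ℂ → ℂ} {lam : ℂ} {q p : ℕ} {η : ℂ → ℂ}
    (hη : IsRayParam ξ lam q p η) (hq : q ≠ 0) (M : ℝ) :
    Tendsto (fun z : ℂ => stripMap η q z / realRoot q z.re) (stripFilter M)
      (𝓝 (rayUnit q p / lam)) := by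
  have h1 := (hη.tendsto_div.comp (tendsto_stripRoot hq M)).mul (tendsto_stripRoot_div_norm q M)
  have h2 := h1.mul ((Complex.continuous_ofReal.tendsto _).comp (tendsto_norm_stripRoot_div (q := q) M))
  rw [Complex.ofReal_one, mul_one, mul_one] at h2
  refine h2.congr fun z => ?_
  have h3 := stripRoot_ne_zero q z
  have h4 : (‖stripRoot q z‖ : ℂ) ≠ 0 := by exact_mod_cast norm_ne_zero_iff.2 h3
  simp only [Function.comp, stripMap]
  push_cast
  field_simp

theorem arg_ray {q p : ℕ} {lam : ℂ} (hlam : lam ≠ 0) :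
    (Complex.arg (rayUnit q p / lam) : Real.Angle) = radiusAngle q lam p := by
  rw [Complex.arg_div_coe_angle (rayUnit_ne_zero _ _) hlam, arg_rayUnit, radiusAngle,
    Real.Angle.coe_sub]

theorem eq_of_mem_sector_singleton {q p : ℕ} {lam : ℂ} (hlam : ‖lam‖ = 1) {x : ℂ}
    (hx : x ∈ sector {radiusAngle q lam p}) : x = ‖x‖ * (rayUnit q p / lam) := by
  have hlam0 : lam ≠ 0 := norm_pos_iff.1 (hlam ▸ one_pos)
  have hu : rayUnit q p / lam ≠ 0 := div_ne_zero (rayUnit_ne_zero _ _) hlam0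
  have hx0 : x ≠ 0 := norm_pos_iff.1 hx.1
  have h : (Complex.arg x : Real.Angle) = Complex.arg (rayUnit q p / lam) := by
    rw [arg_ray hlam0]; exact hx.2.2
  have h2 := (Complex.arg_eq_arg_iff hu hx0).1 (Complex.arg_coe_angle_eq_iff.1 h).symm
  rw [norm_div, norm_rayUnit, hlam, div_one, Complex.ofReal_one, div_one] at h2
  exact h2.symm

theorem mem_sector_singleton {q p : ℕ} {lam : ℂ} (hlam : ‖lam‖ = 1) {r : ℝ} (hr : 0 < r)
    (hr1 : r < 1) : (r : ℂ) * (rayUnit q p / lam) ∈ sector {radiusAngle q lam p} := by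
  have hlam0 : lam ≠ 0 := norm_pos_iff.1 (hlam ▸ one_pos)
  have hn : ‖(r : ℂ) * (rayUnit q p / lam)‖ = r := by
    rw [norm_mul, norm_div, norm_rayUnit, hlam, div_one, mul_one, Complex.norm_real,
      Real.norm_of_nonneg hr.le]
  refine ⟨by rwa [hn], by rwa [hn], ?_⟩
  rw [Complex.arg_real_mul _ hr, arg_ray hlam0]
  exact Set.mem_singleton _

namespace IsFlowSetup
variable {E : Type*} [NormedAddCommGroup E] [InnerProductSpace ℂ E] [FiniteDimensional ℂ E]
  {Γ : AddSubgroup E} {f : ℂ → E} {k : ℕ} {d : ℕ → ℕ} {v : ℕ → E} {κ : ℕ}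
  {lam : ℂ} {H : E →ₗ[ℂ] ℂ} {ξ : ℂ → ℂ} {p m : ℕ} {δ : ℕ → ℕ} {ϑ : ℕ → E} {η : ℂ → ℂ}

theorem eventually_hasDerivAt_stripMap (S : IsFlowSetup Γ f k d v κ lam H ξ)
    (hη : IsRayParam ξ lam (d κ) p η) (M : ℝ) : ∀ᶠ z in stripFilter M,
      HasDerivAt (stripMap η (d κ)) (deriv (stripMap η (d κ)) z) z ∧
      ‖deriv (fun z => f (stripMap η (d κ) z)) z‖ =
        ‖deriv (stripMap η (d κ)) z‖ * ‖deriv f (stripMap η (d κ) z)‖ := by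
  filter_upwards [((tendsto_stripRoot S.pole_ne_zero M).mono_right nhdsWithin_le_nhds).eventually
    hη.analyticAt.eventually_analyticAt, eventually_re_pos_stripFilter M,
    (S.tendsto_stripMap hη M).eventually S.diff] with z h1 h2 h3
  have h4 : HasDerivAt (stripMap η (d κ)) (deriv (stripMap η (d κ)) z) z := by
    have : DifferentiableAt ℂ (stripMap η (d κ)) z :=
      DifferentiableAt.comp (f := stripRoot (d κ)) (g := η) z h1.differentiableAt
        (hasDerivAt_stripRoot _ S.pole_ne_zero (Or.inl h2)).differentiableAt
    exact this.hasDerivAt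
  refine ⟨h4, ?_⟩
  have h5 : HasDerivAt (fun z => f (stripMap η (d κ) z)) _ z := h3.hasDerivAt.scomp z h4
  rw [h5.deriv, norm_smul]

theorem le_first (S : IsFlowSetup Γ f k d v κ lam H ξ) : d κ ≤ d 1 := by
  rcases S.one_le.eq_or_lt with h | h
  · rw [← h]
  · exact (S.flag.lt_of_lt le_rfl h (by have := S.le_k; omega)).le

/-- The pole of f has order d_1 and differentiation in z lowers it by d_κ. The limiting constant is
nonzero because v_1 ≠ 0 and d_1 ≠ 0. -/
theorem exists_tendsto_norm_deriv (S : IsFlowSetup Γ f k d v κ lam H ξ)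
    (hη : IsRayParam ξ lam (d κ) p η) : ∃ C : ℝ, 0 < C ∧ ∀ M : ℝ,
      Tendsto (fun z => ‖stripRoot (d κ) z‖ ^ (d 1 - d κ) *
        ‖deriv (fun z => f (stripMap η (d κ) z)) z‖) (stripFilter M) (𝓝 C) := by
  have := FiniteDimensional.complete ℂ E
  have hq := S.pole_ne_zero
  have hk : 1 ≤ k := S.one_le.trans S.le_k
  obtain ⟨A, hA, hA0, hf⟩ := S.exists_laurent hη LinearMap.id
    (S.flag.tendsto LinearMap.id le_rfl hk (fun i hi hi' => absurd hi' (by omega)))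
  have hv1 : v 1 ≠ 0 := S.flag.indep.ne_zero ⟨le_rfl, hk⟩
  have hD : d 1 ≠ 0 := (S.flag.pos le_rfl hk).ne'
  set A₁ := zpowDeriv (d κ) (-(d 1 : ℤ)) A with hA₁
  have a1 : AnalyticAt ℂ A₁ 0 := analyticAt_zpowDeriv hA
  have a10 : A₁ 0 ≠ 0 := by
    rw [hA₁, zpowDeriv_zero, hA0]
    refine smul_ne_zero (div_ne_zero ?_ (by exact_mod_cast hq)) (smul_ne_zero (pow_ne_zero _
      (div_ne_zero S.lam_ne_zero (rayUnit_ne_zero _ _))) hv1)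
    push_cast; rw [neg_neg]; exact_mod_cast hD
  refine ⟨‖A₁ 0‖, norm_pos_iff.2 a10, fun M => ?_⟩
  have h1 := (tendsto_zpow_smul hq M (-(d 1 : ℤ) + d κ) a1.continuousAt).norm
  refine h1.congr' ?_
  have hf' : ∀ᶠ y in 𝓝[≠] (0 : ℂ), ∀ᶠ y' in 𝓝 y, f (η y') = y' ^ (-(d 1 : ℤ)) • A y' := by
    have := eventually_eventually_nhdsWithin.2 hf
    filter_upwards [this, self_mem_nhdsWithin] with y hy hy0
    rwa [isOpen_compl_singleton.nhdsWithin_eq hy0] at hy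
  have hroot := tendsto_stripRoot hq M
  filter_upwards [hroot.eventually hf', eventually_re_pos_stripFilter M,
    (hroot.mono_right nhdsWithin_le_nhds).eventually hA.eventually_analyticAt] with z h2 h3 h4
  have h5 := hasDerivAt_zpow_smul hq (-(d 1 : ℤ)) (Or.inl h3) h4.differentiableAt
  have h6 := h5.congr_of_eventuallyEq
    ((hasDerivAt_stripRoot _ hq (Or.inl h3)).continuousAt.eventually h2)
  have h7 : deriv (fun z => f (stripMap η (d κ) z)) z = _ := h6.deriv
  rw [h7, norm_smul (‖stripRoot (d κ) z‖ ^ (-(d 1 : ℤ) + d κ))⁻¹]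
  congr 1
  have e : (-(d 1 : ℤ) + d κ) = -((d 1 - d κ : ℕ) : ℤ) := by have := S.le_first; omega
  rw [e, zpow_neg, inv_inv, zpow_natCast, norm_pow, norm_norm]

end IsFlowSetup

/-! ### Densities of the rescaled measures. -/

/-- The asymptotic density of the measures, as a function of the rescaled coordinate. -/
noncomputable def flowWeight (U : Set ℂ) (u : ℂ) (q n : ℕ) (C : ℝ) (s : ℝ) : ℝ :=
  2 * C ^ 2 * (realRoot q s ^ (2 * n))⁻¹ * U.indicator (fun _ => (1 : ℝ)) (realRoot q s * u)

/-- The density of the measures in the strip coordinate. -/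
noncomputable def stripDensity {E : Type*} [NormedAddCommGroup E] [InnerProductSpace ℂ E]
    (f : ℂ → E) (η : ℂ → ℂ) (U : Set ℂ) (q n : ℕ) (N : ℝ) (x : ℝ × ℝ) : ℝ :=
  2 * realRoot q N ^ (2 * n) * ‖deriv (fun z => f (stripMap η q z)) ⟨N * x.1, x.2⟩‖ ^ 2 *
    U.indicator (fun _ => (1 : ℝ)) (stripMap η q ⟨N * x.1, x.2⟩ / realRoot q N)

theorem indicator_one_mem_Icc (U : Set ℂ) (z : ℂ) :
    0 ≤ U.indicator (fun _ => (1 : ℝ)) z ∧ U.indicator (fun _ => (1 : ℝ)) z ≤ 1 := by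
  by_cases h : z ∈ U <;> simp [h]

theorem tendsto_indicator_of_notMem_frontier {ι : Type*} {l : Filter ι} {U : Set ℂ} {z : ℂ}
    (hz : z ∉ frontier U) {g : ι → ℂ} (hg : Tendsto g l (𝓝 z)) :
    Tendsto (fun i => U.indicator (fun _ => (1 : ℝ)) (g i)) l (𝓝 (U.indicator (fun _ => 1) z)) := by
  refine tendsto_nhds_of_eventually_eq ?_
  by_cases h : z ∈ interior U
  · filter_upwards [hg.eventually (mem_interior_iff_mem_nhds.1 h)] with i hi
    rw [Set.indicator_of_mem hi, Set.indicator_of_mem (interior_subset h)]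
  · have h' : z ∉ closure U := fun hc => hz ⟨hc, h⟩
    filter_upwards [hg.eventually (isClosed_closure.isOpen_compl.mem_nhds h')] with i hi
    rw [Set.indicator_of_notMem (fun hm => hi (subset_closure hm)),
      Set.indicator_of_notMem (fun hm => h' (subset_closure hm))]

section admissible
variable {Θ : Set Real.Angle} {U : Set ℂ} {q p : ℕ} {lam : ℂ}

theorem IsAdmissibleOpen.exists_norm_bound (hU : IsAdmissibleOpen Θ (radiusAngle q lam p) U) :
    ∃ r : ℝ, 0 < r ∧ ∀ x ∈ U, r ≤ ‖x‖ ∧ ‖x‖ < 1 := by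
  have hne : (closure U).Nonempty := hU.inter_nonempty.mono fun x hx => subset_closure hx.1
  obtain ⟨x₀, hx₀, hmin⟩ := hU.isCompact.exists_isMinOn hne continuous_norm.continuousOn
  refine ⟨‖x₀‖, norm_pos_iff.2 (hU.closure_subset hx₀).2, fun x hx => ?_⟩
  have hx' := subset_closure hx
  refine ⟨hmin hx', ?_⟩
  simpa using (hU.closure_subset hx').1

/-- Transversality makes the radius meet each of the finitely many boundary arcs in a countable set,
and `realRoot` is injective on positive reals. -/
theorem IsAdmissibleOpen.countable_frontier (hU : IsAdmissibleOpen Θ (radiusAngle q lam p) U)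
    (hq : q ≠ 0) (hlam : ‖lam‖ = 1) :
    {s : ℝ | 0 < s ∧ (realRoot q s : ℂ) * (rayUnit q p / lam) ∈ frontier U}.Countable := by
  obtain ⟨n, γ, hγ, hfr, htr⟩ := hU.boundary
  have hlam0 : lam ≠ 0 := norm_pos_iff.1 (hlam ▸ one_pos)
  have hu : rayUnit q p / lam ≠ 0 := div_ne_zero (rayUnit_ne_zero _ _) hlam0
  set B : Set ℝ := {r | 0 < r ∧ (r : ℂ) * (rayUnit q p / lam) ∈ frontier U} with hB
  have hBc : B.Countable := by
    have : B ⊆ ⋃ i, {r : ℝ | 0 < r ∧ (r : ℂ) * (rayUnit q p / lam) ∈ γ i '' Set.Icc 0 1} := by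
      rintro r ⟨hr, hrf⟩
      rw [hfr, Set.mem_iUnion] at hrf
      obtain ⟨i, hi⟩ := hrf
      exact Set.mem_iUnion.2 ⟨i, hr, hi⟩
    refine (Set.countable_iUnion fun i => countable_ray_inter_arc (hγ i) hu ?_).mono this
    rintro t ht ⟨r, hr, hrt⟩
    refine htr i t ht ?_
    have h1 : γ i t ∈ closure U := frontier_subset_closure (hfr ▸ Set.mem_iUnion.2 ⟨i, t, ht, rfl⟩)
    have h2 : ‖γ i t‖ < 1 := by simpa using (hU.closure_subset h1).1
    rw [hrt] at h2 ⊢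
    refine mem_sector_singleton hlam hr ?_
    rwa [norm_mul, norm_div, norm_rayUnit, hlam, div_one, mul_one, Complex.norm_real,
      Real.norm_of_nonneg hr.le] at h2
  refine Set.MapsTo.countable_of_injOn (f := realRoot q) (t := B) ?_
    ((realRoot_injOn hq).mono fun s hs => hs.1) hBc
  exact fun s hs => ⟨realRoot_pos _ _, hs.2⟩

theorem norm_ray (hlam : ‖lam‖ = 1) (s : ℝ) :
    ‖(realRoot q s : ℂ) * (rayUnit q p / lam)‖ = realRoot q s := by
  rw [norm_mul, norm_div, norm_rayUnit, hlam, div_one, mul_one, Complex.norm_real,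
      Real.norm_of_nonneg (realRoot_pos _ _).le]

/-- Bounds the rescaled variable S independently of a. The factor t allows for the distortion
between |x| and (Re z)^{-1/q}, which tends to 1. -/
theorem IsAdmissibleOpen.exists_range (hU : IsAdmissibleOpen Θ (radiusAngle q lam p) U)
    (hq : q ≠ 0) :
    ∃ α β : ℝ, 0 < α ∧ α < β ∧ ∀ s t : ℝ, 0 < s → t ∈ Set.Icc (1 / 2 : ℝ) 2 → ∀ x ∈ U,
      ‖x‖ = t * realRoot q s → α < s ∧ s < β := by
  obtain ⟨r, hr, hrU⟩ := hU.exists_norm_bound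
  obtain ⟨x₀, hx₀, -⟩ := hU.inter_nonempty
  have hr1 : r < 1 := (hrU x₀ hx₀).1.trans_lt (hrU x₀ hx₀).2
  -- From r ≤ ‖x‖ < 1 and 1/2 ≤ t ≤ 2 the root of s lies in [r/2, 2), strictly inside (r/4, 4); the
  -- end points are the preimages of 4 and r/4.
  refine ⟨((4 : ℝ) ^ q)⁻¹, ((r / 4) ^ q)⁻¹, by positivity, ?_, ?_⟩
  · gcongr; linarith
  · intro s t hs ht x hx hxt
    have ht0 : 0 < t := by linarith [ht.1]
    have e1 : realRoot q s = ‖x‖ / t := by rw [hxt]; field_simp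
    have h1 : realRoot q s < 4 := by
      rw [e1, div_lt_iff₀ ht0]; linarith [(hrU x hx).2, ht.1]
    have h2 : r / 4 < realRoot q s := by
      rw [e1, lt_div_iff₀ ht0]; nlinarith [(hrU x hx).1, ht.2]
    constructor
    · by_contra h
      push Not at h
      have := (realRoot_le_iff hq (by positivity) hs).2 h
      rw [realRoot_inv_pow hq (by norm_num)] at this
      linarith
    · by_contra h
      push Not at h
      have := (realRoot_le_iff hq hs (by positivity)).2 h
      rw [realRoot_inv_pow hq (by positivity)] at this
      linarith

variable {α β C : ℝ} {n : ℕ}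

theorem measurable_realRoot (q : ℕ) : Measurable (realRoot q) := by
  unfold realRoot; fun_prop

theorem measurable_flowWeight (hU : IsOpen U) (u : ℂ) : Measurable (flowWeight U u q n C) := by
  unfold flowWeight
  have h := measurable_realRoot q
  have h2 : Measurable fun s => ((realRoot q s : ℝ) : ℂ) * u :=
    (Complex.measurable_ofReal.comp h).mul_const u
  exact ((h.pow_const _).inv.const_mul _).mul
    ((measurable_const.indicator hU.measurableSet).comp h2)

theorem flowWeight_nonneg (u : ℂ) (s : ℝ) : 0 ≤ flowWeight U u q n C s := by
  have := realRoot_pos q s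
  exact mul_nonneg (by positivity) (indicator_one_mem_Icc U _).1

theorem flowWeight_le (hq : q ≠ 0) (u : ℂ) {s : ℝ} (hs : 0 < s) (hsβ : s ≤ β) :
    flowWeight U u q n C s ≤ 2 * C ^ 2 * (realRoot q β ^ (2 * n))⁻¹ := by
  have h1 := realRoot_pos q s
  have h2 := realRoot_pos q β
  have h3 := (realRoot_le_iff hq (hs.trans_le hsβ) hs).2 hsβ
  calc flowWeight U u q n C s ≤ 2 * C ^ 2 * (realRoot q s ^ (2 * n))⁻¹ * 1 :=
        mul_le_mul_of_nonneg_left (indicator_one_mem_Icc U _).2 (by positivity)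
    _ ≤ _ := by rw [mul_one]; gcongr

theorem integrableOn_flowWeight (hU : IsOpen U) (hq : q ≠ 0) (u : ℂ) (hα : 0 < α) :
    IntegrableOn (flowWeight U u q n C) (Set.Ioc α β) := by
  refine Integrable.of_bound (measurable_flowWeight hU u).aestronglyMeasurable
    (2 * C ^ 2 * (realRoot q β ^ (2 * n))⁻¹) ?_
  refine (ae_restrict_iff' measurableSet_Ioc).2 (Eventually.of_forall fun s hs => ?_)
  rw [Real.norm_of_nonneg (flowWeight_nonneg u s)]
  exact flowWeight_le hq u (hα.trans hs.1) hs.2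

theorem integral_flowWeight_pos (hU : IsOpen U) (hq : q ≠ 0) (hC : 0 < C) (hα : 0 < α) {u : ℂ}
    (h : ∀ s, 0 < s → (realRoot q s : ℂ) * u ∈ U → α < s ∧ s < β)
    (hne : ∃ s, 0 < s ∧ (realRoot q s : ℂ) * u ∈ U) :
    0 < ∫ s in Set.Ioc α β, flowWeight U u q n C s := by
  rw [setIntegral_pos_iff_support_of_nonneg_ae (Eventually.of_forall fun s => flowWeight_nonneg u s)
    (integrableOn_flowWeight hU hq u hα)]
  have hopen : IsOpen {s : ℝ | 0 < s ∧ (realRoot q s : ℂ) * u ∈ U} := by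
    have hc : ContinuousOn (fun s : ℝ => (realRoot q s : ℂ) * u) (Set.Ioi 0) :=
      (Complex.continuous_ofReal.comp_continuousOn (continuousOn_realRoot q)).mul continuousOn_const
    exact hc.isOpen_inter_preimage isOpen_Ioi hU
  refine (hopen.measure_pos volume hne).trans_le (measure_mono ?_)
  rintro s ⟨hs, hsU⟩
  refine ⟨?_, (h s hs hsU).1, (h s hs hsU).2.le⟩
  have h1 := realRoot_pos q s
  rw [Function.mem_support, flowWeight, Set.indicator_of_mem hsU]
  positivity

end admissible

namespace IsFlowSetup
variable {E : Type*} [NormedAddCommGroup E] [InnerProductSpace ℂ E] [FiniteDimensional ℂ E]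
  {Γ : AddSubgroup E} {f : ℂ → E} {k : ℕ} {d : ℕ → ℕ} {v : ℕ → E} {κ : ℕ}
  {lam : ℂ} {H : E →ₗ[ℂ] ℂ} {ξ : ℂ → ℂ} {p m : ℕ} {δ : ℕ → ℕ} {ϑ : ℕ → E} {η : ℂ → ℂ}
  {Θ : Set Real.Angle} {U : Set ℂ} {α β M C : ℝ}

theorem continuousOn_strip {X : Type*} [TopologicalSpace X] {g : ℂ → X} {N : ℝ}
    (h : ∀ s, α ≤ s → ∀ τ, |τ| ≤ M → ContinuousAt g ⟨N * s, τ⟩) :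
    ContinuousOn (fun x : ℝ × ℝ => g ⟨N * x.1, x.2⟩) (Set.Ioc α β ×ˢ Set.Ioc (-M) M) := by
  rintro ⟨s, τ⟩ ⟨hs, hτ⟩
  refine ContinuousAt.continuousWithinAt ?_
  have h1 : Continuous fun x : ℝ × ℝ => (⟨N * x.1, x.2⟩ : ℂ) := by
    simp only [Complex.mk_eq_add_mul_I]; fun_prop
  exact ContinuousAt.comp (g := g) (f := fun x : ℝ × ℝ => (⟨N * x.1, x.2⟩ : ℂ))
    (h s hs.1.le τ (abs_le.2 ⟨hτ.1.le, hτ.2⟩)) h1.continuousAt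

theorem eventually_aestronglyMeasurable_stripDensity (S : IsFlowSetup Γ f k d v κ lam H ξ)
    (hη : IsRayParam ξ lam (d κ) p η) (hU : IsOpen U) (n : ℕ) (hα : 0 < α) :
    ∀ᶠ N : ℝ in atTop, AEStronglyMeasurable (stripDensity f η U (d κ) n N)
      ((volume.restrict (Set.Ioc α β)).prod (volume.restrict (Set.Ioc (-M) M))) := by
  have := FiniteDimensional.complete ℂ E
  borelize E
  filter_upwards [eventually_forall_strip (S.eventually_hasDerivAt_stripMap hη M) hα] with N hN
  have h1 : Continuous fun x : ℝ × ℝ => (⟨N * x.1, x.2⟩ : ℂ) := by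
    simp only [Complex.mk_eq_add_mul_I]; fun_prop
  have h2 : Measurable fun x : ℝ × ℝ =>
      2 * realRoot (d κ) N ^ (2 * n) * ‖deriv (fun z => f (stripMap η (d κ) z)) ⟨N * x.1, x.2⟩‖ ^ 2 :=
    ((((measurable_deriv _).comp h1.measurable).norm).pow_const 2).const_mul _
  have h3 : AEMeasurable (fun x : ℝ × ℝ => stripMap η (d κ) ⟨N * x.1, x.2⟩ / realRoot (d κ) N)
      ((volume.restrict (Set.Ioc α β)).prod (volume.restrict (Set.Ioc (-M) M))) := by
    rw [Measure.prod_restrict]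
    exact ((continuousOn_strip fun s hs τ hτ => (hN s hs τ hτ).1.continuousAt).aemeasurable
      (measurableSet_Ioc.prod measurableSet_Ioc)).div_const _
  exact (h2.aemeasurable.mul ((measurable_const.indicator hU.measurableSet).comp_aemeasurable
    h3)).aestronglyMeasurable

/-- Pointwise convergence off the boundary of U together with a uniform bound. The limit does not
depend on τ, as the strip becomes infinitely thin after rescaling. -/
theorem tendsto_integral_abs_sub (S : IsFlowSetup Γ f k d v κ lam H ξ)
    (hη : IsRayParam ξ lam (d κ) p η) (hU : IsAdmissibleOpen Θ (radiusAngle (d κ) lam p) U)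
    (hα : 0 < α) (hC : 0 < C) (hF : Tendsto (fun z => ‖stripRoot (d κ) z‖ ^ (d 1 - d κ) *
        ‖deriv (fun z => f (stripMap η (d κ) z)) z‖) (stripFilter M) (𝓝 C)) :
    (∀ᶠ N in atTop, Integrable (fun x => stripDensity f η U (d κ) (d 1 - d κ) N x -
        flowWeight U (rayUnit (d κ) p / lam) (d κ) (d 1 - d κ) C x.1)
      ((volume.restrict (Set.Ioc α β)).prod (volume.restrict (Set.Ioc (-M) M)))) ∧
    Tendsto (fun N : ℝ => ∫ x : ℝ × ℝ, |stripDensity f η U (d κ) (d 1 - d κ) N x -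
        flowWeight U (rayUnit (d κ) p / lam) (d κ) (d 1 - d κ) C x.1|
      ∂((volume.restrict (Set.Ioc α β)).prod (volume.restrict (Set.Ioc (-M) M)))) atTop (𝓝 0) := by
  have hq := S.pole_ne_zero
  set n := d 1 - d κ with hn
  set q := d κ with hqd
  set u := rayUnit q p / lam with hu
  set μ := (volume.restrict (Set.Ioc α β)).prod (volume.restrict (Set.Ioc (-M) M)) with hμ
  have hin : ∀ᵐ x : ℝ × ℝ ∂μ, (α < x.1 ∧ x.1 ≤ β) ∧ |x.2| ≤ M := by
    rw [hμ, Measure.prod_restrict]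
    refine (ae_restrict_iff' (measurableSet_Ioc.prod measurableSet_Ioc)).2
      (Eventually.of_forall fun x hx => ⟨⟨hx.1.1, hx.1.2⟩, abs_le.2 ⟨hx.2.1.le, hx.2.2⟩⟩)
  -- Off a countable set of S the limiting point on the radius avoids the frontier, so the indicator
  -- of U converges there.
  have hnull : ∀ᵐ x : ℝ × ℝ ∂μ, ¬ (0 < x.1 ∧ (realRoot q x.1 : ℂ) * u ∈ frontier U) := by
    have h1 : ∀ᵐ s ∂(volume.restrict (Set.Ioc α β)),
        ¬ (0 < s ∧ (realRoot q s : ℂ) * u ∈ frontier U) :=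
      ((hU.countable_frontier hq S.coord.norm_lam).ae_notMem volume).filter_mono
        (ae_mono Measure.restrict_le_self)
    exact Measure.quasiMeasurePreserving_fst.ae h1
  have hratio := tendsto_norm_stripRoot_div (q := q) M
  have hβ := realRoot_pos q β
  -- Valid once the ratio of the two radii is at least 1/2 and the normalized derivative is at most
  -- C + 1, using that the root of S is at least that of β.
  set B := 2 * ((2 / realRoot q β) ^ (2 * n) * (C + 1) ^ 2) with hB
  have hB0 : 0 ≤ B := by positivity
  set B' := 2 * C ^ 2 * (realRoot q β ^ (2 * n))⁻¹ with hB'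
  have hB'0 : 0 ≤ B' := by positivity
  -- the density in terms of the asymptotic quantities
  have hsplit : ∀ (N : ℝ) (x : ℝ × ℝ), 0 < N → 0 < x.1 →
      stripDensity f η U q n N x = 2 * (((‖stripRoot q ⟨N * x.1, x.2⟩‖ / realRoot q (N * x.1))⁻¹ *
        (realRoot q x.1)⁻¹) ^ (2 * n) * (‖stripRoot q ⟨N * x.1, x.2⟩‖ ^ n *
        ‖deriv (fun z => f (stripMap η q z)) ⟨N * x.1, x.2⟩‖) ^ 2) *
        U.indicator (fun _ => (1 : ℝ)) (stripMap η q ⟨N * x.1, x.2⟩ / realRoot q N) := by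
    intro N x hN hx
    have e1 := realRoot_pos q N
    have e2 := realRoot_pos q x.1
    have e3 : 0 < ‖stripRoot q ⟨N * x.1, x.2⟩‖ := norm_pos_iff.2 (stripRoot_ne_zero _ _)
    rw [stripDensity, realRoot_mul q hN hx]
    congr 1
    rw [mul_pow _ _ 2, ← pow_mul, mul_comm n 2, ← mul_assoc (_ ^ (2 * n)), ← mul_pow,
      mul_assoc 2]
    congr 3
    field_simp
  have hpt : ∀ᵐ x : ℝ × ℝ ∂μ, Tendsto (fun N => |stripDensity f η U q n N x -
      flowWeight U u q n C x.1|) atTop (𝓝 0) := by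
    filter_upwards [hin, hnull] with x hx hx'
    have hx0 : 0 < x.1 := hα.trans hx.1.1
    have hz := tendsto_strip (M := M) hx0 hx.2
    have e2 := realRoot_pos q x.1
    have t1 := (((hratio.comp hz).inv₀ one_ne_zero).mul_const (realRoot q x.1)⁻¹).pow (2 * n)
    have t2 := (hF.comp hz).pow 2
    have t3 : Tendsto (fun N : ℝ => stripMap η q ⟨N * x.1, x.2⟩ / realRoot q N) atTop
        (𝓝 (realRoot q x.1 * u)) := by
      have := ((hη.tendsto_stripMap_div hq M).comp hz).mul_const (realRoot q x.1 : ℂ)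
      rw [mul_comm] at this
      refine this.congr' ?_
      filter_upwards [eventually_gt_atTop 0] with N hN
      have e1 : (realRoot q N : ℂ) ≠ 0 := by exact_mod_cast (realRoot_pos q N).ne'
      have e2 : (realRoot q x.1 : ℂ) ≠ 0 := by exact_mod_cast (realRoot_pos q x.1).ne'
      simp only [Function.comp]
      rw [realRoot_mul q hN hx0]
      push_cast; field_simp
    have t4 := ((t1.mul t2).const_mul 2).mul (tendsto_indicator_of_notMem_frontier
      (fun h => hx' ⟨hx0, h⟩) t3)
    have t5 := (t4.sub_const (flowWeight U u q n C x.1)).abs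
    have e3 : 2 * ((1⁻¹ * (realRoot q x.1)⁻¹) ^ (2 * n) * C ^ 2) *
        U.indicator (fun _ => (1 : ℝ)) (realRoot q x.1 * u) - flowWeight U u q n C x.1 = 0 := by
      rw [flowWeight, inv_one, one_mul, inv_pow]; ring
    rw [e3, abs_zero] at t5
    refine t5.congr' ?_
    filter_upwards [eventually_gt_atTop 0] with N hN
    rw [hsplit N x hN hx0]; rfl
  have hmeas : ∀ᶠ N in atTop, AEStronglyMeasurable (fun x : ℝ × ℝ => stripDensity f η U q n N x -
      flowWeight U u q n C x.1) μ := by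
    filter_upwards [S.eventually_aestronglyMeasurable_stripDensity hη hU.isOpen n hα] with N hN
    exact hN.sub ((measurable_flowWeight hU.isOpen u).comp
      measurable_fst).aestronglyMeasurable
  have hbound : ∀ᶠ N in atTop, ∀ᵐ x ∂μ, ‖stripDensity f η U q n N x -
      flowWeight U u q n C x.1‖ ≤ B + B' := by
    have h2 : ∀ᶠ z in stripFilter M, 1 / 2 ≤ ‖stripRoot q z‖ / realRoot q z.re ∧
        ‖stripRoot q z‖ ^ n * ‖deriv (fun z => f (stripMap η q z)) z‖ ≤ C + 1 :=
      (hratio.eventually_const_le (by norm_num)).and (hF.eventually_le_const (by linarith))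
    filter_upwards [eventually_forall_strip h2 hα, eventually_gt_atTop 0] with N hN hN0
    filter_upwards [hin] with x hx
    have hx0 : 0 < x.1 := hα.trans hx.1.1
    obtain ⟨h3, h4⟩ := hN x.1 hx.1.1.le x.2 hx.2
    have e2 := realRoot_pos q x.1
    have h5 : realRoot q β ≤ realRoot q x.1 := (realRoot_le_iff hq (hx0.trans_le hx.1.2) hx0).2 hx.1.2
    have h3' : 1 / 2 ≤ ‖stripRoot q ⟨N * x.1, x.2⟩‖ / realRoot q (N * x.1) := h3
    have h6 : (‖stripRoot q ⟨N * x.1, x.2⟩‖ / realRoot q (N * x.1))⁻¹ ≤ 2 := by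
      rw [inv_le_comm₀ (by linarith) (by norm_num)]; linarith
    have h7 : 0 ≤ (‖stripRoot q ⟨N * x.1, x.2⟩‖ / realRoot q (N * x.1))⁻¹ := by
      rw [inv_nonneg]; linarith
    have h8 : stripDensity f η U q n N x ≤ B := by
      rw [hsplit N x hN0 hx0, hB]
      refine (mul_le_of_le_one_right (by positivity) (indicator_one_mem_Icc U _).2).trans ?_
      have h9 : (‖stripRoot q ⟨N * x.1, x.2⟩‖ / realRoot q (N * x.1))⁻¹ * (realRoot q x.1)⁻¹ ≤
          2 / realRoot q β := by
        rw [div_eq_mul_inv 2 (realRoot q β)]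
        exact mul_le_mul h6 (inv_anti₀ hβ h5) (inv_nonneg.2 e2.le) (by norm_num)
      gcongr
    have h9 : 0 ≤ stripDensity f η U q n N x := by
      rw [hsplit N x hN0 hx0]
      exact mul_nonneg (by positivity) (indicator_one_mem_Icc U _).1
    have h10 : flowWeight U u q n C x.1 ≤ B' := flowWeight_le hq u hx0 hx.1.2
    have h11 : 0 ≤ flowWeight U u q n C x.1 := flowWeight_nonneg u x.1
    rw [Real.norm_eq_abs, abs_le]
    constructor <;> linarith
  refine ⟨?_, ?_⟩
  · filter_upwards [hmeas, hbound] with N h1 h2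
    exact Integrable.of_bound h1 _ h2
  · have h0 := tendsto_integral_filter_of_dominated_convergence (μ := μ) (fun _ => B + B')
      (F := fun (N : ℝ) x => |stripDensity f η U q n N x - flowWeight U u q n C x.1|)
      (f := fun _ => (0 : ℝ)) (l := atTop) (hmeas.mono fun N hN => hN.norm)
      (hbound.mono fun N hN => hN.mono fun x hx => by rwa [Real.norm_eq_abs, abs_abs])
      (integrable_const _) hpt
    simpa using h0

end IsFlowSetup

/-! ### Convergence of the flow measures. -/

theorem integral_flowMeasure {E : Type*} [NormedAddCommGroup E] [InnerProductSpace ℂ E]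
    [FiniteDimensional ℂ E] [MeasurableSpace E] [BorelSpace E] {Γ : AddSubgroup E}
    [DiscreteTopology Γ] {f : ℂ → E} (d : ℕ → ℕ) (κ : ℕ) {U : Set ℂ} {a : ℝ} (ha : 0 < a)
    (hU : MeasurableSet ((fun x : ℂ => (a : ℂ) * x) '' U))
    (hf : ContinuousOn f ((fun x : ℂ => (a : ℂ) * x) '' U))
    {φ : E ⧸ Γ → ℝ} (hφ : Continuous φ) :
    ∫ y, φ y ∂(flowMeasure Γ f d κ U a) = a ^ (2 * d 1) / a ^ d κ *
      ∫ x in (fun x : ℂ => (a : ℂ) * x) '' U, 2 * ‖deriv f x‖ ^ 2 * φ (f x : E ⧸ Γ) := by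
  have := FiniteDimensional.complete ℂ E
  have hmk : Continuous (fun e : E => (e : E ⧸ Γ)) := continuous_quot_mk
  have hm : Measurable fun x => ENNReal.ofReal (2 * ‖deriv f x‖ ^ 2) :=
    ((((measurable_deriv f).norm).pow_const 2).const_mul 2).ennreal_ofReal
  have h1 : AEMeasurable (fun x => (f x : E ⧸ Γ))
      ((volume.restrict ((fun x : ℂ => (a : ℂ) * x) '' U)).withDensity
        (fun x => ENNReal.ofReal (2 * ‖deriv f x‖ ^ 2))) :=
    ((hmk.comp_continuousOn hf).aemeasurable hU).mono_ac (withDensity_absolutelyContinuous _ _)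
  rw [flowMeasure, integral_smul_measure, ENNReal.toReal_ofReal (by positivity), smul_eq_mul,
    integral_map h1 hφ.aestronglyMeasurable,
    integral_withDensity_eq_integral_toReal_smul₀ hm.aemeasurable
      (Eventually.of_forall fun _ => ENNReal.ofReal_lt_top)]
  congr 1
  refine integral_congr_ae (Eventually.of_forall fun x => ?_)
  beta_reduce
  rw [ENNReal.toReal_ofReal (by positivity), smul_eq_mul]

theorem tendsto_inv_pow_nhdsGT {q : ℕ} (hq : q ≠ 0) :
    Tendsto (fun a : ℝ => (a ^ q)⁻¹) (𝓝[>] 0) atTop := by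
  have : Tendsto (fun a : ℝ => a⁻¹ ^ q) (𝓝[>] 0) atTop :=
    (tendsto_pow_atTop hq).comp tendsto_inv_nhdsGT_zero
  exact this.congr fun a => inv_pow a q

namespace IsFlowSetup
variable {E : Type*} [NormedAddCommGroup E] [InnerProductSpace ℂ E] [FiniteDimensional ℂ E]
  [MeasurableSpace E] [BorelSpace E]
  {Γ : AddSubgroup E} [DiscreteTopology Γ] {f : ℂ → E} {k : ℕ} {d : ℕ → ℕ} {v : ℕ → E} {κ : ℕ}
  {lam : ℂ} {H : E →ₗ[ℂ] ℂ} {ξ : ℂ → ℂ} {p m : ℕ} {δ : ℕ → ℕ} {ϑ : ℕ → E} {η : ℂ → ℂ}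
  {Θ : Set Real.Angle} {U : Set ℂ} {α β M C : ℝ}

/-- Since φ is bounded, L¹ convergence of the densities lets the limiting weight replace the true
one in the equidistribution statement. -/
theorem tendsto_integral_strip_density (S : IsFlowSetup Γ f k d v κ lam H ξ)
    (hη : IsRayParam ξ lam (d κ) p η) (hrad : IsRadialExpansion f d v κ lam ξ p m δ ϑ)
    (hΓ : radialSpace v κ ϑ m ≤ realSpan Γ)
    (ν₀ : Measure (torusClosure Γ (radialSpace v κ ϑ m))) [ν₀.IsAddHaarMeasure]
    [IsProbabilityMeasure ν₀] (hU : IsAdmissibleOpen Θ (radiusAngle (d κ) lam p) U)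
    (hα : 0 < α) (hαβ : α ≤ β) (hM : 0 ≤ M)
    (hC : 0 < C) (hF : Tendsto (fun z => ‖stripRoot (d κ) z‖ ^ (d 1 - d κ) *
        ‖deriv (fun z => f (stripMap η (d κ) z)) z‖) (stripFilter M) (𝓝 C))
    {φ : E ⧸ Γ → ℝ} (hφ : Continuous φ) {b : ℝ} (hb : ∀ y, |φ y| ≤ b) :
    Tendsto (fun N : ℝ => ∫ x : ℝ × ℝ, φ (f (stripMap η (d κ) ⟨N * x.1, x.2⟩) : E ⧸ Γ) *
        stripDensity f η U (d κ) (d 1 - d κ) N x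
      ∂((volume.restrict (Set.Ioc α β)).prod (volume.restrict (Set.Ioc (-M) M)))) atTop
      (𝓝 ((∫ τ in Set.Ioc (-M) M, ∫ g, φ ((ϑ (m + 1) : E ⧸ Γ) + g +
        ((τ • (Complex.I • ϑ 0) : E) : E ⧸ Γ)) ∂ν₀) * ∫ s in Set.Ioc α β,
          flowWeight U (rayUnit (d κ) p / lam) (d κ) (d 1 - d κ) C s)) := by
  have hmk : Continuous (fun e : E => (e : E ⧸ Γ)) := continuous_quot_mk
  have hq := S.pole_ne_zero
  have hw := integrableOn_flowWeight (q := d κ) (n := d 1 - d κ) (C := C) (β := β) hU.isOpen hq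
    (rayUnit (d κ) p / lam) hα
  have h1 := S.tendsto_integral_strip hη hrad hΓ ν₀ hα hαβ hM hw hφ hb
  obtain ⟨hint, hlim⟩ := S.tendsto_integral_abs_sub (β := β) hη hU hα hC hF
  have h2 := hlim.const_mul b
  rw [mul_zero] at h2
  set u := rayUnit (d κ) p / lam with hu
  set n := d 1 - d κ with hn
  set μ := (volume.restrict (Set.Ioc α β)).prod (volume.restrict (Set.Ioc (-M) M)) with hμ
  have hmeas : ∀ᶠ N : ℝ in atTop, AEStronglyMeasurable
      (fun x : ℝ × ℝ => φ (f (stripMap η (d κ) ⟨N * x.1, x.2⟩) : E ⧸ Γ)) μ :=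
    S.eventually_aestronglyMeasurable hη hα β M (hφ.comp hmk)
  have hwμ : Integrable (fun x : ℝ × ℝ => flowWeight U u (d κ) n C x.1) μ := hw.comp_fst _
  have h3 : Tendsto (fun N : ℝ => ∫ x : ℝ × ℝ, φ (f (stripMap η (d κ) ⟨N * x.1, x.2⟩) : E ⧸ Γ) *
        (stripDensity f η U (d κ) n N x - flowWeight U u (d κ) n C x.1) ∂μ) atTop (𝓝 0) := by
    refine squeeze_zero_norm' ?_ h2
    filter_upwards [hint] with N h3
    rw [← integral_const_mul]
    refine norm_integral_le_of_norm_le (h3.abs.const_mul b) (Eventually.of_forall fun x => ?_)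
    rw [norm_mul, Real.norm_eq_abs, Real.norm_eq_abs]
    exact mul_le_mul_of_nonneg_right (hb _) (abs_nonneg _)
  have h4 := h3.add h1
  rw [zero_add] at h4
  refine h4.congr' ?_
  filter_upwards [hint, hmeas] with N h5 h6
  have hbd : ∀ᵐ x ∂μ, ‖φ (f (stripMap η (d κ) ⟨N * x.1, x.2⟩) : E ⧸ Γ)‖ ≤ b :=
    Eventually.of_forall fun x => hb _
  rw [← integral_add (h5.bdd_mul h6 hbd) (hwμ.bdd_mul h6 hbd)]
  refine integral_congr_ae (Eventually.of_forall fun x => ?_)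
  beta_reduce; ring

/-- The measures in the strip coordinate. -/
theorem eventually_integral_flowMeasure_eq (S : IsFlowSetup Γ f k d v κ lam H ξ)
    (hf : ContinuousOn f (Metric.ball 0 1 \ {0}))
    {ηs : ℕ → ℂ → ℂ} (hη : ∀ p, IsRayParam ξ lam (d κ) p (ηs p)) (hΘ : IsClosed Θ)
    (huniq : ∀ q < 2 * d κ, IsGammaRadius Γ f d v κ lam ξ q → radiusAngle (d κ) lam q ∈ Θ → q = p)
    (hU : IsAdmissibleOpen Θ (radiusAngle (d κ) lam p) U) (hα : 0 < α)
    (hrange : ∀ s t : ℝ, 0 < s → t ∈ Set.Icc (1 / 2 : ℝ) 2 → ∀ x ∈ U,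
      ‖x‖ = t * realRoot (d κ) s → α < s ∧ s < β)
    {φ : E ⧸ Γ → ℝ} (hφ : Continuous φ) (hφc : HasCompactSupport φ)
    (hM : ∀ e : E, (e : E ⧸ Γ) ∈ tsupport φ → |(H e).im| < M) :
    ∀ᶠ a : ℝ in 𝓝[>] 0, ∫ y, φ y ∂(flowMeasure Γ f d κ U a) =
      ∫ x : ℝ × ℝ, φ (f (stripMap (ηs p) (d κ) ⟨(a ^ d κ)⁻¹ * x.1, x.2⟩) : E ⧸ Γ) *
        stripDensity f (ηs p) U (d κ) (d 1 - d κ) ((a ^ d κ)⁻¹) x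
      ∂((volume.restrict (Set.Ioc α β)).prod (volume.restrict (Set.Ioc (-M) M))) := by
  have hq := S.pole_ne_zero
  set q := d κ with hqd
  set η := ηs p with hηp
  have hratio : ∀ᶠ z in stripFilter M, ‖stripMap η q z‖ / realRoot q z.re ∈ Set.Icc (1 / 2 : ℝ) 2 := by
    have h1 := ((hη p).tendsto_stripMap_div hq M).norm
    rw [norm_div, norm_rayUnit, S.coord.norm_lam, div_one] at h1
    have h2 : Set.Icc (1 / 2 : ℝ) 2 ∈ 𝓝 (1 : ℝ) := Icc_mem_nhds (by norm_num) (by norm_num)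
    filter_upwards [h1.eventually h2] with z hz
    rwa [norm_div, Complex.norm_real, Real.norm_of_nonneg (realRoot_pos _ _).le] at hz
  have hstrip := ((S.coord_stripMap (hη p) M).and ((S.eventually_hasDerivAt_stripMap (hη p) M).and
    (S.eventually_continuousAt_stripMap (hη p) M))).and hratio
  obtain ⟨X₀, hX₀⟩ := eventually_stripFilter_iff.1 hstrip
  -- X₀ is where the strip asymptotics start, and the 1 guarantees Re z > 0.
  have hloc := S.eventually_stripMap_eq hη hΘ huniq hφc (max X₀ 1)
  rw [eventually_nhdsWithin_iff, Metric.eventually_nhds_iff] at hloc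
  obtain ⟨ε, hε, hloc⟩ := hloc
  obtain ⟨r, hr, hrU⟩ := hU.exists_norm_bound
  have hN := (tendsto_inv_pow_nhdsGT hq).eventually (eventually_forall_strip hstrip hα)
  have hsmall : ∀ᶠ a : ℝ in 𝓝[>] 0, a < min ε 1 :=
    (eventually_lt_nhds (lt_min hε one_pos)).filter_mono nhdsWithin_le_nhds
  filter_upwards [hN, self_mem_nhdsWithin, hsmall] with a hNa ha has
  have ha : 0 < a := ha
  have haε : a < ε := has.trans_le (min_le_left _ _)
  have ha1 : a < 1 := has.trans_le (min_le_right _ _)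
  have ha0 : (a : ℂ) ≠ 0 := by exact_mod_cast ha.ne'
  set N := (a ^ q)⁻¹ with hNd
  have hN0 : 0 < N := by positivity
  have hNroot : realRoot q N = a := realRoot_inv_pow hq ha
  set V := (fun x : ℂ => (a : ℂ) * x) '' U with hV
  have hVopen : IsOpen V := (Homeomorph.mulLeft₀ (a : ℂ) ha0).isOpenMap U hU.isOpen
  have hVmem : ∀ y, y ∈ V ↔ y / a ∈ U := by
    intro y
    constructor
    · rintro ⟨x, hx, rfl⟩
      beta_reduce
      rwa [mul_div_cancel_left₀ _ ha0]
    · intro hy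
      exact ⟨y / a, hy, mul_div_cancel₀ _ ha0⟩
  have hVsub : V ⊆ Metric.ball 0 1 \ {0} := by
    rintro _ ⟨x, hx, rfl⟩
    have h1 := hrU x hx
    refine ⟨?_, mul_ne_zero ha0 (norm_pos_iff.1 (hr.trans_le h1.1))⟩
    rw [mem_ball_zero_iff, norm_mul, Complex.norm_real, Real.norm_of_nonneg ha.le]
    nlinarith [h1.2, norm_nonneg x]
  set R : Set (ℝ × ℝ) := Set.Ioc α β ×ˢ Set.Ioc (-M) M with hR
  have hRm : MeasurableSet R := measurableSet_Ioc.prod measurableSet_Ioc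
  have hRin : ∀ x ∈ R, α ≤ x.1 ∧ |x.2| ≤ M := fun x hx => ⟨hx.1.1.le, abs_le.2 ⟨hx.2.1.le, hx.2.2⟩⟩
  set Ψ : ℝ × ℝ → ℂ := fun x => stripMap η q ⟨N * x.1, x.2⟩ with hΨ
  have hΨc : ContinuousOn Ψ R := continuousOn_strip fun s hs τ hτ =>
    (hNa s hs τ hτ).1.2.1.1.continuousAt
  set T : Set (ℝ × ℝ) := R ∩ Ψ ⁻¹' V with hT
  have hTm : MeasurableSet T := by
    obtain ⟨O, hO, hOe⟩ := continuousOn_iff'.1 hΨc V hVopen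
    rw [hT, Set.inter_comm, hOe]
    exact hO.measurableSet.inter hRm
  -- The value of H ∘ f recovers z up to a sign fixed by p.
  have hinj : Set.InjOn Ψ T := by
    intro x hx y hy hxy
    have h1 := (hNa x.1 (hRin x hx.1).1 x.2 (hRin x hx.1).2).1.1
    have h2 := (hNa y.1 (hRin y hy.1).1 y.2 (hRin y hy.1).2).1.1
    have hxy' : stripMap η q ⟨N * x.1, x.2⟩ = stripMap η q ⟨N * y.1, y.2⟩ := hxy
    rw [hxy', h2] at h1
    have h3 := mul_left_cancel₀ (pow_ne_zero p (neg_ne_zero.2 one_ne_zero)) h1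
    rw [Complex.mk.injEq] at h3
    exact Prod.ext (mul_left_cancel₀ hN0.ne' h3.1).symm h3.2.symm
  rw [integral_flowMeasure d κ ha hVopen.measurableSet (hf.mono hVsub) hφ]
  have hΨT : Ψ '' T ⊆ V := by
    rintro _ ⟨x, hx, rfl⟩
    exact hx.2
  -- A point of V sent to the support of φ must be in the image of the rectangle: the sector
  -- contains no other Γ-radius, |Im z| < M on the support, and the rescaled real part lies between
  -- α and β.
  have hrestrict : ∫ x in V, 2 * ‖deriv f x‖ ^ 2 * φ (f x : E ⧸ Γ) =
      ∫ x in Ψ '' T, 2 * ‖deriv f x‖ ^ 2 * φ (f x : E ⧸ Γ) := by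
    refine setIntegral_eq_of_subset_of_forall_sdiff_eq_zero hVopen.measurableSet hΨT ?_
    rintro x ⟨hxV, hx⟩
    by_contra hne
    have hφx : φ (f x : E ⧸ Γ) ≠ 0 := fun h => hne (by rw [h, mul_zero])
    have hsupp : (f x : E ⧸ Γ) ∈ tsupport φ := subset_tsupport _ hφx
    refine hx ?_
    have hxU := (hVmem x).1 hxV
    have hx0 : x ≠ 0 := (hVsub hxV).2
    have hnorm : ‖x‖ = a * ‖x / a‖ := by
      rw [norm_div, Complex.norm_real, Real.norm_of_nonneg ha.le]; field_simp
    have hxε : dist x 0 < ε := by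
      rw [dist_zero_right, hnorm]
      nlinarith [(hrU _ hxU).2, norm_nonneg (x / a)]
    have harg : (Complex.arg x : Real.Angle) ∈ Θ := by
      have := (hU.subset_sector hxU).2.2
      have e : x = (a : ℂ) * (x / a) := (mul_div_cancel₀ _ ha0).symm
      rwa [e, Complex.arg_real_mul _ ha]
    obtain ⟨h1, h2⟩ := hloc hxε hx0 harg hsupp
    set z := (-1) ^ p * H (f x) with hz
    have him : |z.im| < M := by
      rw [hz, abs_im_neg_one_pow_mul]; exact hM _ hsupp
    have hre1 : 1 ≤ z.re := (le_max_right _ _).trans h1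
    have hst := (hX₀ z ((le_max_left _ _).trans h1) him.le).2
    have hre0 : 0 < z.re := by linarith
    have hs : α < z.re / N ∧ z.re / N < β := by
      refine hrange (z.re / N) _ (by positivity) hst (x / a) hxU ?_
      have h3 := realRoot_pos q z.re
      have h4 : realRoot q z.re = a * realRoot q (z.re / N) := by
        conv_lhs => rw [← mul_div_cancel₀ z.re hN0.ne']
        rw [realRoot_mul q hN0 (by positivity), hNroot]
      have h5 := realRoot_pos q (z.re / N)
      rw [h2, h4, norm_div, Complex.norm_real, Real.norm_of_nonneg ha.le]
      field_simp
    have hzN : (⟨N * (z.re / N), z.im⟩ : ℂ) = z := by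
      rw [mul_div_cancel₀ _ hN0.ne']
    have hΨx : Ψ (z.re / N, z.im) = x := by
      simp only [hΨ]; rw [hzN]; exact h2
    refine ⟨(z.re / N, z.im), ⟨⟨⟨hs.1, hs.2.le⟩, (abs_lt.1 him).1, (abs_lt.1 him).2.le⟩, ?_⟩, hΨx⟩
    rw [Set.mem_preimage, hΨx]; exact hxV
  rw [hrestrict, integral_image_stretch (g' := deriv (stripMap η q)) hN0 hTm
    (fun x hx => (hNa x.1 (hRin x hx.1).1 x.2 (hRin x hx.1).2).1.2.1.1) hinj,
    ← integral_const_mul, Measure.prod_restrict, ← Measure.volume_eq_prod]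
  have hmemT : ∀ x ∈ R, (x ∈ T ↔ Ψ x / realRoot q N ∈ U) := by
    intro x hx
    rw [hNroot, ← hVmem]
    exact ⟨fun h => h.2, fun h => ⟨hx, h⟩⟩
  refine Eq.trans ?_ (setIntegral_eq_of_subset_of_forall_sdiff_eq_zero hRm
    (Set.inter_subset_left : T ⊆ R) ?_).symm
  · refine setIntegral_congr_fun hTm fun x hx => ?_
    have h1 := (hNa x.1 (hRin x hx.1).1 x.2 (hRin x hx.1).2).1.2.1.2
    have h2 := (hmemT x hx.1).1 hx
    have h3 : d 1 = q + (d 1 - q) := by have := S.le_first; omega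
    rw [stripDensity, Set.indicator_of_mem h2, h1, hNroot, ← hqd, hNd, mul_one, ← hηp]
    -- The exponent 2d - d_κ is exactly what is needed: with the Jacobian N = a^{-q}, the remaining
    -- factor is a^{2(d - q)}, which balances the squared derivative.
    have h4 : a ^ (2 * d 1) = a ^ q * a ^ q * a ^ (2 * (d 1 - q)) := by
      rw [← pow_add, ← pow_add]; congr 1; omega
    rw [h4]
    have h5 : a ^ q ≠ 0 := by positivity
    field_simp
  · rintro x ⟨hxR, hxT⟩
    rw [stripDensity, Set.indicator_of_notMem fun h => hxT ((hmemT x hxR).2 h), mul_zero, mul_zero]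

/-- Convergence of the rescaled measures. -/
theorem exists_haar_limit (S : IsFlowSetup Γ f k d v κ lam H ξ)
    (hf : ContinuousOn f (Metric.ball 0 1 \ {0}))
    (hrad : IsRadialExpansion f d v κ lam ξ p m δ ϑ) (hΓ : radialSpace v κ ϑ m ≤ realSpan Γ)
    (hΘ : IsClosed Θ)
    (huniq : ∀ q < 2 * d κ, IsGammaRadius Γ f d v κ lam ξ q → radiusAngle (d κ) lam q ∈ Θ → q = p)
    (hU : IsAdmissibleOpen Θ (radiusAngle (d κ) lam p) U) :
    ∃ μ : Measure (E ⧸ Γ),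
      IsHaarMeasureOf
        (closure ((fun z : E => (z : E ⧸ Γ)) '' (limitAffine v κ m ϑ : Set E))) μ ∧
      ∀ φ : E ⧸ Γ → ℝ, Continuous φ → HasCompactSupport φ →
        Tendsto (fun a : ℝ => ∫ y, φ y ∂(flowMeasure Γ f d κ U a)) (𝓝[>] 0)
          (𝓝 (∫ y, φ y ∂μ)) := by
  have hq := S.pole_ne_zero
  choose ηs hη using S.exists_param
  obtain ⟨C, hC, hF⟩ := S.exists_tendsto_norm_deriv (hη p)
  obtain ⟨α, β, hα, hαβ, hrange⟩ := hU.exists_range hq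
  have : CompactSpace (torusClosure Γ (radialSpace v κ ϑ m)) :=
    isCompact_iff_compactSpace.1 (isCompact_torusClosure hΓ)
  set ν₀ : Measure (torusClosure Γ (radialSpace v κ ϑ m)) := Measure.addHaarMeasure ⊤ with hν₀
  have hν₀p : IsProbabilityMeasure ν₀ := ⟨Measure.addHaarMeasure_self (K₀ := ⊤)⟩
  set c := ∫ s in Set.Ioc α β, flowWeight U (rayUnit (d κ) p / lam) (d κ) (d 1 - d κ) C s with hc
  have hc0 : 0 < c := by
    refine integral_flowWeight_pos hU.isOpen hq hC hα (fun s hs hsU =>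
      hrange s 1 hs (by norm_num) _ hsU (by rw [norm_ray S.coord.norm_lam, one_mul])) ?_
    obtain ⟨x, hxU, hx⟩ := hU.inter_nonempty
    have hx0 : 0 < ‖x‖ := hx.1
    refine ⟨(‖x‖ ^ d κ)⁻¹, by positivity, ?_⟩
    rw [realRoot_inv_pow hq hx0, ← eq_of_mem_sector_singleton S.coord.norm_lam hx]
    exact hxU
  set h : E →ₗ[ℝ] ℝ := Complex.imLm.comp (H.restrictScalars ℝ) with hh
  have hhΓ : ∀ z ∈ realSpan Γ, h z = 0 := fun z hz => S.coord.im_eq_zero z hz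
  have hhw : |h (Complex.I • ϑ 0)| = 1 := by
    change |(H (Complex.I • ϑ 0)).im| = 1
    rw [map_smul, S.map_leading (hη p) hrad, smul_eq_mul, mul_comm, abs_im_neg_one_pow_mul]
    simp
  have hhw0 : h (Complex.I • ϑ 0) ≠ 0 := fun h0 => by rw [h0, abs_zero] at hhw; exact zero_ne_one hhw
  obtain ⟨μ, hμ, hμφ⟩ := exists_haar_translate hΓ hhΓ hhw0 ν₀ hc0 (ϑ (m + 1))
  refine ⟨μ, hμ, fun φ hφ hφc => ?_⟩
  rw [hμφ φ hφ hφc]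
  obtain ⟨M₀, hM₀, hM₀b⟩ := S.exists_bound_im_height hφc
  -- Wide enough both for the points of the source sent to the support of φ and for the parameters τ
  -- at which the translated line meets this support; the 1 makes the inequalities strict.
  set M := M₀ + |h (ϑ (m + 1))| + 1 with hM
  have hM0 : 0 ≤ M := by positivity
  obtain ⟨b, hb⟩ := hφc.exists_bound_of_continuous hφ
  have hlim := (S.tendsto_integral_strip_density (hη p) hrad hΓ ν₀ hU hα hαβ.le hM0 hC (hF M) hφ
    hb).comp (tendsto_inv_pow_nhdsGT hq)
  -- |Im H(iϑ_0)| = 1 and Γ_ℝ does not affect Im H, so |τ| ≥ M takes the point out of the support.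
  have hfull : ∫ τ in Set.Ioc (-M) M, ∫ g, φ ((ϑ (m + 1) : E ⧸ Γ) + g +
        ((τ • (Complex.I • ϑ 0) : E) : E ⧸ Γ)) ∂ν₀ = ∫ τ : ℝ, ∫ g, φ ((ϑ (m + 1) : E ⧸ Γ) + g +
        ((τ • (Complex.I • ϑ 0) : E) : E ⧸ Γ)) ∂ν₀ := by
    refine setIntegral_eq_integral_of_forall_compl_eq_zero fun τ hτ => ?_
    refine integral_eq_zero_of_ae (Eventually.of_forall fun g => ?_)
    by_contra hne
    refine hτ ?_
    obtain ⟨a, ha, hag⟩ : ∃ a ∈ realSpan Γ, (a : E ⧸ Γ) = g := by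
      have : (torusClosure Γ (radialSpace v κ ϑ m) : Set (E ⧸ Γ)) ⊆
          (fun e : E => (e : E ⧸ Γ)) '' (realSpan Γ : Set E) := by
        rw [coe_torusClosure]
        exact closure_minimal (Set.image_mono hΓ) (isCompact_image_realSpan Γ).isClosed
      exact this g.2
    have h1 := hM₀b (ϑ (m + 1) + a + τ • (Complex.I • ϑ 0)) (by
      rw [QuotientAddGroup.mk_add, QuotientAddGroup.mk_add, hag]
      exact subset_tsupport _ hne)
    have h2 : |h (ϑ (m + 1)) + τ * h (Complex.I • ϑ 0)| ≤ M₀ := by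
      have e : h (ϑ (m + 1) + a + τ • (Complex.I • ϑ 0)) =
          h (ϑ (m + 1)) + τ * h (Complex.I • ϑ 0) := by
        rw [map_add, map_add, hhΓ a ha, map_smul, add_zero, smul_eq_mul]
      rw [← e]; exact h1
    have h3 : |τ| ≤ M₀ + |h (ϑ (m + 1))| := by
      have e : |τ| = |τ * h (Complex.I • ϑ 0)| := by rw [abs_mul, hhw, mul_one]
      have e2 : τ * h (Complex.I • ϑ 0) =
        (h (ϑ (m + 1)) + τ * h (Complex.I • ϑ 0)) - h (ϑ (m + 1)) := by ring
      rw [e, e2]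
      exact (abs_sub _ _).trans (add_le_add h2 le_rfl)
    have h4 : |τ| < M := by rw [hM]; linarith
    exact ⟨(abs_lt.1 h4).1, (abs_lt.1 h4).2.le⟩
  rw [hfull, mul_comm _ c] at hlim
  refine hlim.congr' ?_
  filter_upwards [S.eventually_integral_flowMeasure_eq hf hη hΘ huniq hU hα hrange hφ hφc
    (M := M) (fun e he => (hM₀b e he).trans_lt (by
      rw [hM]; linarith [abs_nonneg (h (ϑ (m + 1)))]))] with a ha
  rw [ha]; rfl

end IsFlowSetup

/-! ### Admissible discs and separation of the radii. -/

theorem isSmoothArc_circle (c : ℂ) {ρ : ℝ} (hρ : 0 < ρ) :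
    IsSmoothArc (fun t : ℝ => c + ρ * Complex.exp (2 * Real.pi * Complex.I * t)) ∧
    ∀ t ∈ Set.Icc (0 : ℝ) 1, derivWithin
      (fun t : ℝ => c + ρ * Complex.exp (2 * Real.pi * Complex.I * t)) (Set.Icc 0 1) t =
        2 * Real.pi * Complex.I * (ρ * Complex.exp (2 * Real.pi * Complex.I * t)) := by
  have hd : ∀ t : ℝ, HasDerivAt (fun t : ℝ => c + ρ * Complex.exp (2 * Real.pi * Complex.I * t))
      (2 * Real.pi * Complex.I * (ρ * Complex.exp (2 * Real.pi * Complex.I * t))) t := by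
    intro t
    have h1 : HasDerivAt (fun t : ℝ => 2 * Real.pi * Complex.I * (t : ℂ))
        (2 * Real.pi * Complex.I) t := by
      simpa using (Complex.ofRealCLM.hasDerivAt (x := t)).const_mul (2 * Real.pi * Complex.I)
    have h2 := (h1.cexp.const_mul (ρ : ℂ)).const_add c
    refine h2.congr_deriv ?_
    ring
  have hd' : ∀ t ∈ Set.Icc (0 : ℝ) 1, derivWithin
      (fun t : ℝ => c + ρ * Complex.exp (2 * Real.pi * Complex.I * t)) (Set.Icc 0 1) t =
        2 * Real.pi * Complex.I * (ρ * Complex.exp (2 * Real.pi * Complex.I * t)) :=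
    fun t ht => (hd t).hasDerivWithinAt.derivWithin (uniqueDiffOn_Icc_zero_one t ht)
  refine ⟨⟨?_, fun t ht => ?_⟩, hd'⟩
  · have : ContDiff ℝ ∞ (fun t : ℝ => c + ρ * Complex.exp (2 * Real.pi * Complex.I * t)) := by
      have h1 : ContDiff ℝ ∞ (fun t : ℝ => (t : ℂ)) := Complex.ofRealCLM.contDiff
      exact contDiff_const.add (contDiff_const.mul (contDiff_const.mul h1).cexp)
    exact this.contDiffOn
  · rw [hd' t ht]
    have hρ' : (ρ : ℂ) ≠ 0 := by exact_mod_cast hρ.ne'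
    exact mul_ne_zero Complex.two_pi_I_ne_zero (mul_ne_zero hρ' (Complex.exp_ne_zero _))

theorem image_circle (c : ℂ) {ρ : ℝ} (hρ : 0 < ρ) :
    (fun t : ℝ => c + ρ * Complex.exp (2 * Real.pi * Complex.I * t)) '' Set.Icc 0 1 =
      Metric.sphere c ρ := by
  ext x
  rw [mem_sphere_iff_norm]
  constructor
  · rintro ⟨t, -, rfl⟩
    have e : 2 * Real.pi * Complex.I * (t : ℂ) = ((2 * Real.pi * t : ℝ) : ℂ) * Complex.I := by
      push_cast; ring
    rw [add_sub_cancel_left, norm_mul, e, Complex.norm_exp_ofReal_mul_I, Complex.norm_real,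
      Real.norm_of_nonneg hρ.le, mul_one]
  · intro hx
    have h2π := Real.two_pi_pos
    set θ := toIcoMod h2π 0 (Complex.arg (x - c)) with hθ
    have hθm := toIcoMod_mem_Ico h2π 0 (Complex.arg (x - c))
    rw [zero_add] at hθm
    refine ⟨θ / (2 * Real.pi), ⟨div_nonneg hθm.1 h2π.le, (div_le_one h2π).2 hθm.2.le⟩, ?_⟩
    have hexp : Complex.exp (2 * Real.pi * Complex.I * ((θ / (2 * Real.pi) : ℝ) : ℂ)) =
        Complex.exp (Complex.arg (x - c) * Complex.I) := by
      rw [Complex.exp_eq_exp_iff_exists_int]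
      refine ⟨-toIcoDiv h2π 0 (Complex.arg (x - c)), ?_⟩
      have h3 : θ = Complex.arg (x - c) - toIcoDiv h2π 0 (Complex.arg (x - c)) * (2 * Real.pi) := by
        rw [hθ, toIcoMod, zsmul_eq_mul]
      have hpi : (Real.pi : ℂ) ≠ 0 := by exact_mod_cast Real.pi_ne_zero
      rw [h3]
      push_cast
      field_simp
      ring
    beta_reduce
    rw [hexp, ← hx, Complex.norm_mul_exp_arg_mul_I, add_sub_cancel]

/-- A small disc centred on the radius itself: its boundary circle crosses the radius orthogonally.
-/
theorem exists_isAdmissibleOpen {q p : ℕ} {lam : ℂ} (hlam : ‖lam‖ = 1) {Θ : Set Real.Angle}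
    (hΘ : radiusAngle q lam p ∈ interior Θ) :
    ∃ U, IsAdmissibleOpen Θ (radiusAngle q lam p) U := by
  have hlam0 : lam ≠ 0 := norm_pos_iff.1 (hlam ▸ one_pos)
  set u := rayUnit q p / lam with hu
  have hu1 : ‖u‖ = 1 := by rw [hu, norm_div, norm_rayUnit, hlam, div_one]
  have hu0 : u ≠ 0 := norm_pos_iff.1 (hu1 ▸ one_pos)
  set c : ℂ := ((1 / 2 : ℝ) : ℂ) * u with hc
  have hcn : ‖c‖ = 1 / 2 := by
    rw [hc, norm_mul, hu1, mul_one, Complex.norm_real]; norm_num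
  have hc0 : c ≠ 0 := norm_pos_iff.1 (by rw [hcn]; norm_num)
  have hcs : c ∈ sector {radiusAngle q lam p} := mem_sector_singleton hlam (by norm_num) (by norm_num)
  have hnhds : ∀ᶠ x in 𝓝 c, (Complex.arg x : Real.Angle) ∈ Θ := by
    refine (Complex.continuousAt_arg_coe_angle hc0).eventually ?_
    have : (Complex.arg c : Real.Angle) = radiusAngle q lam p := hcs.2.2
    rw [Function.comp_apply, this]
    exact mem_interior_iff_mem_nhds.1 hΘ
  obtain ⟨ε, hε, hεb⟩ := Metric.eventually_nhds_iff.1 hnhds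
  set ρ := min ε (1 / 4) with hρd
  have hρ : 0 < ρ := lt_min hε (by norm_num)
  have hρ4 : ρ ≤ 1 / 4 := min_le_right _ _
  have hclos : closure (Metric.ball c ρ) ⊆ Metric.ball 0 1 \ {0} := by
    intro x hx
    have h1 := Metric.mem_closedBall.1 (Metric.closure_ball_subset_closedBall hx)
    rw [dist_eq_norm] at h1
    have h2 : ‖x‖ ≤ ‖c‖ + ‖x - c‖ := norm_le_norm_add_norm_sub' x c
    have h3 : ‖c‖ ≤ ‖x‖ + ‖x - c‖ := norm_le_norm_add_norm_sub x c
    refine ⟨mem_ball_zero_iff.2 (by linarith), fun hx0 => ?_⟩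
    rw [Set.mem_singleton_iff] at hx0
    rw [hx0, norm_zero] at h3
    rw [hx0] at h1
    linarith
  obtain ⟨harc, hder⟩ := isSmoothArc_circle c hρ
  refine ⟨Metric.ball c ρ, Metric.isOpen_ball, ?_, hclos, ?_, ⟨c, Metric.mem_ball_self hρ, hcs⟩,
    1, fun _ t => c + ρ * Complex.exp (2 * Real.pi * Complex.I * t), fun _ => harc, ?_, ?_⟩
  · rw [closure_ball c hρ.ne']; exact isCompact_closedBall _ _
  · intro x hx
    have h := hclos (subset_closure hx)
    exact ⟨norm_pos_iff.2 h.2, mem_ball_zero_iff.1 h.1,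
      hεb ((Metric.mem_ball.1 hx).trans_le (min_le_left _ _))⟩
  · rw [Set.iUnion_const, image_circle c hρ, frontier_ball c hρ.ne']
  · intro _ t ht hs s hcon
    rw [hder t ht] at hcon
    have hray := eq_of_mem_sector_singleton hlam hs
    beta_reduce at hcon hray
    set w := c + ρ * Complex.exp (2 * Real.pi * Complex.I * t) with hw
    have hwc : (ρ : ℂ) * Complex.exp (2 * Real.pi * Complex.I * t) = w - c := by rw [hw]; ring
    rw [hwc] at hcon
    rw [← hu] at hray
    rw [hray, hc] at hcon
    -- Tangency would equate a purely imaginary number with a real one, forcing w to be the centre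
    -- of the circle.
    have h1 : 2 * Real.pi * Complex.I * ((‖w‖ : ℂ) - ((1 / 2 : ℝ) : ℂ)) = (s : ℂ) * ‖w‖ := by
      refine mul_right_cancel₀ hu0 ?_
      linear_combination hcon
    have h2 := congrArg Complex.im h1
    have e1 : 2 * Real.pi * Complex.I * ((‖w‖ : ℂ) - ((1 / 2 : ℝ) : ℂ)) =
        ((2 * Real.pi * (‖w‖ - 1 / 2) : ℝ) : ℂ) * Complex.I := by push_cast; ring
    rw [e1, Complex.im_ofReal_mul, Complex.I_im, mul_one, ← Complex.ofReal_mul, Complex.ofReal_im] at h2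
    have h3 : ‖w‖ = 1 / 2 := by
      have := (mul_eq_zero.1 h2).resolve_left Real.two_pi_pos.ne'
      linarith
    rw [h3, ← hc] at hray
    have h4 : (ρ : ℂ) * Complex.exp (2 * Real.pi * Complex.I * t) = 0 := by
      rw [hwc, hray, sub_self]
    have hρ' : (ρ : ℂ) ≠ 0 := by exact_mod_cast hρ.ne'
    exact mul_ne_zero hρ' (Complex.exp_ne_zero _) h4

/-- Equal angles mean that 2q divides p - p', impossible for distinct indices below 2q. -/
theorem radiusAngle_injOn {q : ℕ} (hq : q ≠ 0) (lam : ℂ) :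
    Set.InjOn (radiusAngle q lam) (Set.Iio (2 * q)) := by
  intro p hp p' hp' h
  rw [radiusAngle, radiusAngle, Real.Angle.angle_eq_iff_two_pi_dvd_sub] at h
  obtain ⟨n, hn⟩ := h
  have hq' : (q : ℝ) ≠ 0 := by exact_mod_cast hq
  have h1 : (p : ℝ) - p' = 2 * q * n := by
    have hpi := Real.pi_ne_zero
    field_simp at hn
    have h2 : Real.pi * ((p : ℝ) - p') = Real.pi * (2 * q * n) := by linear_combination hn
    exact mul_left_cancel₀ hpi h2
  have h2 : (p : ℤ) - p' = 2 * q * n := by exact_mod_cast h1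
  have hp1 : p < 2 * q := hp
  have hp2 : p' < 2 * q := hp'
  have h3 : n = 0 := by
    by_contra hn0
    rcases lt_or_gt_of_ne hn0 with h | h
    · nlinarith
    · nlinarith
  rw [h3] at h2
  omega

/-! ### Cluster sets. -/

namespace IsFlowSetup
variable {E : Type*} [NormedAddCommGroup E] [InnerProductSpace ℂ E] [FiniteDimensional ℂ E]
  {Γ : AddSubgroup E} {f : ℂ → E} {k : ℕ} {d : ℕ → ℕ} {v : ℕ → E} {κ : ℕ}
  {lam : ℂ} {H : E →ₗ[ℂ] ℂ} {ξ : ℂ → ℂ} {p m : ℕ} {δ : ℕ → ℕ} {ϑ : ℕ → E}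
  {Θ : Set Real.Angle}

/-- Each cluster value is produced by a `Γ`-radius. -/
theorem exists_radius_of_tendsto (S : IsFlowSetup Γ f k d v κ lam H ξ) {𝒰 : Ultrafilter ℂ}
    (h𝒰 : ↑𝒰 ≤ 𝓝[≠] (0 : ℂ)) {y : E ⧸ Γ} (hy : Tendsto (fun x => (f x : E ⧸ Γ)) 𝒰 (𝓝 y)) :
    ∃ p < 2 * d κ, Tendsto (fun x => (Complex.arg x : Real.Angle)) 𝒰 (𝓝 (radiusAngle (d κ) lam p)) ∧
      ∀ (m : ℕ) (δ : ℕ → ℕ) (ϑ : ℕ → E), IsRadialExpansion f d v κ lam ξ p m δ ϑ →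
        radialSpace v κ ϑ m ≤ realSpan Γ ∧
        y ∈ closure ((fun z : E => (z : E ⧸ Γ)) '' (limitAffine v κ m ϑ : Set E)) := by
  choose ηs hη using S.exists_param
  obtain ⟨p, hp, M, hZ, hx⟩ := S.exists_ray_of_tendsto hη h𝒰 hy
  have hy' : Tendsto (fun x => (f (stripMap (ηs p) (d κ) ((-1) ^ p * H (f x))) : E ⧸ Γ)) 𝒰
      (𝓝 y) := hy.congr' (hx.mono fun x hx => by beta_reduce; rw [hx])
  refine ⟨p, hp, ?_, fun m δ ϑ hrad => ⟨S.isGammaRadius_of_tendsto (hη p) hrad hZ hy',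
    S.mem_closure_of_tendsto (hη p) hrad hZ hy'⟩⟩
  refine ((S.tendsto_arg_stripMap (hη p) M).comp hZ).congr' ?_
  filter_upwards [hx] with x hx
  simp only [Function.comp]
  rw [hx]

theorem sectorClusterSet_subset_clusterSet (Γ : AddSubgroup E) (f : ℂ → E) (Θ : Set Real.Angle) :
    sectorClusterSet Γ f Θ ⊆ clusterSet Γ f := fun _ hy =>
  MapClusterPt.mono hy (nhdsWithin_mono _ fun _ hx => norm_pos_iff.1 hx.1)

variable [MeasurableSpace E] [BorelSpace E] [DiscreteTopology Γ]

/-- One inclusion is localization: closedness of Θ forces the selected radius to be p. The other is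
equidistribution: a neighbourhood of a point of the limit set that the map avoided near 0 would have
zero mass in the limit, whereas the Haar measure charges it. -/
theorem sectorClusterSet_eq (S : IsFlowSetup Γ f k d v κ lam H ξ)
    (hf : ContinuousOn f (Metric.ball 0 1 \ {0}))
    (hrad : IsRadialExpansion f d v κ lam ξ p m δ ϑ) (hΓ : radialSpace v κ ϑ m ≤ realSpan Γ)
    (hΘ : IsClosed Θ) (hint : radiusAngle (d κ) lam p ∈ interior Θ)
    (huniq : ∀ q < 2 * d κ, IsGammaRadius Γ f d v κ lam ξ q → radiusAngle (d κ) lam q ∈ Θ → q = p) :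
    sectorClusterSet Γ f Θ =
      closure ((fun z : E => (z : E ⧸ Γ)) '' (limitAffine v κ m ϑ : Set E)) := by
  apply Set.Subset.antisymm
  · intro y hy
    obtain ⟨𝒰, h𝒰, hy⟩ := mapClusterPt_iff_ultrafilter.1 hy
    have h1 : ↑𝒰 ≤ 𝓝[≠] (0 : ℂ) :=
      h𝒰.trans (nhdsWithin_mono _ fun _ hx => norm_pos_iff.1 hx.1)
    obtain ⟨p', hp', harg, h⟩ := S.exists_radius_of_tendsto h1 hy
    have hmem : radiusAngle (d κ) lam p' ∈ Θ := by
      refine hΘ.mem_of_tendsto harg ?_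
      filter_upwards [h𝒰 self_mem_nhdsWithin] with x hx using hx.2.2
    obtain ⟨m', δ', ϑ', hrad'⟩ := S.exists_radial p'
    obtain rfl := huniq p' hp' ⟨m', δ', ϑ', hrad', (h m' δ' ϑ' hrad').1⟩ hmem
    exact (h m δ ϑ hrad).2
  · intro y hy
    rw [sectorClusterSet, Set.mem_ofPred_eq, mapClusterPt_iff_frequently]
    intro s hs
    by_contra hcon
    rw [not_frequently] at hcon
    obtain ⟨U, hU⟩ := exists_isAdmissibleOpen S.coord.norm_lam hint
    obtain ⟨μ, hμ, hlim⟩ := S.exists_haar_limit hf hrad hΓ hΘ huniq hU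
    -- A bump at y supported in the avoided neighbourhood: its integrals vanish for small a, yet
    -- their limit is positive.
    obtain ⟨φ, hφ1, hφ0, hφc, hφr⟩ := exists_continuous_one_zero_of_isCompact
      (isCompact_singleton (x := y)) isOpen_interior.isClosed_compl
      (t := (interior s)ᶜ) (by
        rw [Set.disjoint_singleton_left, Set.notMem_compl_iff]
        exact mem_interior_iff_mem_nhds.2 hs)
    have hpos := hμ.integral_pos φ.continuous hφc (fun y => (hφr y).1) hy
      (by rw [hφ1 (Set.mem_singleton y)]; exact one_ne_zero)
    have hzero : ∀ᶠ a : ℝ in 𝓝[>] 0, ∫ y, φ y ∂(flowMeasure Γ f d κ U a) = 0 := by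
      rw [eventually_nhdsWithin_iff, Metric.eventually_nhds_iff] at hcon
      obtain ⟨ε, hε, hcon⟩ := hcon
      have hsmall : ∀ᶠ a : ℝ in 𝓝[>] 0, a < min ε 1 :=
        (eventually_lt_nhds (lt_min hε one_pos)).filter_mono nhdsWithin_le_nhds
      filter_upwards [self_mem_nhdsWithin, hsmall] with a ha has
      have ha : 0 < a := ha
      have haε : a < ε := has.trans_le (min_le_left _ _)
      have ha1 : a < 1 := has.trans_le (min_le_right _ _)
      have ha0 : (a : ℂ) ≠ 0 := by exact_mod_cast ha.ne'
      have hopen : IsOpen ((fun x : ℂ => (a : ℂ) * x) '' U) :=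
        (Homeomorph.mulLeft₀ (a : ℂ) ha0).isOpenMap U hU.isOpen
      have hin : ∀ x ∈ (fun x : ℂ => (a : ℂ) * x) '' U, x ∈ sector Θ ∧ ‖x‖ < ε := by
        rintro _ ⟨x, hx, rfl⟩
        obtain ⟨h1, h2, h3⟩ := hU.subset_sector hx
        have hn : ‖(a : ℂ) * x‖ = a * ‖x‖ := by
          rw [norm_mul, Complex.norm_real, Real.norm_of_nonneg ha.le]
        refine ⟨⟨?_, ?_, ?_⟩, ?_⟩
        · rw [hn]; positivity
        · rw [hn]; nlinarith
        · rwa [Complex.arg_real_mul _ ha]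
        · rw [hn]; nlinarith
      rw [integral_flowMeasure d κ ha hopen.measurableSet (hf.mono fun x hx =>
        ⟨mem_ball_zero_iff.2 (hin x hx).1.2.1, norm_pos_iff.1 (hin x hx).1.1⟩) φ.continuous]
      rw [setIntegral_eq_zero_of_forall_eq_zero, mul_zero]
      intro x hx
      have h1 : (f x : E ⧸ Γ) ∉ s := hcon (by rw [dist_zero_right]; exact (hin x hx).2) (hin x hx).1
      have h2 : φ (f x : E ⧸ Γ) = 0 := hφ0 fun h => h1 (interior_subset h)
      rw [h2, mul_zero]
    have := tendsto_nhds_unique ((hlim φ φ.continuous hφc).congr' hzero) tendsto_const_nhds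
    exact hpos.ne' this

/-- The cluster set is the union of the closures of π(V') over the finitely many Γ-radii; each
closure is attained by restricting to a sector that isolates its radius. -/
theorem isFiniteUnionOfTranslates (S : IsFlowSetup Γ f k d v κ lam H ξ)
    (hf : ContinuousOn f (Metric.ball 0 1 \ {0})) :
    IsFiniteUnionOfTranslates (clusterSet Γ f) := by
  have hq := S.pole_ne_zero
  set Q := {q | q < 2 * d κ ∧ IsGammaRadius Γ f d v κ lam ξ q} with hQ
  have hQf : Q.Finite := (Set.finite_Iio (2 * d κ)).subset fun q hq => hq.1
  have : Finite Q := hQf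
  choose! m δ ϑ hϑ using fun q (hq : q ∈ Q) => hq.2
  set e := Finite.equivFin Q with he
  refine ⟨Nat.card Q, fun i => ((ϑ (e.symm i) (m (e.symm i) + 1) : E) : E ⧸ Γ),
    fun i => torusClosure Γ (Submodule.span ℝ {Complex.I • ϑ (e.symm i) 0} ⊔
      radialSpace v κ (ϑ (e.symm i)) (m (e.symm i))),
    fun i => ⟨isClosed_torusClosure _ _, isConnected_torusClosure _ _⟩, ?_⟩
  have hcl : ∀ q, (fun g => ((ϑ q (m q + 1) : E) : E ⧸ Γ) + g) ''
      (torusClosure Γ (Submodule.span ℝ {Complex.I • ϑ q 0} ⊔ radialSpace v κ (ϑ q) (m q)) :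
        Set (E ⧸ Γ)) =
      closure ((fun z : E => (z : E ⧸ Γ)) '' (limitAffine v κ (m q) (ϑ q) : Set E)) := fun q =>
    (closure_image_affine Γ _ _).symm
  simp only [hcl]
  apply Set.Subset.antisymm
  · intro y hy
    obtain ⟨𝒰, h𝒰, hy⟩ := mapClusterPt_iff_ultrafilter.1 hy
    obtain ⟨p, hp, -, h⟩ := S.exists_radius_of_tendsto h𝒰 hy
    obtain ⟨m', δ', ϑ', hrad'⟩ := S.exists_radial p
    have hpQ : p ∈ Q := ⟨hp, m', δ', ϑ', hrad', (h m' δ' ϑ' hrad').1⟩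
    refine Set.mem_iUnion.2 ⟨e ⟨p, hpQ⟩, ?_⟩
    rw [Equiv.symm_apply_apply]
    exact (h _ _ _ (hϑ p hpQ).1).2
  · refine Set.iUnion_subset fun i => ?_
    set q : ℕ := (e.symm i).1 with hqi
    have hqQ : q ∈ Q := (e.symm i).2
    -- The complement of the finitely many other angles is open, so it contains a closed
    -- neighbourhood of the angle of this radius.
    set O : Set Real.Angle := (radiusAngle (d κ) lam '' (Set.Iio (2 * d κ) \ {q}))ᶜ with hO
    have hOo : IsOpen O := (((Set.finite_Iio _).sdiff.image _).isClosed).isOpen_compl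
    have hqO : radiusAngle (d κ) lam q ∈ O := by
      rintro ⟨q', hq', h⟩
      exact hq'.2 (radiusAngle_injOn hq lam hq'.1 hqQ.1 h)
    obtain ⟨Θ, hΘn, hΘ, hΘO⟩ := exists_mem_nhds_isClosed_subset (hOo.mem_nhds hqO)
    rw [← S.sectorClusterSet_eq hf (hϑ q hqQ).1 (hϑ q hqQ).2 hΘ (mem_interior_iff_mem_nhds.2 hΘn)
      fun q' hq' _ hm => by
      by_contra hne
      exact hΘO hm ⟨q', ⟨hq', hne⟩, rfl⟩]
    exact sectorClusterSet_subset_clusterSet Γ f Θ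

end IsFlowSetup

end LieFlow

open LieFlow in
theorem theorem3p9 {E : Type*} [NormedAddCommGroup E] [InnerProductSpace ℂ E]
    [FiniteDimensional ℂ E] [MeasurableSpace E] [BorelSpace E]
    (Γ : AddSubgroup E) [DiscreteTopology Γ]
    (f : ℂ → E)
    (hf_smooth : ContDiffOn ℝ ∞ f (Metric.closedBall 0 1 \ {0}))
    (hf_hol : DifferentiableOn ℂ f (Metric.ball 0 1 \ {0}))
    (hf_growth : ∃ N : ℕ, f =O[𝓝[≠] 0] (fun x : ℂ => (x ^ N)⁻¹))
    (H0 : ¬ Bornology.IsBounded (f '' (Metric.closedBall 0 1 \ {0})))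
    (k : ℕ) (d : ℕ → ℕ) (v : ℕ → E) (hv : IsFlagExpansion f k d v)
    (H1 : ¬ (flagSpace v k).restrictScalars ℝ ≤ realSpan Γ)
    (κ : ℕ) (hκ : IsCriticalIndex Γ k v κ)
    (H2 : ∃ θ : ℝ, IsAlmostGammaRadius Γ d v κ θ)
    (lam : ℂ) (H : E →ₗ[ℂ] ℂ) (ξ : ℂ → ℂ) (hξ : IsAdaptedCoordinate Γ f d v κ lam H ξ)
    (H3 : ∃ p < 2 * d κ, IsGammaRadius Γ f d v κ lam ξ p) :
    (∀ p < 2 * d κ, ∀ (m : ℕ) (δ : ℕ → ℕ) (ϑ : ℕ → E),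
      IsRadialExpansion f d v κ lam ξ p m δ ϑ → radialSpace v κ ϑ m ≤ realSpan Γ →
      ∀ Θ : Set Real.Angle, IsCompact Θ → radiusAngle (d κ) lam p ∈ interior Θ →
        (∀ q < 2 * d κ, IsGammaRadius Γ f d v κ lam ξ q → radiusAngle (d κ) lam q ∈ Θ → q = p) →
        (∀ U : Set ℂ, IsAdmissibleOpen Θ (radiusAngle (d κ) lam p) U →
          ∃ μ : Measure (E ⧸ Γ),
            IsHaarMeasureOf
              (closure ((fun z : E => (z : E ⧸ Γ)) '' (limitAffine v κ m ϑ : Set E))) μ ∧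
            ∀ φ : E ⧸ Γ → ℝ, Continuous φ → HasCompactSupport φ →
              Tendsto (fun a : ℝ => ∫ y, φ y ∂(flowMeasure Γ f d κ U a)) (𝓝[>] 0)
                (𝓝 (∫ y, φ y ∂μ))) ∧
        sectorClusterSet Γ f Θ =
          closure ((fun z : E => (z : E ⧸ Γ)) '' (limitAffine v κ m ϑ : Set E))) ∧
    IsFiniteUnionOfTranslates (clusterSet Γ f) := by
  have S : IsFlowSetup Γ f k d v κ lam H ξ := by
    refine ⟨?_, hv, hκ, hξ⟩
    filter_upwards [inter_mem_nhdsWithin {0}ᶜ (Metric.ball_mem_nhds (0 : ℂ) one_pos)] with x hx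
    exact hf_hol.differentiableAt
      ((Metric.isOpen_ball.sdiff isClosed_singleton).mem_nhds ⟨hx.2, hx.1⟩)
  have hf := hf_hol.continuousOn
  exact ⟨fun p hp m δ ϑ hrad hΓ Θ hΘ hint huniq =>
    ⟨fun U hU => S.exists_haar_limit hf hrad hΓ hΘ.isClosed huniq hU,
      S.sectorClusterSet_eq hf hrad hΓ hΘ.isClosed hint huniq⟩,
    S.isFiniteUnionOfTranslates hf⟩
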